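/- All graphs are finite multigraphs (loops and parallel edges are allowed), and we work in the piecewise linear category. A *spatial embedding* of a graph $G$ is an embedding $f$ of $G$ into the $3$-sphere; a *cycle* of $G$ is a subgraph homeomorphic to the circle. The graph $G$ is *intrinsically knotted or completely $3$-linked* (I(K or C3L)) if for every spatial embedding $f$ of $G$ the image $f(G)$ contains a nontrivial knot $f(\gamma)$, $\gamma$ a cycle of $G$, or a $3$-component link $f(\gamma_1\cup\gamma_2\cup\gamma_3)$, $\gamma_i$ mutually disjoint cycles of $G$, all of whose $2$-component sublinks are nonsplittable. A *minor* of $G$ is a graph obtained from a subgraph of $G$ by a finite sequence of contractions of non-loop edges; it is *proper* if it does not equal $G$. A graph is *minor-minimal* with respect to I(K or C3L) if it is I(K or C3L) but none of its proper minors is. A *$\triangle Y$-exchange* turns a graph $G_\triangle$ into the graph $G_Y$ obtained by removing the edges $\overline{uv},\overline{vw},\overline{wu}$ of a cycle of $G_\triangle$ with exactly three edges, adding a new vertex $x$, and joining $x$ by an edge to each of $u,v,w$. **Lemma 2.7.** Let $G_Y$ be obtained from $G_\triangle$ by a single $\triangle Y$-exchange, and suppose that $G_Y$ is minor-minimal with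 respect to I(K or C3L). Then no proper minor of $G_\triangle$ is I(K or C3L). Consequently, if $G_\triangle$ is I(K or C3L), then $G_\triangle$ is also minor-minimal with respect to I(K or C3L). -/

import Mathlib

/-! Finite graphs are Mathlib's multigraphs `Graph α β` (loops and parallel edges allowed). -/

namespace SpatialGraph

open scoped Graph

variable {α β : Type*}

/-! ### Minors -/

open Classical in
/-- `IsEdgeContraction G H`: the graph `H` is `G / e` for some edge `e` of `G` that is not a loop,
i.e. `e = xy` is deleted and its distinct ends `x`, `y` are identified (keeping the name `x`). -/
def IsEdgeContraction (G H : Graph α β) : Prop :=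
  ∃ e x y, G.IsLink e x y ∧ x ≠ y ∧ H = (G.deleteEdges {e}).map (Function.update id y x)

/-- `H` is a minor of `G`: it arises from a subgraph of `G` by a finite (possibly empty) sequence of
edge contractions. -/
def IsMinor (H G : Graph α β) : Prop :=
  ∃ G' : Graph α β, G' ≤ G ∧ Relation.ReflTransGen IsEdgeContraction G' H

/-- A proper minor of `G` is a minor that does not equal `G`. -/
def IsProperMinor (H G : Graph α β) : Prop :=
  IsMinor H G ∧ H ≠ G

/-- `G` is minor-minimal with respect to `P`: it has `P`, and no proper minor of it has `P`. -/
def IsMinorMinimal (P : Graph α β → Prop) (G : Graph α β) : Prop :=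
  P G ∧ ∀ H : Graph α β, IsProperMinor H G → ¬ P H

/-! ### The exchange of a triangle for a Y -/

/-- `IsDeltaYExchange G₁ G₂`: `G₂` is obtained from `G₁` by a single exchange of a triangle for a
`Y`.  The edges `e₁ = uv`, `e₂ = vw`, `e₃ = wu` of a `3`-cycle of `G₁` are removed, a new vertex `x`
is added and is joined to `u`, `v`, `w` by new edges `f₁`, `f₂`, `f₃` (which may reuse the names of
the removed edges, but not those of the remaining ones).
Equivalently, `G₁` is obtained from `G₂` by the reverse exchange of this `Y` for a triangle. -/
def IsDeltaYExchange (G₁ G₂ : Graph α β) : Prop :=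
  ∃ (u v w x : α) (e₁ e₂ e₃ f₁ f₂ f₃ : β),
    (u ≠ v ∧ v ≠ w ∧ w ≠ u) ∧
    (G₁.IsLink e₁ u v ∧ G₁.IsLink e₂ v w ∧ G₁.IsLink e₃ w u) ∧
    x ∉ V(G₁) ∧
    (f₁ ≠ f₂ ∧ f₂ ≠ f₃ ∧ f₃ ≠ f₁) ∧
    (∀ f, f = f₁ ∨ f = f₂ ∨ f = f₃ → f ∉ E(G₁) \ {e₁, e₂, e₃}) ∧
    V(G₂) = insert x V(G₁) ∧
    ∀ e a b, G₂.IsLink e a b ↔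
      (G₁.IsLink e a b ∧ e ∉ ({e₁, e₂, e₃} : Set β)) ∨
        (e = f₁ ∧ s(a, b) = s(u, x)) ∨ (e = f₂ ∧ s(a, b) = s(v, x)) ∨
        (e = f₃ ∧ s(a, b) = s(w, x))

/-! ### Piecewise linear topology -/

/-- A compact polyhedron: a finite union of convex hulls of finite sets. -/
def IsPolyhedron {E : Type*} [AddCommGroup E] [Module ℝ E] (P : Set E) : Prop :=
  ∃ T : Set (Finset E), T.Finite ∧ P = ⋃ t ∈ T, convexHull ℝ (t : Set E)

/-- `f` is piecewise linear on the compact set `P`: its graph over `P` is a compact polyhedron.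
(Then `P` is a polyhedron as well and `f` is continuous on it, as its graph is compact.) -/
def IsPLOn {E F : Type*} [AddCommGroup E] [Module ℝ E] [AddCommGroup F] [Module ℝ F]
    (f : E → F) (P : Set E) : Prop :=
  IsPolyhedron (Set.graphOn f P)

/-- The cube `[-1, 1]ⁿ`, i.e. the unit ball of the sup norm: the standard PL `n`-ball. -/
def cube (n : ℕ) : Set (Fin n → ℝ) :=
  Metric.closedBall 0 1

/-- The boundary of `[-1, 1]ⁿ`, i.e. the unit sphere of the sup norm:
the standard PL `(n - 1)`-sphere. -/
def cubeBoundary (n : ℕ) : Set (Fin n → ℝ) :=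
  Metric.sphere 0 1

/-- The `3`-sphere of the piecewise linear category, as the boundary of the `4`-cube. -/
def threeSphere : Set (Fin 4 → ℝ) :=
  cubeBoundary 4

/-- `S` is a piecewise linearly embedded `2`-sphere in the `3`-sphere. -/
def IsPLTwoSphere (S : Set (Fin 4 → ℝ)) : Prop :=
  ∃ g : (Fin 3 → ℝ) → (Fin 4 → ℝ), IsPLOn g (cubeBoundary 3) ∧ Set.InjOn g (cubeBoundary 3) ∧
    Set.MapsTo g (cubeBoundary 3) threeSphere ∧ S = g '' cubeBoundary 3

/-- A knot `K` in the `3`-sphere is trivial: it bounds a piecewise linearly embedded `2`-disk. -/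
def IsTrivialKnot (K : Set (Fin 4 → ℝ)) : Prop :=
  ∃ g : (Fin 2 → ℝ) → (Fin 4 → ℝ), IsPLOn g (cube 2) ∧ Set.InjOn g (cube 2) ∧
    Set.MapsTo g (cube 2) threeSphere ∧ K = g '' cubeBoundary 2

/-- The `2`-component link with components `K` and `L` is splittable: there is a PL `2`-sphere `S`
in its complement such that `K` and `L` lie in different components of the complement of `S`. -/
def IsSplittable (K L : Set (Fin 4 → ℝ)) : Prop :=
  ∃ S, IsPLTwoSphere S ∧ Disjoint S (K ∪ L) ∧
    ∀ p ∈ K, ∀ q ∈ L,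
      connectedComponentIn (threeSphere \ S) p ≠ connectedComponentIn (threeSphere \ S) q

/-! ### Spatial graphs -/

/-- A spatial embedding of `G`: a piecewise linear embedding of (the geometric realization of) `G`
into the `3`-sphere.  It is given by the images of the vertices and, for each edge, by the image of
that edge as a path parametrized by `[0, 1]`; the conditions say that these fit together to a
piecewise linear injective map on the realization, in which every edge is a copy of `[0, 1]` whose
end points are glued to its ends.  Values outside `V(G)`, `E(G)` and `[0, 1]` are irrelevant. -/
structure SpatialEmbedding (G : Graph α β) where
  /-- The image of a vertex. -/
  vertex : α → (Fin 4 → ℝ)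
  /-- The image of an edge, parametrized by `[0, 1]`. -/
  edge : β → ℝ → (Fin 4 → ℝ)
  vertex_mem : ∀ a ∈ V(G), vertex a ∈ threeSphere
  edge_mem : ∀ e ∈ E(G), ∀ t ∈ Set.Icc (0 : ℝ) 1, edge e t ∈ threeSphere
  edge_pl : ∀ e ∈ E(G), IsPLOn (edge e) (Set.Icc 0 1)
  edge_ends : ∀ e ∈ E(G), ∃ a b, G.IsLink e a b ∧ edge e 0 = vertex a ∧ edge e 1 = vertex b
  vertex_injOn : Set.InjOn vertex V(G)
  edge_inj : ∀ e ∈ E(G), ∀ e' ∈ E(G), ∀ s ∈ Set.Ioo (0 : ℝ) 1, ∀ t ∈ Set.Ioo (0 : ℝ) 1,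
    edge e s = edge e' t → e = e' ∧ s = t
  edge_ne_vertex : ∀ e ∈ E(G), ∀ t ∈ Set.Ioo (0 : ℝ) 1, ∀ a ∈ V(G), edge e t ≠ vertex a

/-- The image `f(C)` of a subgraph `C` under a spatial embedding `f`. -/
def SpatialEmbedding.image {G : Graph α β} (f : SpatialEmbedding G) (C : Graph α β) :
    Set (Fin 4 → ℝ) :=
  (f.vertex '' V(C)) ∪ ⋃ e ∈ E(C), f.edge e '' Set.Icc 0 1

/-- `C` is a cycle of `G`: a subgraph homeomorphic to the circle, that is, with distinct vertices
`v₀, …, vₙ` and distinct edges `e₀, …, eₙ`, where `eᵢ` joins `vᵢ` to `vᵢ₊₁` (indices modulo `n + 1`).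
Loops (`n = 0`) and pairs of parallel edges (`n = 1`) are included. -/
def IsCycleOf (C G : Graph α β) : Prop :=
  C ≤ G ∧ ∃ (n : ℕ) (v : Fin (n + 1) → α) (e : Fin (n + 1) → β),
    Function.Injective v ∧ Function.Injective e ∧ (∀ i, C.IsLink (e i) (v i) (v (i + 1))) ∧
    V(C) = Set.range v ∧ E(C) = Set.range e

/-- `G` is intrinsically knotted or completely `3`-linked: the image of every spatial embedding `f`
of `G` contains a nontrivial knot, or a `3`-component link all of whose `2`-component sublinks are
nonsplittable. -/
def IsIKorC3L (G : Graph α β) : Prop :=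
  ∀ f : SpatialEmbedding G,
    (∃ C, IsCycleOf C G ∧ ¬ IsTrivialKnot (f.image C)) ∨
    ∃ C₁ C₂ C₃, IsCycleOf C₁ G ∧ IsCycleOf C₂ G ∧ IsCycleOf C₃ G ∧
      Disjoint V(C₁) V(C₂) ∧ Disjoint V(C₁) V(C₃) ∧ Disjoint V(C₂) V(C₃) ∧
      ¬ IsSplittable (f.image C₁) (f.image C₂) ∧
      ¬ IsSplittable (f.image C₁) (f.image C₃) ∧
      ¬ IsSplittable (f.image C₂) (f.image C₃)

end SpatialGraph

/-!
Write `P` for the property of being intrinsically knotted or completely `3`-linked. The proof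
matches each minor `H` of the graph with the triangle by a minor `K` of the graph with the star such
that `P H` implies `P K` and such that `K` is proper if `H` is. By minimality of the graph with the
star no proper minor `H` has `P`.

*Combinatorics* (`IsTriangleStar.exists_isMinor`). As long as a sequence of deletions and
contractions leaves the triangle intact, the same deletions and contractions are performed next to
the star, so that `K` arises from `H` by an exchange (`IsTriangleStar`). If an edge of the triangle
is deleted, contracting the opposite edge of the star produces the same graph up to names of edges.
If two vertices of the triangle are merged, two edges of the triangle become parallel, and `K` is
obtained by a contraction in the star followed by the given one: then `K` is `H` without one of
these two edges. From then on `H` and `K` differ in a single edge which is a loop or is parallel to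
an edge of `K` (`IsDeletion`, `IsRedundant`).

*Topology*. It remains to see that `P` survives the removal of certain edges `e₀` from a graph:
loops (`IsIKorC3L.of_add_loop`), edges parallel to another edge which is not a loop
(`IsIKorC3L.of_add_parallel`), and edges `uv` such that there is a path `u, x, v` whose middle
vertex `x` has degree at most three and no loop (`IsIKorC3L.of_add_cherry`). Adding the three edges
of a triangle to the star one by one, the last one shows that `P` passes along an exchange
(`IsTriangleStar.isIKorC3L`). Given a spatial embedding of the graph without `e₀`, the edge `e₀` is
added as the boundary of a small disk in the first case, and closely alongside the parallel edge or
the path in the other two cases. A cycle through `e₀` bounds a disk that is disjoint from the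
remainder of the link, or can be isotoped to a cycle of the smaller graph: `e₀` is replaced by the
arc alongside, or, if the cycle runs through `ux`, the edges `e₀` and `ux` are replaced by `vx`.
Since `x` has degree at most three, no other cycle disjoint from the given one interferes with this.
So a nontrivial knot or a completely `3`-linked link in the larger graph yields one in the smaller
graph.

*Piecewise linear tools*. The `3`-sphere is the boundary of the `4`-cube. Projecting along the
diagonal through a corner of the cube gives a piecewise linear chart onto an open convex subset of
`ℝ³`. The elementary isotopy is the map `push` which moves the centre of a convex polytope and fixes
its boundary; it is piecewise linear since the gauge of a polytope is (`isPLOn_gauge`). It moves two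
sides of a triangle to the third one (`exists_triangle_move`). By shrinking an arc along itself with
such moves it is carried to a straight segment in a chart (`exists_straighten`). There a thin flat
rhombus in general position meets the embedded graph in its diagonal only (`exists_isFlatDisk_arc`);
the edge `e₀` is drawn along two of its sides.
-/

namespace SpatialGraph
open scoped Graph

/-! ### Polyhedra and piecewise linear maps -/

section Polyhedra

variable {E F W : Type*} [AddCommGroup E] [Module ℝ E] [AddCommGroup F] [Module ℝ F]

theorem isPolyhedron_convexHull (t : Finset E) : IsPolyhedron (convexHull ℝ (t : Set E)) :=
  ⟨{t}, Set.finite_singleton t, by simp⟩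

theorem IsPolyhedron.convexHull_of_finite {s : Set E} (hs : s.Finite) :
    IsPolyhedron (convexHull ℝ s) := by
  simpa using isPolyhedron_convexHull hs.toFinset

theorem isPolyhedron_empty : IsPolyhedron (∅ : Set E) :=
  ⟨∅, Set.finite_empty, by simp⟩

theorem IsPolyhedron.biUnion {ι : Type*} {s : Set ι} (hs : s.Finite) {P : ι → Set E}
    (h : ∀ i ∈ s, IsPolyhedron (P i)) : IsPolyhedron (⋃ i ∈ s, P i) := by
  choose! T hT hP using h
  refine ⟨⋃ i ∈ s, T i, hs.biUnion hT, ?_⟩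
  ext x
  simp only [Set.mem_iUnion]
  constructor
  · rintro ⟨i, hi, hx⟩
    rw [hP i hi] at hx
    simp only [Set.mem_iUnion] at hx
    obtain ⟨t, ht, hx⟩ := hx
    exact ⟨t, ⟨i, hi, ht⟩, hx⟩
  · rintro ⟨t, ⟨i, hi, ht⟩, hx⟩
    refine ⟨i, hi, ?_⟩
    rw [hP i hi]
    simp only [Set.mem_iUnion]
    exact ⟨t, ht, hx⟩

theorem IsPolyhedron.iUnion {ι : Type*} [Finite ι] {P : ι → Set E}
    (h : ∀ i, IsPolyhedron (P i)) : IsPolyhedron (⋃ i, P i) := by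
  simpa using IsPolyhedron.biUnion (s := Set.univ) Set.finite_univ (fun i _ => h i)

theorem IsPolyhedron.union {P Q : Set E} (hP : IsPolyhedron P) (hQ : IsPolyhedron Q) :
    IsPolyhedron (P ∪ Q) := by
  rw [Set.union_eq_iUnion]
  exact IsPolyhedron.iUnion (by rintro (_ | _) <;> assumption)

theorem IsPolyhedron.image {P : Set E} (hP : IsPolyhedron P) (f : E →ᵃ[ℝ] F) :
    IsPolyhedron (f '' P) := by
  obtain ⟨T, hT, rfl⟩ := hP
  rw [Set.image_iUnion₂]
  refine .biUnion hT fun t _ => ?_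
  rw [AffineMap.image_convexHull]
  exact .convexHull_of_finite (t.finite_toSet.image _)

theorem IsPolyhedron.image_linear {P : Set E} (hP : IsPolyhedron P) (f : E →ₗ[ℝ] F) :
    IsPolyhedron (f '' P) :=
  hP.image f.toAffineMap

theorem IsPolyhedron.prod {P : Set E} {Q : Set F} (hP : IsPolyhedron P) (hQ : IsPolyhedron Q) :
    IsPolyhedron (P ×ˢ Q) := by
  obtain ⟨T, hT, rfl⟩ := hP
  obtain ⟨U, hU, rfl⟩ := hQ
  have : (⋃ t ∈ T, convexHull ℝ (t : Set E)) ×ˢ (⋃ u ∈ U, convexHull ℝ (u : Set F)) =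
      ⋃ p ∈ T ×ˢ U, convexHull ℝ ((p.1 : Set E) ×ˢ (p.2 : Set F)) := by
    ext ⟨x, y⟩
    simp only [convexHull_prod, Set.mem_prod, Set.mem_iUnion, Prod.exists]
    constructor
    · rintro ⟨⟨t, ht, hx⟩, u, hu, hy⟩
      exact ⟨t, u, ⟨ht, hu⟩, hx, hy⟩
    · rintro ⟨t, u, ⟨ht, hu⟩, hx, hy⟩
      exact ⟨⟨t, ht, hx⟩, u, hu, hy⟩
  rw [this]
  exact .biUnion (hT.prod hU) fun p _ =>
    .convexHull_of_finite (p.1.finite_toSet.prod p.2.finite_toSet)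

/-- The set of nonnegative weights of total mass one satisfying a linear system is a polytope:
by Krein–Milman it is the closed convex hull of its extreme points, and an extreme point is
determined by its support, so there are finitely many of them. -/
theorem isPolyhedron_stdSimplex_inter_fiber {ι : Type*} [Fintype ι] [NormedAddCommGroup W]
    [NormedSpace ℝ W] (A : (ι → ℝ) →ₗ[ℝ] W) (b : W) :
    IsPolyhedron {w ∈ stdSimplex ℝ ι | A w = b} := by
  set K : Set (ι → ℝ) := {w ∈ stdSimplex ℝ ι | A w = b} with hK
  have hcomp : IsCompact K :=
    (isCompact_stdSimplex ℝ ι).inter_right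
      (isClosed_singleton.preimage A.continuous_of_finiteDimensional)
  have hconv : Convex ℝ K :=
    (convex_stdSimplex ℝ ι).inter ((convex_singleton b).linear_preimage A)
  have hfin : (K.extremePoints ℝ).Finite := by
    refine Set.Finite.of_finite_image (f := fun w : ι → ℝ => Function.support w)
      (Set.toFinite _) ?_
    intro w hw w' hw' hsupp
    by_contra hne
    simp only at hsupp
    rw [mem_extremePoints_iff_left] at hw
    obtain ⟨⟨hws, hwA⟩, hext⟩ := hw
    obtain ⟨hws', hwA'⟩ := hw'.1
    -- As the supports agree, moving `w` a little along the line through both points, in either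
    -- direction, stays in `K`, so `w` is not an extreme point.
    obtain ⟨ε, hε, hεw⟩ : ∃ ε > 0, ∀ i, ε * |w i - w' i| ≤ w i := by
      have : ∀ i, ∃ ε > 0, ε * |w i - w' i| ≤ w i := by
        intro i
        by_cases hi : w i = 0
        · have hi' : w' i = 0 := by
            by_contra h
            have : i ∈ Function.support w := by rw [hsupp]; exact h
            exact this hi
          exact ⟨1, one_pos, by simp [hi, hi']⟩
        · have hpos : 0 < w i := lt_of_le_of_ne (hws.1 i) (Ne.symm hi)
          refine ⟨w i / (|w i - w' i| + 1), by positivity, ?_⟩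
          rw [div_mul_eq_mul_div, div_le_iff₀ (by positivity)]
          nlinarith [abs_nonneg (w i - w' i)]
      choose ε hε hεw using this
      rcases isEmpty_or_nonempty ι with h | h
      · exact ⟨1, one_pos, fun i => h.elim i⟩
      · refine ⟨Finset.univ.inf' Finset.univ_nonempty ε, ?_, fun i => ?_⟩
        · rw [gt_iff_lt, Finset.lt_inf'_iff]; exact fun i _ => hε i
        · exact (mul_le_mul_of_nonneg_right (Finset.inf'_le _ (Finset.mem_univ i))
            (abs_nonneg _)).trans (hεw i)
    have hmem : ∀ c : ℝ, |c| ≤ ε → w + c • (w - w') ∈ K := by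
      intro c hc
      refine ⟨⟨fun i => ?_, ?_⟩, ?_⟩
      · have h1 := hεw i
        have h2 : |c * (w i - w' i)| ≤ ε * |w i - w' i| := by
          rw [abs_mul]; exact mul_le_mul_of_nonneg_right hc (abs_nonneg _)
        have := neg_abs_le (c * (w i - w' i))
        simp only [Pi.add_apply, Pi.smul_apply, Pi.sub_apply, smul_eq_mul]
        linarith
      · simp only [Pi.add_apply, Pi.smul_apply, Pi.sub_apply, smul_eq_mul,
          Finset.sum_add_distrib, ← Finset.mul_sum, Finset.sum_sub_distrib, hws.2, hws'.2]
        ring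
      · simp [hwA, hwA']
    have h1 := hmem ε (by rw [abs_of_pos hε])
    have h2 := hmem (-ε) (by rw [abs_neg, abs_of_pos hε])
    have h3 := hext _ h1 _ h2 ⟨1/2, 1/2, by norm_num, by norm_num, by norm_num, by
      ext i; simp; ring⟩
    apply hne
    have : ε • (w - w') = 0 := by simpa using h3
    rcases smul_eq_zero.1 this with h | h
    · exact absurd h hε.ne'
    · exact sub_eq_zero.1 h
  rw [← closure_convexHull_extremePoints hcomp hconv,
    (hfin.isCompact_convexHull ℝ).isClosed.closure_eq]
  exact .convexHull_of_finite hfin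

theorem IsPolyhedron.inter_fiber [NormedAddCommGroup W] [NormedSpace ℝ W] {P : Set E}
    (hP : IsPolyhedron P) (A : E →ₗ[ℝ] W) (b : W) : IsPolyhedron {x ∈ P | A x = b} := by
  obtain ⟨T, hT, rfl⟩ := hP
  have : {x ∈ ⋃ t ∈ T, convexHull ℝ (t : Set E) | A x = b} =
      ⋃ t ∈ T, {x ∈ convexHull ℝ (t : Set E) | A x = b} := by
    ext x; simp only [Set.mem_iUnion, Set.mem_ofPred_eq]; tauto
  rw [this]
  refine .biUnion hT fun t _ => ?_
  classical
  let L : (t → ℝ) →ₗ[ℝ] E := Fintype.linearCombination ℝ (fun i : t => (i : E))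
  have hL : convexHull ℝ (t : Set E) = L '' stdSimplex ℝ t := by
    have h := convexHull_basis_eq_stdSimplex (R := ℝ) (ι := t)
    rw [← h, ← LinearMap.coe_toAffineMap, AffineMap.image_convexHull]
    congr 1
    ext x
    simp only [LinearMap.coe_toAffineMap, Set.mem_image, Set.mem_range, exists_exists_eq_and]
    constructor
    · intro hx
      refine ⟨⟨x, hx⟩, ?_⟩
      simp [L, Fintype.linearCombination_apply, ite_smul, Finset.sum_ite_eq]
    · rintro ⟨i, rfl⟩
      simp [L, Fintype.linearCombination_apply, ite_smul, Finset.sum_ite_eq]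
  have : {x ∈ convexHull ℝ (t : Set E) | A x = b} =
      L '' {w ∈ stdSimplex ℝ t | (A ∘ₗ L) w = b} := by
    rw [hL]; ext x; constructor
    · rintro ⟨⟨w, hw, rfl⟩, h⟩; exact ⟨w, ⟨hw, h⟩, rfl⟩
    · rintro ⟨w, ⟨hw, h⟩, rfl⟩; exact ⟨⟨w, hw, rfl⟩, h⟩
  rw [this]
  exact (isPolyhedron_stdSimplex_inter_fiber _ _).image_linear L

theorem IsPolyhedron.inter [NormedAddCommGroup W] [NormedSpace ℝ W] {P Q : Set W}
    (hP : IsPolyhedron P) (hQ : IsPolyhedron Q) : IsPolyhedron (P ∩ Q) := by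
  have : P ∩ Q = LinearMap.fst ℝ W W ''
      {z ∈ P ×ˢ Q | (LinearMap.fst ℝ W W - LinearMap.snd ℝ W W) z = 0} := by
    ext x
    constructor
    · rintro ⟨h1, h2⟩
      exact ⟨(x, x), ⟨⟨h1, h2⟩, by simp⟩, rfl⟩
    · rintro ⟨⟨y, z⟩, ⟨⟨h1, h2⟩, h⟩, rfl⟩
      simp only [LinearMap.sub_apply, LinearMap.fst_apply, LinearMap.snd_apply, sub_eq_zero] at h
      subst h
      exact ⟨h1, h2⟩
  rw [this]
  exact ((hP.prod hQ).inter_fiber _ _).image_linear _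

end Polyhedra

section Compact
variable {E : Type*} [NormedAddCommGroup E] [NormedSpace ℝ E]

theorem IsPolyhedron.isCompact {P : Set E} (hP : IsPolyhedron P) : IsCompact P := by
  obtain ⟨T, hT, rfl⟩ := hP
  exact hT.isCompact_biUnion fun t _ => t.finite_toSet.isCompact_convexHull ℝ

theorem isPolyhedron_Icc (a b : ℝ) : IsPolyhedron (Set.Icc a b) := by
  rcases le_or_gt a b with h | h
  · rw [← segment_eq_Icc h, ← convexHull_pair]
    exact .convexHull_of_finite (Set.toFinite _)
  · rw [Set.Icc_eq_empty (not_le.2 h)]; exact isPolyhedron_empty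

theorem IsPolyhedron.inter_halfspace {P : Set E} [FiniteDimensional ℝ E] (hP : IsPolyhedron P)
    (l : E →ₗ[ℝ] ℝ) (c : ℝ) : IsPolyhedron {x ∈ P | l x ≤ c} := by
  obtain ⟨M, hM⟩ : ∃ M, ∀ x ∈ P, c - l x ≤ M := by
    have := (hP.isCompact.image l.continuous_of_finiteDimensional).bddBelow
    obtain ⟨m, hm⟩ := this
    exact ⟨c - m, fun x hx => by linarith [hm ⟨x, hx, rfl⟩]⟩
  have : {x ∈ P | l x ≤ c} = LinearMap.fst ℝ E ℝ ''
      {z ∈ P ×ˢ Set.Icc 0 M | (l ∘ₗ LinearMap.fst ℝ E ℝ + LinearMap.snd ℝ E ℝ) z = c} := by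
    ext x
    constructor
    · rintro ⟨h1, h2⟩
      exact ⟨(x, c - l x), ⟨⟨h1, by simpa using h2, hM x h1⟩, by simp⟩, rfl⟩
    · rintro ⟨⟨y, s⟩, ⟨⟨h1, h2, h3⟩, h⟩, rfl⟩
      simp only [LinearMap.add_apply, LinearMap.coe_comp, Function.comp_apply,
        LinearMap.fst_apply, LinearMap.snd_apply] at h ⊢
      refine ⟨h1, ?_⟩
      simp only at h2 ⊢
      linarith
  rw [this]
  exact ((hP.prod (isPolyhedron_Icc 0 M)).inter_fiber _ _).image_linear _

end Compact

section PL
variable {E F H : Type*} [NormedAddCommGroup E] [NormedSpace ℝ E]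
  [NormedAddCommGroup F] [NormedSpace ℝ F] [NormedAddCommGroup H] [NormedSpace ℝ H]

theorem IsPLOn.congr {f g : E → F} {P : Set E} (hf : IsPLOn f P) (h : Set.EqOn f g P) :
    IsPLOn g P := by
  have : Set.graphOn g P = Set.graphOn f P := by
    rw [Set.graphOn_inj]; exact h.symm
  rw [IsPLOn, this]; exact hf

theorem IsPLOn.isPolyhedron_image {f : E → F} {P : Set E} (hf : IsPLOn f P) :
    IsPolyhedron (f '' P) := by
  have := IsPolyhedron.image_linear hf (LinearMap.snd ℝ E F)
  rwa [LinearMap.coe_snd, Set.image_snd_graphOn] at this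

theorem IsPLOn.union {f : E → F} {P Q : Set E} (hP : IsPLOn f P) (hQ : IsPLOn f Q) :
    IsPLOn f (P ∪ Q) := by
  rw [IsPLOn, Set.graphOn_union]; exact IsPolyhedron.union hP hQ

theorem isPLOn_affine (f : E →ᵃ[ℝ] F) {P : Set E} (hP : IsPolyhedron P) : IsPLOn f P := by
  exact hP.image ((AffineMap.id ℝ E).prod f)

theorem isPLOn_linear (f : E →ₗ[ℝ] F) {P : Set E} (hP : IsPolyhedron P) : IsPLOn f P :=
  isPLOn_affine f.toAffineMap hP

theorem isPLOn_const (c : F) {P : Set E} (hP : IsPolyhedron P) : IsPLOn (fun _ => c) P :=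
  isPLOn_affine (AffineMap.const ℝ E c) hP

theorem isPLOn_id {P : Set E} (hP : IsPolyhedron P) : IsPLOn id P :=
  isPLOn_linear LinearMap.id hP

theorem IsPLOn.mono {f : E → F} {P Q : Set E} (hf : IsPLOn f P) (hQ : IsPolyhedron Q)
    (h : Q ⊆ P) : IsPLOn f Q := by
  have : Set.graphOn f Q = Set.graphOn f P ∩ Q ×ˢ (f '' P) := by
    ext ⟨x, y⟩
    simp only [Set.mem_graphOn, Set.mem_inter_iff, Set.mem_prod]
    constructor
    · rintro ⟨h1, rfl⟩; exact ⟨⟨h h1, rfl⟩, h1, x, h h1, rfl⟩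
    · rintro ⟨⟨h1, h2⟩, h3, -⟩; exact ⟨h3, h2⟩
  rw [IsPLOn, this]
  exact IsPolyhedron.inter hf (hQ.prod hf.isPolyhedron_image)

theorem IsPLOn.comp {g : F → H} {f : E → F} {P : Set E} {Q : Set F} (hg : IsPLOn g Q)
    (hf : IsPLOn f P) (h : Set.MapsTo f P Q) : IsPLOn (g ∘ f) P := by
  let A : (E × F) × (F × H) →ₗ[ℝ] F :=
    (LinearMap.snd ℝ E F) ∘ₗ LinearMap.fst ℝ (E × F) (F × H) -
      (LinearMap.fst ℝ F H) ∘ₗ LinearMap.snd ℝ (E × F) (F × H)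
  let B : (E × F) × (F × H) →ₗ[ℝ] E × H :=
    ((LinearMap.fst ℝ E F) ∘ₗ LinearMap.fst ℝ (E × F) (F × H)).prod
      ((LinearMap.snd ℝ F H) ∘ₗ LinearMap.snd ℝ (E × F) (F × H))
  have : Set.graphOn (g ∘ f) P =
      B '' {z ∈ Set.graphOn f P ×ˢ Set.graphOn g Q | A z = 0} := by
    ext ⟨x, z⟩
    simp only [Set.mem_graphOn, Set.mem_image, Set.mem_ofPred_eq, Set.mem_prod]
    constructor
    · rintro ⟨hx, rfl⟩
      exact ⟨((x, f x), (f x, g (f x))), ⟨⟨⟨hx, rfl⟩, h hx, rfl⟩, by simp [A]⟩, rfl⟩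
    · rintro ⟨⟨⟨x', y⟩, ⟨y', z'⟩⟩, ⟨⟨⟨hx, hy⟩, hy', hz⟩, hA⟩, hB⟩
      simp only [A, B, LinearMap.sub_apply, LinearMap.coe_comp, Function.comp_apply,
        LinearMap.fst_apply, LinearMap.snd_apply, sub_eq_zero, LinearMap.prod_apply,
        Function.prod] at hA hB hx hy hy' hz
      obtain ⟨rfl, rfl⟩ := hB
      subst hA
      subst hy
      exact ⟨hx, hz⟩
  rw [IsPLOn, this]
  exact ((IsPolyhedron.prod hf hg).inter_fiber A 0).image_linear B

theorem IsPLOn.prodMk {f : E → F} {g : E → H} {P : Set E} (hf : IsPLOn f P) (hg : IsPLOn g P) :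
    IsPLOn (fun x => (f x, g x)) P := by
  let A : (E × F) × (E × H) →ₗ[ℝ] E :=
    (LinearMap.fst ℝ E F) ∘ₗ LinearMap.fst ℝ (E × F) (E × H) -
      (LinearMap.fst ℝ E H) ∘ₗ LinearMap.snd ℝ (E × F) (E × H)
  let B : (E × F) × (E × H) →ₗ[ℝ] E × (F × H) :=
    ((LinearMap.fst ℝ E F) ∘ₗ LinearMap.fst ℝ (E × F) (E × H)).prod
      (((LinearMap.snd ℝ E F) ∘ₗ LinearMap.fst ℝ (E × F) (E × H)).prod
      ((LinearMap.snd ℝ E H) ∘ₗ LinearMap.snd ℝ (E × F) (E × H)))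
  have : Set.graphOn (fun x => (f x, g x)) P =
      B '' {z ∈ Set.graphOn f P ×ˢ Set.graphOn g P | A z = 0} := by
    ext ⟨x, y, z⟩
    simp only [Set.mem_graphOn, Set.mem_image, Set.mem_ofPred_eq, Set.mem_prod, Prod.mk.injEq]
    constructor
    · rintro ⟨hx, rfl, rfl⟩
      exact ⟨((x, f x), (x, g x)), ⟨⟨⟨hx, rfl⟩, hx, rfl⟩, by simp [A]⟩, rfl⟩
    · rintro ⟨⟨⟨x', y'⟩, ⟨x'', z'⟩⟩, ⟨⟨⟨hx, hy⟩, hx', hz⟩, hA⟩, hB⟩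
      simp only [A, B, LinearMap.sub_apply, LinearMap.coe_comp, Function.comp_apply,
        LinearMap.fst_apply, LinearMap.snd_apply, sub_eq_zero, LinearMap.prod_apply,
        Function.prod] at hA hB hx hy hx' hz
      obtain ⟨rfl, rfl, rfl⟩ := hB
      subst hA
      exact ⟨hx, hy, hz⟩
  rw [IsPLOn, this]
  exact ((IsPolyhedron.prod hf hg).inter_fiber A 0).image_linear B

theorem IsPLOn.linear_comp {f : E → F} {P : Set E} (hf : IsPLOn f P) (A : F →ₗ[ℝ] H) :
    IsPLOn (fun x => A (f x)) P :=
  (isPLOn_linear A hf.isPolyhedron_image).comp hf (Set.mapsTo_image f P)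

theorem IsPLOn.add {f g : E → F} {P : Set E} (hf : IsPLOn f P) (hg : IsPLOn g P) :
    IsPLOn (fun x => f x + g x) P :=
  (hf.prodMk hg).linear_comp (LinearMap.fst ℝ F F + LinearMap.snd ℝ F F)

theorem IsPLOn.smul_const {f : E → ℝ} {P : Set E} (hf : IsPLOn f P) (c : F) :
    IsPLOn (fun x => f x • c) P :=
  hf.linear_comp (LinearMap.toSpanSingleton ℝ F c)

theorem IsPLOn.const_smul {f : E → F} {P : Set E} (hf : IsPLOn f P) (c : ℝ) :
    IsPLOn (fun x => c • f x) P :=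
  hf.linear_comp (c • LinearMap.id)

theorem IsPLOn.max {f g : E → ℝ} {P : Set E} (hf : IsPLOn f P) (hg : IsPLOn g P) :
    IsPLOn (fun x => max (f x) (g x)) P := by
  have hfg := hf.prodMk hg
  set Q := (fun x => (f x, g x)) '' P
  have hQ : IsPolyhedron Q := hfg.isPolyhedron_image
  have h1 : IsPLOn (fun z : ℝ × ℝ => Max.max z.1 z.2)
      {z ∈ Q | (LinearMap.fst ℝ ℝ ℝ - LinearMap.snd ℝ ℝ ℝ) z ≤ 0} := by
    refine (isPLOn_linear (LinearMap.snd ℝ ℝ ℝ) (hQ.inter_halfspace _ 0)).congr ?_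
    rintro z ⟨-, hz⟩
    simp only [LinearMap.sub_apply, LinearMap.fst_apply, LinearMap.snd_apply] at hz
    simp only [LinearMap.snd_apply]
    rw [max_eq_right (by linarith)]
  have h2 : IsPLOn (fun z : ℝ × ℝ => Max.max z.1 z.2)
      {z ∈ Q | (LinearMap.snd ℝ ℝ ℝ - LinearMap.fst ℝ ℝ ℝ) z ≤ 0} := by
    refine (isPLOn_linear (LinearMap.fst ℝ ℝ ℝ) (hQ.inter_halfspace _ 0)).congr ?_
    rintro z ⟨-, hz⟩
    simp only [LinearMap.sub_apply, LinearMap.fst_apply, LinearMap.snd_apply] at hz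
    simp only [LinearMap.fst_apply]
    rw [max_eq_left (by linarith)]
  refine (h1.union h2).comp hfg fun x hx => ?_
  simp only [Set.mem_union, Set.mem_ofPred_eq, LinearMap.sub_apply, LinearMap.fst_apply,
    LinearMap.snd_apply]
  rcases le_total (f x) (g x) with h | h
  · exact Or.inl ⟨⟨x, hx, rfl⟩, by linarith⟩
  · exact Or.inr ⟨⟨x, hx, rfl⟩, by linarith⟩

theorem IsPLOn.min {f g : E → ℝ} {P : Set E} (hf : IsPLOn f P) (hg : IsPLOn g P) :
    IsPLOn (fun x => min (f x) (g x)) P := by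
  refine (((hf.const_smul (-1)).max (hg.const_smul (-1))).const_smul (-1)).congr fun x _ => ?_
  simp [max_neg_neg]

theorem IsPLOn.of_leftInvOn {f : E → F} {g : F → E} {P : Set E} (hf : IsPLOn f P)
    (h : Set.LeftInvOn g f P) : IsPLOn g (f '' P) := by
  have : Set.graphOn g (f '' P) =
      ((LinearMap.snd ℝ E F).prod (LinearMap.fst ℝ E F)) '' Set.graphOn f P := by
    ext ⟨y, x⟩
    simp only [Set.mem_graphOn, Set.mem_image, LinearMap.prod_apply, Function.prod, Prod.exists]
    constructor
    · intro hh
      obtain ⟨⟨z, hz, rfl⟩, h'⟩ := hh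
      rw [h hz] at h'; subst h'
      exact ⟨z, f z, ⟨hz, rfl⟩, rfl⟩
    · rintro ⟨a, b, ⟨ha, rfl⟩, hab⟩
      have h1 : f a = y := congrArg Prod.fst hab
      have h2 : a = x := congrArg Prod.snd hab
      subst h1 h2
      exact ⟨⟨a, ha, rfl⟩, h ha⟩
  rw [IsPLOn, this]
  exact IsPolyhedron.image_linear hf _

theorem IsPLOn.continuousOn {f : E → F} {P : Set E} (hf : IsPLOn f P) : ContinuousOn f P := by
  rw [continuousOn_iff_isClosed]
  intro t ht
  have hc : IsCompact (Set.graphOn f P ∩ Prod.snd ⁻¹' t) :=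
    IsCompact.inter_right (IsPolyhedron.isCompact hf) (ht.preimage continuous_snd)
  refine ⟨Prod.fst '' (Set.graphOn f P ∩ Prod.snd ⁻¹' t),
    (hc.image continuous_fst).isClosed, ?_⟩
  ext x
  simp only [Set.mem_inter_iff, Set.mem_preimage, Set.mem_image, Set.mem_graphOn, Prod.exists,
    exists_and_right, exists_eq_right]
  constructor
  · rintro ⟨h1, h2⟩; exact ⟨⟨f x, ⟨h2, rfl⟩, h1⟩, h2⟩
  · rintro ⟨⟨y, ⟨h2, rfl⟩, h1⟩, _⟩; exact ⟨h1, h2⟩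

end PL

section UpperBoundary
variable {E : Type*} [AddCommGroup E] [Module ℝ E]

/-- The upper boundary of a polytope in `E × ℝ` is a polyhedron.  It is the union of the hulls of
those sets of vertices whose hull lies in the upper boundary: if a point written with positive
weights on `s` cannot be moved up inside the polytope, then no point of the hull of `s` can, since
the point is a proper convex combination of any point of the hull with another one. -/
theorem isPolyhedron_upperBoundary (t : Finset (E × ℝ)) :
    IsPolyhedron {z ∈ convexHull ℝ (t : Set (E × ℝ)) |
      ∀ r, (z.1, r) ∈ convexHull ℝ (t : Set (E × ℝ)) → r ≤ z.2} := by
  classical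
  set C := convexHull ℝ (t : Set (E × ℝ)) with hC
  set U := {z ∈ C | ∀ r, (z.1, r) ∈ C → r ≤ z.2} with hU
  have hCc : Convex ℝ C := convex_convexHull ℝ _
  refine ⟨{s ∈ (t.powerset : Set (Finset (E × ℝ))) | convexHull ℝ (s : Set (E × ℝ)) ⊆ U},
    (Finset.finite_toSet _).subset (Set.sep_subset _ _), ?_⟩
  apply Set.Subset.antisymm
  · rintro y ⟨hyC, hy⟩
    rw [hC, Finset.mem_convexHull'] at hyC
    obtain ⟨w, hw0, hw1, hwy⟩ := hyC
    set s := t.filter fun i => 0 < w i with hs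
    have hst : s ⊆ t := Finset.filter_subset _ _
    have hzero : ∀ i ∈ t, i ∉ s → w i = 0 := fun i hi his => by
      by_contra h
      exact his (Finset.mem_filter.2 ⟨hi, lt_of_le_of_ne (hw0 i hi) (Ne.symm h)⟩)
    have hw1' : ∑ i ∈ s, w i = 1 := by
      rw [← hw1]; exact Finset.sum_subset hst hzero
    have hwy' : ∑ i ∈ s, w i • i = y := by
      rw [← hwy]; exact Finset.sum_subset hst fun i hi his => by simp [hzero i hi his]
    have hpos : ∀ i ∈ s, 0 < w i := fun i hi => (Finset.mem_filter.1 hi).2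
    have hys : y ∈ convexHull ℝ (s : Set (E × ℝ)) := by
      rw [Finset.mem_convexHull']; exact ⟨w, fun i hi => (hpos i hi).le, hw1', hwy'⟩
    simp only [Set.mem_iUnion]
    refine ⟨s, ⟨by simpa using hst, ?_⟩, hys⟩
    intro z hz
    have hsC : convexHull ℝ (s : Set (E × ℝ)) ⊆ C := convexHull_mono (by exact_mod_cast hst)
    refine ⟨hsC hz, fun r hr => ?_⟩
    rw [Finset.mem_convexHull'] at hz
    obtain ⟨v, hv0, hv1, hvz⟩ := hz
    -- all weights of `y` dominate `ε` times those of `z`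
    obtain ⟨ε, hε, hε1, hεw⟩ : ∃ ε > 0, ε < 1 ∧ ∀ i ∈ s, ε * v i ≤ w i := by
      have hne : s.Nonempty := by
        rw [Finset.nonempty_iff_ne_empty]; rintro h; rw [h] at hw1'; simp at hw1'
      refine ⟨min (s.inf' hne w) (1/2), ?_, ?_, fun i hi => ?_⟩
      · rw [gt_iff_lt, lt_min_iff, Finset.lt_inf'_iff]; exact ⟨hpos, by norm_num⟩
      · exact (min_le_right _ _).trans_lt (by norm_num)
      · have h1 : v i ≤ 1 := by rw [← hv1]; exact Finset.single_le_sum hv0 hi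
        have h2 : min (s.inf' hne w) (1/2) ≤ w i := (min_le_left _ _).trans (Finset.inf'_le _ hi)
        nlinarith [hv0 i hi, hpos i hi]
    set z' : E × ℝ := ∑ i ∈ s, ((w i - ε * v i) / (1 - ε)) • i with hz'
    have hz'C : z' ∈ C := by
      apply hsC
      rw [Finset.mem_convexHull']
      refine ⟨fun i => (w i - ε * v i) / (1 - ε), fun i hi =>
        div_nonneg (by linarith [hεw i hi]) (by linarith), ?_, rfl⟩
      rw [← Finset.sum_div, Finset.sum_sub_distrib, ← Finset.mul_sum, hw1', hv1, mul_one,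
        div_self (by linarith)]
    have hyz : y = ε • z + (1 - ε) • z' := by
      rw [← hwy', ← hvz, hz', Finset.smul_sum, Finset.smul_sum, ← Finset.sum_add_distrib]
      refine Finset.sum_congr rfl fun i _ => ?_
      rw [smul_smul, smul_smul, ← add_smul, mul_div_cancel₀ _ (by linarith : (1 - ε) ≠ 0)]
      congr 1; ring
    have hup : ε • (z.1, r) + (1 - ε) • z' ∈ C :=
      hCc hr hz'C hε.le (by linarith) (by ring)
    have hfst : ε • (z.1, r) + (1 - ε) • z' = (y.1, ε * r + (1 - ε) * z'.2) := by
      rw [hyz]; ext <;> simp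
    rw [hfst] at hup
    have := hy _ hup
    rw [hyz] at this
    simp only [Prod.snd_add, Prod.smul_snd, smul_eq_mul] at this
    nlinarith
  · intro y hy
    simp only [Set.mem_iUnion] at hy
    obtain ⟨s, ⟨-, hs⟩, hy⟩ := hy
    exact hs hy

end UpperBoundary
end SpatialGraph
namespace SpatialGraph
open scoped Graph

/-! ### The 3-sphere and its piecewise linear homeomorphisms -/

theorem isPolyhedron_cube (n : ℕ) : IsPolyhedron (cube n) := by
  have : cube n = convexHull ℝ (Set.univ.pi fun _ : Fin n => ({-1, 1} : Set ℝ)) := by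
    rw [convexHull_pi, cube, closedBall_pi _ zero_le_one]
    congr 1
    funext i
    rw [convexHull_pair, segment_eq_Icc (by norm_num), Real.closedBall_eq_Icc]
    simp
  rw [this]
  exact .convexHull_of_finite (Set.Finite.pi fun _ => Set.toFinite _)

theorem mem_cube {n : ℕ} {x : Fin n → ℝ} : x ∈ cube n ↔ ∀ i, |x i| ≤ 1 := by
  rw [cube, mem_closedBall_zero_iff, pi_norm_le_iff_of_nonneg zero_le_one]
  simp

theorem mem_cubeBoundary {n : ℕ} {x : Fin n → ℝ} :
    x ∈ cubeBoundary n ↔ (∀ i, |x i| ≤ 1) ∧ ∃ i, |x i| = 1 := by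
  rw [cubeBoundary, mem_sphere_zero_iff_norm, ← mem_cube, cube, mem_closedBall_zero_iff]
  constructor
  · intro h
    refine ⟨h.le, ?_⟩
    by_contra! hne
    have h1 : ∀ i, |x i| < 1 := fun i =>
      lt_of_le_of_ne (by simpa using (norm_le_pi_norm x i).trans h.le) (hne i)
    have : ‖x‖ < 1 := (pi_norm_lt_iff one_pos).2 (by simpa using h1)
    exact this.ne h
  · rintro ⟨h, i, hi⟩
    refine le_antisymm h ?_
    rw [← hi]
    simpa using norm_le_pi_norm x i

theorem mem_threeSphere {x : Fin 4 → ℝ} :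
    x ∈ threeSphere ↔ (∀ i, |x i| ≤ 1) ∧ ∃ i, |x i| = 1 :=
  mem_cubeBoundary

theorem isPolyhedron_cubeBoundary (n : ℕ) : IsPolyhedron (cubeBoundary n) := by
  have : cubeBoundary n = ⋃ i : Fin n,
      ({x ∈ cube n | (LinearMap.proj i : (Fin n → ℝ) →ₗ[ℝ] ℝ) x = 1} ∪
        {x ∈ cube n | (LinearMap.proj i : (Fin n → ℝ) →ₗ[ℝ] ℝ) x = -1}) := by
    ext x
    simp only [mem_cubeBoundary, Set.mem_iUnion, Set.mem_union, Set.mem_ofPred_eq,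
      LinearMap.proj_apply, mem_cube]
    constructor
    · rintro ⟨h, i, hi⟩
      refine ⟨i, ?_⟩
      rcases eq_or_eq_neg_of_abs_eq hi with h' | h'
      · exact Or.inl ⟨h, h'⟩
      · exact Or.inr ⟨h, h'⟩
    · rintro ⟨i, ⟨h, hi⟩ | ⟨h, hi⟩⟩
      · exact ⟨h, i, by simp [hi]⟩
      · exact ⟨h, i, by simp [hi]⟩
  rw [this]
  exact .iUnion fun i => ((isPolyhedron_cube n).inter_fiber _ _).union
    ((isPolyhedron_cube n).inter_fiber _ _)

theorem isPolyhedron_threeSphere : IsPolyhedron threeSphere :=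
  isPolyhedron_cubeBoundary 4

/-- `h` restricts to a piecewise linear homeomorphism of the `3`-sphere.  (The inverse is
automatically piecewise linear, as its graph is the transposed one.) -/
def IsPLHomeo (h : (Fin 4 → ℝ) → (Fin 4 → ℝ)) : Prop :=
  IsPLOn h threeSphere ∧ Set.BijOn h threeSphere threeSphere

theorem IsPLHomeo.comp {h k : (Fin 4 → ℝ) → (Fin 4 → ℝ)} (hh : IsPLHomeo h) (hk : IsPLHomeo k) :
    IsPLHomeo (h ∘ k) :=
  ⟨hh.1.comp hk.1 hk.2.mapsTo, hh.2.comp hk.2⟩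

theorem IsPLHomeo.exists_inverse {h : (Fin 4 → ℝ) → (Fin 4 → ℝ)} (hh : IsPLHomeo h) :
    ∃ k, IsPLHomeo k ∧ Set.InvOn k h threeSphere threeSphere := by
  have hinv := hh.2.invOn_invFunOn
  refine ⟨Function.invFunOn h threeSphere, ⟨?_, ?_⟩, hinv⟩
  · have := hh.1.of_leftInvOn hinv.1
    rwa [hh.2.image_eq] at this
  · exact hinv.symm.bijOn hh.2.surjOn.mapsTo_invFunOn hh.2.mapsTo

theorem IsPLHomeo.continuousOn {h : (Fin 4 → ℝ) → (Fin 4 → ℝ)} (hh : IsPLHomeo h) :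
    ContinuousOn h threeSphere :=
  hh.1.continuousOn

theorem IsTrivialKnot.image {K : Set (Fin 4 → ℝ)} (hK : IsTrivialKnot K)
    {h : (Fin 4 → ℝ) → (Fin 4 → ℝ)} (hh : IsPLHomeo h) : IsTrivialKnot (h '' K) := by
  obtain ⟨g, hg, hinj, hmaps, rfl⟩ := hK
  exact ⟨h ∘ g, hh.1.comp hg hmaps, hh.2.injOn.comp hinj hmaps, hh.2.mapsTo.comp hmaps,
    (Set.image_comp _ _ _).symm⟩

theorem IsPLTwoSphere.subset {S : Set (Fin 4 → ℝ)} (hS : IsPLTwoSphere S) : S ⊆ threeSphere := by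
  obtain ⟨g, -, -, hmaps, rfl⟩ := hS
  exact hmaps.image_subset

theorem IsPLTwoSphere.image {S : Set (Fin 4 → ℝ)} (hS : IsPLTwoSphere S)
    {h : (Fin 4 → ℝ) → (Fin 4 → ℝ)} (hh : IsPLHomeo h) : IsPLTwoSphere (h '' S) := by
  obtain ⟨g, hg, hinj, hmaps, rfl⟩ := hS
  exact ⟨h ∘ g, hh.1.comp hg hmaps, hh.2.injOn.comp hinj hmaps, hh.2.mapsTo.comp hmaps,
    (Set.image_comp _ _ _).symm⟩

theorem connectedComponentIn_eq_iff {X : Type*} [TopologicalSpace X] {U : Set X} {p q : X}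
    (hp : p ∈ U) (hq : q ∈ U) :
    connectedComponentIn U p = connectedComponentIn U q ↔
      ∃ s ⊆ U, IsPreconnected s ∧ p ∈ s ∧ q ∈ s := by
  constructor
  · intro h
    exact ⟨connectedComponentIn U p, connectedComponentIn_subset U p,
      isPreconnected_connectedComponentIn, mem_connectedComponentIn hp,
      h ▸ mem_connectedComponentIn hq⟩
  · rintro ⟨s, hs, hc, hps, hqs⟩
    exact connectedComponentIn_eq (hc.subset_connectedComponentIn hps hs hqs)

theorem IsSplittable.symm {K L : Set (Fin 4 → ℝ)} (h : IsSplittable K L) : IsSplittable L K := by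
  obtain ⟨S, hS, hd, hne⟩ := h
  exact ⟨S, hS, by rwa [Set.union_comm], fun p hp q hq => (hne q hq p hp).symm⟩

theorem IsSplittable.image {K L : Set (Fin 4 → ℝ)} (hKL : IsSplittable K L)
    (hK : K ⊆ threeSphere) (hL : L ⊆ threeSphere)
    {h : (Fin 4 → ℝ) → (Fin 4 → ℝ)} (hh : IsPLHomeo h) : IsSplittable (h '' K) (h '' L) := by
  obtain ⟨S, hS, hd, hne⟩ := hKL
  obtain ⟨k, hk, hkl, hkr⟩ := hh.exists_inverse
  have hSs := hS.subset
  rw [Set.disjoint_left] at hd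
  have hout : ∀ p ∈ K ∪ L, p ∈ threeSphere ∧ p ∈ threeSphere \ S ∧ h p ∈ threeSphere \ h '' S := by
    intro p hp
    have hps : p ∈ threeSphere := Set.union_subset hK hL hp
    refine ⟨hps, ⟨hps, fun h' => hd h' hp⟩, hh.2.mapsTo hps, ?_⟩
    rintro ⟨s, hs, hsp⟩
    rw [hh.2.injOn (hSs hs) hps hsp] at hs
    exact hd hs hp
  refine ⟨h '' S, hS.image hh, ?_, ?_⟩
  · rw [← Set.image_union, Set.disjoint_left]
    rintro _ h1 ⟨p, hp, rfl⟩
    exact (hout p hp).2.2.2 h1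
  · rintro _ ⟨p, hp, rfl⟩ _ ⟨q, hq, rfl⟩ heq
    apply hne p hp q hq
    have hp' := hout p (Or.inl hp)
    have hq' := hout q (Or.inr hq)
    rw [connectedComponentIn_eq_iff hp'.2.2 hq'.2.2] at heq
    rw [connectedComponentIn_eq_iff hp'.2.1 hq'.2.1]
    obtain ⟨s, hs, hc, hps, hqs⟩ := heq
    have hss : s ⊆ threeSphere := fun x hx => (hs hx).1
    refine ⟨k '' s, ?_, hc.image _ (hk.continuousOn.mono hss), ⟨_, hps, hkl hp'.1⟩,
      ⟨_, hqs, hkl hq'.1⟩⟩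
    rintro _ ⟨x, hx, rfl⟩
    refine ⟨hk.2.mapsTo (hss hx), fun hxS => (hs hx).2 ⟨_, hxS, hkr (hss hx)⟩⟩

theorem IsPLHomeo.image_image_inverse {h k : (Fin 4 → ℝ) → (Fin 4 → ℝ)}
    (hinv : Set.InvOn k h threeSphere threeSphere) {K : Set (Fin 4 → ℝ)} (hK : K ⊆ threeSphere) :
    k '' (h '' K) = K :=
  (hinv.1.mono hK).image_image

theorem isTrivialKnot_image_iff {K : Set (Fin 4 → ℝ)} (hK : K ⊆ threeSphere)
    {h : (Fin 4 → ℝ) → (Fin 4 → ℝ)} (hh : IsPLHomeo h) :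
    IsTrivialKnot (h '' K) ↔ IsTrivialKnot K := by
  obtain ⟨k, hk, hinv⟩ := hh.exists_inverse
  refine ⟨fun h' => ?_, fun h' => h'.image hh⟩
  rw [← IsPLHomeo.image_image_inverse hinv hK]
  exact h'.image hk

theorem isSplittable_image_iff {K L : Set (Fin 4 → ℝ)}
    (hK : K ⊆ threeSphere) (hL : L ⊆ threeSphere)
    {h : (Fin 4 → ℝ) → (Fin 4 → ℝ)} (hh : IsPLHomeo h) :
    IsSplittable (h '' K) (h '' L) ↔ IsSplittable K L := by
  obtain ⟨k, hk, hinv⟩ := hh.exists_inverse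
  refine ⟨fun h' => ?_, fun h' => h'.image hK hL hh⟩
  rw [← IsPLHomeo.image_image_inverse hinv hK, ← IsPLHomeo.image_image_inverse hinv hL]
  exact h'.image ((Set.image_mono hK).trans hh.2.image_eq.subset)
    ((Set.image_mono hL).trans hh.2.image_eq.subset) hk

end SpatialGraph
namespace SpatialGraph
open scoped Graph

/-! ### Pushing the centre of a convex polytope -/

section Push

variable {E : Type*} [NormedAddCommGroup E] [NormedSpace ℝ E]

/-- The gauge of a polytope around the origin is piecewise linear: the graph of `-gauge s` over
`R • s` is the upper boundary of the pyramid with apex `(0, 0)` over the base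
`(R • s) × {-R}`. -/
theorem isPLOn_gauge {s : Set E} {t : Finset E} (hs : s = convexHull ℝ (t : Set E))
    (hs0 : s ∈ nhds 0) {Q : Set E} (hQ : IsPolyhedron Q) : IsPLOn (gauge s) Q := by
  classical
  have hconv : Convex ℝ s := hs ▸ convex_convexHull ℝ _
  have hcomp : IsCompact s := hs ▸ t.finite_toSet.isCompact_convexHull ℝ
  have habs : Absorbent ℝ s := absorbent_nhds_zero hs0
  have hvb : Bornology.IsVonNBounded ℝ s := (NormedSpace.isVonNBounded_iff ℝ).2 hcomp.isBounded
  have hcont := continuous_gauge hconv hs0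
  have hsmul : ∀ (c : ℝ) (y : E), 0 ≤ c → gauge s (c • y) = c * gauge s y := fun c y hc => by
    rw [gauge_smul_of_nonneg hc]; rfl
  obtain ⟨R, hR, hQR⟩ : ∃ R > 0, ∀ y ∈ Q, gauge s y ≤ R := by
    obtain ⟨M, hM⟩ := (hQ.isCompact.image hcont).bddAbove
    exact ⟨max M 1, by positivity, fun y hy => (hM ⟨y, hy, rfl⟩).trans (le_max_left _ _)⟩
  let u : E →ᵃ[ℝ] E × ℝ := (R • AffineMap.id ℝ E).prod (AffineMap.const ℝ E (-R))
  have hu : ∀ y, u y = (R • y, -R) := fun y => rfl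
  let T : Finset (E × ℝ) := insert (0, 0) (t.image u)
  set C := convexHull ℝ (T : Set (E × ℝ)) with hC
  -- The pyramid lies below the graph of `-gauge s`,
  have hle : ∀ z ∈ C, gauge s z.1 + z.2 ≤ 0 ∧ gauge s z.1 ≤ R := by
    have hcv : Convex ℝ {z : E × ℝ | gauge s z.1 + z.2 ≤ 0 ∧ gauge s z.1 ≤ R} := by
      rintro z ⟨h1, h2⟩ z' ⟨h1', h2'⟩ a b ha hb hab
      have h3 := gauge_add_le hconv habs (a • z.1) (b • z'.1)
      rw [hsmul _ _ ha, hsmul _ _ hb] at h3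
      simp only [Set.mem_ofPred_eq, Prod.fst_add, Prod.smul_fst, Prod.snd_add, Prod.smul_snd,
        smul_eq_mul]
      constructor
      · nlinarith [mul_le_mul_of_nonneg_left h1 ha, mul_le_mul_of_nonneg_left h1' hb]
      · have : R = a * R + b * R := by rw [← add_mul, hab, one_mul]
        nlinarith [mul_le_mul_of_nonneg_left h2 ha, mul_le_mul_of_nonneg_left h2' hb]
    refine fun z hz => convexHull_min ?_ hcv hz
    intro z hz
    simp only [T, Finset.coe_insert, Finset.coe_image, Set.mem_insert_iff, Set.mem_image] at hz
    rcases hz with rfl | ⟨b, hb, rfl⟩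
    · simp [gauge_zero, hR.le]
    · have hb' : gauge s b ≤ 1 := gauge_le_one_of_mem (hs ▸ subset_convexHull ℝ _ hb)
      simp only [hu, Set.mem_ofPred_eq, hsmul R b hR.le]
      constructor <;> nlinarith
  -- and it contains this graph, which is thus its upper boundary.
  have hmem : ∀ y, gauge s y ≤ R → (y, -gauge s y) ∈ C := by
    intro y hy
    rcases eq_or_ne y 0 with rfl | hy0
    · rw [gauge_zero, neg_zero]
      exact subset_convexHull ℝ _ (by simp [T])
    · have hg : 0 < gauge s y := (gauge_pos habs hvb).2 hy0
      have hβ : (gauge s y)⁻¹ • y ∈ s := by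
        have : gauge s ((gauge s y)⁻¹ • y) ≤ 1 := by
          rw [hsmul _ _ (by positivity), inv_mul_cancel₀ hg.ne']
        rw [gauge_le_one_iff_mem_closure hconv hs0, hcomp.isClosed.closure_eq] at this
        exact this
      have h1 : u ((gauge s y)⁻¹ • y) ∈ C := by
        have : u '' s ⊆ C := by
          rw [hs, AffineMap.image_convexHull]
          refine convexHull_mono ?_
          simp [T]
        exact this ⟨_, hβ, rfl⟩
      have h0 : ((0 : E), (0 : ℝ)) ∈ C := subset_convexHull ℝ _ (by simp [T])
      have := (convex_convexHull ℝ (T : Set (E × ℝ))) h0 h1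
        (sub_nonneg.2 ((div_le_one hR).2 hy)) (by positivity : 0 ≤ gauge s y / R) (by ring)
      convert this using 1
      rw [hu]
      ext
      · simp only [Prod.smul_mk, smul_zero, Prod.mk_add_mk, zero_add, smul_smul]
        rw [show gauge s y / R * (R * (gauge s y)⁻¹) = 1 by field_simp, one_smul]
      · simp only [Prod.smul_mk, smul_zero, Prod.mk_add_mk, zero_add, smul_eq_mul]
        field_simp
        ring
  have hD : IsPLOn (fun y => -gauge s y) {y | gauge s y ≤ R} := by
    have : Set.graphOn (fun y => -gauge s y) {y | gauge s y ≤ R} =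
        {z ∈ C | ∀ r, (z.1, r) ∈ C → r ≤ z.2} := by
      ext ⟨y, r⟩
      simp only [Set.mem_graphOn, Set.mem_ofPred_eq]
      constructor
      · rintro ⟨h1, rfl⟩
        exact ⟨hmem y h1, fun r hr => by linarith [(hle _ hr).1]⟩
      · rintro ⟨h1, h2⟩
        have := hle _ h1
        refine ⟨this.2, le_antisymm (h2 _ (hmem y this.2)) ?_⟩
        simp only at this
        linarith [this.1]
    rw [IsPLOn, this]
    exact isPolyhedron_upperBoundary T
  refine ((hD.const_smul (-1)).mono hQ hQR).congr fun y _ => by simp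

/-- The map that pushes the centre `p` of the convex body `B` to `q`, fixes the complement of `B`
and maps each segment from `p` to a point of the boundary onto the segment from `q`. -/
noncomputable def push (B : Set E) (p q : E) (y : E) : E :=
  y + max 0 (1 - gauge ((fun z => z - p) '' B) (y - p)) • (q - p)

variable {B : Set E} {p q : E}

theorem sub_image_mem_nhds {V : Type*} [NormedAddCommGroup V] {B : Set V} {p : V}
    (hp : p ∈ interior B) : (fun z => z - p) '' B ∈ nhds (0 : V) := by
  rw [mem_nhds_iff]
  refine ⟨(fun z => z - p) '' interior B, Set.image_mono interior_subset, ?_, p, hp, sub_self p⟩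
  exact (Homeomorph.subRight p).isOpenMap _ isOpen_interior

theorem convex_sub_image (hB : Convex ℝ B) : Convex ℝ ((fun z => z - p) '' B) := by
  have := hB.translate (-p)
  simpa [sub_eq_neg_add] using this

theorem gauge_sub_lt_one_iff (hB : Convex ℝ B) (hp : p ∈ interior B) {y : E} :
    gauge ((fun z => z - p) '' B) (y - p) < 1 ↔ y ∈ interior B := by
  rw [gauge_lt_one_iff_mem_interior (convex_sub_image hB) (sub_image_mem_nhds hp)]
  have : interior ((fun z => z - p) '' B) = (fun z => z - p) '' interior B :=
    ((Homeomorph.subRight p).image_interior B).symm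
  rw [this, Function.Injective.mem_set_image sub_left_injective]

theorem push_eq_self (hB : Convex ℝ B) (hp : p ∈ interior B) {y : E} (hy : y ∉ interior B) :
    push B p q y = y := by
  rw [← gauge_sub_lt_one_iff hB hp, not_lt] at hy
  rw [push, max_eq_left (by linarith), zero_smul, add_zero]

theorem push_center (B : Set E) (p q : E) : push B p q p = q := by
  simp [push, gauge_zero]

theorem push_lineMap (hB : Convex ℝ B) (hp : p ∈ interior B) {a : E} (ha : a ∈ B)
    (ha' : a ∉ interior B) {s : ℝ} (hs0 : 0 ≤ s) (hs1 : s ≤ 1) :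
    push B p q (AffineMap.lineMap p a s) = AffineMap.lineMap q a s := by
  have h1 : gauge ((fun z => z - p) '' B) (a - p) = 1 := by
    rw [← gauge_sub_lt_one_iff hB hp, not_lt] at ha'
    exact le_antisymm (gauge_le_one_of_mem ⟨a, ha, rfl⟩) ha'
  rw [push, AffineMap.lineMap_apply_module']
  have h2 : s • (a - p) + p - p = s • (a - p) := by abel
  rw [h2, gauge_smul_of_nonneg hs0, h1, smul_eq_mul, mul_one, max_eq_right (by linarith),
    AffineMap.lineMap_apply_module']
  module

theorem push_bijective (hB : Convex ℝ B) (hp : p ∈ interior B) (hq : q ∈ interior B) :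
    Function.Bijective (push B p q) := by
  set g : E → ℝ := gauge ((fun z => z - p) '' B) with hg
  have hconv := convex_sub_image (p := p) hB
  have hnhds := sub_image_mem_nhds hp
  have hadd : ∀ x y, g (x + y) ≤ g x + g y := gauge_add_le hconv (absorbent_nhds_zero hnhds)
  have hsm : ∀ (c : ℝ) x, 0 ≤ c → g (c • x) = c * g x := fun c x hc => by
    rw [hg, gauge_smul_of_nonneg hc]; rfl
  have hd : g (q - p) < 1 := (gauge_sub_lt_one_iff hB hp).2 hq
  set φ : E → ℝ := fun y => max 0 (1 - g (y - p)) with hφ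
  have hpush : ∀ y, push B p q y = y + φ y • (q - p) := fun y => rfl
  -- `φ` decreases in the direction of the push at a rate less than one
  have hrate : ∀ y (τ : ℝ), 0 < τ → φ y - φ (y + τ • (q - p)) < τ := by
    intro y τ hτ
    have h1 : g (y + τ • (q - p) - p) ≤ g (y - p) + τ * g (q - p) := by
      rw [← hsm _ _ hτ.le, show y + τ • (q - p) - p = (y - p) + τ • (q - p) by abel]
      exact hadd _ _
    have h2 : φ (y + τ • (q - p)) ≥ 1 - g (y + τ • (q - p) - p) := le_max_right _ _
    have h3 : φ (y + τ • (q - p)) ≥ 0 := le_max_left _ _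
    have h4 : τ * g (q - p) < τ := by nlinarith
    rcases max_cases 0 (1 - g (y - p)) with ⟨h, -⟩ | ⟨h, -⟩
    · have : φ y = 0 := h
      linarith
    · have : φ y = 1 - g (y - p) := h
      linarith
  constructor
  · have key : ∀ y y', φ y' ≤ φ y → push B p q y = push B p q y' → y = y' := by
      intro y y' hle heq
      rw [hpush, hpush] at heq
      have hy' : y' = y + (φ y - φ y') • (q - p) := by
        rw [sub_smul, ← add_sub_assoc, heq]; abel
      rcases hle.eq_or_lt with h | h
      · rw [hy', h]; simp
      · exfalso
        have := hrate y (φ y - φ y') (by linarith)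
        rw [← hy'] at this
        exact lt_irrefl _ this
    intro y y' heq
    rcases le_total (φ y') (φ y) with h | h
    · exact key y y' h heq
    · exact (key y' y h heq.symm).symm
  · intro z
    have hcont : Continuous fun s : ℝ => s - φ (z - s • (q - p)) := by
      have : Continuous g := continuous_gauge hconv hnhds
      fun_prop
    have hφ1 : ∀ y, φ y ≤ 1 := fun y =>
      max_le zero_le_one (by linarith [gauge_nonneg (s := (fun z => z - p) '' B) (y - p)])
    have hφ0 : ∀ y, 0 ≤ φ y := fun y => le_max_left _ _
    obtain ⟨s, -, hs⟩ := intermediate_value_Icc (zero_le_one (α := ℝ)) hcont.continuousOn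
      (show (0 : ℝ) ∈ Set.Icc _ _ from ⟨by simpa using hφ0 z, by simpa using hφ1 _⟩)
    refine ⟨z - s • (q - p), ?_⟩
    rw [hpush, ← sub_eq_zero.1 hs]
    abel

theorem isPLOn_push [FiniteDimensional ℝ E] {t : Finset E} (hB : B = convexHull ℝ (t : Set E))
    (hp : p ∈ interior B)
    {Q : Set E} (hQ : IsPolyhedron Q) : IsPLOn (push B p q) Q := by
  classical
  have hBt : (fun z => z - p) '' B =
      convexHull ℝ ((t.image fun z => z - p : Finset E) : Set E) := by
    have := AffineMap.image_convexHull (AffineMap.id ℝ E - AffineMap.const ℝ E p) (t : Set E)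
    rw [hB]
    rw [Finset.coe_image]
    exact this
  have hid : IsPLOn (fun y : E => y) Q := isPLOn_id hQ
  have hsub : IsPLOn (fun y : E => y - p) Q :=
    (isPLOn_affine (AffineMap.id ℝ E - AffineMap.const ℝ E p) hQ).congr fun _ _ => rfl
  have h1 : IsPLOn (fun y => gauge ((fun z => z - p) '' B) (y - p)) Q :=
    (isPLOn_gauge hBt (sub_image_mem_nhds hp) hsub.isPolyhedron_image).comp hsub
      (Set.mapsTo_image _ _)
  have h2 : IsPLOn (fun y => 1 - gauge ((fun z => z - p) '' B) (y - p)) Q :=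
    ((isPLOn_const (1 : ℝ) hQ).add (h1.const_smul (-1))).congr fun y _ => by
      simp [sub_eq_add_neg]
  exact (hid.add (((isPLOn_const (0 : ℝ) hQ).max h2).smul_const (q - p))).congr fun y _ => rfl

end Push
end SpatialGraph
namespace SpatialGraph
open scoped Graph
open Filter Topology

/-! ### Finite unions of segments -/

section SegUnion

/-- A finite union of closed segments. -/
def IsSegUnion {E : Type*} [AddCommGroup E] [Module ℝ E] (Z : Set E) : Prop :=
  ∃ S : Set (E × E), S.Finite ∧ Z = ⋃ p ∈ S, segment ℝ p.1 p.2

theorem isSegUnion_empty {E : Type*} [AddCommGroup E] [Module ℝ E] :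
    IsSegUnion (∅ : Set E) :=
  ⟨∅, Set.finite_empty, by simp⟩

theorem isSegUnion_segment {E : Type*} [AddCommGroup E] [Module ℝ E] (a b : E) :
    IsSegUnion (segment ℝ a b) :=
  ⟨{(a, b)}, Set.finite_singleton _, by simp⟩

theorem isSegUnion_singleton {E : Type*} [AddCommGroup E] [Module ℝ E] (a : E) :
    IsSegUnion ({a} : Set E) := by
  simpa using isSegUnion_segment a a

theorem IsSegUnion.biUnion {E ι : Type*} [AddCommGroup E] [Module ℝ E] {s : Set ι}
    (hs : s.Finite) {Z : ι → Set E} (h : ∀ i ∈ s, IsSegUnion (Z i)) :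
    IsSegUnion (⋃ i ∈ s, Z i) := by
  choose! T hT hZ using h
  refine ⟨⋃ i ∈ s, T i, hs.biUnion hT, ?_⟩
  rw [Set.biUnion_iUnion]
  refine Set.iUnion_congr fun i => ?_
  rw [Set.biUnion_iUnion]
  exact Set.iUnion_congr fun hi => hZ i hi

theorem IsSegUnion.union {E : Type*} [AddCommGroup E] [Module ℝ E] {Z Z' : Set E}
    (h : IsSegUnion Z) (h' : IsSegUnion Z') : IsSegUnion (Z ∪ Z') := by
  have := IsSegUnion.biUnion (s := (Set.univ : Set Bool)) Set.finite_univ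
    (Z := fun b => cond b Z Z') (by rintro (_ | _) - <;> assumption)
  rwa [Set.biUnion_univ, ← Set.union_eq_iUnion] at this

theorem IsSegUnion.image_linear {E F : Type*} [AddCommGroup E] [Module ℝ E] [AddCommGroup F]
    [Module ℝ F] {Z : Set E} (h : IsSegUnion Z) (f : E →ₗ[ℝ] F) : IsSegUnion (f '' Z) := by
  obtain ⟨S, hS, rfl⟩ := h
  rw [Set.image_iUnion₂]
  refine .biUnion hS fun p _ => ?_
  rw [← LinearMap.coe_toAffineMap, image_segment]
  exact isSegUnion_segment _ _

variable {E : Type*} [NormedAddCommGroup E] [NormedSpace ℝ E]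

theorem isCompact_segment (a b : E) : IsCompact (segment ℝ a b) := by
  rw [← convexHull_pair]
  exact (Set.toFinite _).isCompact_convexHull ℝ

theorem IsSegUnion.isCompact {Z : Set E} (h : IsSegUnion Z) : IsCompact Z := by
  obtain ⟨S, hS, rfl⟩ := h
  exact hS.isCompact_biUnion fun p _ => isCompact_segment _ _

theorem IsSegUnion.inter_convex {Z C : Set E} (h : IsSegUnion Z) (hC : Convex ℝ C)
    (hC' : IsClosed C) : IsSegUnion (Z ∩ C) := by
  obtain ⟨S, hS, rfl⟩ := h
  rw [Set.iUnion₂_inter]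
  refine .biUnion hS fun p _ => ?_
  set L : ℝ →ᵃ[ℝ] E := AffineMap.lineMap p.1 p.2 with hL
  have hLc : Continuous L := AffineMap.lineMap_continuous
  have hseg : segment ℝ p.1 p.2 ∩ C = L '' (Set.Icc 0 1 ∩ L ⁻¹' C) := by
    rw [segment_eq_image_lineMap, Set.image_inter_preimage]
  rcases (Set.Icc (0 : ℝ) 1 ∩ L ⁻¹' C).eq_empty_or_nonempty with he | hne
  · rw [hseg, he, Set.image_empty]; exact isSegUnion_empty
  · have hconv : Convex ℝ (Set.Icc (0 : ℝ) 1 ∩ L ⁻¹' C) :=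
      (convex_Icc 0 1).inter (hC.affine_preimage L)
    have hcomp : IsCompact (Set.Icc (0 : ℝ) 1 ∩ L ⁻¹' C) :=
      isCompact_Icc.inter_right (hC'.preimage hLc)
    have hIcc := eq_Icc_of_connected_compact ⟨hne, hconv.isPreconnected⟩ hcomp
    have hle : sInf (Set.Icc (0 : ℝ) 1 ∩ L ⁻¹' C) ≤ sSup (Set.Icc (0 : ℝ) 1 ∩ L ⁻¹' C) := by
      by_contra h
      rw [Set.Icc_eq_empty h] at hIcc
      exact hne.ne_empty hIcc
    rw [hseg, hIcc, ← segment_eq_Icc hle, image_segment]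
    exact isSegUnion_segment _ _

end SegUnion

section Thin

variable {E : Type*} [NormedAddCommGroup E] [NormedSpace ℝ E]

theorem eventually_disjoint_thickening {X : Type*} [PseudoEMetricSpace X] {K C : Set X}
    (hK : IsCompact K) (hC : IsClosed C)
    (h : Disjoint K C) : ∀ᶠ ε in 𝓝[>] (0 : ℝ), Disjoint (Metric.thickening ε K) C := by
  obtain ⟨δ, hδ, hd⟩ := h.exists_thickenings hK hC
  filter_upwards [Ioo_mem_nhdsGT hδ] with ε hε
  exact hd.mono (Metric.thickening_mono hε.2.le _) (Metric.self_subset_thickening hδ _)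

theorem Set.Finite.subsingleton_of_convex {C : Set E} (hfin : C.Finite) (hC : Convex ℝ C) :
    C.Subsingleton := by
  by_contra h
  exact hC.isPreconnected.infinite_of_nontrivial (Set.not_subsingleton_iff.1 h) hfin

/-- A segment which meets the polytope `T₀` in the vertex `a` only also meets a slightly larger
polytope with the vertex `a` in `a` only.  Here the larger polytope is the hull of `a` and `W`;
it suffices that the end `s` of the segment is not in it and that the segment misses `W`. -/
theorem eq_of_mem_segment_of_mem_convexHull_insert {a s y : E} {V : Set E} (hV : V.Nonempty)
    (hs : s ∉ convexHull ℝ (insert a V)) (hd : Disjoint (convexHull ℝ V) (segment ℝ a s))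
    (hy : y ∈ segment ℝ a s) (hy' : y ∈ convexHull ℝ (insert a V)) : y = a := by
  by_contra hya
  have hy'' := hy'
  rw [convexHull_insert hV, convexJoin_singleton_left, Set.mem_iUnion₂] at hy'
  obtain ⟨w, hw, hyw⟩ := hy'
  have hwT : segment ℝ a w ⊆ convexHull ℝ (insert a V) :=
    (convex_convexHull ℝ _).segment_subset (subset_convexHull ℝ _ (by simp))
      (convexHull_mono (Set.subset_insert _ _) hw)
  rw [segment_eq_image', Set.mem_image] at hy hyw
  obtain ⟨τ, ⟨hτ0, hτ1⟩, rfl⟩ := hy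
  obtain ⟨μ, ⟨hμ0, hμ1⟩, h⟩ := hyw
  have heq : μ • (w - a) = τ • (s - a) := by simpa using h
  have hτ : 0 < τ := lt_of_le_of_ne hτ0 (by rintro rfl; simp at hya)
  have hμ : 0 < μ := lt_of_le_of_ne hμ0 (by
    rintro rfl
    rw [zero_smul] at heq
    rw [← heq] at hya
    simp at hya)
  rcases le_total τ μ with hle | hle
  · refine Set.disjoint_left.1 hd hw ?_
    rw [segment_eq_image']
    refine ⟨τ / μ, ⟨by positivity, (div_le_one hμ).2 hle⟩, ?_⟩
    simp only
    rw [div_eq_inv_mul, mul_smul, ← heq, smul_smul, inv_mul_cancel₀ hμ.ne', one_smul]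
    abel
  · apply hs
    apply hwT
    rw [segment_eq_image']
    refine ⟨μ / τ, ⟨by positivity, (div_le_one hτ).2 hle⟩, ?_⟩
    simp only
    rw [div_eq_inv_mul, mul_smul, heq, smul_smul, inv_mul_cancel₀ hτ.ne', one_smul]
    abel

theorem notMem_interior_convexHull_insert {a p : E} {V : Set E} (ha : a ∉ convexHull ℝ V)
    (hp : p ∈ convexHull ℝ V) : a ∉ interior (convexHull ℝ (insert a V)) := by
  intro hint
  have hV : V.Nonempty := by
    rw [← convexHull_nonempty_iff (𝕜 := ℝ)]; exact ⟨p, hp⟩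
  have hcont : Continuous fun η : ℝ => a + η • (a - p) := by fun_prop
  have hmem : ∀ᶠ η in 𝓝[>] (0 : ℝ), a + η • (a - p) ∈ convexHull ℝ (insert a V) := by
    apply nhdsWithin_le_nhds
    have := hcont.tendsto 0
    simp only [zero_smul, add_zero] at this
    exact this (mem_interior_iff_mem_nhds.1 hint)
  obtain ⟨η, hη, hη0⟩ := (hmem.and self_mem_nhdsWithin).exists
  replace hη0 : 0 < η := hη0
  rw [convexHull_insert hV, convexJoin_singleton_left, Set.mem_iUnion₂] at hη
  obtain ⟨w, hw, hyw⟩ := hη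
  rw [segment_eq_image'] at hyw
  obtain ⟨μ, ⟨hμ0, -⟩, h⟩ := hyw
  have heq : μ • (w - a) = η • (a - p) := by simpa using h
  apply ha
  have hpos : 0 < μ + η := by linarith
  have : a = (μ / (μ + η)) • w + (η / (μ + η)) • p := by
    have h2 : (μ + η) • a = μ • w + η • p := by
      rw [smul_sub, smul_sub, sub_eq_sub_iff_add_eq_add] at heq
      rw [add_smul, heq, add_comm]
    rw [div_eq_inv_mul, div_eq_inv_mul, mul_smul, mul_smul, ← smul_add, ← h2, smul_smul,
      inv_mul_cancel₀ hpos.ne', one_smul]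
  rw [this]
  exact convex_convexHull ℝ V hw hp (by positivity) (by positivity) (by field_simp)

/-- Let `F` consist of vertices of the hull of `F ∪ {p, q}`.  A family of segments meeting this
hull only in `F` also meets only in `F` a suitable polytope `B` that contains `p` and `q` in its
interior and has the points of `F` on its boundary. -/
theorem exists_thin_polytope [FiniteDimensional ℝ E] {F : Set E} (hFfin : F.Finite) {p q : E}
    (hF : ∀ a ∈ F, a ∉ convexHull ℝ (insert p (insert q (F \ {a})))) {Z : Set E}
    (hZ : IsSegUnion Z) (hZF : Z ∩ convexHull ℝ (insert p (insert q F)) ⊆ F) {O : Set E}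
    (hO : IsOpen O) (hTO : convexHull ℝ (insert p (insert q F)) ⊆ O) :
    ∃ t : Finset E, p ∈ interior (convexHull ℝ (t : Set E)) ∧
      q ∈ interior (convexHull ℝ (t : Set E)) ∧ F ⊆ convexHull ℝ (t : Set E) ∧
      (∀ a ∈ F, a ∉ interior (convexHull ℝ (t : Set E))) ∧ convexHull ℝ (t : Set E) ⊆ O ∧
      Z ∩ convexHull ℝ (t : Set E) ⊆ F := by
  classical
  set T₀ := convexHull ℝ (insert p (insert q F)) with hT₀
  set W : E → Set E := fun a => convexHull ℝ (insert p (insert q (F \ {a}))) with hW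
  have hT₀c : IsCompact T₀ := ((hFfin.insert q).insert p).isCompact_convexHull ℝ
  have hWc : ∀ a, IsCompact (W a) := fun a =>
    (((hFfin.subset Set.sdiff_subset).insert q).insert p).isCompact_convexHull ℝ
  have hWT : ∀ a, W a ⊆ T₀ := fun a =>
    convexHull_mono (Set.insert_subset_insert (Set.insert_subset_insert Set.sdiff_subset))
  obtain ⟨S, hS, rfl⟩ := hZ
  have hseg : ∀ σ ∈ S, segment ℝ σ.1 σ.2 ∩ T₀ ⊆ F := fun σ hσ y hy =>
    hZF ⟨Set.mem_biUnion hσ hy.1, hy.2⟩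
  -- All the open conditions needed below hold on small neighbourhoods of the hulls `T₀` and `W a`.
  have e1 : ∀ᶠ ε in 𝓝[>] (0 : ℝ), Metric.thickening ε T₀ ⊆ O := by
    filter_upwards [eventually_disjoint_thickening hT₀c hO.isClosed_compl
      (Set.disjoint_compl_right_iff_subset.2 hTO)] with ε hε
    exact Set.disjoint_compl_right_iff_subset.1 hε
  have e2 : ∀ᶠ ε in 𝓝[>] (0 : ℝ), ∀ a ∈ F, Disjoint (Metric.thickening ε (W a)) {a} := by
    rw [eventually_all_finite hFfin]
    exact fun a ha => eventually_disjoint_thickening (hWc a) isClosed_singleton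
      (Set.disjoint_singleton_right.2 (hF a ha))
  have e3 : ∀ᶠ ε in 𝓝[>] (0 : ℝ), ∀ σ ∈ S, Disjoint T₀ (segment ℝ σ.1 σ.2) →
      Disjoint (Metric.thickening ε T₀) (segment ℝ σ.1 σ.2) := by
    rw [eventually_all_finite hS]
    intro σ _
    by_cases h : Disjoint T₀ (segment ℝ σ.1 σ.2)
    · filter_upwards [eventually_disjoint_thickening hT₀c (isCompact_segment _ _).isClosed h]
        with ε hε _ using hε
    · filter_upwards with ε h' using absurd h' h
  have e4 : ∀ᶠ ε in 𝓝[>] (0 : ℝ), ∀ σ ∈ S, ∀ s ∈ ({σ.1, σ.2} : Set E), s ∉ T₀ →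
      s ∉ Metric.thickening ε T₀ := by
    rw [eventually_all_finite hS]
    intro σ _
    rw [eventually_all_finite (Set.toFinite _)]
    intro s _
    by_cases h : s ∈ T₀
    · filter_upwards with ε h' using absurd h h'
    · filter_upwards [eventually_disjoint_thickening hT₀c isClosed_singleton
        (Set.disjoint_singleton_right.2 h)] with ε hε _
      exact Set.disjoint_singleton_right.1 hε
  have e5 : ∀ᶠ ε in 𝓝[>] (0 : ℝ), ∀ σ ∈ S, ∀ a ∈ F, a ∈ segment ℝ σ.1 σ.2 →
      Disjoint (Metric.thickening ε (W a)) (segment ℝ σ.1 σ.2) := by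
    rw [eventually_all_finite hS]
    intro σ hσ
    rw [eventually_all_finite hFfin]
    intro a ha
    by_cases h : a ∈ segment ℝ σ.1 σ.2
    · have : Disjoint (W a) (segment ℝ σ.1 σ.2) := by
        rw [Set.disjoint_left]
        intro y hy hyσ
        have hsub : (segment ℝ σ.1 σ.2 ∩ T₀).Subsingleton :=
          Set.Finite.subsingleton_of_convex (hFfin.subset (hseg σ hσ))
            ((convex_segment _ _).inter (convex_convexHull ℝ _))
        have haT : a ∈ T₀ := subset_convexHull ℝ _ (by simp [ha])
        have : y = a := hsub ⟨hyσ, hWT a hy⟩ ⟨h, haT⟩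
        exact hF a ha (this ▸ hy)
      filter_upwards [eventually_disjoint_thickening (hWc a) (isCompact_segment _ _).isClosed this]
        with ε hε _ using hε
    · filter_upwards with ε h' using absurd h' h
  obtain ⟨ε, ⟨⟨⟨⟨⟨e1, e2⟩, e3⟩, e4⟩, e5⟩, hε⟩⟩ :=
    (((((e1.and e2).and e3).and e4).and e5).and self_mem_nhdsWithin).exists
  replace hε : 0 < ε := hε
  -- The polytope is the hull of `F` and of small simplices around `p` and `q`.
  obtain ⟨bp, hbp, hbp'⟩ := exists_mem_interior_convexHull_affineBasis (Metric.ball_mem_nhds p hε)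
  obtain ⟨bq, hbq, hbq'⟩ := exists_mem_interior_convexHull_affineBasis (Metric.ball_mem_nhds q hε)
  have hsubp : Set.range bp ⊆ Metric.ball p ε := (subset_convexHull ℝ _).trans hbp'
  have hsubq : Set.range bq ⊆ Metric.ball q ε := (subset_convexHull ℝ _).trans hbq'
  have hthick : ∀ F' : Set E, convexHull ℝ (Set.range bp ∪ (Set.range bq ∪ F')) ⊆
      Metric.thickening ε (convexHull ℝ (insert p (insert q F'))) := by
    intro F'
    refine convexHull_min ?_ ((convex_convexHull ℝ _).thickening ε)
    refine Set.union_subset ?_ (Set.union_subset ?_ ?_)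
    · exact fun x hx => Metric.mem_thickening_iff.2
        ⟨p, subset_convexHull ℝ _ (by simp), hsubp hx⟩
    · exact fun x hx => Metric.mem_thickening_iff.2
        ⟨q, subset_convexHull ℝ _ (by simp), hsubq hx⟩
    · exact fun x hx => Metric.self_subset_thickening hε _ (subset_convexHull ℝ _ (by simp [hx]))
  have hfin : (Set.range bp ∪ (Set.range bq ∪ F)).Finite :=
    (Set.finite_range _).union ((Set.finite_range _).union hFfin)
  refine ⟨hfin.toFinset, ?_⟩
  rw [hfin.coe_toFinset]
  set V : E → Set E := fun a => Set.range bp ∪ (Set.range bq ∪ F \ {a}) with hV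
  have hVp : ∀ a, p ∈ convexHull ℝ (V a) := fun a =>
    convexHull_mono Set.subset_union_left (interior_subset hbp)
  have hVne : ∀ a, (V a).Nonempty := fun a => by
    rw [← convexHull_nonempty_iff (𝕜 := ℝ)]; exact ⟨p, hVp a⟩
  have hins : ∀ a ∈ F, Set.range bp ∪ (Set.range bq ∪ F) = insert a (V a) := by
    intro a ha
    ext x
    simp only [hV, Set.mem_union, Set.mem_insert_iff, Set.mem_sdiff, Set.mem_singleton_iff]
    by_cases h : x = a
    · simp [h, ha]
    · simp [h]
  have hVd : ∀ a, convexHull ℝ (V a) ⊆ Metric.thickening ε (W a) := fun a => hthick _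
  refine ⟨interior_mono (convexHull_mono Set.subset_union_left) hbp,
    interior_mono (convexHull_mono (Set.subset_union_left.trans Set.subset_union_right)) hbq,
    fun a ha => subset_convexHull ℝ _ (by simp [ha]), fun a ha => ?_, (hthick F).trans e1, ?_⟩
  · rw [hins a ha]
    exact notMem_interior_convexHull_insert
      (fun h => Set.disjoint_singleton_right.1 (e2 a ha) (hVd a h)) (hVp a)
  · rintro y ⟨hyZ, hyB⟩
    rw [Set.mem_iUnion₂] at hyZ
    obtain ⟨σ, hσ, hyσ⟩ := hyZ
    by_cases hd : Disjoint T₀ (segment ℝ σ.1 σ.2)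
    · exact absurd hyσ (Set.disjoint_left.1 (e3 σ hσ hd) (hthick F hyB))
    · rw [Set.not_disjoint_iff] at hd
      obtain ⟨a, haT, haσ⟩ := hd
      have haF : a ∈ F := hseg σ hσ ⟨haσ, haT⟩
      have hsub : (segment ℝ σ.1 σ.2 ∩ T₀).Subsingleton :=
        Set.Finite.subsingleton_of_convex (hFfin.subset (hseg σ hσ))
          ((convex_segment _ _).inter (convex_convexHull ℝ _))
      by_cases hya : y = a
      · exact hya ▸ haF
      exfalso
      -- The segment meets `T₀` in `a` only, so its end `s` on the side of `y` is off `T₀`, hence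
      -- off the polytope, and the part of the segment from `a` to `s` leaves the polytope at `a`.
      obtain ⟨s, hs, hys⟩ : ∃ s ∈ ({σ.1, σ.2} : Set E), y ∈ segment ℝ a s := by
        have : y ∈ segment ℝ σ.1 a ∪ segment ℝ a σ.2 := by
          rw [segment_eq_image_lineMap] at haσ hyσ
          obtain ⟨u, hu, rfl⟩ := haσ
          obtain ⟨v, hv, rfl⟩ := hyσ
          rcases le_total v u with h | h
          · left
            have : AffineMap.lineMap σ.1 σ.2 v ∈ (AffineMap.lineMap σ.1 σ.2 : ℝ →ᵃ[ℝ] E) ''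
                segment ℝ 0 u := ⟨v, by rw [segment_eq_Icc hu.1]; exact ⟨hv.1, h⟩, rfl⟩
            rwa [image_segment, AffineMap.lineMap_apply_zero] at this
          · right
            have : AffineMap.lineMap σ.1 σ.2 v ∈ (AffineMap.lineMap σ.1 σ.2 : ℝ →ᵃ[ℝ] E) ''
                segment ℝ u 1 := ⟨v, by rw [segment_eq_Icc hu.2]; exact ⟨h, hv.2⟩, rfl⟩
            rwa [image_segment, AffineMap.lineMap_apply_one] at this
        rcases this with h | h
        · exact ⟨σ.1, by simp, by rwa [segment_symm]⟩
        · exact ⟨σ.2, by simp, h⟩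
      have hsσ : s ∈ segment ℝ σ.1 σ.2 := by
        rcases hs with rfl | rfl
        · exact left_mem_segment ℝ _ _
        · exact right_mem_segment ℝ _ _
      have hsT : s ∉ T₀ := by
        intro h
        have : s = a := hsub ⟨hsσ, h⟩ ⟨haσ, haT⟩
        rw [this, segment_same] at hys
        exact hya hys
      refine hya (eq_of_mem_segment_of_mem_convexHull_insert (hVne a) ?_ ?_ hys ?_)
      · rw [← hins a haF]
        exact fun h => e4 σ hσ s hs hsT (hthick F h)
      · exact (e5 σ hσ a haF haσ).mono (hVd a)
          ((convex_segment _ _).segment_subset haσ hsσ)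
      · rwa [← hins a haF]

/-- The basic move: a piecewise linear homeomorphism supported in a small neighbourhood of the hull
of `F ∪ {p, q}` that fixes `Z` and carries each segment from `p` to a point of `F` to the segment
from `q`. -/
theorem exists_local_move [FiniteDimensional ℝ E] {F : Set E} (hFfin : F.Finite) {p q : E}
    (hF : ∀ a ∈ F, a ∉ convexHull ℝ (insert p (insert q (F \ {a})))) {Z : Set E}
    (hZ : IsSegUnion Z) (hZF : Z ∩ convexHull ℝ (insert p (insert q F)) ⊆ F) {O : Set E}
    (hO : IsOpen O) (hTO : convexHull ℝ (insert p (insert q F)) ⊆ O) :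
    ∃ (h : E → E) (B : Set E), Function.Bijective h ∧ (∀ Q, IsPolyhedron Q → IsPLOn h Q) ∧
      IsCompact B ∧ B ⊆ O ∧ (∀ y ∉ B, h y = y) ∧ (∀ y ∈ Z, h y = y) ∧ h p = q ∧
      ∀ a ∈ F, ∀ s ∈ Set.Icc (0 : ℝ) 1, h (AffineMap.lineMap p a s) = AffineMap.lineMap q a s := by
  obtain ⟨t, hp, hq, hFt, hFi, htO, hZt⟩ := exists_thin_polytope hFfin hF hZ hZF hO hTO
  have hconv := convex_convexHull ℝ (t : Set E)
  refine ⟨push (convexHull ℝ (t : Set E)) p q, convexHull ℝ (t : Set E),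
    push_bijective hconv hp hq, fun Q hQ => isPLOn_push rfl hp hQ,
    t.finite_toSet.isCompact_convexHull ℝ, htO,
    fun y hy => push_eq_self hconv hp fun h => hy (interior_subset h), fun y hy => ?_,
    push_center _ _ _, fun a ha s hs => push_lineMap hconv hp (hFt ha) (hFi a ha) hs.1 hs.2⟩
  refine push_eq_self hconv hp fun h => ?_
  exact hFi y (hZt ⟨hy, interior_subset h⟩) h

end Thin
end SpatialGraph
namespace SpatialGraph
open scoped Graph
open Filter Topology

/-! ### Charts of the 3-sphere -/

/-- The inclusion of `ℝ³` as the hyperplane of `ℝ⁴` in which the last coordinate vanishes. -/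
def hyperplaneIncl : (Fin 3 → ℝ) →ₗ[ℝ] (Fin 4 → ℝ) :=
  LinearMap.pi ![LinearMap.proj 0, LinearMap.proj 1, LinearMap.proj 2, 0]

@[simp] theorem hyperplaneIncl_zero (y : Fin 3 → ℝ) : hyperplaneIncl y 0 = y 0 := rfl
@[simp] theorem hyperplaneIncl_one (y : Fin 3 → ℝ) : hyperplaneIncl y 1 = y 1 := rfl
@[simp] theorem hyperplaneIncl_two (y : Fin 3 → ℝ) : hyperplaneIncl y 2 = y 2 := rfl
@[simp] theorem hyperplaneIncl_three (y : Fin 3 → ℝ) : hyperplaneIncl y 3 = 0 := rfl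

/-- The largest coordinate of `hyperplaneIncl y`. -/
noncomputable def maxCoord (y : Fin 3 → ℝ) : ℝ :=
  max (max (y 0) (y 1)) (max (y 2) 0)

theorem hyperplaneIncl_le_maxCoord (y : Fin 3 → ℝ) (j : Fin 4) :
    hyperplaneIncl y j ≤ maxCoord y := by
  fin_cases j <;> simp [maxCoord]

theorem exists_hyperplaneIncl_eq_maxCoord (y : Fin 3 → ℝ) :
    ∃ j, hyperplaneIncl y j = maxCoord y := by
  rw [maxCoord]
  rcases max_choice (max (y 0) (y 1)) (max (y 2) 0) with h | h
  · rcases max_choice (y 0) (y 1) with h' | h'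
    · exact ⟨0, by rw [h, h']; rfl⟩
    · exact ⟨1, by rw [h, h']; rfl⟩
  · rcases max_choice (y 2) 0 with h' | h'
    · exact ⟨2, by rw [h, h']; rfl⟩
    · exact ⟨3, by rw [h, h']; rfl⟩

/-- A choice of signs, that is, a corner of the `4`-cube.  It determines the chart of the
`3`-sphere around this corner. -/
def IsCorner (σ : Fin 4 → ℝ) : Prop :=
  ∀ j, σ j = 1 ∨ σ j = -1

theorem IsCorner.mul_self {σ : Fin 4 → ℝ} (hσ : IsCorner σ) (j : Fin 4) : σ j * σ j = 1 := by
  rcases hσ j with h | h <;> simp [h]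

/-- The linear projection of `ℝ⁴` to `ℝ³` along the diagonal through the corner `σ`. -/
def chartProj (σ : Fin 4 → ℝ) : (Fin 4 → ℝ) →ₗ[ℝ] (Fin 3 → ℝ) :=
  LinearMap.pi fun i => σ i.castSucc • LinearMap.proj i.castSucc - σ 3 • LinearMap.proj 3

/-- The inverse chart: `chartInv σ y` is the point of the line over `y` parallel to the diagonal
through `σ` at which the largest of the coordinates, with signs according to `σ`, is `1`. -/
noncomputable def chartInv (σ : Fin 4 → ℝ) (y : Fin 3 → ℝ) : Fin 4 → ℝ :=
  fun j => σ j * (hyperplaneIncl y j + (1 - maxCoord y))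

/-- The range of the chart, an open convex subset of `ℝ³`. -/
def chartRange : Set (Fin 3 → ℝ) :=
  {y | ∀ j k, hyperplaneIncl y k - hyperplaneIncl y j < 2}

/-- The domain of the chart: the points of the sphere that lie on no facet of the `4`-cube avoiding
the corner `σ`. -/
def chartDomain (σ : Fin 4 → ℝ) : Set (Fin 4 → ℝ) :=
  {x ∈ threeSphere | ∀ j, -1 < σ j * x j}

theorem exists_mem_chartDomain {x : Fin 4 → ℝ} (hx : x ∈ threeSphere) :
    ∃ σ, IsCorner σ ∧ x ∈ chartDomain σ := by
  refine ⟨fun j => if 0 ≤ x j then 1 else -1, fun j => ?_, hx, fun j => ?_⟩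
  · simp only; split_ifs <;> simp
  · simp only; split_ifs with h
    · linarith
    · push Not at h; linarith

theorem isOpen_chartRange : IsOpen chartRange := by
  have : chartRange = ⋂ j : Fin 4, ⋂ k : Fin 4,
      {y | hyperplaneIncl y k - hyperplaneIncl y j < 2} := by
    ext y; simp [chartRange]
  rw [this]
  have hc : Continuous hyperplaneIncl := hyperplaneIncl.continuous_of_finiteDimensional
  refine isOpen_iInter_of_finite fun j => isOpen_iInter_of_finite fun k => ?_
  exact isOpen_lt (by fun_prop) continuous_const

theorem convex_chartRange : Convex ℝ chartRange := by
  intro y hy z hz a b ha hb hab j k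
  have h1 := hy j k
  have h2 := hz j k
  simp only [map_add, map_smul, Pi.add_apply, Pi.smul_apply, smul_eq_mul]
  rcases ha.eq_or_lt with rfl | ha
  · have : b = 1 := by linarith
    subst this; linarith
  · nlinarith [mul_lt_mul_of_pos_left h1 ha, mul_le_mul_of_nonneg_left h2.le hb]

theorem continuous_maxCoord : Continuous maxCoord := by
  unfold maxCoord; fun_prop

theorem continuous_chartInv (σ : Fin 4 → ℝ) : Continuous (chartInv σ) := by
  have := continuous_maxCoord
  have hc : Continuous hyperplaneIncl := hyperplaneIncl.continuous_of_finiteDimensional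
  unfold chartInv; fun_prop

theorem continuous_chartProj (σ : Fin 4 → ℝ) : Continuous (chartProj σ) :=
  (chartProj σ).continuous_of_finiteDimensional

theorem chartProj_apply (σ x : Fin 4 → ℝ) (i : Fin 3) :
    chartProj σ x i = σ i.castSucc * x i.castSucc - σ 3 * x 3 := rfl

theorem hyperplaneIncl_chartProj (σ x : Fin 4 → ℝ) (j : Fin 4) :
    hyperplaneIncl (chartProj σ x) j = σ j * x j - σ 3 * x 3 := by
  fin_cases j
  · rfl
  · rfl
  · rfl
  · simp

theorem mul_chartInv {σ : Fin 4 → ℝ} (hσ : IsCorner σ) (y : Fin 3 → ℝ) (j : Fin 4) :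
    σ j * chartInv σ y j = hyperplaneIncl y j + (1 - maxCoord y) := by
  rw [chartInv, ← mul_assoc, hσ.mul_self, one_mul]

theorem chartProj_chartInv {σ : Fin 4 → ℝ} (hσ : IsCorner σ) (y : Fin 3 → ℝ) :
    chartProj σ (chartInv σ y) = y := by
  funext i
  rw [chartProj_apply, mul_chartInv hσ, mul_chartInv hσ]
  fin_cases i <;> simp

theorem chartInv_injective {σ : Fin 4 → ℝ} (hσ : IsCorner σ) :
    Function.Injective (chartInv σ) :=
  Function.LeftInverse.injective (chartProj_chartInv hσ)

theorem abs_corner {σ : Fin 4 → ℝ} (hσ : IsCorner σ) (j : Fin 4) (x : ℝ) :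
    |x| = |σ j * x| := by
  rcases hσ j with h | h <;> simp [h]

theorem chartInv_mem {σ : Fin 4 → ℝ} (hσ : IsCorner σ) {y : Fin 3 → ℝ} (hy : y ∈ chartRange) :
    chartInv σ y ∈ chartDomain σ := by
  obtain ⟨k, hk⟩ := exists_hyperplaneIncl_eq_maxCoord y
  refine ⟨mem_threeSphere.2 ⟨fun j => ?_, k, ?_⟩, fun j => ?_⟩
  · rw [abs_corner hσ j, mul_chartInv hσ, abs_le]
    have := hyperplaneIncl_le_maxCoord y j
    have := hy j k
    constructor <;> linarith
  · rw [abs_corner hσ k, mul_chartInv hσ, hk]; simp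
  · rw [mul_chartInv hσ]
    have := hy j k
    linarith

theorem maxCoord_chartProj {σ x : Fin 4 → ℝ} (hσ : IsCorner σ) (hx : x ∈ chartDomain σ) :
    maxCoord (chartProj σ x) = 1 - σ 3 * x 3 := by
  obtain ⟨hxS, hx1⟩ := hx
  obtain ⟨hle, k, hk⟩ := mem_threeSphere.1 hxS
  have hle' : ∀ j, σ j * x j ≤ 1 := fun j => by
    have := hle j; rw [abs_corner hσ j] at this; exact (abs_le.1 this).2
  have hk' : σ k * x k = 1 := by
    rw [abs_corner hσ k] at hk
    rcases eq_or_eq_neg_of_abs_eq hk with h | h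
    · exact h
    · exact absurd h (hx1 k).ne'
  apply le_antisymm
  · obtain ⟨j, hj⟩ := exists_hyperplaneIncl_eq_maxCoord (chartProj σ x)
    rw [← hj, hyperplaneIncl_chartProj]
    linarith [hle' j]
  · rw [← hk', ← hyperplaneIncl_chartProj]
    exact hyperplaneIncl_le_maxCoord _ k

theorem chartInv_chartProj {σ x : Fin 4 → ℝ} (hσ : IsCorner σ) (hx : x ∈ chartDomain σ) :
    chartInv σ (chartProj σ x) = x := by
  funext j
  rw [chartInv, maxCoord_chartProj hσ hx, hyperplaneIncl_chartProj]
  have := hσ.mul_self j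
  linear_combination x j * this

theorem chartProj_mem {σ x : Fin 4 → ℝ} (hσ : IsCorner σ) (hx : x ∈ chartDomain σ) :
    chartProj σ x ∈ chartRange := by
  intro j k
  rw [hyperplaneIncl_chartProj, hyperplaneIncl_chartProj]
  have h1 := hx.2 j
  have h2 := (mem_threeSphere.1 hx.1).1 k
  rw [abs_corner hσ k] at h2
  linarith [(abs_le.1 h2).2]

theorem isPLOn_chartInv (σ : Fin 4 → ℝ) {Q : Set (Fin 3 → ℝ)} (hQ : IsPolyhedron Q) :
    IsPLOn (chartInv σ) Q := by
  have hproj : ∀ i, IsPLOn (fun y : Fin 3 → ℝ => y i) Q := fun i =>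
    isPLOn_linear (LinearMap.proj i) hQ
  have hM : IsPLOn maxCoord Q :=
    ((hproj 0).max (hproj 1)).max ((hproj 2).max (isPLOn_const 0 hQ))
  let D : (Fin 4 → ℝ) →ₗ[ℝ] (Fin 4 → ℝ) := LinearMap.pi fun j => σ j • LinearMap.proj j
  have h1 := isPLOn_linear (D ∘ₗ hyperplaneIncl) hQ
  refine ((h1.add (isPLOn_const σ hQ)).add (hM.smul_const (-σ))).congr fun y _ => ?_
  funext j
  simp only [LinearMap.coe_comp, Function.comp_apply, D, LinearMap.pi_apply, LinearMap.smul_apply,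
    LinearMap.proj_apply, smul_eq_mul, Pi.add_apply, Pi.smul_apply, Pi.neg_apply, chartInv]
  ring

theorem IsPolyhedron.inter_halfspaces {E ι : Type*} [NormedAddCommGroup E] [NormedSpace ℝ E]
    [FiniteDimensional ℝ E] {P : Set E} (hP : IsPolyhedron P) (s : Finset ι)
    (l : ι → E →ₗ[ℝ] ℝ) (c : ι → ℝ) : IsPolyhedron {x ∈ P | ∀ i ∈ s, l i x ≤ c i} := by
  classical
  induction s using Finset.induction_on with
  | empty => simpa using hP
  | insert a s _ ih =>
    convert ih.inter_halfspace (l a) (c a) using 1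
    ext x
    simp only [Finset.forall_mem_insert, Set.mem_ofPred_eq]
    tauto

/-- A homeomorphism of the range of a chart with compact support, extended by the identity to the
sphere. -/
noncomputable def chartExtend (σ : Fin 4 → ℝ) (h : (Fin 3 → ℝ) → (Fin 3 → ℝ))
    (x : Fin 4 → ℝ) : Fin 4 → ℝ :=
  open Classical in if x ∈ chartDomain σ then chartInv σ (h (chartProj σ x)) else x

theorem chartExtend_chartInv {σ : Fin 4 → ℝ} (hσ : IsCorner σ) (h : (Fin 3 → ℝ) → (Fin 3 → ℝ))
    {y : Fin 3 → ℝ} (hy : y ∈ chartRange) :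
    chartExtend σ h (chartInv σ y) = chartInv σ (h y) := by
  rw [chartExtend, if_pos (chartInv_mem hσ hy), chartProj_chartInv hσ]

theorem chartExtend_eq_self {σ : Fin 4 → ℝ} (hσ : IsCorner σ) {h : (Fin 3 → ℝ) → (Fin 3 → ℝ)}
    {x : Fin 4 → ℝ} (hx : x ∈ chartDomain σ → h (chartProj σ x) = chartProj σ x) :
    chartExtend σ h x = x := by
  rw [chartExtend]
  split_ifs with hd
  · rw [hx hd, chartInv_chartProj hσ hd]
  · rfl

theorem exists_margin {σ : Fin 4 → ℝ} (hσ : IsCorner σ) {B : Set (Fin 3 → ℝ)} (hB : IsCompact B)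
    (hBO : B ⊆ chartRange) : ∃ c > (-1 : ℝ), ∀ y ∈ B, ∀ j, c < σ j * chartInv σ y j := by
  rcases B.eq_empty_or_nonempty with rfl | hne
  · exact ⟨0, by norm_num, by simp⟩
  have : ∀ j, ∃ c > (-1 : ℝ), ∀ y ∈ B, c < σ j * chartInv σ y j := by
    intro j
    have hc : Continuous fun y => σ j * chartInv σ y j := by
      have := continuous_chartInv σ
      fun_prop
    obtain ⟨y₀, hy₀, hmin⟩ := hB.exists_isMinOn hne hc.continuousOn
    have h0 := (chartInv_mem hσ (hBO hy₀)).2 j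
    refine ⟨(-1 + σ j * chartInv σ y₀ j) / 2, by linarith, fun y hy => ?_⟩
    have := isMinOn_iff.1 hmin y hy
    linarith
  choose c hc hcB using this
  refine ⟨Finset.univ.inf' Finset.univ_nonempty c, ?_, fun y hy j => ?_⟩
  · rw [gt_iff_lt, Finset.lt_inf'_iff]; exact fun i _ => hc i
  · exact (Finset.inf'_le _ (Finset.mem_univ j)).trans_lt (hcB j y hy)

theorem isPLHomeo_chartExtend {σ : Fin 4 → ℝ} (hσ : IsCorner σ) {h : (Fin 3 → ℝ) → (Fin 3 → ℝ)}
    (hbij : Function.Bijective h) (hPL : ∀ Q, IsPolyhedron Q → IsPLOn h Q)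
    {B : Set (Fin 3 → ℝ)} (hBc : IsCompact B) (hBO : B ⊆ chartRange)
    (hid : ∀ y ∉ B, h y = y) : IsPLHomeo (chartExtend σ h) := by
  have hmaps : ∀ y ∈ chartRange, h y ∈ chartRange := by
    intro y hy
    by_contra hn
    have h1 : h (h y) = h y := hid _ fun hb => hn (hBO hb)
    rw [hbij.1 h1] at hn
    exact hn hy
  constructor
  · obtain ⟨c, hc, hcB⟩ := exists_margin hσ hBc hBO
    let l : Fin 4 → (Fin 4 → ℝ) →ₗ[ℝ] ℝ := fun j => σ j • LinearMap.proj j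
    have hl : ∀ j x, l j x = σ j * x j := fun j x => rfl
    -- The sphere is covered by `C`, which lies in the chart, and by `L`, where the map is the
    -- identity.
    set C : Set (Fin 4 → ℝ) := {x ∈ threeSphere | ∀ j ∈ Finset.univ, (-l j) x ≤ -c} with hC
    have hCp : IsPolyhedron C := isPolyhedron_threeSphere.inter_halfspaces _ _ _
    have hCd : ∀ x ∈ C, x ∈ chartDomain σ := fun x hx => ⟨hx.1, fun j => by
      have := hx.2 j (Finset.mem_univ j)
      rw [LinearMap.neg_apply, hl] at this
      linarith⟩
    have h1 : IsPLOn (chartExtend σ h) C := by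
      have hp := isPLOn_linear (chartProj σ) hCp
      have h2 := (hPL _ hp.isPolyhedron_image).comp hp (Set.mapsTo_image _ _)
      have h3 := (isPLOn_chartInv σ h2.isPolyhedron_image).comp h2 (Set.mapsTo_image _ _)
      refine h3.congr fun x hx => ?_
      rw [chartExtend, if_pos (hCd x hx)]; rfl
    set L : Set (Fin 4 → ℝ) := ⋃ j, {x ∈ threeSphere | l j x ≤ c} with hL
    have hLp : IsPolyhedron L := .iUnion fun j => isPolyhedron_threeSphere.inter_halfspace _ _
    have h2 : IsPLOn (chartExtend σ h) L := by
      refine (isPLOn_id hLp).congr fun x hx => ?_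
      rw [Set.mem_iUnion] at hx
      obtain ⟨j, hxS, hj⟩ := hx
      refine (chartExtend_eq_self hσ fun hd => hid _ fun hb => ?_).symm
      have := hcB _ hb j
      rw [chartInv_chartProj hσ hd, ← hl] at this
      exact absurd hj (not_le.2 this)
    have : threeSphere = C ∪ L := by
      ext x
      constructor
      · intro hx
        by_cases hxL : ∃ j, l j x ≤ c
        · right
          obtain ⟨j, hj⟩ := hxL
          exact Set.mem_iUnion.2 ⟨j, hx, hj⟩
        · left
          push Not at hxL
          exact ⟨hx, fun j _ => by rw [LinearMap.neg_apply]; linarith [hxL j]⟩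
      · rintro (hx | hx)
        · exact hx.1
        · obtain ⟨j, hj⟩ := Set.mem_iUnion.1 hx
          exact hj.1
    rw [this]
    exact h1.union h2
  · have hdom : ∀ x ∈ threeSphere, (x ∈ chartDomain σ → chartExtend σ h x ∈ chartDomain σ) ∧
        (x ∉ chartDomain σ → chartExtend σ h x = x) := by
      intro x hx
      constructor
      · intro hd
        rw [chartExtend, if_pos hd]
        exact chartInv_mem hσ (hmaps _ (chartProj_mem hσ hd))
      · intro hd
        rw [chartExtend, if_neg hd]
    refine ⟨fun x hx => ?_, fun x hx x' hx' heq => ?_, fun z hz => ?_⟩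
    · by_cases hd : x ∈ chartDomain σ
      · exact ((hdom x hx).1 hd).1
      · rwa [(hdom x hx).2 hd]
    · by_cases hd : x ∈ chartDomain σ <;> by_cases hd' : x' ∈ chartDomain σ
      · rw [chartExtend, if_pos hd, chartExtend, if_pos hd'] at heq
        have := hbij.1 (chartInv_injective hσ heq)
        rw [← chartInv_chartProj hσ hd, this, chartInv_chartProj hσ hd']
      · have := (hdom x hx).1 hd
        rw [heq, (hdom x' hx').2 hd'] at this
        exact absurd this hd'
      · have := (hdom x' hx').1 hd'
        rw [← heq, (hdom x hx).2 hd] at this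
        exact absurd this hd
      · rwa [(hdom x hx).2 hd, (hdom x' hx').2 hd'] at heq
    · by_cases hd : z ∈ chartDomain σ
      · obtain ⟨y, hy⟩ := hbij.2 (chartProj σ z)
        have hyO : y ∈ chartRange := by
          by_contra hn
          have := hid y fun hb => hn (hBO hb)
          rw [this] at hy
          exact hn (hy ▸ chartProj_mem hσ hd)
        refine ⟨chartInv σ y, (chartInv_mem hσ hyO).1, ?_⟩
        rw [chartExtend_chartInv hσ h hyO, hy, chartInv_chartProj hσ hd]
      · exact ⟨z, hz, (hdom z hz).2 hd⟩

/-- Near a compact subset of the range of a chart, a family of segments in the sphere is a family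
of segments in the chart. -/
theorem exists_isSegUnion_chart {σ : Fin 4 → ℝ} (hσ : IsCorner σ) {T : Set (Fin 3 → ℝ)}
    (hT : IsCompact T) (hTO : T ⊆ chartRange) {Z : Set (Fin 4 → ℝ)} (hZ : IsSegUnion Z)
    (hZS : Z ⊆ threeSphere) : ∃ (Z' O' : Set (Fin 3 → ℝ)), IsSegUnion Z' ∧ IsOpen O' ∧ T ⊆ O' ∧
      O' ⊆ chartRange ∧ (∀ y ∈ O', chartInv σ y ∈ Z → y ∈ Z') ∧
      ∀ y ∈ Z', y ∈ chartRange ∧ chartInv σ y ∈ Z := by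
  obtain ⟨c, hc, hcT⟩ := exists_margin hσ hT hTO
  -- The half-spaces keep a margin `c` from the boundary of the chart, so that what remains of `Z`
  -- is a union of closed segments in the chart.
  set C : Set (Fin 4 → ℝ) := {x | ∀ j, c ≤ σ j * x j} with hC
  have hCeq : C = ⋂ j, {x | c ≤ (σ j • LinearMap.proj j : (Fin 4 → ℝ) →ₗ[ℝ] ℝ) x} := by
    ext x; simp [hC]
  have hCconv : Convex ℝ C := by
    rw [hCeq]
    exact convex_iInter fun j => convex_halfSpace_ge (LinearMap.isLinear _) c
  have hCcl : IsClosed C := by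
    rw [hCeq]
    exact isClosed_iInter fun j => isClosed_le continuous_const
      (LinearMap.continuous_of_finiteDimensional _)
  have hdom : ∀ x ∈ Z ∩ C, x ∈ chartDomain σ := fun x hx =>
    ⟨hZS hx.1, fun j => hc.trans_le (hx.2 j)⟩
  refine ⟨chartProj σ '' (Z ∩ C), chartRange ∩ ⋂ j, {y | c < σ j * chartInv σ y j},
    (hZ.inter_convex hCconv hCcl).image_linear _, ?_, ?_, Set.inter_subset_left, ?_, ?_⟩
  · refine isOpen_chartRange.inter (isOpen_iInter_of_finite fun j => ?_)
    have := continuous_chartInv σ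
    exact isOpen_lt continuous_const (by fun_prop)
  · exact fun y hy => ⟨hTO hy, Set.mem_iInter.2 fun j => hcT y hy j⟩
  · rintro y ⟨-, hy⟩ hyZ
    exact ⟨chartInv σ y, ⟨hyZ, fun j => (Set.mem_iInter.1 hy j).le⟩, chartProj_chartInv hσ y⟩
  · rintro _ ⟨x, hx, rfl⟩
    exact ⟨chartProj_mem hσ (hdom x hx), by rw [chartInv_chartProj hσ (hdom x hx)]; exact hx.1⟩

/-- The basic move, in a chart of the sphere. -/
theorem exists_move {σ : Fin 4 → ℝ} (hσ : IsCorner σ) {F : Set (Fin 3 → ℝ)} (hFfin : F.Finite)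
    {p q : Fin 3 → ℝ} (hF : ∀ a ∈ F, a ∉ convexHull ℝ (insert p (insert q (F \ {a}))))
    (hTO : convexHull ℝ (insert p (insert q F)) ⊆ chartRange)
    {Z : Set (Fin 4 → ℝ)} (hZ : IsSegUnion Z) (hZS : Z ⊆ threeSphere)
    (hZF : ∀ y ∈ convexHull ℝ (insert p (insert q F)), chartInv σ y ∈ Z → y ∈ F) :
    ∃ H, IsPLHomeo H ∧ (∀ z ∈ Z, H z = z) ∧ H (chartInv σ p) = chartInv σ q ∧
      ∀ a ∈ F, ∀ s ∈ Set.Icc (0 : ℝ) 1, H (chartInv σ (AffineMap.lineMap p a s)) =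
        chartInv σ (AffineMap.lineMap q a s) := by
  have hTc : IsCompact (convexHull ℝ (insert p (insert q F))) :=
    ((hFfin.insert q).insert p).isCompact_convexHull ℝ
  obtain ⟨Z', O', hZ', hO', hTO', hO'r, hZZ', hZ'Z⟩ := exists_isSegUnion_chart hσ hTc hTO hZ hZS
  obtain ⟨h, B, hbij, hPL, hBc, hBO, hid, hfix, hpq, hline⟩ := exists_local_move hFfin hF hZ'
    (fun y hy => hZF y hy.2 (hZ'Z y hy.1).2) hO' hTO'
  have hconv := convex_convexHull ℝ (insert p (insert q F))
  have hpT : p ∈ convexHull ℝ (insert p (insert q F)) := subset_convexHull ℝ _ (by simp)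
  refine ⟨chartExtend σ h, isPLHomeo_chartExtend hσ hbij hPL hBc (hBO.trans hO'r) hid,
    fun z hz => chartExtend_eq_self hσ fun hd => ?_, ?_, fun a ha s hs => ?_⟩
  · by_cases hb : chartProj σ z ∈ B
    · exact hfix _ (hZZ' _ (hBO hb) (by rwa [chartInv_chartProj hσ hd]))
    · exact hid _ hb
  · rw [chartExtend_chartInv hσ h (hTO hpT), hpq]
  · rw [chartExtend_chartInv hσ h, hline a ha s hs]
    have haT : a ∈ convexHull ℝ (insert p (insert q F)) := subset_convexHull ℝ _ (by simp [ha])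
    refine hTO (hconv.segment_subset hpT haT ?_)
    rw [segment_eq_image_lineMap]
    exact ⟨s, hs, rfl⟩

end SpatialGraph
namespace SpatialGraph
open scoped Graph
open Filter Topology

/-! ### Elementary moves across triangles -/

section SegmentLemmas
variable {E : Type*} [AddCommGroup E] [Module ℝ E]

theorem segment_union_midpoint (a c : E) :
    segment ℝ a (midpoint ℝ a c) ∪ segment ℝ (midpoint ℝ a c) c = segment ℝ a c := by
  apply Set.Subset.antisymm
  · refine Set.union_subset ?_ ?_
    · exact (convex_segment a c).segment_subset (left_mem_segment ℝ a c) (midpoint_mem_segment a c)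
    · exact (convex_segment a c).segment_subset (midpoint_mem_segment a c) (right_mem_segment ℝ a c)
  · intro y hy
    rw [segment_eq_image_lineMap] at hy
    obtain ⟨u, hu, rfl⟩ := hy
    have hL : ∀ s t : ℝ, (AffineMap.lineMap a c : ℝ →ᵃ[ℝ] E) '' segment ℝ s t =
      segment ℝ (AffineMap.lineMap a c s) (AffineMap.lineMap a c t) :=
    fun s t => image_segment _ _ _ _
    have hm : (AffineMap.lineMap a c : ℝ →ᵃ[ℝ] E) (1 / 2) = midpoint ℝ a c := by
      rw [midpoint]; norm_num
    rcases le_total u (1 / 2) with h | h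
    · left
      have := hL 0 (1/2)
      rw [hm, AffineMap.lineMap_apply_zero] at this
      rw [← this]
      exact ⟨u, by rw [segment_eq_Icc (by norm_num)]; exact ⟨hu.1, h⟩, rfl⟩
    · right
      have := hL (1/2) 1
      rw [hm, AffineMap.lineMap_apply_one] at this
      rw [← this]
      exact ⟨u, by rw [segment_eq_Icc (by norm_num)]; exact ⟨h, hu.2⟩, rfl⟩

/-- If `a` is a vertex of the triangle `a b c`, then it is also a vertex of the hull of `a`, `b`,
`c` and the midpoint of `a` and `c`. -/
theorem notMem_convexHull_midpoint {a b c : E} (ha : a ∉ segment ℝ b c) :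
    a ∉ convexHull ℝ {b, midpoint ℝ a c, c} := by
  intro h
  rw [convexHull_insert (by simp), convexHull_pair, convexJoin_singleton_left,
    Set.mem_iUnion₂] at h
  obtain ⟨w, hw, haw⟩ := h
  obtain ⟨u, v, hu, hv, huv, rfl⟩ := hw
  obtain ⟨r, s, hr, hs, hrs, h⟩ := haw
  apply ha
  have hm : midpoint ℝ a c = (1 / 2 : ℝ) • a + (1 / 2 : ℝ) • c := by
    rw [midpoint_eq_smul_add, smul_add]; simp
  rw [hm] at h
  have hsu : s * u ≤ 1 := by
    have : s ≤ 1 := by linarith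
    have : u ≤ 1 := by linarith
    nlinarith
  have hpos : 0 < 1 - s * u / 2 := by linarith
  refine ⟨(1 - s * u / 2)⁻¹ * r, (1 - s * u / 2)⁻¹ * (s * v + s * u / 2), by positivity,
    by positivity, ?_, ?_⟩
  · rw [← mul_add, inv_mul_eq_one₀ hpos.ne']
    have : v = 1 - u := by linarith
    subst this
    linarith
  · have h2 : (1 - s * u / 2) • a = r • b + (s * v + s * u / 2) • c := by
      have : a - (s * u / 2) • a = r • b + (s * v + s * u / 2) • c := by
        nth_rw 1 [← h]
        module
      rw [← this, sub_smul, one_smul]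
    rw [mul_smul, mul_smul, ← smul_add, ← h2, smul_smul, inv_mul_cancel₀ hpos.ne', one_smul]

end SegmentLemmas

theorem image_chartInv_segment {σ : Fin 4 → ℝ} {H : (Fin 4 → ℝ) → (Fin 4 → ℝ)}
    {p q a : Fin 3 → ℝ} (h : ∀ s ∈ Set.Icc (0 : ℝ) 1, H (chartInv σ (AffineMap.lineMap p a s)) =
        chartInv σ (AffineMap.lineMap q a s)) :
    H '' (chartInv σ '' segment ℝ p a) = chartInv σ '' segment ℝ q a := by
  rw [segment_eq_image_lineMap, segment_eq_image_lineMap, Set.image_image, Set.image_image,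
    Set.image_image]
  exact Set.image_congr h

/-- A piecewise linear homeomorphism of the sphere replaces the sides `ab` and `bc` of a triangle by
the side `ac`, and fixes a family of segments meeting the triangle in `a` and `c` at most. -/
theorem exists_triangle_move {σ : Fin 4 → ℝ} (hσ : IsCorner σ) {a b c : Fin 3 → ℝ}
    (ha : a ∈ chartRange) (hb : b ∈ chartRange) (hc : c ∈ chartRange)
    (hac : a ∉ segment ℝ b c) (hca : c ∉ segment ℝ a b) {Z : Set (Fin 4 → ℝ)}
    (hZ : IsSegUnion Z) (hZS : Z ⊆ threeSphere)
    (hZT : ∀ y ∈ convexHull ℝ {a, b, c}, chartInv σ y ∈ Z → y = a ∨ y = c) :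
    ∃ H, IsPLHomeo H ∧ (∀ z ∈ Z, H z = z) ∧ H (chartInv σ a) = chartInv σ a ∧
      H (chartInv σ c) = chartInv σ c ∧
      H '' (chartInv σ '' (segment ℝ a b ∪ segment ℝ b c)) = chartInv σ '' segment ℝ a c := by
  have hne : a ≠ c := by rintro rfl; exact hac (right_mem_segment ℝ b a)
  -- The vertex `b` is pushed to the midpoint of `ac`.
  set m := midpoint ℝ a c with hm
  have hsub : convexHull ℝ (insert b (insert m {a, c})) ⊆ convexHull ℝ {a, b, c} := by
    have h1 : ∀ x ∈ ({a, b, c} : Set (Fin 3 → ℝ)), x ∈ convexHull ℝ {a, b, c} := fun x hx =>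
      subset_convexHull ℝ _ hx
    refine convexHull_min ?_ (convex_convexHull ℝ _)
    rintro x (rfl | rfl | rfl | rfl)
    · exact h1 _ (by simp)
    · exact (convex_convexHull ℝ _).segment_subset (h1 a (by simp)) (h1 c (by simp))
        (midpoint_mem_segment a c)
    · exact h1 _ (by simp)
    · exact h1 _ (by simp)
  have hrange : convexHull ℝ {a, b, c} ⊆ chartRange := by
    refine convexHull_min ?_ convex_chartRange
    rintro x (rfl | rfl | rfl) <;> assumption
  have hF : ∀ x ∈ ({a, c} : Set (Fin 3 → ℝ)),
      x ∉ convexHull ℝ (insert b (insert m (({a, c} : Set (Fin 3 → ℝ)) \ {x}))) := by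
    rintro x (rfl | rfl)
    · have : ({x, c} : Set (Fin 3 → ℝ)) \ {x} = {c} := by
        ext y; simp only [Set.mem_sdiff, Set.mem_insert_iff, Set.mem_singleton_iff]
        constructor
        · tauto
        · rintro rfl; exact ⟨Or.inr rfl, hne.symm⟩
      rw [this]
      exact notMem_convexHull_midpoint hac
    · have : ({a, x} : Set (Fin 3 → ℝ)) \ {x} = {a} := by
        ext y; simp only [Set.mem_sdiff, Set.mem_insert_iff, Set.mem_singleton_iff]
        constructor
        · tauto
        · rintro rfl; exact ⟨Or.inl rfl, hne⟩
      rw [this, hm, midpoint_comm]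
      exact notMem_convexHull_midpoint (by rwa [segment_symm])
  obtain ⟨H, hH, hfix, hbm, hline⟩ := exists_move hσ (F := {a, c}) (Set.toFinite _) (p := b)
    (q := m) (Z := Z) hF (hsub.trans hrange) hZ hZS fun y hy hyZ => hZT y (hsub hy) hyZ
  have hend : ∀ x ∈ ({a, c} : Set (Fin 3 → ℝ)), H (chartInv σ x) = chartInv σ x := fun x hx => by
      simpa using hline x hx 1 (by simp)
  refine ⟨H, hH, hfix, hend a (by simp), hend c (by simp), ?_⟩
  rw [Set.image_union, Set.image_union, segment_symm ℝ a b,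
      image_chartInv_segment (hline a (by simp)), image_chartInv_segment (hline c (by simp)),
      segment_symm ℝ m a, ← Set.image_union, segment_union_midpoint]

/-- A piecewise linear homeomorphism of the sphere moves the end `c` of the segment `ac` to `b`, and
fixes a family of segments meeting the triangle `a b c` in `a` at most. -/
theorem exists_slide {σ : Fin 4 → ℝ} (hσ : IsCorner σ) {a b c : Fin 3 → ℝ}
    (ha : a ∈ chartRange) (hb : b ∈ chartRange) (hc : c ∈ chartRange)
    (hac : a ∉ segment ℝ b c) {Z : Set (Fin 4 → ℝ)}
    (hZ : IsSegUnion Z) (hZS : Z ⊆ threeSphere)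
    (hZT : ∀ y ∈ convexHull ℝ {a, b, c}, chartInv σ y ∈ Z → y = a) :
    ∃ H, IsPLHomeo H ∧ (∀ z ∈ Z, H z = z) ∧ H (chartInv σ a) = chartInv σ a ∧
      H (chartInv σ c) = chartInv σ b ∧
      H '' (chartInv σ '' segment ℝ a c) = chartInv σ '' segment ℝ a b := by
  have hset : (insert c (insert b {a}) : Set (Fin 3 → ℝ)) = {a, b, c} := by
    ext y; simp only [Set.mem_insert_iff, Set.mem_singleton_iff]; tauto
  have hrange : convexHull ℝ {a, b, c} ⊆ chartRange := by
    refine convexHull_min ?_ convex_chartRange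
    rintro x (rfl | rfl | rfl) <;> assumption
  obtain ⟨H, hH, hfix, hbm, hline⟩ := exists_move hσ (F := {a}) (Set.toFinite _) (p := c)
    (q := b) (Z := Z) (by
      rintro x rfl
      rw [Set.sdiff_self, LawfulSingleton.insert_empty_eq, convexHull_pair, segment_symm]
      exact hac) (by rwa [hset]) hZ hZS (by rw [hset]; exact hZT)
  refine ⟨H, hH, hfix, by simpa using hline a rfl 1 (by simp), hbm, ?_⟩
  rw [segment_symm, image_chartInv_segment (hline a rfl), segment_symm]

end SpatialGraph
namespace SpatialGraph
open scoped Graph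
open Filter Topology

/-! ### Piecewise linear paths -/

section Paths

variable {E : Type*} [NormedAddCommGroup E] [NormedSpace ℝ E]

/-- The interval carrying a piecewise linear path is a finite union of compact intervals on which
the path is affine: if the hull of a finite set is part of the graph of the path, then the path is
affine over its projection. -/
theorem IsPLOn.exists_pieces {γ : ℝ → E} {P : Set ℝ} (hγ : IsPLOn γ P) :
    ∃ 𝓘 : Set (Set ℝ), 𝓘.Finite ∧ P = ⋃₀ 𝓘 ∧ ∀ I ∈ 𝓘, IsCompact I ∧ Convex ℝ I ∧
      ∀ s ∈ I, ∀ t ∈ I, ∀ a b : ℝ, 0 ≤ a → 0 ≤ b → a + b = 1 →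
        γ (a * s + b * t) = a • γ s + b • γ t := by
  obtain ⟨T, hT, hgr⟩ := hγ
  refine ⟨(fun t : Finset (ℝ × E) => Prod.fst '' convexHull ℝ (t : Set (ℝ × E))) '' T,
    hT.image _, ?_, ?_⟩
  · rw [← Set.image_fst_graphOn γ P, hgr, Set.image_iUnion₂, Set.sUnion_image]
  · rintro _ ⟨t, ht, rfl⟩
    have hsub : convexHull ℝ (t : Set (ℝ × E)) ⊆ Set.graphOn γ P := by
      rw [hgr]; exact Set.subset_biUnion_of_mem (u := fun t : Finset (ℝ × E) =>
        convexHull ℝ (t : Set (ℝ × E))) ht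
    have hconv := convex_convexHull ℝ (t : Set (ℝ × E))
    refine ⟨(t.finite_toSet.isCompact_convexHull ℝ).image continuous_fst,
      hconv.linear_image (LinearMap.fst ℝ ℝ E), ?_⟩
    rintro _ ⟨x, hx, rfl⟩ _ ⟨y, hy, rfl⟩ a b ha hb hab
    have h1 := (Set.mem_graphOn.1 (hsub hx)).2
    have h2 := (Set.mem_graphOn.1 (hsub hy)).2
    have h3 := (Set.mem_graphOn.1 (hsub (hconv hx hy ha hb hab))).2
    simp only [Prod.fst_add, Prod.smul_fst, smul_eq_mul, Prod.snd_add, Prod.smul_snd] at h3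
    rw [h3, h1, h2]

theorem IsPLOn.isSegUnion_image {γ : ℝ → E} {P : Set ℝ} (hγ : IsPLOn γ P) :
    IsSegUnion (γ '' P) := by
  obtain ⟨𝓘, hfin, hP, hI⟩ := hγ.exists_pieces
  rw [hP, Set.sUnion_eq_biUnion, Set.image_iUnion₂]
  refine .biUnion hfin fun I hI' => ?_
  obtain ⟨hc, hconv, haff⟩ := hI I hI'
  rcases I.eq_empty_or_nonempty with rfl | hne
  · rw [Set.image_empty]; exact isSegUnion_empty
  have hIcc := eq_Icc_of_connected_compact ⟨hne, hconv.isPreconnected⟩ hc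
  have h1 : sInf I ∈ I := hc.sInf_mem hne
  have h2 : sSup I ∈ I := hc.sSup_mem hne
  have hle : sInf I ≤ sSup I := by
    rw [hIcc] at h1; exact h1.1.trans h1.2
  have : γ '' I = segment ℝ (γ (sInf I)) (γ (sSup I)) := by
    have hIs : I = segment ℝ (sInf I) (sSup I) := by rw [segment_eq_Icc hle]; exact hIcc
    ext x
    constructor
    · rintro ⟨r, hr, rfl⟩
      rw [hIs] at hr
      obtain ⟨a, b, ha, hb, hab, rfl⟩ := hr
      exact ⟨a, b, ha, hb, hab, (haff _ h1 _ h2 a b ha hb hab).symm⟩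
    · rintro ⟨a, b, ha, hb, hab, rfl⟩
      exact ⟨a * sInf I + b * sSup I, hconv h1 h2 ha hb hab, haff _ h1 _ h2 a b ha hb hab⟩
  rw [this]
  exact isSegUnion_segment _ _

/-- `γ` is affine on `[s, t]`. -/
def IsAffineOn (γ : ℝ → E) (s t : ℝ) : Prop :=
  ∃ A : ℝ →ᵃ[ℝ] E, Set.EqOn γ A (Set.Icc s t)

theorem IsAffineOn.mono {γ : ℝ → E} {s t s' t' : ℝ} (h : IsAffineOn γ s t) (hs : s ≤ s')
    (ht : t' ≤ t) : IsAffineOn γ s' t' :=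
  h.imp fun _ hA => hA.mono (Set.Icc_subset_Icc hs ht)

theorem isAffineOn_of_mem_piece {γ : ℝ → E} {I : Set ℝ}
    (haff : ∀ s ∈ I, ∀ t ∈ I, ∀ a b : ℝ, 0 ≤ a → 0 ≤ b → a + b = 1 →
        γ (a * s + b * t) = a • γ s + b • γ t) {s t : ℝ} (hs : s ∈ I) (ht : t ∈ I) (hst : s < t) :
    IsAffineOn γ s t := by
  refine ⟨(AffineMap.lineMap (γ s) (γ t)).comp
    ((t - s)⁻¹ • (AffineMap.id ℝ ℝ - AffineMap.const ℝ ℝ s)), fun r hr => ?_⟩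
  have hpos : 0 < t - s := sub_pos.2 hst
  have h1 : 0 ≤ (t - s)⁻¹ * (r - s) := mul_nonneg (by positivity) (by linarith [hr.1])
  have h2 : (t - s)⁻¹ * (r - s) ≤ 1 := by
    rw [inv_mul_le_one₀ hpos]; linarith [hr.2]
  have := haff s hs t ht (1 - (t - s)⁻¹ * (r - s)) ((t - s)⁻¹ * (r - s)) (by linarith) h1
    (by ring)
  have hr' : (1 - (t - s)⁻¹ * (r - s)) * s + (t - s)⁻¹ * (r - s) * t = r := by
    field_simp; ring
  rw [hr'] at this
  rw [this]
  simp [AffineMap.lineMap_apply_module]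

theorem IsPLOn.exists_isAffineOn_left {γ : ℝ → E} (hγ : IsPLOn γ (Set.Icc 0 1)) {t : ℝ}
    (ht : t ∈ Set.Ioc (0 : ℝ) 1) : ∃ s ∈ Set.Ico 0 t, IsAffineOn γ s t := by
  obtain ⟨𝓘, hfin, hP, hI⟩ := hγ.exists_pieces
  by_contra! hno
  have h1 : ∀ᶠ s in 𝓝[<] t, ∀ I ∈ 𝓘, s ∉ I := by
    rw [eventually_all_finite hfin]
    intro I hI'
    obtain ⟨hc, -, haff⟩ := hI I hI'
    by_cases htI : t ∈ I
    · filter_upwards [Ico_mem_nhdsLT ht.1] with s hs hsI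
      exact hno s hs (isAffineOn_of_mem_piece haff hsI htI hs.2)
    · exact nhdsWithin_le_nhds (hc.isClosed.isOpen_compl.mem_nhds htI)
  obtain ⟨s, hs, hs'⟩ := (h1.and (Ico_mem_nhdsLT ht.1)).exists
  have : s ∈ Set.Icc (0 : ℝ) 1 := ⟨hs'.1, hs'.2.le.trans ht.2⟩
  rw [hP] at this
  obtain ⟨I, hI', hsI⟩ := this
  exact hs I hI' hsI

theorem IsPLOn.exists_isAffineOn_right {γ : ℝ → E} (hγ : IsPLOn γ (Set.Icc 0 1)) {t : ℝ}
    (ht : t ∈ Set.Ico (0 : ℝ) 1) : ∃ s ∈ Set.Ioc t 1, IsAffineOn γ t s := by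
  obtain ⟨𝓘, hfin, hP, hI⟩ := hγ.exists_pieces
  by_contra! hno
  have h1 : ∀ᶠ s in 𝓝[>] t, ∀ I ∈ 𝓘, s ∉ I := by
    rw [eventually_all_finite hfin]
    intro I hI'
    obtain ⟨hc, -, haff⟩ := hI I hI'
    by_cases htI : t ∈ I
    · filter_upwards [Ioc_mem_nhdsGT ht.2] with s hs hsI
      exact hno s hs (isAffineOn_of_mem_piece haff htI hsI hs.1)
    · exact nhdsWithin_le_nhds (hc.isClosed.isOpen_compl.mem_nhds htI)
  obtain ⟨s, hs, hs'⟩ := (h1.and (Ioc_mem_nhdsGT ht.2)).exists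
  have : s ∈ Set.Icc (0 : ℝ) 1 := ⟨ht.1.trans hs'.1.le, hs'.2⟩
  rw [hP] at this
  obtain ⟨I, hI', hsI⟩ := this
  exact hs I hI' hsI

theorem image_Icc_of_eqOn_affine {γ : ℝ → E} {A : ℝ →ᵃ[ℝ] E} {s t : ℝ} (hst : s ≤ t)
    (h : Set.EqOn γ A (Set.Icc s t)) : γ '' Set.Icc s t = segment ℝ (γ s) (γ t) := by
  rw [h.image_eq, ← segment_eq_Icc hst, image_segment, h ⟨le_rfl, hst⟩, h ⟨hst, le_rfl⟩]

end Paths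

/-! ### Straightening an arc -/

/-- If the ray from `b` through `a` meets the triangle `a b c` beyond `a`, then `a` is not a vertex
of it. -/
theorem eq_of_mem_convexHull_of_mem_ray {E : Type*} [AddCommGroup E] [Module ℝ E] {a b c : E}
    {κ : ℝ} (hκ : 1 ≤ κ) (hac : a ∉ segment ℝ b c)
    (hy : b + κ • (a - b) ∈ convexHull ℝ {a, b, c}) : b + κ • (a - b) = a := by
  have hab : a ≠ b := by rintro rfl; exact hac (left_mem_segment ℝ _ _)
  rw [convexHull_insert (by simp), convexHull_pair, convexJoin_singleton_left,
    Set.mem_iUnion₂] at hy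
  obtain ⟨w, ⟨u, v, hu, hv, huv, rfl⟩, r, s, hr, hs, hrs, h⟩ := hy
  have heq : (κ - r) • (a - b) = (s * v) • (c - b) := by
    have h1 : (κ - r) • (a - b) = (b + κ • (a - b)) - b - r • (a - b) := by module
    rw [h1, ← h]
    obtain rfl : s = 1 - r := by linarith
    obtain rfl : u = 1 - v := by linarith
    module
  have hle : s * v ≤ κ - r := by
    have : s * v ≤ s := by nlinarith
    linarith
  rcases (mul_nonneg hs hv).eq_or_lt with h0 | hpos
  · rw [← h0, zero_smul, smul_eq_zero, sub_eq_zero, sub_eq_zero] at heq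
    have hκr : κ = r := heq.resolve_right hab
    obtain rfl : κ = 1 := le_antisymm (by linarith) hκ
    module
  · exfalso
    apply hac
    rw [segment_eq_image']
    have hκr : 0 < κ - r := hpos.trans_le hle
    refine ⟨(s * v) / (κ - r), ⟨by positivity, (div_le_one hκr).2 hle⟩, ?_⟩
    simp only
    rw [div_eq_inv_mul, mul_smul, ← heq, smul_smul, inv_mul_cancel₀ hκr.ne', one_smul]
    abel

/-- Some piecewise linear homeomorphism of the sphere carries the initial part `γ[0, s]` of the path
`γ` to the initial part `γ[0, t]`, respecting the ends. -/
def IsShrinkable (γ : ℝ → Fin 4 → ℝ) (s t : ℝ) : Prop :=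
  ∃ H, IsPLHomeo H ∧ H '' (γ '' Set.Icc 0 s) = γ '' Set.Icc 0 t ∧ H (γ 0) = γ 0 ∧ H (γ s) = γ t

theorem IsShrinkable.trans {γ : ℝ → Fin 4 → ℝ} {r s t : ℝ} (h : IsShrinkable γ r s)
    (h' : IsShrinkable γ s t) : IsShrinkable γ r t := by
  obtain ⟨H, hH, h1, h2, h3⟩ := h
  obtain ⟨K, hK, k1, k2, k3⟩ := h'
  exact ⟨K ∘ H, hK.comp hH, by rw [Set.image_comp, h1, k1], by simp [h2, k2], by simp [h3, k3]⟩

theorem IsShrinkable.symm {γ : ℝ → Fin 4 → ℝ} (hγS : Set.MapsTo γ (Set.Icc 0 1) threeSphere)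
    {s t : ℝ} (hs : s ∈ Set.Icc (0 : ℝ) 1) (h : IsShrinkable γ s t) :
    IsShrinkable γ t s := by
  obtain ⟨H, hH, h1, h2, h3⟩ := h
  obtain ⟨K, hK, hinv⟩ := hH.exists_inverse
  have hsub : γ '' Set.Icc 0 s ⊆ threeSphere :=
    (Set.image_mono (Set.Icc_subset_Icc_right hs.2)).trans hγS.image_subset
  refine ⟨K, hK, ?_, ?_, ?_⟩
  · rw [← h1, IsPLHomeo.image_image_inverse hinv hsub]
  · nth_rw 1 [← h2]; exact hinv.1 (hγS ⟨le_rfl, zero_le_one⟩)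
  · rw [← h3]; exact hinv.1 (hγS hs)

section Straighten

variable {γ : ℝ → Fin 4 → ℝ} (hγ : IsPLOn γ (Set.Icc 0 1)) (hinj : Set.InjOn γ (Set.Icc 0 1))
  (hγS : Set.MapsTo γ (Set.Icc 0 1) threeSphere)

theorem image_Icc_eq_chartInv {σ : Fin 4 → ℝ} (hσ : IsCorner σ) {s t : ℝ}
    (hd : ∀ r ∈ Set.Icc s t, γ r ∈ chartDomain σ) {s' t' : ℝ} (hs : s ≤ s') (ht : t' ≤ t) :
    γ '' Set.Icc s' t' = chartInv σ '' ((fun r => chartProj σ (γ r)) '' Set.Icc s' t') := by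
  rw [Set.image_image]
  exact Set.image_congr fun r hr =>
    (chartInv_chartProj hσ (hd r ⟨hs.trans hr.1, hr.2.trans ht⟩)).symm

theorem IsAffineOn.chartProj {s t : ℝ} (h : IsAffineOn γ s t) (σ : Fin 4 → ℝ) :
    IsAffineOn (fun r => chartProj σ (γ r)) s t := by
  obtain ⟨A, hA⟩ := h
  exact ⟨(SpatialGraph.chartProj σ).toAffineMap.comp A, fun r hr => by simp [hA hr]⟩

include hγ hinj hγS

/-- Shrinking within a straight part of the path. -/
theorem isShrinkable_left {σ : Fin 4 → ℝ} (hσ : IsCorner σ) {s r t : ℝ} (hs : 0 ≤ s)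
    (hsr : s < r) (hrt : r ≤ t) (ht : t ≤ 1) (hd : ∀ r ∈ Set.Icc s t, γ r ∈ chartDomain σ)
    (haff : IsAffineOn γ s t) : IsShrinkable γ t r := by
  set Y : ℝ → Fin 3 → ℝ := fun r => SpatialGraph.chartProj σ (γ r) with hY
  obtain ⟨A, hA⟩ := haff.chartProj σ
  have hYγ : ∀ r ∈ Set.Icc s t, chartInv σ (Y r) = γ r := fun r hr =>
    chartInv_chartProj hσ (hd r hr)
  have hYr : ∀ r ∈ Set.Icc s t, Y r ∈ chartRange := fun r hr => chartProj_mem hσ (hd r hr)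
  have hseg : ∀ s' t', s ≤ s' → s' ≤ t' → t' ≤ t → segment ℝ (Y s') (Y t') = Y '' Set.Icc s' t' :=
    fun s' t' h1 h2 h3 => (image_Icc_of_eqOn_affine h2 (hA.mono (Set.Icc_subset_Icc h1 h3))).symm
  have hI : ∀ r ∈ Set.Icc s t, r ∈ Set.Icc (0 : ℝ) 1 := fun r hr =>
    ⟨hs.trans hr.1, hr.2.trans ht⟩
  have hs_mem : s ∈ Set.Icc s t := ⟨le_rfl, by linarith⟩
  have hr_mem : r ∈ Set.Icc s t := ⟨hsr.le, hrt⟩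
  have ht_mem : t ∈ Set.Icc s t := ⟨by linarith, le_rfl⟩
  have hZp : IsPLOn γ (Set.Icc 0 s) := hγ.mono (isPolyhedron_Icc _ _)
    (Set.Icc_subset_Icc_right (by linarith))
  have hZS : γ '' Set.Icc 0 s ⊆ threeSphere :=
    (Set.image_mono (Set.Icc_subset_Icc_right (by linarith))).trans hγS.image_subset
  have hac : Y s ∉ segment ℝ (Y r) (Y t) := by
    rw [hseg r t hsr.le hrt le_rfl]
    rintro ⟨r', hr', heq⟩
    have hr'm : r' ∈ Set.Icc s t := ⟨hsr.le.trans hr'.1, hr'.2⟩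
    have : γ r' = γ s := by rw [← hYγ _ hr'm, ← hYγ _ hs_mem, heq]
    have := hinj (hI _ hr'm) (hI _ hs_mem) this
    linarith [hr'.1]
  obtain ⟨H, hH, hfix, h1, h2, h3⟩ := exists_slide hσ (hYr s hs_mem) (hYr r hr_mem) (hYr t ht_mem)
    hac hZp.isSegUnion_image hZS (by
      intro y hy hyZ
      have hyseg : y ∈ segment ℝ (Y s) (Y t) := by
        refine convexHull_min ?_ (convex_segment _ _) hy
        rintro x (rfl | rfl | rfl)
        · exact left_mem_segment ℝ _ _
        · rw [hseg s t le_rfl (by linarith) le_rfl]; exact ⟨r, hr_mem, rfl⟩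
        · exact right_mem_segment ℝ _ _
      rw [hseg s t le_rfl (by linarith) le_rfl] at hyseg
      obtain ⟨r', hr', rfl⟩ := hyseg
      rw [hYγ r' hr'] at hyZ
      obtain ⟨r'', hr'', heq⟩ := hyZ
      have := hinj ⟨hr''.1, by linarith [hr''.2]⟩ (hI _ hr') heq
      have : r' = s := le_antisymm (by linarith [hr''.2]) hr'.1
      rw [this])
  have himg : ∀ t', s ≤ t' → t' ≤ t →
      γ '' Set.Icc 0 t' = γ '' Set.Icc 0 s ∪ chartInv σ '' segment ℝ (Y s) (Y t') := by
    intro t' h h'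
    rw [hseg s t' le_rfl h h', ← image_Icc_eq_chartInv hσ hd le_rfl h', ← Set.image_union,
      Set.Icc_union_Icc_eq_Icc hs h]
  refine ⟨H, hH, ?_, ?_, ?_⟩
  · rw [himg t (by linarith) le_rfl, himg r hsr.le hrt, Set.image_union, h3]
    congr 1
    exact (Set.image_congr hfix).trans (Set.image_id' _)
  · exact hfix _ ⟨0, ⟨le_rfl, hs⟩, rfl⟩
  · rw [← hYγ t ht_mem, h2, hYγ r hr_mem]

/-- Shrinking across a bend at `t`: the bend is first straightened by a move across a triangle, and
then the end is moved. -/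
theorem eventually_isShrinkable_right {t : ℝ} (ht : t ∈ Set.Ioo (0 : ℝ) 1) :
    ∀ᶠ r in 𝓝[>] t, IsShrinkable γ r t := by
  have htI : t ∈ Set.Icc (0 : ℝ) 1 := ⟨ht.1.le, ht.2.le⟩
  obtain ⟨σ, hσ, htd⟩ := exists_mem_chartDomain (hγS htI)
  set Y : ℝ → Fin 3 → ℝ := fun r => SpatialGraph.chartProj σ (γ r) with hY
  obtain ⟨s₀, hs₀, haff₀⟩ := hγ.exists_isAffineOn_left ⟨ht.1, ht.2.le⟩
  obtain ⟨t₁, ht₁, haff₁⟩ := hγ.exists_isAffineOn_right ⟨ht.1.le, ht.2⟩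
  have hcont : ContinuousAt γ t := hγ.continuousOn.continuousAt (Icc_mem_nhds ht.1 ht.2)
  have hYcont : ContinuousAt Y t := (continuous_chartProj σ).continuousAt.comp hcont
  -- a convex neighbourhood of `Y t` in the chart which avoids the part of the path before `s₀`
  have hK : IsClosed (γ '' Set.Icc 0 s₀) :=
    (isCompact_Icc.image_of_continuousOn (hγ.continuousOn.mono
      (Set.Icc_subset_Icc_right (hs₀.2.le.trans ht.2.le)))).isClosed
  have htK : γ t ∉ γ '' Set.Icc 0 s₀ := by
    rintro ⟨r, hr, heq⟩
    have := hinj ⟨hr.1, by linarith [hr.2, hs₀.2, ht.2]⟩ htI heq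
    linarith [hr.2, hs₀.2]
  have hopen : IsOpen (chartRange ∩ chartInv σ ⁻¹' (γ '' Set.Icc 0 s₀)ᶜ) :=
    isOpen_chartRange.inter (hK.isOpen_compl.preimage (continuous_chartInv σ))
  have hmem : Y t ∈ chartRange ∩ chartInv σ ⁻¹' (γ '' Set.Icc 0 s₀)ᶜ :=
    ⟨chartProj_mem hσ htd, by
      change chartInv σ (Y t) ∉ _
      rwa [chartInv_chartProj hσ htd]⟩
  obtain ⟨ε, hε, hball⟩ := Metric.isOpen_iff.1 hopen _ hmem
  have hev : ∀ᶠ r in 𝓝 t, Y r ∈ Metric.ball (Y t) ε ∧ (∀ j, -1 < σ j * γ r j) := by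
    refine (hYcont.eventually (Metric.ball_mem_nhds _ hε)).and ?_
    rw [eventually_all]
    intro j
    have : ContinuousAt (fun r => σ j * γ r j) t :=
      continuousAt_const.mul ((continuous_apply j).continuousAt.comp hcont)
    exact this.eventually (lt_mem_nhds (htd.2 j))
  obtain ⟨α, β, ⟨hα, hβ⟩, hαβ⟩ := (mem_nhds_iff_exists_Ioo_subset).1 hev
  obtain ⟨s, hs1, hs2⟩ := exists_between (max_lt hα hs₀.2)
  obtain ⟨hsα, hss₀⟩ := max_lt_iff.1 hs1
  filter_upwards [Ioo_mem_nhdsGT hβ, Ioc_mem_nhdsGT ht₁.1] with r hrβ hrt₁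
  have hd : ∀ r' ∈ Set.Icc s r, γ r' ∈ chartDomain σ := fun r' hr' =>
    ⟨hγS ⟨by linarith [hs₀.1, hr'.1], by linarith [hr'.2, hrt₁.2, ht₁.2]⟩,
      (hαβ ⟨by linarith [hr'.1], by linarith [hr'.2, hrβ.2]⟩).2⟩
  have hb : ∀ r' ∈ Set.Icc s r, Y r' ∈ Metric.ball (Y t) ε := fun r' hr' =>
    (hαβ ⟨by linarith [hr'.1], by linarith [hr'.2, hrβ.2]⟩).1
  have hYγ : ∀ r' ∈ Set.Icc s r, chartInv σ (Y r') = γ r' := fun r hr =>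
    chartInv_chartProj hσ (hd r hr)
  have hYr : ∀ r' ∈ Set.Icc s r, Y r' ∈ chartRange := fun r hr => chartProj_mem hσ (hd r hr)
  have hI : ∀ r' ∈ Set.Icc s r, r' ∈ Set.Icc (0 : ℝ) 1 := fun r' hr' =>
    ⟨by linarith [hs₀.1, hr'.1], by linarith [hr'.2, hrt₁.2, ht₁.2]⟩
  have hs_mem : s ∈ Set.Icc s r := ⟨le_rfl, by linarith [hrt₁.1]⟩
  have ht_mem : t ∈ Set.Icc s r := ⟨hs2.le, hrt₁.1.le⟩
  have hr_mem : r ∈ Set.Icc s r := ⟨by linarith [hrt₁.1], le_rfl⟩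
  obtain ⟨A, hA⟩ := haff₀.chartProj σ
  obtain ⟨A', hA'⟩ := haff₁.chartProj σ
  have hseg₀ : segment ℝ (Y s) (Y t) = Y '' Set.Icc s t :=
    (image_Icc_of_eqOn_affine hs2.le (hA.mono (Set.Icc_subset_Icc_left hss₀.le))).symm
  have hseg₁ : segment ℝ (Y t) (Y r) = Y '' Set.Icc t r :=
    (image_Icc_of_eqOn_affine hrt₁.1.le (hA'.mono (Set.Icc_subset_Icc_right hrt₁.2))).symm
  have hYinj : ∀ x ∈ Set.Icc s r, ∀ y ∈ Set.Icc s r, Y x = Y y → x = y := by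
    intro x hx y hy heq
    exact hinj (hI _ hx) (hI _ hy) (by rw [← hYγ _ hx, ← hYγ _ hy, heq])
  have hac : Y s ∉ segment ℝ (Y t) (Y r) := by
    rw [hseg₁]
    rintro ⟨r', hr', heq⟩
    have := hYinj r' ⟨hs2.le.trans hr'.1, hr'.2⟩ s hs_mem heq
    linarith [hr'.1]
  have hca : Y r ∉ segment ℝ (Y s) (Y t) := by
    rw [hseg₀]
    rintro ⟨r', hr', heq⟩
    have := hYinj r' ⟨hr'.1, hr'.2.trans hrt₁.1.le⟩ r hr_mem heq
    linarith [hr'.2, hrt₁.1]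
  have hZp : IsPLOn γ (Set.Icc 0 s) := hγ.mono (isPolyhedron_Icc _ _)
    (Set.Icc_subset_Icc_right (by linarith [ht.2]))
  have hZS : γ '' Set.Icc 0 s ⊆ threeSphere :=
    (Set.image_mono (Set.Icc_subset_Icc_right (by linarith [ht.2]))).trans hγS.image_subset
  have hZT : ∀ y ∈ convexHull ℝ {Y s, Y t, Y r}, chartInv σ y ∈ γ '' Set.Icc 0 s → y = Y s := by
    rintro y hy ⟨r', hr', heq⟩
    have hyb : y ∈ Metric.ball (Y t) ε := by
      refine convexHull_min ?_ (convex_ball _ _) hy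
      rintro x (rfl | rfl | rfl)
      · exact hb _ hs_mem
      · exact hb _ ht_mem
      · exact hb _ hr_mem
    -- Such a point lies on the straight part of the path before `t`, hence on the ray from `Y t`
    -- through `Y s`, at or beyond `Y s`; the triangle contains no point of this ray beyond `Y s`.
    have hr's₀ : s₀ < r' := by
      by_contra! h
      exact (hball hyb).2 ⟨r', ⟨hr'.1, h⟩, heq⟩
    have hyY : y = Y r' := by rw [hY]; simp only; rw [heq, chartProj_chartInv hσ]
    have hr'm : r' ∈ Set.Icc s₀ t := ⟨hr's₀.le, hr'.2.trans hs2.le⟩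
    have hpos : 0 < t - s := by linarith
    have hray : Y r' = Y t + ((t - r') / (t - s)) • (Y s - Y t) := by
      have hA : Set.EqOn Y A (Set.Icc s₀ t) := hA
      rw [hA hr'm, hA ⟨hs₀.2.le, le_rfl⟩, hA ⟨hss₀.le, hs2.le⟩]
      have h1 : ∀ x, A x = A 0 + x • A.linear 1 := fun x => by
        conv_lhs => rw [A.decomp]
        have : A.linear x = x • A.linear 1 := by rw [← map_smul]; simp
        simp [this, add_comm]
      rw [h1 r', h1 t, h1 s]
      have h2 : ((t - r') / (t - s)) * (s - t) = r' - t := by field_simp; ring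
      have h3 : A 0 + s • A.linear 1 - (A 0 + t • A.linear 1) = (s - t) • A.linear 1 := by module
      rw [h3, smul_smul, h2]
      module
    rw [hyY, hray]
    rw [hyY, hray] at hy
    exact eq_of_mem_convexHull_of_mem_ray
      ((one_le_div hpos).2 (by linarith [hr'.2])) hac hy
  obtain ⟨H, hH, hfix, h1, h2, h3⟩ := exists_triangle_move hσ (hYr s hs_mem) (hYr t ht_mem)
    (hYr r hr_mem) hac hca hZp.isSegUnion_image hZS fun y hy hyZ => Or.inl (hZT y hy hyZ)
  obtain ⟨K, hK, kfix, k1, k2, k3⟩ := exists_slide hσ (hYr s hs_mem) (hYr t ht_mem)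
    (hYr r hr_mem) hac hZp.isSegUnion_image hZS hZT
  have himg_t : γ '' Set.Icc 0 t = γ '' Set.Icc 0 s ∪ chartInv σ '' segment ℝ (Y s) (Y t) := by
    rw [hseg₀, ← image_Icc_eq_chartInv hσ hd le_rfl hrt₁.1.le, ← Set.image_union,
      Set.Icc_union_Icc_eq_Icc (by linarith [hs₀.1]) hs2.le]
  have himg_r : γ '' Set.Icc 0 r = γ '' Set.Icc 0 s ∪
      chartInv σ '' (segment ℝ (Y s) (Y t) ∪ segment ℝ (Y t) (Y r)) := by
    rw [hseg₀, hseg₁, Set.image_union, ← image_Icc_eq_chartInv hσ hd le_rfl hrt₁.1.le,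
      ← image_Icc_eq_chartInv hσ hd hs2.le le_rfl, ← Set.image_union, ← Set.image_union,
      Set.Icc_union_Icc_eq_Icc hs2.le hrt₁.1.le, Set.Icc_union_Icc_eq_Icc (by linarith [hs₀.1])
      (by linarith [hrt₁.1])]
  have h0 : γ 0 ∈ γ '' Set.Icc 0 s := ⟨0, ⟨le_rfl, by linarith [hs₀.1]⟩, rfl⟩
  refine ⟨K ∘ H, hK.comp hH, ?_, ?_, ?_⟩
  · rw [himg_r, himg_t, Set.image_union, Set.image_comp, Set.image_comp, h3, k3]
    congr 1
    rw [(Set.image_congr hfix).trans (Set.image_id' _), (Set.image_congr kfix).trans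
      (Set.image_id' _)]
  · simp only [Function.comp_apply]
    rw [hfix _ h0, kfix _ h0]
  · simp only [Function.comp_apply]
    rw [← hYγ r hr_mem, h2, k2, hYγ t ht_mem]

/-- A piecewise linear homeomorphism of the sphere carries a given arc to a straight segment in a
chart. -/
theorem exists_straighten : ∃ H σ u v, IsPLHomeo H ∧ IsCorner σ ∧ u ∈ chartRange ∧
    v ∈ chartRange ∧ u ≠ v ∧ H '' (γ '' Set.Icc 0 1) = chartInv σ '' segment ℝ u v ∧
    H (γ 0) = chartInv σ u ∧ H (γ 1) = chartInv σ v := by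
  have hdom : ∀ t ∈ Set.Icc (0 : ℝ) 1, ∃ σ, IsCorner σ ∧
      ∀ᶠ r in 𝓝[Set.Icc 0 1] t, γ r ∈ chartDomain σ := by
    intro t ht
    obtain ⟨σ, hσ, htd⟩ := exists_mem_chartDomain (hγS ht)
    refine ⟨σ, hσ, ?_⟩
    have h1 : ∀ᶠ r in 𝓝[Set.Icc 0 1] t, ∀ j, -1 < σ j * γ r j := by
      rw [eventually_all]
      intro j
      have : ContinuousWithinAt (fun r => σ j * γ r j) (Set.Icc 0 1) t :=
        continuousWithinAt_const.mul
          ((continuous_apply j).continuousAt.comp_continuousWithinAt (hγ.continuousOn t ht))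
      exact this.eventually (lt_mem_nhds (htd.2 j))
    filter_upwards [h1, self_mem_nhdsWithin] with r h1 hr
    exact ⟨hγS hr, h1⟩
  -- The relation is symmetric and transitive and holds locally, hence on the whole interval.
  have hall : ∀ s ∈ Set.Ioc (0 : ℝ) 1, ∀ t ∈ Set.Ioc (0 : ℝ) 1, IsShrinkable γ s t := by
    intro s hs t ht
    refine isPreconnected_Ioc.induction₂ (IsShrinkable γ) (fun t ht => ?_)
      (fun x y z _ _ _ h h' => h.trans h')
      (fun x y hx _ h => h.symm hγS ⟨hx.1.le, hx.2⟩) hs ht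
    have htI : t ∈ Set.Icc (0 : ℝ) 1 := ⟨ht.1.le, ht.2⟩
    have hleft : ∀ᶠ r in 𝓝[≤] t, IsShrinkable γ t r := by
      obtain ⟨σ, hσ, hev⟩ := hdom t htI
      obtain ⟨s₀, hs₀, haff⟩ := hγ.exists_isAffineOn_left ht
      obtain ⟨U, hU, hUd⟩ := mem_nhdsWithin_iff_exists_mem_nhds_inter.1 hev
      obtain ⟨δ, hδ, hδU⟩ := Metric.mem_nhds_iff.1 hU
      obtain ⟨s₁, hs₁, hs₁t⟩ := exists_between (max_lt hs₀.2 (sub_lt_self t hδ))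
      obtain ⟨h1, h2⟩ := max_lt_iff.1 hs₁
      filter_upwards [Ioc_mem_nhdsLE hs₁t] with r hr
      refine isShrinkable_left hγ hinj hγS hσ (by linarith [hs₀.1]) hr.1 hr.2 ht.2
        (fun r' hr' => ?_)
        (haff.mono h1.le le_rfl)
      refine hUd ⟨hδU ?_, by linarith [hs₀.1, hr'.1], hr'.2.trans ht.2⟩
      rw [Metric.mem_ball, Real.dist_eq, abs_lt]
      constructor <;> linarith [hr'.1, hr'.2]
    rcases ht.2.eq_or_lt with rfl | ht1
    · exact nhdsWithin_mono _ (fun x hx => hx.2) hleft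
    · have hright : ∀ᶠ r in 𝓝[>] t, IsShrinkable γ t r := by
        filter_upwards [eventually_isShrinkable_right hγ hinj hγS ⟨ht.1, ht1⟩,
          Ioc_mem_nhdsGT ht1] with r hr hr'
        exact hr.symm hγS ⟨by linarith [ht.1, hr'.1], hr'.2⟩
      apply nhdsWithin_le_nhds
      rw [← nhdsLE_sup_nhdsGT]
      exact eventually_sup.2 ⟨hleft, hright⟩
  -- Near its start the path is a straight segment in a chart, to which it can be shrunk.
  obtain ⟨σ, hσ, hev⟩ := hdom 0 ⟨le_rfl, zero_le_one⟩
  obtain ⟨t₁, ht₁, haff⟩ := hγ.exists_isAffineOn_right (t := 0) ⟨le_rfl, one_pos⟩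
  obtain ⟨U, hU, hUd⟩ := mem_nhdsWithin_iff_exists_mem_nhds_inter.1 hev
  obtain ⟨δ, hδ, hδU⟩ := Metric.mem_nhds_iff.1 hU
  obtain ⟨r, hr0, hr⟩ := exists_between (lt_min ht₁.1 hδ)
  obtain ⟨hr1, hr2⟩ := lt_min_iff.1 hr
  have hrI : r ∈ Set.Ioc (0 : ℝ) 1 := ⟨hr0, hr1.le.trans ht₁.2⟩
  have hd : ∀ r' ∈ Set.Icc 0 r, γ r' ∈ chartDomain σ := fun r' hr' => by
    refine hUd ⟨hδU ?_, hr'.1, hr'.2.trans hrI.2⟩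
    rw [Metric.mem_ball, Real.dist_eq, abs_lt]
    constructor <;> linarith [hr'.1, hr'.2]
  have h0m : (0 : ℝ) ∈ Set.Icc 0 r := ⟨le_rfl, hr0.le⟩
  have hrm : r ∈ Set.Icc 0 r := ⟨hr0.le, le_rfl⟩
  obtain ⟨H, hH, h1, h2, h3⟩ := hall 1 ⟨one_pos, le_rfl⟩ r hrI
  obtain ⟨A, hA⟩ := haff.chartProj σ
  refine ⟨H, σ, SpatialGraph.chartProj σ (γ 0), SpatialGraph.chartProj σ (γ r), hH, hσ,
    chartProj_mem hσ (hd _ h0m), chartProj_mem hσ (hd _ hrm), ?_, ?_, ?_, ?_⟩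
  · intro heq
    have : γ 0 = γ r := by
      rw [← chartInv_chartProj hσ (hd _ h0m), ← chartInv_chartProj hσ (hd _ hrm), heq]
    have := hinj ⟨le_rfl, zero_le_one⟩ ⟨hrI.1.le, hrI.2⟩ this
    linarith
  · rw [h1, image_Icc_eq_chartInv hσ hd le_rfl le_rfl,
      image_Icc_of_eqOn_affine hr0.le (hA.mono (Set.Icc_subset_Icc_right hr1.le))]
  · rw [h2, chartInv_chartProj hσ (hd _ h0m)]
  · rw [h3, chartInv_chartProj hσ (hd _ hrm)]

end Straighten
end SpatialGraph
namespace SpatialGraph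
open scoped Graph
open Filter Topology

/-! ### Flat disks in a chart -/

section GeneralPosition
variable {E : Type*} [AddCommGroup E] [Module ℝ E]

/-- A functional which vanishes on `e`, but on none of finitely many vectors not parallel to it. -/
theorem exists_dual_ne_zero {S : Set E} (hS : S.Finite) (e : E) :
    ∃ l : E →ₗ[ℝ] ℝ, l e = 0 ∧ ∀ w ∈ S, w ∉ Submodule.span ℝ {e} → l w ≠ 0 := by
  classical
  set M := Submodule.span ℝ {e}
  have hfin : Finite {w // w ∈ S ∧ w ∉ M} := (hS.subset fun w hw => hw.1).to_subtype
  obtain ⟨f, hf⟩ := Module.exists_dual_forall_apply_ne_zero (K := ℝ) (M := E ⧸ M)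
    (fun w : {w // w ∈ S ∧ w ∉ M} => M.mkQ w.1)
    (fun w => by simpa [Submodule.Quotient.mk_eq_zero] using w.2.2)
  refine ⟨f.comp M.mkQ, ?_, fun w hw hwM => hf ⟨w, hw, hwM⟩⟩
  have : M.mkQ e = 0 := by
    rw [Submodule.mkQ_apply, Submodule.Quotient.mk_eq_zero]
    exact Submodule.mem_span_singleton_self e
  simp [this]

/-- The affine map `(s, t) ↦ m + s h + t d`. -/
def planeMap (m h d : E) : (ℝ × ℝ) →ᵃ[ℝ] E :=
  ((LinearMap.fst ℝ ℝ ℝ).smulRight h + (LinearMap.snd ℝ ℝ ℝ).smulRight d).toAffineMap +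
    AffineMap.const ℝ (ℝ × ℝ) m

theorem planeMap_apply (m h d : E) (p : ℝ × ℝ) :
    planeMap m h d p = p.1 • h + p.2 • d + m := by
  simp [planeMap]

theorem planeMap_injective {m h d : E} (hl : LinearIndependent ℝ ![h, d]) :
    Function.Injective (planeMap m h d) := by
  intro p q hpq
  rw [planeMap_apply, planeMap_apply, add_left_inj] at hpq
  have := LinearIndependent.pair_iff.1 hl (p.1 - q.1) (p.2 - q.2) (by
    rw [sub_smul, sub_smul]
    have : p.1 • h - q.1 • h + (p.2 • d - q.2 • d) = p.1 • h + p.2 • d - (q.1 • h + q.2 • d) := by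
      abel
    rw [this, hpq, sub_self])
  exact Prod.ext (sub_eq_zero.1 this.1) (sub_eq_zero.1 this.2)

end GeneralPosition

/-- The square with the corners `(±1, 0)` and `(0, ±1)`. -/
def diamond : Set (ℝ × ℝ) := {p | |p.1| + |p.2| ≤ 1}

theorem mem_diamond {p : ℝ × ℝ} : p ∈ diamond ↔ |p.1| + |p.2| ≤ 1 := Iff.rfl

theorem convex_diamond : Convex ℝ diamond := by
  rintro ⟨x, y⟩ hp ⟨x', y'⟩ hq a b ha hb hab
  simp only [mem_diamond] at *
  simp only [Prod.smul_mk, Prod.mk_add_mk, smul_eq_mul]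
  have h1 : |a * x + b * x'| ≤ a * |x| + b * |x'| := (abs_add_le _ _).trans (by
    rw [abs_mul, abs_mul, abs_of_nonneg ha, abs_of_nonneg hb])
  have h2 : |a * y + b * y'| ≤ a * |y| + b * |y'| := (abs_add_le _ _).trans (by
    rw [abs_mul, abs_mul, abs_of_nonneg ha, abs_of_nonneg hb])
  nlinarith

theorem isCompact_diamond : IsCompact diamond := by
  refine Metric.isCompact_of_isClosed_isBounded ?_ ?_
  · exact isClosed_le (by fun_prop) continuous_const
  · refine (Metric.isBounded_closedBall (x := (0 : ℝ × ℝ)) (r := 1)).subset fun p hp => ?_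
    rw [mem_diamond] at hp
    rw [mem_closedBall_zero_iff, Prod.norm_def, max_le_iff, Real.norm_eq_abs, Real.norm_eq_abs]
    constructor <;> linarith [abs_nonneg p.1, abs_nonneg p.2]

theorem eventually_forall_mem {X E : Type*} [TopologicalSpace X] [TopologicalSpace E] {K : Set X}
    (hK : IsCompact K) {F : ℝ → X → E} (hF : Continuous fun p : ℝ × X => F p.1 p.2) {O : Set E}
    (hO : IsOpen O) (h : ∀ x ∈ K, F 0 x ∈ O) : ∀ᶠ δ in 𝓝 (0 : ℝ), ∀ x ∈ K, F δ x ∈ O := by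
  refine hK.eventually_forall_of_forall_eventually fun x hx => ?_
  exact hF.continuousAt.preimage_mem_nhds (hO.mem_nhds (h x hx))

section ThinRhombus
variable {E : Type*} [NormedAddCommGroup E] [NormedSpace ℝ E]

theorem continuous_planeMap_smul (m h d : E) :
    Continuous fun p : ℝ × (ℝ × ℝ) => planeMap m h (p.1 • d) p.2 := by
  simp only [planeMap_apply]
  fun_prop

/-- A thin flat rhombus about the segment from `m - h` to `m + h`, in general position with respect
to a finite family of segments, meets this family in its diagonal only. -/
theorem exists_thin_rhombus [FiniteDimensional ℝ E] (hdim : 3 ≤ Module.finrank ℝ E) {m h : E}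
    (hh : h ≠ 0) {Z : Set E} (hZ : IsSegUnion Z) {O : Set E} (hO : IsOpen O)
    (hmO : segment ℝ (m - h) (m + h) ⊆ O) :
    ∃ d, LinearIndependent ℝ ![h, d] ∧ (∀ p ∈ diamond, planeMap m h d p ∈ O) ∧
      ∀ p ∈ diamond, planeMap m h d p ∈ Z → p.2 = 0 := by
  obtain ⟨S, hS, rfl⟩ := hZ
  -- The rhombus is chosen in a level set of a functional `l` that vanishes on `h` and is nonzero
  -- on the directions of the segments not parallel to `h`; such a segment meets the level set in
  -- at most one point.
  obtain ⟨l, hlh, hl⟩ := exists_dual_ne_zero (S := (fun p : E × E => p.2 - p.1) '' S)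
    (hS.image _) h
  have hfr := LinearMap.finrank_range_add_finrank_ker l
  obtain ⟨d, hd, hdh⟩ : ∃ d ∈ LinearMap.ker l, d ∉ Submodule.span ℝ {h} := by
    by_contra! hcon
    have h1 : LinearMap.ker l ≤ Submodule.span ℝ {h} := hcon
    have h2 := Submodule.finrank_mono h1
    have h3 := Submodule.finrank_le (LinearMap.range l)
    rw [finrank_span_singleton hh] at h2
    rw [Module.finrank_self] at h3
    omega
  have hld : l d = 0 := hd
  have hind : ∀ s t : ℝ, s • h + t • d = 0 → t = 0 := by
    intro s t hst
    by_contra ht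
    refine hdh (Submodule.mem_span_singleton.2 ⟨-(t⁻¹ * s), ?_⟩)
    have : t • d = -(s • h) := by rw [eq_neg_iff_add_eq_zero, add_comm]; exact hst
    rw [neg_smul, mul_smul, ← smul_neg, ← this, smul_smul, inv_mul_cancel₀ ht, one_smul]
  set line : Set E := Set.range fun s : ℝ => m + s • h with hline
  have h0 : ∀ p : ℝ × ℝ, planeMap m h ((0 : ℝ) • d) p ∈ line := fun p =>
    ⟨p.1, by simp [planeMap_apply, add_comm]⟩
  have hoff : ∀ (δ : ℝ) (p : ℝ × ℝ), 0 < δ → planeMap m h (δ • d) p ∈ line → p.2 = 0 := by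
    rintro δ p hδ ⟨s, hs⟩
    rw [planeMap_apply, add_comm _ m] at hs
    have := add_left_cancel hs
    have := hind (p.1 - s) (p.2 * δ) (by
      rw [sub_smul, mul_smul, sub_add_eq_add_sub, this]; simp)
    exact (mul_eq_zero.1 this).resolve_right hδ.ne'
  have hall : ∀ I ∈ S, ∀ᶠ δ in 𝓝[>] (0 : ℝ), ∀ p ∈ diamond,
      planeMap m h (δ • d) p ∈ segment ℝ I.1 I.2 → p.2 = 0 := by
    intro I hI
    have hlev : ∀ (δ : ℝ) (p : ℝ × ℝ), l (planeMap m h (δ • d) p) = l m := fun δ p => by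
      simp [planeMap_apply, hlh, hld]
    set J := segment ℝ I.1 I.2 ∩ {y | l y = l m} with hJ
    have hJc : IsClosed J := by
      refine (isCompact_segment _ _).isClosed.inter (isClosed_eq ?_ continuous_const)
      exact LinearMap.continuous_of_finiteDimensional _
    -- The part of the segment in the level set lies in the line through `m` or avoids it.
    have hJd : J ⊆ line ∨ Disjoint line J := by
      by_contra! hcon
      obtain ⟨h1, h2⟩ := hcon
      obtain ⟨z, ⟨s, hs⟩, hz⟩ := Set.not_disjoint_iff.1 h2
      refine h1 fun y hy => ?_
      obtain ⟨⟨r, hr, hzr⟩, hzl⟩ := (segment_eq_image' ℝ I.1 I.2 ▸ hz.1 :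
        z ∈ _ '' _), hz.2
      obtain ⟨⟨r', hr', hyr⟩, hyl⟩ := (segment_eq_image' ℝ I.1 I.2 ▸ hy.1 :
        y ∈ _ '' _), hy.2
      have hyz : y = z + (r' - r) • (I.2 - I.1) := by rw [← hyr, ← hzr]; module
      by_cases hw : I.2 - I.1 ∈ Submodule.span ℝ {h}
      · obtain ⟨c, hc⟩ := Submodule.mem_span_singleton.1 hw
        refine ⟨s + (r' - r) * c, ?_⟩
        rw [hyz, ← hs, ← hc]
        module
      · have hlw := hl _ ⟨I, hI, rfl⟩ hw
        have : (r' - r) * l (I.2 - I.1) = 0 := by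
          have h3 := congrArg l hyz
          rw [map_add, map_smul, smul_eq_mul] at h3
          have h4 : l y = l m := hyl
          have h5 : l z = l m := hzl
          linarith
        have : r' - r = 0 := (mul_eq_zero.1 this).resolve_right hlw
        rw [hyz, this, zero_smul, add_zero, ← hs]
        exact ⟨s, rfl⟩
    rcases hJd with hJd | hJd
    · filter_upwards [self_mem_nhdsWithin] with δ hδ p _ hp
      exact hoff δ p hδ (hJd ⟨hp, hlev δ p⟩)
    · have := eventually_forall_mem isCompact_diamond (F := fun δ p => planeMap m h (δ • d) p)
        (continuous_planeMap_smul m h d) (O := Jᶜ) hJc.isOpen_compl fun p _ hp =>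
          Set.disjoint_left.1 hJd (h0 p) hp
      filter_upwards [nhdsWithin_le_nhds this] with δ hδ p hpd hp
      exact absurd ⟨hp, hlev δ p⟩ (hδ p hpd)
  have hOev := eventually_forall_mem isCompact_diamond
    (F := fun δ p => planeMap m h (δ • d) p) (continuous_planeMap_smul m h d) hO
    (fun p hp => hmO (by
      rw [mem_diamond] at hp
      have : |p.1| ≤ 1 := by linarith [abs_nonneg p.2]
      obtain ⟨h1, h2⟩ := abs_le.1 this
      refine ⟨(1 - p.1) / 2, (1 + p.1) / 2, by linarith, by linarith, by ring, ?_⟩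
      rw [planeMap_apply]
      module))
  obtain ⟨δ, ⟨h1, h2⟩, hδ⟩ := (((hS.eventually_all.2 hall).and
    (nhdsWithin_le_nhds hOev)).and self_mem_nhdsWithin).exists
  replace hδ : 0 < δ := hδ
  refine ⟨δ • d, LinearIndependent.pair_iff.2 fun s t hst => ?_, h2, fun p hp hpZ => ?_⟩
  · rw [smul_smul] at hst
    have ht : t = 0 := (mul_eq_zero.1 (hind _ _ hst)).resolve_right hδ.ne'
    subst ht
    simp only [zero_mul, zero_smul, add_zero, smul_eq_zero, hh, or_false] at hst
    exact ⟨hst, rfl⟩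
  · obtain ⟨I, hI, hpI⟩ := Set.mem_iUnion₂.1 hpZ
    exact h1 I hI p hp hpI

/-- In general position, a short segment from `u` meets a finite family of segments in `u` only. -/
theorem exists_free_segment [FiniteDimensional ℝ E] (hdim : 3 ≤ Module.finrank ℝ E) (u : E)
    {Z : Set E} (hZ : IsSegUnion Z) {O : Set E} (hO : IsOpen O) (hu : u ∈ O) :
    ∃ h : E, h ≠ 0 ∧ segment ℝ u (u + h) ⊆ O ∧ ∀ y ∈ segment ℝ u (u + h), y ∈ Z → y = u := by
  obtain ⟨S, hS, rfl⟩ := hZ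
  obtain ⟨l, -, hl⟩ := exists_dual_ne_zero (S := (fun p : E × E => p.2 - p.1) '' S)
    (hS.image _) 0
  have hfr := LinearMap.finrank_range_add_finrank_ker l
  obtain ⟨d, hd, hd0⟩ : ∃ d ∈ LinearMap.ker l, d ≠ 0 := by
    by_contra! hcon
    have h1 : LinearMap.ker l = ⊥ := (Submodule.eq_bot_iff _).2 hcon
    have h3 := Submodule.finrank_le (LinearMap.range l)
    rw [Module.finrank_self] at h3
    rw [h1, finrank_bot] at hfr
    omega
  have hld : l d = 0 := hd
  have hcont : Continuous fun p : ℝ × ℝ => u + (p.1 * p.2) • d := by fun_prop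
  have hall : ∀ I ∈ S, ∀ᶠ δ in 𝓝[>] (0 : ℝ), ∀ r ∈ Set.Icc (0 : ℝ) 1,
      u + (δ * r) • d ∈ segment ℝ I.1 I.2 → u + (δ * r) • d = u := by
    intro I hI
    by_cases huI : u ∈ segment ℝ I.1 I.2
    · refine Eventually.of_forall fun δ r _ hr => ?_
      obtain ⟨a, ha, hua⟩ := (segment_eq_image' ℝ I.1 I.2 ▸ huI : u ∈ _ '' _)
      obtain ⟨b, hb, hub⟩ := (segment_eq_image' ℝ I.1 I.2 ▸ hr : _ ∈ _ '' _)
      have hw : (δ * r) • d = (b - a) • (I.2 - I.1) := by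
        have : u + (δ * r) • d = u + (b - a) • (I.2 - I.1) := by
          rw [← hub]; nth_rw 1 [← hua]; module
        exact add_left_cancel this
      by_cases hI0 : I.2 - I.1 = 0
      · rw [hw, hI0, smul_zero, add_zero]
      · have hlw := hl _ ⟨I, hI, rfl⟩ (by simpa using hI0)
        have h1 := congrArg l hw
        rw [map_smul, map_smul, hld, smul_zero, smul_eq_mul] at h1
        have : b - a = 0 := (mul_eq_zero.1 h1.symm).resolve_right hlw
        rw [hw, this, zero_smul, add_zero]
    · have := eventually_forall_mem (isCompact_Icc (a := (0 : ℝ)) (b := 1))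
        (F := fun δ r => u + (δ * r) • d) hcont
        (O := (segment ℝ I.1 I.2)ᶜ) (isCompact_segment _ _).isClosed.isOpen_compl
        fun r _ => by simpa using huI
      filter_upwards [nhdsWithin_le_nhds this] with δ hδ r hr hrI
      exact absurd hrI (hδ r hr)
  have hOev := eventually_forall_mem (isCompact_Icc (a := (0 : ℝ)) (b := 1))
        (F := fun δ r => u + (δ * r) • d) hcont hO fun r _ => by simpa using hu
  obtain ⟨δ, ⟨h1, h2⟩, hδ⟩ := (((hS.eventually_all.2 hall).and
    (nhdsWithin_le_nhds hOev)).and self_mem_nhdsWithin).exists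
  replace hδ : 0 < δ := hδ
  have hseg : ∀ y ∈ segment ℝ u (u + δ • d), ∃ r ∈ Set.Icc (0 : ℝ) 1, y = u + (δ * r) • d := by
    intro y hy
    rw [segment_eq_image'] at hy
    obtain ⟨r, hr, rfl⟩ := hy
    exact ⟨r, hr, by simp only [add_sub_cancel_left]; rw [smul_smul, mul_comm]⟩
  refine ⟨δ • d, smul_ne_zero hδ.ne' hd0, fun y hy => ?_, fun y hy hyZ => ?_⟩
  · obtain ⟨r, hr, rfl⟩ := hseg y hy
    exact h2 r hr
  · obtain ⟨r, hr, rfl⟩ := hseg y hy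
    obtain ⟨I, hI, hpI⟩ := Set.mem_iUnion₂.1 hyZ
    exact h1 I hI r hr hpI

end ThinRhombus

/-- A flat disk in the sphere: a parametrization of a rhombus in the range of a chart by the square
`diamond`. -/
def IsFlatDisk (κ : ℝ × ℝ → (Fin 4 → ℝ)) : Prop :=
  ∃ (σ : Fin 4 → ℝ) (m h d : Fin 3 → ℝ), IsCorner σ ∧ LinearIndependent ℝ ![h, d] ∧
    (∀ p ∈ diamond, planeMap m h d p ∈ chartRange) ∧ κ = fun p => chartInv σ (planeMap m h d p)

theorem IsFlatDisk.injective {κ : ℝ × ℝ → (Fin 4 → ℝ)} (hκ : IsFlatDisk κ) :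
    Function.Injective κ := by
  obtain ⟨σ, m, h, d, hσ, hl, -, rfl⟩ := hκ
  exact (chartInv_injective hσ).comp (planeMap_injective hl)

theorem IsFlatDisk.mem_threeSphere {κ : ℝ × ℝ → (Fin 4 → ℝ)} (hκ : IsFlatDisk κ) {p : ℝ × ℝ}
    (hp : p ∈ diamond) : κ p ∈ threeSphere := by
  obtain ⟨σ, m, h, d, hσ, hl, hr, rfl⟩ := hκ
  exact (chartInv_mem hσ (hr p hp)).1

theorem IsFlatDisk.isPLOn {κ : ℝ × ℝ → (Fin 4 → ℝ)} (hκ : IsFlatDisk κ) {P : Set (ℝ × ℝ)}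
    (hP : IsPolyhedron P) : IsPLOn κ P := by
  obtain ⟨σ, m, h, d, hσ, hl, -, rfl⟩ := hκ
  exact (isPLOn_chartInv σ (hP.image _)).comp (isPLOn_affine _ hP) (Set.mapsTo_image _ _)

theorem IsFlatDisk.flip {κ : ℝ × ℝ → (Fin 4 → ℝ)} (hκ : IsFlatDisk κ) :
    IsFlatDisk fun p => κ (-p.1, p.2) := by
  obtain ⟨σ, m, h, d, hσ, hl, hr, rfl⟩ := hκ
  have hmap : ∀ p : ℝ × ℝ, planeMap m h d (-p.1, p.2) = planeMap m (-h) d p := fun p => by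
    simp [planeMap_apply]
  refine ⟨σ, m, -h, d, hσ, ?_, fun p hp => ?_, funext fun p => by simp only [hmap]⟩
  · rw [LinearIndependent.pair_iff] at hl ⊢
    intro s t hst
    have := hl (-s) t (by rw [neg_smul, ← smul_neg]; exact hst)
    exact ⟨neg_eq_zero.1 this.1, this.2⟩
  · rw [← hmap]
    exact hr _ (by simpa [mem_diamond] using hp)

theorem IsFlatDisk.exists_triangle_move {κ : ℝ × ℝ → (Fin 4 → ℝ)} (hκ : IsFlatDisk κ)
    {a b c : ℝ × ℝ} (ha : a ∈ diamond) (hb : b ∈ diamond) (hc : c ∈ diamond)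
    (hac : a ∉ segment ℝ b c) (hca : c ∉ segment ℝ a b) {Z : Set (Fin 4 → ℝ)}
    (hZ : IsSegUnion Z) (hZS : Z ⊆ threeSphere)
    (hZT : ∀ p ∈ convexHull ℝ {a, b, c}, κ p ∈ Z → p = a ∨ p = c) :
    ∃ H, IsPLHomeo H ∧ (∀ z ∈ Z, H z = z) ∧ H (κ a) = κ a ∧ H (κ c) = κ c ∧
      H '' (κ '' (segment ℝ a b ∪ segment ℝ b c)) = κ '' segment ℝ a c := by
  obtain ⟨σ, m, h, d, hσ, hl, hr, rfl⟩ := hκ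
  have hinj := planeMap_injective (m := m) hl
  have hseg : ∀ p q : ℝ × ℝ, segment ℝ (planeMap m h d p) (planeMap m h d q) =
    planeMap m h d '' segment ℝ p q := fun p q => (image_segment _ _ _ _).symm
  obtain ⟨H, h1, h2, h3, h4, h5⟩ := SpatialGraph.exists_triangle_move hσ (hr a ha) (hr b hb)
    (hr c hc) (by rw [hseg]; rintro ⟨p, hp, hpa⟩; exact hac (hinj hpa ▸ hp))
    (by rw [hseg]; rintro ⟨p, hp, hpa⟩; exact hca (hinj hpa ▸ hp)) hZ hZS (by
      intro y hy hyZ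
      have : ({planeMap m h d a, planeMap m h d b, planeMap m h d c} : Set (Fin 3 → ℝ)) =
        planeMap m h d '' {a, b, c} := by simp [Set.image_insert_eq]
      rw [this, ← AffineMap.image_convexHull] at hy
      obtain ⟨p, hp, rfl⟩ := hy
      rcases hZT p hp hyZ with rfl | rfl <;> simp)
  refine ⟨H, h1, h2, h3, h4, ?_⟩
  rw [hseg, hseg, hseg, ← Set.image_union, Set.image_image, Set.image_image] at h5
  rw [Set.image_image, h5]
  rw [Set.image_image]

/-- Along a segment in a chart, there is a flat disk which meets a given family of segments in the
sphere in its diagonal only. -/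
theorem exists_isFlatDisk_segment {σ : Fin 4 → ℝ} (hσ : IsCorner σ) {u v : Fin 3 → ℝ}
    (hu : u ∈ chartRange) (hv : v ∈ chartRange) (huv : u ≠ v) {X : Set (Fin 4 → ℝ)}
    (hX : IsSegUnion X) (hXS : X ⊆ threeSphere) :
    ∃ κ, IsFlatDisk κ ∧ (∀ r, κ (r, 0) = chartInv σ (AffineMap.lineMap u v ((1 + r) / 2))) ∧
      ∀ p ∈ diamond, κ p ∈ X → p.2 = 0 := by
  have hsub : segment ℝ u v ⊆ chartRange := convex_chartRange.segment_subset hu hv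
  obtain ⟨Z', O', hZ', hO', hTO', hO'r, hZZ', -⟩ := exists_isSegUnion_chart hσ
    (isCompact_segment u v) hsub hX hXS
  set m : Fin 3 → ℝ := (1 / 2 : ℝ) • (u + v) with hm
  set h : Fin 3 → ℝ := (1 / 2 : ℝ) • (v - u) with hh
  have hu' : m - h = u := by rw [hm, hh]; module
  have hv' : m + h = v := by rw [hm, hh]; module
  obtain ⟨d, hl, hdO, hdZ⟩ := exists_thin_rhombus (E := Fin 3 → ℝ) (by simp) (m := m) (h := h)
    (by rw [hh]; exact smul_ne_zero (by norm_num) (sub_ne_zero.2 huv.symm)) hZ' hO'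
    (by rwa [hu', hv'])
  refine ⟨fun p => chartInv σ (planeMap m h d p), ⟨σ, m, h, d, hσ, hl, fun p hp => hO'r (hdO p hp),
    rfl⟩, fun r => ?_, fun p hp hpX => hdZ p hp (hZZ' _ (hdO p hp) hpX)⟩
  change chartInv σ (planeMap m h d (r, 0)) = _
  congr 1
  rw [planeMap_apply, AffineMap.lineMap_apply_module', hm, hh]
  module

/-- At a point of the sphere, there is a flat disk which meets a given family of segments in this
point, a corner of the disk, at most. -/
theorem exists_isFlatDisk_point {z : Fin 4 → ℝ} (hz : z ∈ threeSphere) {X : Set (Fin 4 → ℝ)}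
    (hX : IsSegUnion X) (hXS : X ⊆ threeSphere) :
    ∃ κ, IsFlatDisk κ ∧ κ (-1, 0) = z ∧ ∀ p ∈ diamond, κ p ∈ X → p = (-1, 0) := by
  obtain ⟨σ, hσ, hzd⟩ := exists_mem_chartDomain hz
  set u := chartProj σ z with hu
  have hur : u ∈ chartRange := chartProj_mem hσ hzd
  have huz : chartInv σ u = z := chartInv_chartProj hσ hzd
  obtain ⟨Z', O', hZ', hO', hTO', hO'r, hZZ', -⟩ := exists_isSegUnion_chart hσ
    (isCompact_singleton (x := u)) (Set.singleton_subset_iff.2 hur) hX hXS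
  obtain ⟨h, hh, hhO, hhZ⟩ := exists_free_segment (E := Fin 3 → ℝ) (by simp) u hZ' hO'
    (hTO' rfl)
  have hvO : u + h ∈ O' := hhO (right_mem_segment ℝ _ _)
  obtain ⟨κ, hκ, hκl, hκX⟩ := exists_isFlatDisk_segment hσ hur (hO'r hvO) (by simpa using hh)
    hX hXS
  have hk0 : κ (-1, 0) = z := by rw [hκl, ← huz]; norm_num
  refine ⟨κ, hκ, hk0, fun p hp hpX => hκ.injective ?_⟩
  have hp2 := hκX p hp hpX
  have hp1 : |p.1| ≤ 1 := by rw [mem_diamond] at hp; linarith [abs_nonneg p.2]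
  obtain ⟨h1, h2⟩ := abs_le.1 hp1
  have hpe : p = (p.1, 0) := Prod.ext rfl hp2
  rw [hpe, hκl] at hpX
  have hmem : AffineMap.lineMap u (u + h) ((1 + p.1) / 2) ∈ segment ℝ u (u + h) := by
    rw [segment_eq_image_lineMap]
    exact ⟨_, ⟨by linarith, by linarith⟩, rfl⟩
  rw [hk0, ← huz, hpe, hκl]
  congr 1
  exact hhZ _ hmem (hZZ' _ (hhO hmem) hpX)

end SpatialGraph
namespace SpatialGraph
open scoped Graph
open Filter Topology

/-! ### The boundary of a flat disk -/

/-- The two sides of `diamond` above the axis. -/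
def upperArc : Set (ℝ × ℝ) := {p | |p.1| ≤ 1 ∧ p.2 = 1 - |p.1|}

/-- The two sides of `diamond` below the axis. -/
def lowerArc : Set (ℝ × ℝ) := {p | |p.1| ≤ 1 ∧ p.2 = |p.1| - 1}

/-- The boundary of `diamond`. -/
def diamondBoundary : Set (ℝ × ℝ) := {p | |p.1| + |p.2| = 1}

/-- The segment from `(a, 0)` to `(b, 0)` on the axis, for `a ≤ b`. -/
def axis (a b : ℝ) : Set (ℝ × ℝ) := {p | p.1 ∈ Set.Icc a b ∧ p.2 = 0}

theorem segment_eq_axis {a b : ℝ} (hab : a ≤ b) : segment ℝ ((a, 0) : ℝ × ℝ) (b, 0) = axis a b := by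
  have := image_segment ℝ (LinearMap.inl ℝ ℝ ℝ).toAffineMap a b
  simp only [LinearMap.coe_toAffineMap, LinearMap.inl_apply] at this
  rw [← this, segment_eq_Icc hab]
  ext ⟨x, y⟩
  simp only [axis, Set.mem_image, Set.mem_ofPred_eq]
  constructor
  · rintro ⟨z, hz, h⟩; cases h; exact ⟨hz, rfl⟩
  · rintro ⟨hz, rfl⟩; exact ⟨x, hz, rfl⟩

theorem mem_segment_oblique {s t : ℝ} {p : ℝ × ℝ} :
    p ∈ segment ℝ (s, 0) (0, t) ↔ ∃ r ∈ Set.Icc (0 : ℝ) 1, p = ((1 - r) * s, r * t) := by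
  rw [segment_eq_image]
  simp [eq_comm]

theorem upperArc_eq : upperArc = segment ℝ (-1, 0) (0, 1) ∪ segment ℝ (0, 1) (1, 0) := by
  rw [segment_symm ℝ (0, 1)]
  ext ⟨x, y⟩
  rw [Set.mem_union, mem_segment_oblique, mem_segment_oblique]
  simp only [upperArc, Set.mem_ofPred_eq, Prod.mk.injEq]
  constructor
  · rintro ⟨h, rfl⟩
    have := abs_nonneg x
    rcases abs_cases x with ⟨h1, h2⟩ | ⟨h1, h2⟩
    · right; exact ⟨1 - x, ⟨by linarith, by linarith⟩, by ring, by rw [h1]; ring⟩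
    · left; exact ⟨1 + x, ⟨by linarith, by linarith⟩, by ring, by rw [h1]; ring⟩
  · rintro (⟨r, hr, rfl, rfl⟩ | ⟨r, hr, rfl, rfl⟩)
    · have : |(1 - r) * -1| = 1 - r := by
        rw [abs_of_nonpos] <;> linarith [hr.2]
      rw [this]; constructor <;> linarith [hr.1]
    · have : |(1 - r) * 1| = 1 - r := by
        rw [abs_of_nonneg] <;> linarith [hr.2]
      rw [this]; constructor <;> linarith [hr.1]

theorem lowerArc_eq : lowerArc = segment ℝ (-1, 0) (0, -1) ∪ segment ℝ (0, -1) (1, 0) := by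
  rw [segment_symm ℝ (0, -1)]
  ext ⟨x, y⟩
  rw [Set.mem_union, mem_segment_oblique, mem_segment_oblique]
  simp only [lowerArc, Set.mem_ofPred_eq, Prod.mk.injEq]
  constructor
  · rintro ⟨h, rfl⟩
    have := abs_nonneg x
    rcases abs_cases x with ⟨h1, h2⟩ | ⟨h1, h2⟩
    · right; exact ⟨1 - x, ⟨by linarith, by linarith⟩, by ring, by rw [h1]; ring⟩
    · left; exact ⟨1 + x, ⟨by linarith, by linarith⟩, by ring, by rw [h1]; ring⟩
  · rintro (⟨r, hr, rfl, rfl⟩ | ⟨r, hr, rfl, rfl⟩)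
    · have : |(1 - r) * -1| = 1 - r := by
        rw [abs_of_nonpos] <;> linarith [hr.2]
      rw [this]; constructor <;> linarith [hr.1]
    · have : |(1 - r) * 1| = 1 - r := by
        rw [abs_of_nonneg] <;> linarith [hr.2]
      rw [this]; constructor <;> linarith [hr.1]

theorem upperArc_union_lowerArc : upperArc ∪ lowerArc = diamondBoundary := by
  ext ⟨x, y⟩
  simp only [upperArc, lowerArc, diamondBoundary, Set.mem_union, Set.mem_ofPred_eq]
  constructor
  · rintro (⟨h, rfl⟩ | ⟨h, rfl⟩)
    · rw [abs_of_nonneg (a := 1 - |x|) (by linarith)]; ring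
    · rw [abs_of_nonpos (a := |x| - 1) (by linarith)]; ring
  · intro h
    have h1 := abs_nonneg y
    rcases abs_cases y with ⟨h2, h3⟩ | ⟨h2, h3⟩
    · left; constructor <;> linarith
    · right; constructor <;> linarith

theorem upperArc_subset : upperArc ⊆ diamond := by
  rintro ⟨x, y⟩ ⟨h, h'⟩
  simp only at h h'
  rw [mem_diamond, h', abs_of_nonneg (a := 1 - |x|) (by linarith)]
  simp

theorem lowerArc_subset : lowerArc ⊆ diamond := fun p hp => by
  have : p ∈ diamondBoundary := upperArc_union_lowerArc ▸ Or.inr hp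
  exact le_of_eq this

/-- The linear bijection from the square with sides parallel to the coordinate axes to `diamond`. -/
noncomputable def squareToDiamond : (Fin 2 → ℝ) →ₗ[ℝ] ℝ × ℝ :=
  let p (i : Fin 2) : (Fin 2 → ℝ) →ₗ[ℝ] ℝ := LinearMap.proj i
  LinearMap.prod ((1 / 2 : ℝ) • (p 0 + p 1)) ((1 / 2 : ℝ) • (p 1 - p 0))

theorem squareToDiamond_apply (x : Fin 2 → ℝ) :
    squareToDiamond x = ((x 0 + x 1) / 2, (x 1 - x 0) / 2) := by
  simp only [squareToDiamond, LinearMap.prod_apply, Function.prod, LinearMap.smul_apply,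
    LinearMap.add_apply, LinearMap.proj_apply, LinearMap.sub_apply, smul_eq_mul, Prod.mk.injEq]
  constructor <;> ring

theorem abs_add_abs_halves (a b : ℝ) : |(a + b) / 2| + |(b - a) / 2| = max |a| |b| := by
  rcases abs_cases ((a + b) / 2) with ⟨h1, h1'⟩ | ⟨h1, h1'⟩ <;>
  rcases abs_cases ((b - a) / 2) with ⟨h2, h2'⟩ | ⟨h2, h2'⟩ <;>
  rcases abs_cases a with ⟨h3, h3'⟩ | ⟨h3, h3'⟩ <;>
  rcases abs_cases b with ⟨h4, h4'⟩ | ⟨h4, h4'⟩ <;>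
  rcases max_cases |a| |b| with ⟨h5, h5'⟩ | ⟨h5, h5'⟩ <;>
  rw [h5] <;> linarith

theorem abs_squareToDiamond (x : Fin 2 → ℝ) :
    |(squareToDiamond x).1| + |(squareToDiamond x).2| = max |x 0| |x 1| := by
  rw [squareToDiamond_apply]; exact abs_add_abs_halves _ _

theorem squareToDiamond_injective : Function.Injective squareToDiamond := by
  intro x y h
  rw [squareToDiamond_apply, squareToDiamond_apply, Prod.mk.injEq] at h
  funext i
  fin_cases i
  · show x 0 = y 0
    linarith [h.1, h.2]
  · show x 1 = y 1
    linarith [h.1, h.2]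

theorem image_cubeBoundary_two : squareToDiamond '' cubeBoundary 2 = diamondBoundary := by
  have key : ∀ x : Fin 2 → ℝ, x ∈ cubeBoundary 2 ↔ squareToDiamond x ∈ diamondBoundary := by
    intro x
    rw [mem_cubeBoundary, diamondBoundary, Set.mem_ofPred_eq, abs_squareToDiamond]
    simp only [Fin.forall_fin_two, Fin.exists_fin_two]
    constructor
    · rintro ⟨⟨h1, h2⟩, h | h⟩
      · rw [max_eq_left (h ▸ h2), h]
      · rw [max_eq_right (h ▸ h1), h]
    · intro h
      refine ⟨⟨h ▸ le_max_left _ _, h ▸ le_max_right _ _⟩, ?_⟩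
      rcases max_choice |x 0| |x 1| with h' | h'
      · left; rw [← h', h]
      · right; rw [← h', h]
  ext p
  constructor
  · rintro ⟨x, hx, rfl⟩; exact (key x).1 hx
  · intro hp
    have : squareToDiamond ![p.1 - p.2, p.1 + p.2] = p := by
      rw [squareToDiamond_apply]
      refine Prod.ext ?_ ?_ <;> simp
    exact ⟨_, (key _).2 (by rwa [this]), this⟩

theorem squareToDiamond_mem {x : Fin 2 → ℝ} (hx : x ∈ cube 2) : squareToDiamond x ∈ diamond := by
  rw [mem_diamond, abs_squareToDiamond]
  rw [mem_cube] at hx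
  exact max_le (hx 0) (hx 1)

theorem IsFlatDisk.isTrivialKnot_boundary {κ : ℝ × ℝ → (Fin 4 → ℝ)} (hκ : IsFlatDisk κ) :
    IsTrivialKnot (κ '' diamondBoundary) := by
  refine ⟨fun x => κ (squareToDiamond x), ?_, (hκ.injective.comp squareToDiamond_injective).injOn,
    fun x hx => hκ.mem_threeSphere (squareToDiamond_mem hx), ?_⟩
  · exact (hκ.isPLOn ((isPolyhedron_cube 2).image_linear _)).comp
      (isPLOn_linear squareToDiamond (isPolyhedron_cube 2)) (Set.mapsTo_image _ _)
  · rw [← image_cubeBoundary_two, Set.image_image]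

section Box
variable {E : Type*} [NormedAddCommGroup E] [NormedSpace ℝ E]

/-- A parametrization by the cube of a flat box about a flat rhombus. -/
noncomputable def boxMap (m h d n : E) (ε : ℝ) (x : Fin 3 → ℝ) : E :=
  ((1 + ε) * ((x 0 + x 1) / 2)) • h + ((1 + ε) * ((x 1 - x 0) / 2)) • d + (ε * x 2) • n + m

theorem boxMap_eq (m h d n : E) (ε : ℝ) : ∃ L : (Fin 3 → ℝ) →ₗ[ℝ] E,
    boxMap m h d n ε = fun x => L x + m := by
  set p : Fin 3 → (Fin 3 → ℝ) →ₗ[ℝ] ℝ := fun i => LinearMap.proj i with hp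
  refine ⟨(((1 + ε) / 2) • (p 0 + p 1)).smulRight h + (((1 + ε) / 2) • (p 1 - p 0)).smulRight d +
    (ε • p 2).smulRight n, ?_⟩
  funext x
  simp only [boxMap, LinearMap.add_apply, LinearMap.smulRight_apply, LinearMap.smul_apply, hp,
    LinearMap.proj_apply, LinearMap.sub_apply, smul_eq_mul]
  congr 4 <;> ring

theorem boxMap_injective {m h d n : E} (hl : LinearIndependent ℝ ![h, d, n]) {ε : ℝ} (hε : 0 < ε) :
    Function.Injective (boxMap m h d n ε) := by
  intro x y hxy
  rw [Fintype.linearIndependent_iff] at hl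
  have := hl ![(1 + ε) * ((x 0 + x 1) / 2) - (1 + ε) * ((y 0 + y 1) / 2),
    (1 + ε) * ((x 1 - x 0) / 2) - (1 + ε) * ((y 1 - y 0) / 2), ε * x 2 - ε * y 2] (by
      simp only [Fin.sum_univ_three, Matrix.cons_val_zero, Matrix.cons_val_one, Matrix.cons_val]
      rw [boxMap, boxMap, add_left_inj] at hxy
      rw [← sub_eq_zero] at hxy
      rw [← hxy]
      module)
  have h0 := this 0
  have h1 := this 1
  have h2 := this 2
  simp only [Matrix.cons_val_zero, Matrix.cons_val_one, Matrix.cons_val] at h0 h1 h2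
  rw [← mul_sub] at h0 h1 h2
  have h0' := (mul_eq_zero.1 h0).resolve_left (by positivity)
  have h1' := (mul_eq_zero.1 h1).resolve_left (by positivity)
  have h2' := (mul_eq_zero.1 h2).resolve_left hε.ne'
  funext i
  fin_cases i
  · show x 0 = y 0
    linarith
  · show x 1 = y 1
    linarith
  · show x 2 = y 2
    linarith

end Box

/-- The boundary of a flat disk is separated from everything off the disk, by the boundary of a
flat box about the disk. -/
theorem IsFlatDisk.isSplittable_boundary {κ : ℝ × ℝ → (Fin 4 → ℝ)} (hκ : IsFlatDisk κ)
    {Z : Set (Fin 4 → ℝ)} (hZ : IsClosed Z) (hZS : Z ⊆ threeSphere)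
    (hZκ : ∀ p ∈ diamond, κ p ∉ Z) :
    IsSplittable (κ '' diamondBoundary) Z := by
  obtain ⟨σ, m, h, d, hσ, hl, hr, rfl⟩ := hκ
  obtain ⟨n, hn⟩ : ∃ n, LinearIndependent ℝ ![h, d, n] := by
    obtain ⟨n, hn⟩ := exists_linearIndependent_snoc_of_lt_finrank hl (by simp)
    refine ⟨n, ?_⟩
    have : ![h, d, n] = Fin.snoc ![h, d] n := by
      funext i
      fin_cases i <;> rfl
    rw [this]
    exact hn
  have hcont : Continuous fun p : ℝ × (Fin 3 → ℝ) => boxMap m h d n p.1 p.2 := by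
    unfold boxMap; fun_prop
  have hO : IsOpen (chartRange ∩ chartInv σ ⁻¹' Zᶜ) :=
    isOpen_chartRange.inter (hZ.isOpen_compl.preimage (continuous_chartInv σ))
  have hev := eventually_forall_mem (isPolyhedron_cube 3).isCompact
    (F := fun ε x => boxMap m h d n ε x) hcont hO fun x hx => by
      have : boxMap m h d n 0 x = planeMap m h d (squareToDiamond ![x 0, x 1]) := by
        rw [squareToDiamond_apply, planeMap_apply]
        simp [boxMap]
      have hd : squareToDiamond ![x 0, x 1] ∈ diamond := by
        refine squareToDiamond_mem (mem_cube.2 ?_)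
        rw [mem_cube] at hx
        simp [Fin.forall_fin_two, hx]
      simp only [this]
      exact ⟨hr _ hd, hZκ _ hd⟩
  have hev' : ∀ᶠ ε in 𝓝[>] (0 : ℝ), _ := nhdsWithin_le_nhds hev
  obtain ⟨ε, hε, hε0⟩ := (hev'.and self_mem_nhdsWithin).exists
  replace hε0 : 0 < ε := hε0
  set g : (Fin 3 → ℝ) → (Fin 4 → ℝ) := fun x => chartInv σ (boxMap m h d n ε x) with hg
  have hinj : Function.Injective g := (chartInv_injective hσ).comp (boxMap_injective hn hε0)
  obtain ⟨L, hL⟩ := boxMap_eq m h d n ε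
  have hLinj : Function.Injective L := fun x y hxy => boxMap_injective (m := m) hn hε0 (by
    rw [hL]; simp only [hxy])
  have hLsurj : Function.Surjective L := LinearMap.injective_iff_surjective.1 hLinj
  have hbs : cubeBoundary 3 ⊆ cube 3 := Metric.sphere_subset_closedBall
  have hgS : ∀ x ∈ cube 3, g x ∈ threeSphere := fun x hx => (chartInv_mem hσ (hε x hx).1).1
  have hgcont : Continuous g := by
    refine (continuous_chartInv σ).comp ?_
    exact hcont.comp (Continuous.prodMk_right ε)
  -- The open box, as an open set in the ambient space of the sphere.
  set U : Set (Fin 4 → ℝ) := (⋂ j, {x | -1 < σ j * x j}) ∩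
    chartProj σ ⁻¹' (boxMap m h d n ε '' Metric.ball 0 1) with hU
  have hUo : IsOpen U := by
    refine IsOpen.inter ?_ (IsOpen.preimage (continuous_chartProj σ) ?_)
    · exact isOpen_iInter_of_finite fun j => isOpen_lt continuous_const (by fun_prop)
    · have : boxMap m h d n ε '' Metric.ball 0 1 =
          (Homeomorph.addRight m) '' (L '' Metric.ball 0 1) := by
        rw [hL, Set.image_image]; rfl
      rw [this]
      exact (Homeomorph.addRight m).isOpenMap _
        (LinearMap.isOpenMap_of_finiteDimensional L hLsurj _ Metric.isOpen_ball)
  have hUg : ∀ x ∈ threeSphere ∩ U, ∃ y ∈ Metric.ball (0 : Fin 3 → ℝ) 1, x = g y := by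
    rintro x ⟨hx, hx1, y, hy, hyx⟩
    exact ⟨y, hy, by rw [hg]; simp only [hyx]; exact (chartInv_chartProj hσ
      ⟨hx, Set.mem_iInter.1 hx1⟩).symm⟩
  have hgU : ∀ y ∈ Metric.ball (0 : Fin 3 → ℝ) 1, g y ∈ U := fun y hy =>
    ⟨Set.mem_iInter.2 (chartInv_mem hσ (hε y (Metric.ball_subset_closedBall hy)).1).2,
      by
      rw [Set.mem_preimage]; rw [hg]; simp only; rw [chartProj_chartInv hσ]; exact ⟨y, hy, rfl⟩⟩
  -- `U` and `V` are the two sides of the boundary of the box `g` parametrizes.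
  set V : Set (Fin 4 → ℝ) := (g '' cube 3)ᶜ with hV
  have hVo : IsOpen V := ((isPolyhedron_cube 3).isCompact.image hgcont).isClosed.isOpen_compl
  -- The factor `1 + ε` puts the boundary of the disk in the interior of the box.
  have hKU : ∀ p ∈ diamondBoundary, ∃ y ∈ Metric.ball (0 : Fin 3 → ℝ) 1,
      chartInv σ (planeMap m h d p) = g y := by
    intro p hp
    have hpos : (0 : ℝ) < 1 + ε := by linarith
    have hp' : |p.1| + |p.2| = 1 := hp
    refine ⟨![(1 + ε)⁻¹ * (p.1 - p.2), (1 + ε)⁻¹ * (p.1 + p.2), 0], ?_, ?_⟩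
    · have hlt : (1 + ε)⁻¹ < 1 := inv_lt_one_of_one_lt₀ (by linarith)
      have hinv : 0 < (1 + ε)⁻¹ := by positivity
      rw [mem_ball_zero_iff, pi_norm_lt_iff one_pos]
      have h1 : |p.1 - p.2| ≤ 1 := (abs_sub _ _).trans hp'.le
      have h2 : |p.1 + p.2| ≤ 1 := (abs_add_le _ _).trans hp'.le
      intro i
      fin_cases i
      · show ‖(1 + ε)⁻¹ * (p.1 - p.2)‖ < 1
        rw [Real.norm_eq_abs, abs_mul, abs_of_pos hinv]; nlinarith
      · show ‖(1 + ε)⁻¹ * (p.1 + p.2)‖ < 1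
        rw [Real.norm_eq_abs, abs_mul, abs_of_pos hinv]; nlinarith
      · simp
    · rw [hg]
      simp only [boxMap, planeMap_apply, Matrix.cons_val_zero, Matrix.cons_val_one, Matrix.cons_val]
      congr 1
      have e1 : (1 + ε) * (((1 + ε)⁻¹ * (p.1 - p.2) + (1 + ε)⁻¹ * (p.1 + p.2)) / 2) = p.1 := by
        field_simp; ring
      have e2 : (1 + ε) * (((1 + ε)⁻¹ * (p.1 + p.2) - (1 + ε)⁻¹ * (p.1 - p.2)) / 2) = p.2 := by
        field_simp; ring
      rw [e1, e2]
      simp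
  refine ⟨g '' cubeBoundary 3, ⟨g, ?_, hinj.injOn, fun x hx => hgS x (hbs hx), rfl⟩, ?_, ?_⟩
  · have haff : IsPLOn (boxMap m h d n ε) (cubeBoundary 3) := by
      rw [hL]
      exact isPLOn_affine (L.toAffineMap + AffineMap.const ℝ _ m) (isPolyhedron_cubeBoundary 3)
    exact (isPLOn_chartInv σ haff.isPolyhedron_image).comp haff (Set.mapsTo_image _ _)
  · rw [Set.disjoint_union_right]
    constructor
    · rw [Set.disjoint_left]
      rintro _ ⟨x, hx, rfl⟩ ⟨p, hp, hpx⟩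
      obtain ⟨y, hy, hpy⟩ := hKU p hp
      have hxy : y = x := hinj (hpy.symm.trans hpx)
      rw [hxy, mem_ball_zero_iff] at hy
      have : ‖x‖ = 1 := mem_sphere_zero_iff_norm.1 hx
      linarith
    · rw [Set.disjoint_left]
      rintro _ ⟨x, hx, rfl⟩ hxZ
      exact (hε x (hbs hx)).2 hxZ
  · rintro _ ⟨p, hp, rfl⟩ q hq heq
    obtain ⟨y, hy, hpy⟩ := hKU p hp
    have hyc : y ∈ cube 3 := Metric.ball_subset_closedBall hy
    simp only at heq
    rw [hpy] at heq
    have hyS : g y ∈ threeSphere \ g '' cubeBoundary 3 := by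
      refine ⟨hgS y hyc, ?_⟩
      rintro ⟨x, hx, hxy⟩
      rw [hinj hxy] at hx
      have h1 : ‖y‖ = 1 := mem_sphere_zero_iff_norm.1 hx
      rw [mem_ball_zero_iff] at hy
      linarith
    obtain ⟨s, hs, hsp, hps, hqs⟩ := (connectedComponentIn_eq_iff hyS
      ⟨hZS hq, fun ⟨x, hx, hxq⟩ => (hε x (hbs hx)).2 (show g x ∈ Z from hxq ▸ hq)⟩).1 heq
    -- A connected set off the boundary of the box cannot meet both of its sides.
    have hcov : s ⊆ U ∪ V := by
      intro x hx
      by_cases hxV : x ∈ V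
      · exact Or.inr hxV
      · obtain ⟨z, hz, rfl⟩ := not_not.1 hxV
        left
        refine hgU z ?_
        rw [mem_ball_zero_iff]
        have h1 : ‖z‖ ≤ 1 := mem_closedBall_zero_iff.1 hz
        refine h1.lt_of_ne fun h2 => (hs hx).2 ⟨z, mem_sphere_zero_iff_norm.2 h2, rfl⟩
    have hqV : q ∈ V := by
      rintro ⟨x, hx, rfl⟩
      exact (hε x hx).2 hq
    obtain ⟨x, hxs, hxU, hxV⟩ := hsp U V hUo hVo hcov ⟨_, hps, hgU y hy⟩ ⟨q, hqs, hqV⟩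
    obtain ⟨z, hz, rfl⟩ := hUg x ⟨(hs hxs).1, hxU⟩
    exact hxV ⟨z, Metric.ball_subset_closedBall hz, rfl⟩

end SpatialGraph
namespace SpatialGraph
open scoped Graph
open Filter Topology

/-! ### Moves across a flat disk -/

theorem mem_diamond_corner : ((-1, 0) : ℝ × ℝ) ∈ diamond ∧ ((1, 0) : ℝ × ℝ) ∈ diamond ∧
    ((0, 1) : ℝ × ℝ) ∈ diamond ∧ ((0, -1) : ℝ × ℝ) ∈ diamond := by
  simp [mem_diamond]

theorem IsFlatDisk.isSegUnion_segment {κ : ℝ × ℝ → (Fin 4 → ℝ)} (hκ : IsFlatDisk κ)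
    (a b : ℝ × ℝ) : IsSegUnion (κ '' segment ℝ a b) := by
  have hA : IsPLOn (AffineMap.lineMap a b : ℝ →ᵃ[ℝ] ℝ × ℝ) (Set.Icc (0 : ℝ) 1) :=
    isPLOn_affine _ (isPolyhedron_Icc 0 1)
  have := (hκ.isPLOn hA.isPolyhedron_image).comp hA (Set.mapsTo_image _ _)
  have := this.isSegUnion_image
  rwa [Set.image_comp, ← segment_eq_image_lineMap] at this

theorem IsFlatDisk.isSegUnion_upperArc {κ : ℝ × ℝ → (Fin 4 → ℝ)} (hκ : IsFlatDisk κ) :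
    IsSegUnion (κ '' upperArc) := by
  rw [upperArc_eq, Set.image_union]
  exact (hκ.isSegUnion_segment _ _).union (hκ.isSegUnion_segment _ _)

theorem IsFlatDisk.image_subset {κ : ℝ × ℝ → (Fin 4 → ℝ)} (hκ : IsFlatDisk κ) {P : Set (ℝ × ℝ)}
    (hP : P ⊆ diamond) : κ '' P ⊆ threeSphere := by
  rintro _ ⟨p, hp, rfl⟩
  exact hκ.mem_threeSphere (hP hp)

/-- The upper side of a flat disk is moved to the diagonal. -/
theorem IsFlatDisk.exists_move_upperArc {κ : ℝ × ℝ → (Fin 4 → ℝ)} (hκ : IsFlatDisk κ)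
    {Z : Set (Fin 4 → ℝ)} (hZ : IsSegUnion Z) (hZS : Z ⊆ threeSphere)
    (hZκ : ∀ p ∈ diamond, κ p ∈ Z → p = (-1, 0) ∨ p = (1, 0)) :
    ∃ H, IsPLHomeo H ∧ (∀ z ∈ Z, H z = z) ∧ H '' (κ '' upperArc) = κ '' axis (-1) 1 := by
  obtain ⟨h1, h2, h3, -⟩ := mem_diamond_corner
  obtain ⟨H, hH, hfix, -, -, him⟩ := hκ.exists_triangle_move h1 h3 h2
    (by rw [segment_symm, mem_segment_oblique]
        rintro ⟨r, hr, h⟩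
        have := (Prod.ext_iff.1 h).1
        simp only at this
        linarith [hr.2])
    (by rw [mem_segment_oblique]
        rintro ⟨r, hr, h⟩
        have := (Prod.ext_iff.1 h).1
        simp only at this
        linarith [hr.2]) hZ hZS fun p hp => hZκ p (convexHull_min (by
          rintro x (rfl | rfl | rfl) <;> assumption) convex_diamond hp)
  refine ⟨H, hH, hfix, ?_⟩
  rw [upperArc_eq, him, segment_eq_axis (by norm_num)]

theorem convex_le_combination (a b c : ℝ) : Convex ℝ {p : ℝ × ℝ | a * p.1 + b * p.2 ≤ c} :=
  convex_halfSpace_le (f := fun p : ℝ × ℝ => a * p.1 + b * p.2)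
    ⟨fun x y => by simp only [Prod.fst_add, Prod.snd_add]; ring,
      fun r x => by simp only [Prod.smul_fst, Prod.smul_snd, smul_eq_mul]; ring⟩ c

/-- The upper side of a flat disk together with the initial part of the diagonal up to the point
`(ξ, 0)` is moved to the remaining part of the diagonal, across two triangles. -/
theorem IsFlatDisk.exists_move_detour {κ : ℝ × ℝ → (Fin 4 → ℝ)} (hκ : IsFlatDisk κ) {ξ : ℝ}
    (hξ : ξ ∈ Set.Ioo (-1 : ℝ) 1) {Z : Set (Fin 4 → ℝ)} (hZ : IsSegUnion Z) (hZS : Z ⊆ threeSphere)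
    (hZκ : ∀ p ∈ diamond, κ p ∈ Z → p = (ξ, 0) ∨ p = (1, 0)) :
    ∃ H, IsPLHomeo H ∧ (∀ z ∈ Z, H z = z) ∧
      H '' (κ '' (axis (-1) ξ ∪ upperArc)) = κ '' axis ξ 1 := by
  obtain ⟨h1, h2, h3, -⟩ := mem_diamond_corner
  obtain ⟨hξ1, hξ2⟩ := hξ
  have hx : ((ξ, 0) : ℝ × ℝ) ∈ diamond := by
    simp [mem_diamond, abs_le]; constructor <;> linarith
  have hsub : segment ℝ ((0, 1) : ℝ × ℝ) (1, 0) ⊆ diamond := convex_diamond.segment_subset h3 h2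
  have hleft : ∀ p ∈ convexHull ℝ ({(ξ, 0), (-1, 0), (0, 1)} : Set (ℝ × ℝ)),
      p.1 + ξ * p.2 ≤ ξ := by
    intro p hp
    have := convexHull_min (s := ({(ξ, 0), (-1, 0), (0, 1)} : Set (ℝ × ℝ)))
      (t := {p : ℝ × ℝ | 1 * p.1 + ξ * p.2 ≤ ξ}) (by
        rintro x (rfl | rfl | rfl)
        · simp
        · simp only [Set.mem_ofPred_eq]; linarith
        · simp) (convex_le_combination 1 ξ ξ) hp
    simpa using this
  -- The detour is shortened across the triangle with vertices `(ξ, 0)`, `(-1, 0)`, `(0, 1)`,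
  obtain ⟨H, hH, hfix, hx', hc', him⟩ := hκ.exists_triangle_move (a := (ξ, 0)) (b := (-1, 0))
    (c := (0, 1)) hx h1 h3
    (by rw [mem_segment_oblique]
        rintro ⟨r, hr, h⟩
        have e1 := (Prod.ext_iff.1 h).1
        have e2 := (Prod.ext_iff.1 h).2
        simp only at e1 e2
        have : r = 0 := by linarith
        subst this
        linarith)
    (by rw [segment_symm, segment_eq_axis hξ1.le]
        rintro ⟨-, h⟩
        simp at h)
    (Z := Z ∪ κ '' segment ℝ (0, 1) (1, 0)) (hZ.union (hκ.isSegUnion_segment _ _))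
    (Set.union_subset hZS (hκ.image_subset hsub)) (by
      intro p hp hpZ
      have hpd : p ∈ diamond := convexHull_min (by
        rintro x (rfl | rfl | rfl) <;> assumption) convex_diamond hp
      have hl := hleft p hp
      rcases hpZ with hpZ | ⟨q, hq, hqp⟩
      · rcases hZκ p hpd hpZ with h | rfl
        · exact Or.inl h
        · simp only at hl; linarith
      · rw [hκ.injective hqp, segment_symm, mem_segment_oblique] at hq
        obtain ⟨r, hr, rfl⟩ := hq
        right
        simp only at hl
        have : r = 1 := by nlinarith [hr.2]
        subst this
        simp)
  -- and then across the triangle with vertices `(ξ, 0)`, `(0, 1)`, `(1, 0)`.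
  obtain ⟨H', hH', hfix', -, -, him'⟩ := hκ.exists_triangle_move (a := (ξ, 0)) (b := (0, 1))
    (c := (1, 0)) hx h3 h2
    (by rw [segment_symm, mem_segment_oblique]
        rintro ⟨r, hr, h⟩
        have e1 := (Prod.ext_iff.1 h).1
        have e2 := (Prod.ext_iff.1 h).2
        simp only at e1 e2
        have : r = 0 := by linarith
        subst this
        linarith)
    (by rw [mem_segment_oblique]
        rintro ⟨r, hr, h⟩
        have e1 := (Prod.ext_iff.1 h).1
        have e2 := (Prod.ext_iff.1 h).2
        simp only at e1 e2
        have : r = 0 := by linarith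
        subst this
        linarith) hZ hZS fun p hp => hZκ p (convexHull_min (by
          rintro x (rfl | rfl | rfl) <;> assumption) convex_diamond hp)
  refine ⟨H' ∘ H, hH'.comp hH, fun z hz => ?_, ?_⟩
  · rw [Function.comp_apply, hfix z (Or.inl hz), hfix' z hz]
  · have hid : H '' (κ '' segment ℝ (0, 1) (1, 0)) = κ '' segment ℝ (0, 1) (1, 0) := by
      have : Set.EqOn H id (κ '' segment ℝ (0, 1) (1, 0)) := fun z hz => hfix z (Or.inr hz)
      rw [this.image_eq, Set.image_id]
    rw [upperArc_eq, ← Set.union_assoc, ← segment_eq_axis hξ1.le, segment_symm ℝ (-1, 0) (ξ, 0),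
      Set.image_union, Set.image_comp, Set.image_union, him, hid, ← Set.image_union, him',
      segment_eq_axis hξ2.le]

/-- The upper side of a flat disk and its diagonal bound a disk. -/
theorem IsFlatDisk.exists_move_lowerArc {κ : ℝ × ℝ → (Fin 4 → ℝ)} (hκ : IsFlatDisk κ)
    {Z : Set (Fin 4 → ℝ)} (hZ : IsSegUnion Z) (hZS : Z ⊆ threeSphere)
    (hZκ : ∀ p ∈ diamond, κ p ∉ Z) :
    ∃ H, IsPLHomeo H ∧ (∀ z ∈ Z, H z = z) ∧
      H '' (κ '' diamondBoundary) = κ '' (axis (-1) 1 ∪ upperArc) := by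
  obtain ⟨h1, h2, -, h4⟩ := mem_diamond_corner
  have hup : ∀ p ∈ convexHull ℝ ({(-1, 0), (0, -1), (1, 0)} : Set (ℝ × ℝ)), p.2 ≤ 0 := by
    intro p hp
    have := convexHull_min (s := ({(-1, 0), (0, -1), (1, 0)} : Set (ℝ × ℝ)))
      (t := {p : ℝ × ℝ | 0 * p.1 + 1 * p.2 ≤ 0}) (by
        rintro x (rfl | rfl | rfl) <;> simp) (convex_le_combination 0 1 0) hp
    simpa using this
  obtain ⟨H, hH, hfix, -, -, him⟩ := hκ.exists_triangle_move h1 h4 h2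
    (by rw [segment_symm, mem_segment_oblique]
        rintro ⟨r, hr, h⟩
        have := (Prod.ext_iff.1 h).1
        simp only at this
        linarith [hr.2])
    (by rw [mem_segment_oblique]
        rintro ⟨r, hr, h⟩
        have := (Prod.ext_iff.1 h).1
        simp only at this
        linarith [hr.2]) (Z := Z ∪ κ '' upperArc) (hZ.union hκ.isSegUnion_upperArc)
        (Set.union_subset hZS (hκ.image_subset upperArc_subset)) (by
      intro p hp hpZ
      have hpd : p ∈ diamond := convexHull_min (by
        rintro x (rfl | rfl | rfl) <;> assumption) convex_diamond hp
      rcases hpZ with hpZ | ⟨q, hq, hqp⟩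
      · exact absurd hpZ (hZκ p hpd)
      · rw [hκ.injective hqp] at hq
        obtain ⟨hq1, hq2⟩ := hq
        have hp2 := hup p hp
        have hp3 : p.2 = 0 := le_antisymm hp2 (by linarith)
        have hp4 : |p.1| = 1 := by linarith
        rcases eq_or_eq_neg_of_abs_eq hp4 with h | h
        · exact Or.inr (Prod.ext h hp3)
        · exact Or.inl (Prod.ext h hp3))
  refine ⟨H, hH, fun z hz => hfix z (Or.inl hz), ?_⟩
  have hid : H '' (κ '' upperArc) = κ '' upperArc := by
    have : Set.EqOn H id (κ '' upperArc) := fun z hz => hfix z (Or.inr hz)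
    rw [this.image_eq, Set.image_id]
  rw [← upperArc_union_lowerArc, Set.image_union, Set.image_union, hid, lowerArc_eq, him,
    segment_eq_axis (by norm_num), Set.image_union, Set.union_comm]

theorem IsFlatDisk.isTrivialKnot_upperArc {κ : ℝ × ℝ → (Fin 4 → ℝ)} (hκ : IsFlatDisk κ) :
    IsTrivialKnot (κ '' (axis (-1) 1 ∪ upperArc)) := by
  obtain ⟨H, hH, -, him⟩ := hκ.exists_move_lowerArc isSegUnion_empty (Set.empty_subset _)
    (fun _ _ => Set.notMem_empty _)
  rw [← him]
  exact hκ.isTrivialKnot_boundary.image hH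

theorem IsFlatDisk.isSplittable_upperArc {κ : ℝ × ℝ → (Fin 4 → ℝ)} (hκ : IsFlatDisk κ)
    {Z : Set (Fin 4 → ℝ)} (hZ : IsSegUnion Z) (hZS : Z ⊆ threeSphere)
    (hZκ : ∀ p ∈ diamond, κ p ∉ Z) : IsSplittable (κ '' (axis (-1) 1 ∪ upperArc)) Z := by
  obtain ⟨H, hH, hfix, him⟩ := hκ.exists_move_lowerArc hZ hZS hZκ
  have hid : H '' Z = Z := by
    have : Set.EqOn H id Z := hfix
    rw [this.image_eq, Set.image_id]
  rw [← him, ← hid]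
  refine (hκ.isSplittable_boundary hZ.isCompact.isClosed hZS hZκ).image
    (hκ.image_subset ?_) hZS hH
  rw [← upperArc_union_lowerArc]
  exact Set.union_subset upperArc_subset lowerArc_subset

/-! ### Paths along the sides of a flat disk -/

/-- The path along the upper sides of `diamond`. -/
noncomputable def upperPath (t : ℝ) : ℝ × ℝ := (2 * t - 1, min (2 * t) (2 - 2 * t))

/-- The closed path around `diamond`, starting at `(-1, 0)`. -/
noncomputable def boundaryPath (t : ℝ) : ℝ × ℝ :=
  (min (4 * t - 1) (3 - 4 * t), max (min (4 * t) (2 - 4 * t)) (4 * t - 4))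

theorem isPLOn_linear_poly (a b : ℝ) : IsPLOn (fun t : ℝ => a * t + b) (Set.Icc 0 1) := by
  have := isPLOn_affine ((LinearMap.mul ℝ ℝ a).toAffineMap + AffineMap.const ℝ ℝ b)
    (isPolyhedron_Icc 0 1)
  exact this.congr fun t _ => by simp

theorem isPLOn_upperPath : IsPLOn upperPath (Set.Icc 0 1) := by
  have h1 := isPLOn_linear_poly 2 (-1)
  have h2 := (isPLOn_linear_poly 2 0).min (isPLOn_linear_poly (-2) 2)
  refine (h1.prodMk h2).congr fun t _ => ?_
  simp only [upperPath]
  congr 1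
  ring_nf

theorem isPLOn_boundaryPath : IsPLOn boundaryPath (Set.Icc 0 1) := by
  have h1 := (isPLOn_linear_poly 4 (-1)).min (isPLOn_linear_poly (-4) 3)
  have h2 := ((isPLOn_linear_poly 4 0).min (isPLOn_linear_poly (-4) 2)).max
    (isPLOn_linear_poly 4 (-4))
  refine (h1.prodMk h2).congr fun t _ => ?_
  simp only [boundaryPath]
  congr 1 <;> ring_nf

theorem image_upperPath : upperPath '' Set.Icc 0 1 = upperArc := by
  have key : ∀ t : ℝ, min (2 * t) (2 - 2 * t) = 1 - |2 * t - 1| := fun t => by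
    rcases abs_cases (2 * t - 1) with ⟨h, h'⟩ | ⟨h, h'⟩ <;>
    rcases min_cases (2 * t) (2 - 2 * t) with ⟨k, k'⟩ | ⟨k, k'⟩ <;> (rw [h, k]; linarith)
  ext ⟨x, y⟩
  simp only [upperArc, Set.mem_image, Set.mem_ofPred_eq, upperPath, Prod.mk.injEq, key]
  constructor
  · rintro ⟨t, ht, rfl, rfl⟩
    exact ⟨abs_le.2 ⟨by linarith [ht.1], by linarith [ht.2]⟩, rfl⟩
  · rintro ⟨h, rfl⟩
    obtain ⟨h1, h2⟩ := abs_le.1 h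
    refine ⟨(x + 1) / 2, ⟨by linarith, by linarith⟩, by ring, ?_⟩
    congr 2
    ring

theorem upperPath_injective : Function.Injective upperPath := fun s t h => by
  have := (Prod.ext_iff.1 h).1
  simp only [upperPath] at this
  linarith

theorem upperPath_zero : upperPath 0 = (-1, 0) := by simp [upperPath]

theorem upperPath_one : upperPath 1 = (1, 0) := by norm_num [upperPath]

theorem upperPath_snd_pos {t : ℝ} (ht : t ∈ Set.Ioo (0 : ℝ) 1) : 0 < (upperPath t).2 := by
  simp only [upperPath, lt_min_iff]
  constructor <;> linarith [ht.1, ht.2]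

theorem upperPath_mem {t : ℝ} (ht : t ∈ Set.Icc (0 : ℝ) 1) : upperPath t ∈ diamond :=
  upperArc_subset (image_upperPath ▸ Set.mem_image_of_mem _ ht)

theorem boundaryPath_cases {t : ℝ} (ht : t ∈ Set.Icc (0 : ℝ) 1) :
    (t ≤ 1 / 4 ∧ boundaryPath t = (4 * t - 1, 4 * t)) ∨
    (1 / 4 ≤ t ∧ t ≤ 1 / 2 ∧ boundaryPath t = (4 * t - 1, 2 - 4 * t)) ∨
    (1 / 2 ≤ t ∧ t ≤ 3 / 4 ∧ boundaryPath t = (3 - 4 * t, 2 - 4 * t)) ∨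
    (3 / 4 ≤ t ∧ boundaryPath t = (3 - 4 * t, 4 * t - 4)) := by
  obtain ⟨h0, h1⟩ := ht
  simp only [boundaryPath, Prod.mk.injEq]
  rcases le_total t (1 / 4) with h | h
  · left
    refine ⟨h, min_eq_left (by linarith), ?_⟩
    rw [min_eq_left (by linarith), max_eq_left (by linarith)]
  rcases le_total t (1 / 2) with h' | h'
  · right; left
    refine ⟨h, h', min_eq_left (by linarith), ?_⟩
    rw [min_eq_right (by linarith), max_eq_left (by linarith)]
  rcases le_total t (3 / 4) with h'' | h''
  · right; right; left
    refine ⟨h', h'', min_eq_right (by linarith), ?_⟩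
    rw [min_eq_right (by linarith), max_eq_left (by linarith)]
  · right; right; right
    refine ⟨h'', min_eq_right (by linarith), ?_⟩
    rw [min_eq_right (by linarith), max_eq_right (by linarith)]

theorem image_boundaryPath : boundaryPath '' Set.Icc 0 1 = diamondBoundary := by
  ext ⟨x, y⟩
  simp only [diamondBoundary, Set.mem_image, Set.mem_ofPred_eq]
  constructor
  · rintro ⟨t, ht, h⟩
    rcases boundaryPath_cases ht with ⟨h1, h2⟩ | ⟨h1, h1', h2⟩ | ⟨h1, h1', h2⟩ | ⟨h1, h2⟩ <;>
    (rw [h2] at h; cases h)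
    · rw [abs_of_nonpos (by linarith), abs_of_nonneg (a := 4 * t) (by linarith [ht.1])]; ring
    · rw [abs_of_nonneg (by linarith), abs_of_nonneg (a := 2 - 4 * t) (by linarith)]; ring
    · rw [abs_of_nonneg (by linarith), abs_of_nonpos (a := 2 - 4 * t) (by linarith)]; ring
    · rw [abs_of_nonpos (by linarith), abs_of_nonpos (a := 4 * t - 4) (by linarith [ht.2])]; ring
  · intro h
    simp only [boundaryPath, Prod.mk.injEq]
    rcases abs_cases x with ⟨hx, hx'⟩ | ⟨hx, hx'⟩ <;> rcases abs_cases y with ⟨hy, hy'⟩ | ⟨hy, hy'⟩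
    · refine ⟨(x + 1) / 4, ⟨by linarith, by linarith⟩, ?_, ?_⟩
      · rw [min_eq_left (by linarith)]; ring
      · rw [min_eq_right (by linarith), max_eq_left (by linarith)]; linarith
    · refine ⟨(3 - x) / 4, ⟨by linarith, by linarith⟩, ?_, ?_⟩
      · rw [min_eq_right (by linarith)]; ring
      · rw [min_eq_right (by linarith), max_eq_left (by linarith)]; linarith
    · refine ⟨(x + 1) / 4, ⟨by linarith, by linarith⟩, ?_, ?_⟩
      · rw [min_eq_left (by linarith)]; ring
      · rw [min_eq_left (by linarith), max_eq_left (by linarith)]; linarith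
    · refine ⟨(3 - x) / 4, ⟨by linarith, by linarith⟩, ?_, ?_⟩
      · rw [min_eq_right (by linarith)]; ring
      · rw [min_eq_right (by linarith), max_eq_right (by linarith)]; linarith

theorem boundaryPath_zero : boundaryPath 0 = (-1, 0) := by norm_num [boundaryPath]

theorem boundaryPath_one : boundaryPath 1 = (-1, 0) := by norm_num [boundaryPath]

theorem boundaryPath_injOn : Set.InjOn boundaryPath (Set.Ioo 0 1) := by
  intro s hs t ht h
  have hs' := hs; have ht' := ht
  obtain ⟨s0, s1⟩ := hs
  obtain ⟨t0, t1⟩ := ht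
  rcases boundaryPath_cases (Set.Ioo_subset_Icc_self hs') with
    ⟨h1, h2⟩ | ⟨h1, h1', h2⟩ | ⟨h1, h1', h2⟩ | ⟨h1, h2⟩ <;>
  rcases boundaryPath_cases (Set.Ioo_subset_Icc_self ht') with
    ⟨k1, k2⟩ | ⟨k1, k1', k2⟩ | ⟨k1, k1', k2⟩ | ⟨k1, k2⟩ <;>
  · rw [h2, k2, Prod.mk.injEq] at h
    linarith [h.1, h.2]

theorem boundaryPath_ne {t : ℝ} (ht : t ∈ Set.Ioo (0 : ℝ) 1) : boundaryPath t ≠ (-1, 0) := by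
  intro h
  have ht' := ht
  obtain ⟨t0, t1⟩ := ht
  rcases boundaryPath_cases (Set.Ioo_subset_Icc_self ht') with
    ⟨k1, k2⟩ | ⟨k1, k1', k2⟩ | ⟨k1, k1', k2⟩ | ⟨k1, k2⟩ <;>
  · rw [k2, Prod.mk.injEq] at h
    linarith [h.1, h.2]

theorem boundaryPath_mem {t : ℝ} (ht : t ∈ Set.Icc (0 : ℝ) 1) : boundaryPath t ∈ diamond := by
  have : boundaryPath t ∈ diamondBoundary := image_boundaryPath ▸ Set.mem_image_of_mem _ ht
  exact le_of_eq this

end SpatialGraph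
namespace SpatialGraph
open scoped Graph
open Filter Topology

/-! ### Straight arcs and flat disks along them -/

theorem IsSegUnion.image_isPLHomeo {Z : Set (Fin 4 → ℝ)} (hZ : IsSegUnion Z)
    (hZS : Z ⊆ threeSphere) {H : (Fin 4 → ℝ) → (Fin 4 → ℝ)} (hH : IsPLHomeo H) :
    IsSegUnion (H '' Z) := by
  obtain ⟨S, hS, rfl⟩ := hZ
  rw [Set.image_iUnion₂]
  refine .biUnion hS fun I hI => ?_
  have hA : IsPLOn (AffineMap.lineMap I.1 I.2 : ℝ →ᵃ[ℝ] (Fin 4 → ℝ)) (Set.Icc (0 : ℝ) 1) :=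
    isPLOn_affine _ (isPolyhedron_Icc 0 1)
  have hm : Set.MapsTo (AffineMap.lineMap I.1 I.2 : ℝ →ᵃ[ℝ] (Fin 4 → ℝ)) (Set.Icc (0 : ℝ) 1)
      threeSphere := fun t ht => hZS (Set.mem_biUnion hI (by
        rw [segment_eq_image_lineMap]; exact Set.mem_image_of_mem _ ht))
  have := (hH.1.comp hA hm).isSegUnion_image
  rwa [Set.image_comp, ← segment_eq_image_lineMap] at this

theorem image_Icc_of_injOn {φ : ℝ → ℝ} (hφ : ContinuousOn φ (Set.Icc 0 1))
    (hinj : Set.InjOn φ (Set.Icc 0 1)) (h01 : φ 0 ≤ φ 1) {s t : ℝ} (hs : 0 ≤ s) (hst : s ≤ t)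
    (ht : t ≤ 1) : φ '' Set.Icc s t = Set.Icc (φ s) (φ t) := by
  have hmono := (hφ.strictMonoOn_of_injOn_Icc zero_le_one h01 hinj).monotoneOn
  have hsub : Set.Icc s t ⊆ Set.Icc 0 1 := Set.Icc_subset_Icc hs ht
  apply Set.Subset.antisymm
  · rintro _ ⟨r, hr, rfl⟩
    exact ⟨hmono (hsub ⟨le_rfl, hst⟩) (hsub hr) hr.1, hmono (hsub hr) (hsub ⟨hst, le_rfl⟩) hr.2⟩
  · exact intermediate_value_Icc hst (hφ.mono hsub)

/-- After a piecewise linear homeomorphism of the sphere, a given arc is the diagonal of a flat disk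
which meets a given family of segments in its diagonal only. -/
theorem exists_isFlatDisk_arc {γ : ℝ → (Fin 4 → ℝ)} (hγ : IsPLOn γ (Set.Icc 0 1))
    (hinj : Set.InjOn γ (Set.Icc 0 1)) (hγS : Set.MapsTo γ (Set.Icc 0 1) threeSphere)
    {X : Set (Fin 4 → ℝ)} (hX : IsSegUnion X) (hXS : X ⊆ threeSphere) :
    ∃ H κ, IsPLHomeo H ∧ IsFlatDisk κ ∧ (∀ p ∈ diamond, κ p ∈ H '' X → p.2 = 0) ∧
      ∃ φ : ℝ → ℝ, φ 0 = -1 ∧ φ 1 = 1 ∧ Set.InjOn φ (Set.Icc 0 1) ∧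
        (∀ s ∈ Set.Icc (0 : ℝ) 1, H (γ s) = κ (φ s, 0)) ∧
        ∀ s t, 0 ≤ s → s ≤ t → t ≤ 1 → H '' (γ '' Set.Icc s t) = κ '' axis (φ s) (φ t) := by
  obtain ⟨H, σ, u, v, hH, hσ, hu, hv, huv, him, h0, h1⟩ := exists_straighten hγ hinj hγS
  obtain ⟨κ, hκ, hκl, hκX⟩ := exists_isFlatDisk_segment hσ hu hv huv (hX.image_isPLHomeo hXS hH)
    (by rintro _ ⟨x, hx, rfl⟩; exact hH.2.mapsTo (hXS hx))
  -- The parameter on the diagonal is read off from a coordinate in which `u` and `v` differ.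
  obtain ⟨i, hi⟩ : ∃ i, u i ≠ v i := Function.ne_iff.1 huv
  have hvi : v i - u i ≠ 0 := sub_ne_zero.2 hi.symm
  set φ : ℝ → ℝ := fun s => 2 * (chartProj σ (H (γ s)) i - u i) / (v i - u i) - 1 with hφ
  have hHγ : ContinuousOn (fun s => H (γ s)) (Set.Icc 0 1) :=
    hH.continuousOn.comp hγ.continuousOn hγS
  have hφc : ContinuousOn φ (Set.Icc 0 1) := by
    have h2 : ContinuousOn (fun s => chartProj σ (H (γ s)) i) (Set.Icc 0 1) :=
      ((continuous_apply i).comp (continuous_chartProj σ)).comp_continuousOn hHγ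
    exact ((continuousOn_const.mul (h2.sub continuousOn_const)).div_const _).sub continuousOn_const
  have hφ0 : φ 0 = -1 := by
    simp only [hφ]; rw [h0, chartProj_chartInv hσ]; simp
  have hφ1 : φ 1 = 1 := by
    simp only [hφ]; rw [h1, chartProj_chartInv hσ]; field_simp; ring
  have hval : ∀ s ∈ Set.Icc (0 : ℝ) 1, H (γ s) = κ (φ s, 0) := by
    intro s hs
    have : H (γ s) ∈ chartInv σ '' segment ℝ u v := by
      rw [← him]; exact ⟨_, ⟨s, hs, rfl⟩, rfl⟩
    rw [segment_eq_image_lineMap] at this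
    obtain ⟨_, ⟨r, hr, rfl⟩, hrs⟩ := this
    rw [hκl]
    have : (1 + φ s) / 2 = r := by
      simp only [hφ]
      rw [← hrs, chartProj_chartInv hσ, AffineMap.lineMap_apply_module']
      simp only [Pi.add_apply, Pi.smul_apply, Pi.sub_apply, smul_eq_mul]
      field_simp
      ring
    rw [this, hrs]
  have hφinj : Set.InjOn φ (Set.Icc 0 1) := by
    intro s hs t ht hst
    refine hinj hs ht (hH.2.injOn (hγS hs) (hγS ht) ?_)
    rw [hval s hs, hval t ht, hst]
  refine ⟨H, κ, hH, hκ, hκX, φ, hφ0, hφ1, hφinj, hval, fun s t hs hst ht => ?_⟩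
  have himφ := image_Icc_of_injOn hφc hφinj (by rw [hφ0, hφ1]; norm_num) hs hst ht
  have hsub : Set.Icc s t ⊆ Set.Icc 0 1 := Set.Icc_subset_Icc hs ht
  ext x
  constructor
  · rintro ⟨_, ⟨r, hr, rfl⟩, rfl⟩
    exact ⟨_, ⟨himφ ▸ Set.mem_image_of_mem φ hr, rfl⟩, (hval r (hsub hr)).symm⟩
  · rintro ⟨⟨y, z⟩, ⟨hy, hz⟩, rfl⟩
    simp only at hy hz
    subst hz
    rw [← himφ] at hy
    obtain ⟨r, hr, rfl⟩ := hy
    exact ⟨_, ⟨r, hr, rfl⟩, hval r (hsub hr)⟩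

/-- The concatenation of two paths. -/
noncomputable def concat {E : Type*} (γ₁ γ₂ : ℝ → E) (t : ℝ) : E :=
  if t ≤ 1 / 2 then γ₁ (2 * t) else γ₂ (2 * t - 1)

section Concat
variable {E : Type*} {γ₁ γ₂ : ℝ → E}

theorem concat_left {t : ℝ} (ht : t ≤ 1 / 2) : concat γ₁ γ₂ t = γ₁ (2 * t) := if_pos ht

theorem concat_right (h : γ₁ 1 = γ₂ 0) {t : ℝ} (ht : 1 / 2 ≤ t) :
    concat γ₁ γ₂ t = γ₂ (2 * t - 1) := by
  rcases ht.eq_or_lt with rfl | ht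
  · rw [concat_left le_rfl]; norm_num [h]
  · exact if_neg (not_le.2 ht)

theorem image_concat_left : concat γ₁ γ₂ '' Set.Icc 0 (1 / 2) = γ₁ '' Set.Icc 0 1 := by
  ext x
  constructor
  · rintro ⟨t, ht, rfl⟩
    exact ⟨2 * t, ⟨by linarith [ht.1], by linarith [ht.2]⟩, (concat_left ht.2).symm⟩
  · rintro ⟨t, ht, rfl⟩
    refine ⟨t / 2, ⟨by linarith [ht.1], by linarith [ht.2]⟩, ?_⟩
    rw [concat_left (by linarith [ht.2])]
    congr 1
    ring

theorem image_concat_right (h : γ₁ 1 = γ₂ 0) :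
    concat γ₁ γ₂ '' Set.Icc (1 / 2) 1 = γ₂ '' Set.Icc 0 1 := by
  ext x
  constructor
  · rintro ⟨t, ht, rfl⟩
    exact ⟨2 * t - 1, ⟨by linarith [ht.1], by linarith [ht.2]⟩, (concat_right h ht.1).symm⟩
  · rintro ⟨t, ht, rfl⟩
    refine ⟨(t + 1) / 2, ⟨by linarith [ht.1], by linarith [ht.2]⟩, ?_⟩
    rw [concat_right h (by linarith [ht.1])]
    congr 1
    ring

theorem IsPLOn.comp_affine_Icc [NormedAddCommGroup E] [NormedSpace ℝ E] {γ : ℝ → E}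
    (hγ : IsPLOn γ (Set.Icc 0 1)) (a b : ℝ) {s t : ℝ}
    (hst : Set.MapsTo (fun r => a * r + b) (Set.Icc s t) (Set.Icc 0 1)) :
    IsPLOn (fun r => γ (a * r + b)) (Set.Icc s t) := by
  have h := isPLOn_affine ((LinearMap.mul ℝ ℝ a).toAffineMap + AffineMap.const ℝ ℝ b)
    (isPolyhedron_Icc s t)
  have h' : IsPLOn (fun r : ℝ => a * r + b) (Set.Icc s t) := h.congr fun t _ => by simp
  exact hγ.comp h' hst

theorem isPLOn_concat [NormedAddCommGroup E] [NormedSpace ℝ E] (h₁ : IsPLOn γ₁ (Set.Icc 0 1))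
    (h₂ : IsPLOn γ₂ (Set.Icc 0 1)) (h : γ₁ 1 = γ₂ 0) : IsPLOn (concat γ₁ γ₂) (Set.Icc 0 1) := by
  rw [← Set.Icc_union_Icc_eq_Icc (b := (1 / 2 : ℝ)) (by norm_num) (by norm_num)]
  refine IsPLOn.union ?_ ?_
  · refine (h₁.comp_affine_Icc 2 0 (s := 0) (t := 1 / 2) fun r hr => ?_).congr fun r hr => ?_
    · exact Set.mem_Icc.2 ⟨by linarith [hr.1], by linarith [hr.2]⟩
    · change γ₁ (2 * r + 0) = _
      rw [add_zero, concat_left hr.2]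
  · refine (h₂.comp_affine_Icc 2 (-1) (s := 1 / 2) (t := 1) fun r hr => ?_).congr fun r hr => ?_
    · exact Set.mem_Icc.2 ⟨by linarith [hr.1], by linarith [hr.2]⟩
    · have e : 2 * r + -1 = 2 * r - 1 := by ring
      change γ₂ (2 * r + -1) = _
      rw [e, concat_right h hr.1]

theorem concat_injOn (h₁ : Set.InjOn γ₁ (Set.Icc 0 1)) (h₂ : Set.InjOn γ₂ (Set.Icc 0 1))
    (h : γ₁ 1 = γ₂ 0) (hd : ∀ s ∈ Set.Icc (0 : ℝ) 1, ∀ t ∈ Set.Icc (0 : ℝ) 1, γ₁ s = γ₂ t → t = 0) :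
    Set.InjOn (concat γ₁ γ₂) (Set.Icc 0 1) := by
  have key : ∀ s ∈ Set.Icc (0 : ℝ) (1 / 2), ∀ t ∈ Set.Icc (1 / 2 : ℝ) 1,
      concat γ₁ γ₂ s = concat γ₁ γ₂ t → s = t := by
    intro s hs t ht hst
    have h1s : (2 * s) ∈ Set.Icc (0 : ℝ) 1 := ⟨by linarith [hs.1], by linarith [hs.2]⟩
    have h1t : (2 * t - 1) ∈ Set.Icc (0 : ℝ) 1 := ⟨by linarith [ht.1], by linarith [ht.2]⟩
    rw [concat_left hs.2, concat_right h ht.1] at hst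
    have h0 := hd _ h1s _ h1t hst
    rw [h0, ← h] at hst
    have := h₁ h1s ⟨zero_le_one, le_rfl⟩ hst
    linarith
  intro s hs t ht hst
  rcases le_total s (1 / 2) with h1 | h1 <;> rcases le_total t (1 / 2) with h2 | h2
  · rw [concat_left h1, concat_left h2] at hst
    have := h₁ ⟨by linarith [hs.1], by linarith⟩ ⟨by linarith [ht.1], by linarith⟩ hst
    linarith
  · exact key s ⟨hs.1, h1⟩ t ⟨h2, ht.2⟩ hst
  · exact (key t ⟨ht.1, h2⟩ s ⟨h1, hs.2⟩ hst.symm).symm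
  · rw [concat_right h h1, concat_right h h2] at hst
    have := h₂ ⟨by linarith, by linarith [hs.2]⟩ ⟨by linarith, by linarith [ht.2]⟩ hst
    linarith

end Concat

end SpatialGraph
namespace SpatialGraph
open scoped Graph
open Filter Topology

/-! ### Images of spatial embeddings -/

variable {α β α' β' : Type*} {G : Graph α β}

namespace SpatialEmbedding

/-- The image of the vertices in `V` and the edges in `E`. -/
def part (f : SpatialEmbedding G) (V : Set α) (E : Set β) : Set (Fin 4 → ℝ) :=
  (f.vertex '' V) ∪ ⋃ e ∈ E, f.edge e '' Set.Icc 0 1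

theorem image_eq_part (f : SpatialEmbedding G) (C : Graph α β) : f.image C = f.part V(C) E(C) := rfl

theorem part_mono (f : SpatialEmbedding G) {V V' : Set α} {E E' : Set β} (hV : V ⊆ V')
    (hE : E ⊆ E') : f.part V E ⊆ f.part V' E' :=
  Set.union_subset_union (Set.image_mono hV) (Set.biUnion_subset_biUnion_left hE)

theorem part_union (f : SpatialEmbedding G) (V V' : Set α) (E E' : Set β) :
    f.part (V ∪ V') (E ∪ E') = f.part V E ∪ f.part V' E' := by
  rw [part, part, part, Set.image_union, Set.biUnion_union, Set.union_union_union_comm]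

theorem part_subset_threeSphere (f : SpatialEmbedding G) {V : Set α} {E : Set β} (hV : V ⊆ V(G))
    (hE : E ⊆ E(G)) : f.part V E ⊆ threeSphere := by
  rintro x (⟨a, ha, rfl⟩ | hx)
  · exact f.vertex_mem a (hV ha)
  · obtain ⟨e, he, t, ht, rfl⟩ := Set.mem_iUnion₂.1 hx
    exact f.edge_mem e (hE he) t ht

theorem image_subset_threeSphere (f : SpatialEmbedding G) {C : Graph α β} (hC : C ≤ G) :
    f.image C ⊆ threeSphere :=
  f.part_subset_threeSphere hC.vertexSet_mono hC.edgeSet_mono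

theorem isSegUnion_part (f : SpatialEmbedding G) {V : Set α} {E : Set β} (hV : V.Finite)
    (hE : E.Finite) (hEG : E ⊆ E(G)) : IsSegUnion (f.part V E) := by
  refine IsSegUnion.union ?_ (.biUnion hE fun e he => (f.edge_pl e (hEG he)).isSegUnion_image)
  rw [← Set.biUnion_of_singleton (f.vertex '' V), Set.biUnion_image]
  exact .biUnion hV fun a _ => isSegUnion_singleton _

theorem edge_ends_of_isLink (f : SpatialEmbedding G) {e : β} {a b : α} (h : G.IsLink e a b) :
    (f.edge e 0 = f.vertex a ∧ f.edge e 1 = f.vertex b) ∨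
      (f.edge e 0 = f.vertex b ∧ f.edge e 1 = f.vertex a) := by
  obtain ⟨a', b', h', h0, h1⟩ := f.edge_ends e h.edge_mem
  rcases h.eq_and_eq_or_eq_and_eq h' with ⟨rfl, rfl⟩ | ⟨rfl, rfl⟩
  · exact Or.inl ⟨h0, h1⟩
  · exact Or.inr ⟨h0, h1⟩

end SpatialEmbedding

theorem eq_zero_or_eq_one_or_mem_Ioo {t : ℝ} (ht : t ∈ Set.Icc (0 : ℝ) 1) :
    t = 0 ∨ t = 1 ∨ t ∈ Set.Ioo (0 : ℝ) 1 := by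
  rcases ht.1.eq_or_lt with h | h
  · exact Or.inl h.symm
  · rcases ht.2.eq_or_lt with h' | h'
    · exact Or.inr (Or.inl h')
    · exact Or.inr (Or.inr ⟨h, h'⟩)

/-- `V` and `E` are the sets of vertices and edges of a subgraph of `G`. -/
def IsPart (G : Graph α β) (V : Set α) (E : Set β) : Prop :=
  V ⊆ V(G) ∧ E ⊆ E(G) ∧ ∀ e ∈ E, ∀ a, G.Inc e a → a ∈ V

theorem isPart_of_le {C : Graph α β} (h : C ≤ G) : IsPart G V(C) E(C) := by
  refine ⟨h.vertexSet_mono, h.edgeSet_mono, fun e he a ha => ?_⟩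
  exact ((h.inc_congr he).2 ha).vertex_mem

theorem IsPart.union {V V' : Set α} {E E' : Set β} (h : IsPart G V E) (h' : IsPart G V' E') :
    IsPart G (V ∪ V') (E ∪ E') := by
  refine ⟨Set.union_subset h.1 h'.1, Set.union_subset h.2.1 h'.2.1, ?_⟩
  rintro e (he | he) a ha
  · exact Or.inl (h.2.2 e he a ha)
  · exact Or.inr (h'.2.2 e he a ha)

theorem isPart_link {e : β} {a b : α} (h : G.IsLink e a b) : IsPart G {a, b} {e} := by
  refine ⟨?_, by simpa using h.edge_mem, ?_⟩
  · rintro x (rfl | rfl)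
    · exact h.left_mem
    · exact h.right_mem
  · rintro _ rfl x hx
    exact hx.eq_or_eq_of_isLink h

theorem isPart_vertices {V : Set α} (h : V ⊆ V(G)) : IsPart G V ∅ :=
  ⟨h, Set.empty_subset _, fun _ he => absurd he (Set.notMem_empty _)⟩

theorem IsPart.isLink {V : Set α} {E : Set β} (h : IsPart G V E) {e : β} (he : e ∈ E) {a b : α}
    (hl : G.IsLink e a b) : a ∈ V ∧ b ∈ V :=
  ⟨h.2.2 e he a hl.inc_left, h.2.2 e he b hl.inc_right⟩

namespace SpatialEmbedding

theorem mem_part_cases (f : SpatialEmbedding G) {V : Set α} {E : Set β} (h : IsPart G V E)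
    {x : Fin 4 → ℝ} (hx : x ∈ f.part V E) :
    (∃ a ∈ V, x = f.vertex a) ∨ ∃ e ∈ E, ∃ t ∈ Set.Ioo (0 : ℝ) 1, x = f.edge e t := by
  rcases hx with ⟨a, ha, rfl⟩ | hx
  · exact Or.inl ⟨a, ha, rfl⟩
  · obtain ⟨e, he, t, ht, rfl⟩ := Set.mem_iUnion₂.1 hx
    obtain ⟨a, b, hab, h0, h1⟩ := f.edge_ends e (h.2.1 he)
    obtain ⟨ha, hb⟩ := h.isLink he hab
    rcases eq_zero_or_eq_one_or_mem_Ioo ht with rfl | rfl | ht'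
    · exact Or.inl ⟨a, ha, h0⟩
    · exact Or.inl ⟨b, hb, h1⟩
    · exact Or.inr ⟨e, he, t, ht', rfl⟩

theorem vertex_mem_part (f : SpatialEmbedding G) {V : Set α} {E : Set β} (h : IsPart G V E)
    {a : α} (ha : a ∈ V(G)) : f.vertex a ∈ f.part V E ↔ a ∈ V := by
  refine ⟨fun hx => ?_, fun hx => Or.inl ⟨a, hx, rfl⟩⟩
  rcases f.mem_part_cases h hx with ⟨b, hb, hab⟩ | ⟨e, he, t, ht, heq⟩
  · rwa [f.vertex_injOn ha (h.1 hb) hab]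
  · exact absurd heq.symm (f.edge_ne_vertex e (h.2.1 he) t ht a ha)

theorem part_inter_part (f : SpatialEmbedding G) {V V' : Set α} {E E' : Set β} (h : IsPart G V E)
    (h' : IsPart G V' E') : f.part V E ∩ f.part V' E' = f.part (V ∩ V') (E ∩ E') := by
  apply Set.Subset.antisymm
  · rintro x ⟨hx, hx'⟩
    rcases f.mem_part_cases h hx with ⟨a, ha, rfl⟩ | ⟨e, he, t, ht, rfl⟩
    · exact Or.inl ⟨a, ⟨ha, (f.vertex_mem_part h' (h.1 ha)).1 hx'⟩, rfl⟩
    · rcases f.mem_part_cases h' hx' with ⟨b, hb, hab⟩ | ⟨e', he', t', ht', heq⟩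
      · exact absurd hab (f.edge_ne_vertex e (h.2.1 he) t ht b (h'.1 hb))
      · obtain ⟨rfl, rfl⟩ := f.edge_inj e (h.2.1 he) e' (h'.2.1 he') t ht t' ht' heq
        exact Or.inr (Set.mem_biUnion ⟨he, he'⟩ ⟨t, Set.Ioo_subset_Icc_self ht, rfl⟩)
  · exact Set.subset_inter (f.part_mono Set.inter_subset_left Set.inter_subset_left)
      (f.part_mono Set.inter_subset_right Set.inter_subset_right)

theorem part_link (f : SpatialEmbedding G) {e : β} {a b : α} (h : G.IsLink e a b) :
    f.part {a, b} {e} = f.edge e '' Set.Icc 0 1 := by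
  rw [part, Set.biUnion_singleton, Set.union_eq_right]
  rintro _ ⟨x, hx, rfl⟩
  rcases f.edge_ends_of_isLink h with ⟨h0, h1⟩ | ⟨h0, h1⟩ <;> rcases hx with rfl | rfl
  · exact ⟨0, by simp, h0⟩
  · exact ⟨1, by simp, h1⟩
  · exact ⟨1, by simp, h1⟩
  · exact ⟨0, by simp, h0⟩

/-- An edge with distinct ends, as an arc with a prescribed orientation. -/
theorem exists_arc (f : SpatialEmbedding G) {e : β} {a b : α} (h : G.IsLink e a b) (hab : a ≠ b) :
    ∃ γ : ℝ → (Fin 4 → ℝ), IsPLOn γ (Set.Icc 0 1) ∧ Set.InjOn γ (Set.Icc 0 1) ∧ γ 0 = f.vertex a ∧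
      γ 1 = f.vertex b ∧ γ '' Set.Icc 0 1 = f.part {a, b} {e} := by
  have he := h.edge_mem
  have hne : f.vertex a ≠ f.vertex b := fun hf => hab (f.vertex_injOn h.left_mem h.right_mem hf)
  have hinj : Set.InjOn (f.edge e) (Set.Icc 0 1) := by
    have hend : ∀ c ∈ V(G), ∀ t ∈ Set.Ioo (0 : ℝ) 1, f.edge e t ≠ f.vertex c := fun c hc t ht =>
      f.edge_ne_vertex e he t ht c hc
    obtain ⟨p, hp, q, hq, h0, h1, hpq⟩ : ∃ p ∈ V(G), ∃ q ∈ V(G), f.edge e 0 = f.vertex p ∧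
        f.edge e 1 = f.vertex q ∧ f.vertex p ≠ f.vertex q := by
      rcases f.edge_ends_of_isLink h with ⟨h0, h1⟩ | ⟨h0, h1⟩
      · exact ⟨a, h.left_mem, b, h.right_mem, h0, h1, hne⟩
      · exact ⟨b, h.right_mem, a, h.left_mem, h0, h1, hne.symm⟩
    intro s hs t ht hst
    rcases eq_zero_or_eq_one_or_mem_Ioo hs with rfl | rfl | hs' <;>
    rcases eq_zero_or_eq_one_or_mem_Ioo ht with rfl | rfl | ht'
    · rfl
    · rw [h0, h1] at hst; exact absurd hst hpq
    · rw [h0] at hst; exact absurd hst.symm (hend p hp t ht')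
    · rw [h0, h1] at hst; exact absurd hst.symm hpq
    · rfl
    · rw [h1] at hst; exact absurd hst.symm (hend q hq t ht')
    · rw [h0] at hst; exact absurd hst (hend p hp s hs')
    · rw [h1] at hst; exact absurd hst (hend q hq s hs')
    · exact (f.edge_inj e he e he s hs' t ht' hst).2
  rw [f.part_link h]
  rcases f.edge_ends_of_isLink h with ⟨h0, h1⟩ | ⟨h0, h1⟩
  · exact ⟨f.edge e, f.edge_pl e he, hinj, h0, h1, rfl⟩
  · have hm : Set.MapsTo (fun r : ℝ => -1 * r + 1) (Set.Icc 0 1) (Set.Icc 0 1) := fun r hr =>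
      Set.mem_Icc.2 ⟨by linarith [hr.2], by linarith [hr.1]⟩
    refine ⟨fun r => f.edge e (-1 * r + 1), (f.edge_pl e he).comp_affine_Icc (-1) 1 hm,
      fun s hs t ht hst => ?_, ?_, ?_, ?_⟩
    · have := hinj (hm hs) (hm ht) hst
      linarith
    · norm_num [h1]
    · norm_num [h0]
    · ext x
      constructor
      · rintro ⟨r, hr, rfl⟩; exact ⟨_, hm hr, rfl⟩
      · rintro ⟨r, hr, rfl⟩
        exact ⟨-1 * r + 1, hm hr, by simp only; congr 1; ring⟩

/-- The spatial embedding followed by a piecewise linear homeomorphism of the sphere. -/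
def mapHomeo (f : SpatialEmbedding G) {H : (Fin 4 → ℝ) → (Fin 4 → ℝ)} (hH : IsPLHomeo H) :
    SpatialEmbedding G where
  vertex a := H (f.vertex a)
  edge e t := H (f.edge e t)
  vertex_mem a ha := hH.2.mapsTo (f.vertex_mem a ha)
  edge_mem e he t ht := hH.2.mapsTo (f.edge_mem e he t ht)
  edge_pl e he := hH.1.comp (f.edge_pl e he) (f.edge_mem e he)
  edge_ends e he := by
    obtain ⟨a, b, h, h0, h1⟩ := f.edge_ends e he
    exact ⟨a, b, h, by rw [h0], by rw [h1]⟩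
  vertex_injOn a ha b hb hab :=
    f.vertex_injOn ha hb (hH.2.injOn (f.vertex_mem a ha) (f.vertex_mem b hb) hab)
  edge_inj e he e' he' s hs t ht hst :=
    f.edge_inj e he e' he' s hs t ht (hH.2.injOn (f.edge_mem e he s (Set.Ioo_subset_Icc_self hs))
      (f.edge_mem e' he' t (Set.Ioo_subset_Icc_self ht)) hst)
  edge_ne_vertex e he t ht a ha heq :=
    f.edge_ne_vertex e he t ht a ha (hH.2.injOn (f.edge_mem e he t (Set.Ioo_subset_Icc_self ht))
      (f.vertex_mem a ha) heq)

theorem part_mapHomeo (f : SpatialEmbedding G) {H : (Fin 4 → ℝ) → (Fin 4 → ℝ)} (hH : IsPLHomeo H)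
    (V : Set α) (E : Set β) : (f.mapHomeo hH).part V E = H '' f.part V E := by
  simp only [part, mapHomeo, Set.image_union, Set.image_iUnion₂, Set.image_image]

/-! ### Knotted or linked spatial embeddings -/

/-- The images of `C` and `D` form a nonsplittable link. -/
def IsLinkedPair (f : SpatialEmbedding G) (C D : Graph α β) : Prop :=
  Disjoint V(C) V(D) ∧ ¬ IsSplittable (f.image C) (f.image D)

/-- The image of `f` contains a nontrivial knot or a completely linked `3`-component link. -/
def IsKnottedOrLinked (f : SpatialEmbedding G) : Prop :=
  (∃ C, IsCycleOf C G ∧ ¬ IsTrivialKnot (f.image C)) ∨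
    ∃ C₁ C₂ C₃, IsCycleOf C₁ G ∧ IsCycleOf C₂ G ∧ IsCycleOf C₃ G ∧
      f.IsLinkedPair C₁ C₂ ∧ f.IsLinkedPair C₁ C₃ ∧ f.IsLinkedPair C₂ C₃

theorem IsLinkedPair.symm {f : SpatialEmbedding G} {C D : Graph α β} (h : f.IsLinkedPair C D) :
    f.IsLinkedPair D C :=
  ⟨h.1.symm, fun h' => h.2 h'.symm⟩

end SpatialEmbedding

theorem isIKorC3L_iff : IsIKorC3L G ↔ ∀ f : SpatialEmbedding G, f.IsKnottedOrLinked := by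
  refine forall_congr' fun f => or_congr Iff.rfl ?_
  refine exists_congr fun C₁ => exists_congr fun C₂ => exists_congr fun C₃ => ?_
  unfold SpatialEmbedding.IsLinkedPair
  tauto

/-- Knottedness or linkedness is inherited along a correspondence of cycles which respects
nontrivial knots and nonsplittable links. -/
theorem SpatialEmbedding.IsKnottedOrLinked.transfer {G' : Graph α' β'} {f : SpatialEmbedding G}
    {f' : SpatialEmbedding G'} (hf : f.IsKnottedOrLinked)
    (R : Graph α β → Graph α' β' → Prop)
    (hknot : ∀ C, IsCycleOf C G → ¬ IsTrivialKnot (f.image C) →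
      ∃ C', IsCycleOf C' G' ∧ ¬ IsTrivialKnot (f'.image C'))
    (hlink : ∀ C D, IsCycleOf C G → IsCycleOf D G → f.IsLinkedPair C D → ∃ C', R C C')
    (hR : ∀ C C', IsCycleOf C G → R C C' → IsCycleOf C' G')
    (hRR : ∀ C D C' D', IsCycleOf C G → IsCycleOf D G → R C C' → R D D' → f.IsLinkedPair C D →
      f'.IsLinkedPair C' D') : f'.IsKnottedOrLinked := by
  rcases hf with ⟨C, hC, hCk⟩ | ⟨C₁, C₂, C₃, h1, h2, h3, h12, h13, h23⟩
  · exact Or.inl (hknot C hC hCk)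
  · obtain ⟨D₁, hD₁⟩ := hlink C₁ C₂ h1 h2 h12
    obtain ⟨D₂, hD₂⟩ := hlink C₂ C₃ h2 h3 h23
    obtain ⟨D₃, hD₃⟩ := hlink C₃ C₂ h3 h2 h23.symm
    exact Or.inr ⟨D₁, D₂, D₃, hR _ _ h1 hD₁, hR _ _ h2 hD₂, hR _ _ h3 hD₃,
      hRR _ _ _ _ h1 h2 hD₁ hD₂ h12, hRR _ _ _ _ h1 h3 hD₁ hD₃ h13, hRR _ _ _ _ h2 h3 hD₂ hD₃ h23⟩

theorem SpatialEmbedding.isKnottedOrLinked_of_mapHomeo {f : SpatialEmbedding G}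
    {H : (Fin 4 → ℝ) → (Fin 4 → ℝ)} (hH : IsPLHomeo H) (h : (f.mapHomeo hH).IsKnottedOrLinked) :
    f.IsKnottedOrLinked := by
  have him : ∀ C, (f.mapHomeo hH).image C = H '' f.image C := fun C => f.part_mapHomeo hH _ _
  refine h.transfer Eq (fun C hC hk => ⟨C, hC, fun ht => hk ?_⟩) (fun C _ _ _ _ => ⟨C, rfl⟩)
    (fun C C' hC h => h ▸ hC) fun C D C' D' hC hD h1 h2 hCD => ?_
  · rw [him]; exact ht.image hH
  · subst h1 h2
    refine ⟨hCD.1, fun hs => hCD.2 ?_⟩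
    rw [him, him]
    exact hs.image (f.image_subset_threeSphere hC.1) (f.image_subset_threeSphere hD.1) hH

/-! ### Cycles -/

theorem exists_isCycleOf {n : ℕ} {v : Fin (n + 1) → α} {e : Fin (n + 1) → β}
    (hv : Function.Injective v) (he : Function.Injective e)
    (h : ∀ i, G.IsLink (e i) (v i) (v (i + 1))) :
    ∃ C, IsCycleOf C G ∧ V(C) = Set.range v ∧ E(C) = Set.range e := by
  set C := (G.restrict (Set.range e)).induce (Set.range v) with hC
  have hl : ∀ i, C.IsLink (e i) (v i) (v (i + 1)) := fun i =>
    ⟨⟨⟨i, rfl⟩, h i⟩, ⟨i, rfl⟩, ⟨i + 1, rfl⟩⟩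
  have hle : C ≤ G := by
    refine ⟨?_, fun e' a b hab => hab.1.2⟩
    rintro _ ⟨i, rfl⟩
    exact (h i).left_mem
  have hE : E(C) = Set.range e := by
    ext e'
    constructor
    · intro h'
      obtain ⟨a, b, hab⟩ := C.exists_isLink_of_mem_edgeSet h'
      exact hab.1.1
    · rintro ⟨i, rfl⟩
      exact (hl i).edge_mem
  exact ⟨C, ⟨hle, n, v, e, hv, he, hl, rfl, hE⟩, rfl, hE⟩

theorem IsCycleOf.of_le {C H : Graph α β} (h : IsCycleOf C G) (hC : C ≤ H) : IsCycleOf C H :=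
  ⟨hC, h.2⟩

/-- A vertex of a cycle is incident with a loop or with two edges of the cycle. -/
theorem IsCycleOf.exists_inc {C : Graph α β} (h : IsCycleOf C G) {x : α} (hx : x ∈ V(C)) :
    (∃ e, C.IsLink e x x) ∨ ∃ e e', e ≠ e' ∧ C.Inc e x ∧ C.Inc e' x := by
  obtain ⟨-, n, v, e, hv, he, hl, hV, hE⟩ := h
  rw [hV] at hx
  obtain ⟨i, rfl⟩ := hx
  rcases Nat.eq_zero_or_pos n with rfl | hn
  · left
    have := hl i
    rw [show i + 1 = i from Fin.ext (by omega)] at this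
    exact ⟨_, this⟩
  · right
    have h1 := hl (i - 1)
    rw [sub_add_cancel] at h1
    refine ⟨e i, e (i - 1), fun h => ?_, (hl i).inc_left, h1.inc_right⟩
    have h2 := he h
    have h3 : (1 : Fin (n + 1)) = 0 := by
      have := congrArg (fun j => i - j) h2
      simpa using this.symm
    have := congrArg Fin.val h3
    rw [Fin.val_one', Fin.val_zero, Nat.mod_eq_of_lt (by omega)] at this
    omega

/-- The property of being intrinsically knotted or completely `3`-linked passes to every graph
containing a copy of the given one, whose edges may have other names. -/
theorem IsIKorC3L.of_embedding {G : Graph α β} {G' : Graph α β'} (h : IsIKorC3L G) (ρ : β → β')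
    (hρ : Set.InjOn ρ E(G)) (hV : V(G) ⊆ V(G'))
    (hl : ∀ e a b, G.IsLink e a b → G'.IsLink (ρ e) a b) : IsIKorC3L G' := by
  rw [isIKorC3L_iff] at h ⊢
  intro f'
  have hE : ∀ e ∈ E(G), ρ e ∈ E(G') := fun e he => by
    obtain ⟨a, b, hab⟩ := G.exists_isLink_of_mem_edgeSet he
    exact (hl e a b hab).edge_mem
  let f : SpatialEmbedding G :=
    { vertex := f'.vertex
      edge := fun e => f'.edge (ρ e)
      vertex_mem := fun a ha => f'.vertex_mem a (hV ha)
      edge_mem := fun e he => f'.edge_mem (ρ e) (hE e he)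
      edge_pl := fun e he => f'.edge_pl (ρ e) (hE e he)
      edge_ends := fun e he => by
        obtain ⟨a, b, hab⟩ := G.exists_isLink_of_mem_edgeSet he
        rcases f'.edge_ends_of_isLink (hl e a b hab) with h' | h'
        · exact ⟨a, b, hab, h'⟩
        · exact ⟨b, a, hab.symm, h'⟩
      vertex_injOn := f'.vertex_injOn.mono hV
      edge_inj := fun e he e' he' s hs t ht hst => by
        obtain ⟨h1, h2⟩ := f'.edge_inj _ (hE e he) _ (hE e' he') s hs t ht hst
        exact ⟨hρ he he' h1, h2⟩
      edge_ne_vertex := fun e he t ht a ha => f'.edge_ne_vertex _ (hE e he) t ht a (hV ha) }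
  have hcyc : ∀ C, IsCycleOf C G → ∃ C', IsCycleOf C' G' ∧ V(C') = V(C) ∧ E(C') = ρ '' E(C) := by
    rintro C ⟨hle, n, v, e, hv, he, hCl, hCV, hCE⟩
    have he' : Function.Injective fun i => ρ (e i) := fun i j hij =>
      he (hρ (hle.edgeSet_mono (hCl i).edge_mem) (hle.edgeSet_mono (hCl j).edge_mem) hij)
    obtain ⟨C', h1, h2, h3⟩ := exists_isCycleOf (G := G') hv he' fun i =>
      hl _ _ _ ((hCl i).mono hle)
    exact ⟨C', h1, h2.trans hCV.symm, by rw [h3, hCE, ← Set.range_comp]; rfl⟩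
  have him : ∀ (C : Graph α β) (C' : Graph α β'), V(C') = V(C) → E(C') = ρ '' E(C) →
      f'.image C' = f.image C := by
    intro C C' h1 h2
    rw [SpatialEmbedding.image, SpatialEmbedding.image, h1, h2, Set.biUnion_image]
  refine (h f).transfer (fun C C' => IsCycleOf C' G' ∧ V(C') = V(C) ∧ E(C') = ρ '' E(C))
    (fun C hC hk => ?_) (fun C _ hC _ _ => hcyc C hC) (fun C C' _ h => h.1)
    fun C D C' D' _ _ h1 h2 hCD => ?_
  · obtain ⟨C', h1, h2, h3⟩ := hcyc C hC
    exact ⟨C', h1, by rwa [him C C' h2 h3]⟩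
  · refine ⟨by rw [h1.2.1, h2.2.1]; exact hCD.1, ?_⟩
    rw [him C C' h1.2.1 h1.2.2, him D D' h2.2.1 h2.2.2]
    exact hCD.2

end SpatialGraph
namespace SpatialGraph
open scoped Graph

/-! ### Paths and cycles -/

variable {α β : Type*} {G H : Graph α β}

/-- There is a path in `G` from the first to the second given vertex, whose sets of vertices and
edges are the given ones. -/
inductive IsPath (G : Graph α β) : α → α → Set α → Set β → Prop
  | nil {a : α} (ha : a ∈ V(G)) : IsPath G a a {a} ∅
  | cons {e : β} {a b c : α} {V : Set α} {E : Set β} (h : G.IsLink e a b) (hp : IsPath G b c V E)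
      (ha : a ∉ V) : IsPath G a c (insert a V) (insert e E)

namespace IsPath

variable {a b c : α} {e : β} {V : Set α} {E : Set β}

theorem left_mem (h : IsPath G a b V E) : a ∈ V := by
  cases h <;> simp

theorem right_mem (h : IsPath G a b V E) : b ∈ V := by
  induction h with
  | nil => rfl
  | cons _ _ _ ih => exact Or.inr ih

theorem isPart (h : IsPath G a b V E) : IsPart G V E := by
  induction h with
  | nil ha => exact isPart_vertices (Set.singleton_subset_iff.2 ha)
  | @cons e a b c V E h hp ha ih =>
    have := (isPart_link h).union ih
    have hV : ({a, b} : Set α) ∪ V = insert a V := by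
      rw [Set.insert_union, Set.singleton_union, Set.insert_eq_of_mem hp.left_mem]
    rwa [hV, Set.singleton_union] at this

theorem eq_of_closed (h : IsPath G a a V E) : V = {a} ∧ E = ∅ := by
  cases h with
  | nil => exact ⟨rfl, rfl⟩
  | cons _ hp ha => exact absurd hp.right_mem ha

theorem transfer (h : IsPath G a b V E) (hV : V ⊆ V(H))
    (hE : ∀ e ∈ E, ∀ x y, G.IsLink e x y → H.IsLink e x y) : IsPath H a b V E := by
  induction h with
  | nil ha => exact .nil (hV rfl)
  | cons h hp ha ih =>
    exact .cons (hE _ (Or.inl rfl) _ _ h) (ih ((Set.subset_insert _ _).trans hV)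
      fun e he => hE e (Or.inr he)) ha

theorem snoc (hp : IsPath G a b V E) (h : G.IsLink e b c) (hc : c ∉ V) :
    IsPath G a c (insert c V) (insert e E) := by
  induction hp with
  | @nil b hb =>
    have := IsPath.cons h (.nil h.right_mem) (fun hbc : b = c => hc hbc.symm)
    rwa [Set.pair_comm] at this
  | @cons e' a b b' V E h' hp ha ih =>
    rw [Set.insert_comm, Set.insert_comm e]
    refine .cons h' (ih h fun h => hc (Or.inr h)) ?_
    rintro (rfl | h)
    · exact hc (Or.inl rfl)
    · exact ha h

theorem symm (hp : IsPath G a b V E) : IsPath G b a V E := by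
  induction hp with
  | nil ha => exact .nil ha
  | cons h hp ha ih => exact ih.snoc h.symm ha

/-- An edge of a path at its initial vertex is its initial edge. -/
theorem uncons {x : α} (hp : IsPath G a c V E) (he : e ∈ E) (hl : G.IsLink e a x) :
    ∃ V' E', IsPath G x c V' E' ∧ a ∉ V' ∧ e ∉ E' ∧ V = insert a V' ∧ E = insert e E' := by
  cases hp with
  | nil => exact absurd he (Set.notMem_empty _)
  | @cons e' _ b _ V' E' h hp ha =>
    have hne : ∀ y, G.IsLink e a y → e ∉ E' := fun y hy he' => ha (hp.isPart.isLink he' hy).1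
    rcases he with rfl | he
    · rw [hl.right_unique h]
      exact ⟨V', E', hp, ha, hne _ h, rfl, rfl⟩
    · exact absurd he (hne _ hl)

theorem of_seq {w : ℕ → α} {g : ℕ → β} (n : ℕ) (h0 : w 0 ∈ V(G))
    (hl : ∀ k < n, G.IsLink (g k) (w k) (w (k + 1))) (hw : Set.InjOn w (Set.Iic n)) :
    IsPath G (w 0) (w n) (w '' Set.Iic n) (g '' Set.Iio n) := by
  induction n with
  | zero =>
    have h1 : Set.Iic 0 = {0} := by ext; simp
    have h2 : Set.Iio 0 = (∅ : Set ℕ) := by ext; simp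
    rw [h1, h2, Set.image_singleton, Set.image_empty]
    exact .nil h0
  | succ n ih =>
    have h1 : Set.Iic (n + 1) = insert (n + 1) (Set.Iic n) := by
      ext; simp only [Set.mem_Iic, Set.mem_insert_iff]; omega
    have h2 : Set.Iio (n + 1) = insert n (Set.Iio n) := by
      ext; simp only [Set.mem_Iio, Set.mem_insert_iff]; omega
    have hsub : Set.Iic n ⊆ Set.Iic (n + 1) := Set.Iic_subset_Iic.2 (Nat.le_succ n)
    rw [h1, h2, Set.image_insert_eq, Set.image_insert_eq]
    refine (ih (fun k hk => hl k (hk.trans (Nat.lt_succ_self n))) (hw.mono hsub)).snoc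
      (hl n (Nat.lt_succ_self n)) ?_
    rintro ⟨k, hk, hkn⟩
    have h3 := hw (hsub hk) (Set.mem_Iic.2 le_rfl) hkn
    have h4 : k ≤ n := hk
    omega

theorem exists_seq (hp : IsPath G a b V E) (e₀ : β) : ∃ (n : ℕ) (w : ℕ → α) (g : ℕ → β),
    w 0 = a ∧ w n = b ∧ Set.InjOn w (Set.Iic n) ∧ Set.InjOn g (Set.Iio n) ∧
    (∀ k < n, G.IsLink (g k) (w k) (w (k + 1))) ∧ V = w '' Set.Iic n ∧ E = g '' Set.Iio n := by
  induction hp with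
  | @nil a ha =>
    refine ⟨0, fun _ => a, fun _ => e₀, rfl, rfl, ?_, ?_, ?_, ?_, ?_⟩
    · intro i hi j hj _
      rw [Nat.le_zero.1 hi, Nat.le_zero.1 hj]
    · intro i hi
      exact absurd hi (Nat.not_lt_zero i)
    · intro i hi
      exact absurd hi (Nat.not_lt_zero i)
    · rw [Set.Nonempty.image_const ⟨0, Set.mem_Iic.2 le_rfl⟩]
    · ext x
      simp
  | @cons e a b c V E h hp ha ih =>
    have hne : e ∉ E := fun he => ha (hp.isPart.isLink he h).1
    obtain ⟨n, w, g, h0, hn, hw, hg, hl, rfl, rfl⟩ := ih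
    refine ⟨n + 1, fun | 0 => a | k + 1 => w k, fun | 0 => e | k + 1 => g k, rfl, hn, ?_, ?_,
      ?_, ?_, ?_⟩
    · rintro (_ | i) hi (_ | j) hj hij
      · rfl
      · exact absurd ⟨j, Nat.succ_le_succ_iff.1 hj, hij.symm⟩ ha
      · exact absurd ⟨i, Nat.succ_le_succ_iff.1 hi, hij⟩ ha
      · rw [hw (Nat.succ_le_succ_iff.1 hi) (Nat.succ_le_succ_iff.1 hj) hij]
    · rintro (_ | i) hi (_ | j) hj hij
      · rfl
      · exact absurd ⟨j, Nat.succ_lt_succ_iff.1 hj, hij.symm⟩ hne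
      · exact absurd ⟨i, Nat.succ_lt_succ_iff.1 hi, hij⟩ hne
      · rw [hg (Nat.succ_lt_succ_iff.1 hi) (Nat.succ_lt_succ_iff.1 hj) hij]
    · rintro (_ | k) hk
      · simp only [h0]; exact h
      · exact hl k (Nat.succ_lt_succ_iff.1 hk)
    · ext x
      constructor
      · rintro (rfl | ⟨k, hk, rfl⟩)
        · exact ⟨0, Nat.zero_le _, rfl⟩
        · exact ⟨k + 1, Nat.succ_le_succ hk, rfl⟩
      · rintro ⟨_ | k, hk, rfl⟩
        · exact Or.inl rfl
        · exact Or.inr ⟨k, Nat.succ_le_succ_iff.1 hk, rfl⟩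
    · ext x
      constructor
      · rintro (rfl | ⟨k, hk, rfl⟩)
        · exact ⟨0, Nat.succ_pos _, rfl⟩
        · exact ⟨k + 1, Nat.succ_lt_succ hk, rfl⟩
      · rintro ⟨_ | k, hk, rfl⟩
        · exact Or.inl rfl
        · exact Or.inr ⟨k, Nat.succ_lt_succ_iff.1 hk, rfl⟩

/-- A path is closed to a cycle by a further edge between its ends. -/
theorem exists_isCycleOf (hp : IsPath G a b V E) (h : G.IsLink e a b) (he : e ∉ E) :
    ∃ C, IsCycleOf C G ∧ V(C) = V ∧ E(C) = insert e E := by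
  obtain ⟨n, w, g, rfl, rfl, hw, hg, hl, rfl, rfl⟩ := hp.exists_seq e
  have hlt : ∀ i : Fin (n + 1), i ≠ Fin.last n → (i : ℕ) < n := fun i hi =>
    lt_of_le_of_ne (Nat.lt_succ_iff.1 i.2) fun h => hi (Fin.ext h)
  have key := SpatialGraph.exists_isCycleOf (G := G) (n := n) (v := fun i => w i)
    (e := fun i => if (i : ℕ) < n then g i else e) (fun i j hij => Fin.ext
      (hw (Nat.lt_succ_iff.1 i.2) (Nat.lt_succ_iff.1 j.2) hij)) (fun i j hij => by
      by_cases hi : (i : ℕ) < n <;> by_cases hj : (j : ℕ) < n <;> simp only [hi, hj, if_true,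
        if_false] at hij
      · exact Fin.ext (hg hi hj hij)
      · exact absurd ⟨_, hi, hij⟩ he
      · exact absurd ⟨_, hj, hij.symm⟩ he
      · exact Fin.ext (by omega)) (fun i => by
      by_cases hi : i = Fin.last n
      · subst hi
        simp only [Fin.val_last, lt_irrefl, if_false, Fin.last_add_one, Fin.val_zero]
        exact h.symm
      · have := hlt i hi
        simp only [this, if_true]
        rw [Fin.val_add_one_of_lt (Fin.lt_last_iff_ne_last.2 hi)]
        exact hl i this)
  obtain ⟨C, hC, hV, hE⟩ := key
  refine ⟨C, hC, hV.trans ?_, hE.trans ?_⟩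
  · ext x
    constructor
    · rintro ⟨i, rfl⟩
      exact ⟨i, Nat.lt_succ_iff.1 i.2, rfl⟩
    · rintro ⟨k, hk, rfl⟩
      exact ⟨⟨k, Nat.lt_succ_iff.2 hk⟩, rfl⟩
  · ext x
    constructor
    · rintro ⟨i, rfl⟩
      by_cases hi : (i : ℕ) < n
      · simp only [hi, if_true]; exact Or.inr ⟨i, hi, rfl⟩
      · simp only [hi, if_false]; exact Or.inl rfl
    · rintro (rfl | ⟨k, hk, rfl⟩)
      · exact ⟨Fin.last n, by simp⟩
      · have hk' : k < n := hk
        exact ⟨⟨k, hk'.trans (Nat.lt_succ_self n)⟩, by simp [hk']⟩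

end IsPath

/-- The complement of an edge in a cycle is a path between the ends of this edge. -/
theorem IsCycleOf.exists_isPath {C : Graph α β} (hC : IsCycleOf C G) {e : β} {a b : α}
    (he : C.IsLink e a b) : ∃ E, IsPath C a b V(C) E ∧ e ∉ E ∧ E(C) = insert e E := by
  obtain ⟨-, n, v, d, hv, hd, hl, hV, hE⟩ := hC
  obtain ⟨i, rfl⟩ : e ∈ Set.range d := hE ▸ he.edge_mem
  -- The indices in cyclic order, beginning after `i` and ending at `i`.
  set s : ℕ → Fin (n + 1) := fun k => i + Fin.ofNat (n + 1) (k + 1) with hs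
  have hval : ∀ k ≤ n, (Fin.ofNat (n + 1) k : ℕ) = k := fun k hk =>
    Nat.mod_eq_of_lt (Nat.lt_succ_iff.2 hk)
  have hadd : ∀ k, s k + 1 = s (k + 1) := fun k => by
    rw [hs]
    simp only
    rw [add_assoc]
    congr 1
    apply Fin.ext
    simp [Fin.val_add]
  have h0 : s 0 = i + 1 := by
    rw [hs]
    simp only
    congr 1
  have hn : s n = i := by
    rw [hs]
    simp only
    have : Fin.ofNat (n + 1) (n + 1) = 0 := by apply Fin.ext; simp
    rw [this, add_zero]
  have hsinj : Set.InjOn s (Set.Iic n) := by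
    intro j hj k hk hjk
    have h1 : s j + i + Fin.ofNat (n + 1) n = s k + i + Fin.ofNat (n + 1) n := by rw [hjk]
    have hsh : ∀ j ≤ n, Fin.ofNat (n + 1) (j + 1) + Fin.ofNat (n + 1) n = Fin.ofNat (n + 1) j := by
      intro j hj
      apply Fin.ext
      rw [Fin.val_add, hval n le_rfl, hval j hj]
      simp only [Fin.ofNat, Nat.mod_add_mod]
      rw [show j + 1 + n = j + (n + 1) by ring, Nat.add_mod_right, Nat.mod_eq_of_lt (by omega)]
    have h2 := add_left_cancel hjk
    have h3 : Fin.ofNat (n + 1) j = Fin.ofNat (n + 1) k := by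
      rw [← hsh j hj, ← hsh k hk, h2]
    have := congrArg Fin.val h3
    rwa [hval j hj, hval k hk] at this
  have hsurj : ∀ j, ∃ k ≤ n, s k = j := fun j => by
    have hcard : (s '' (Finset.Iic n : Finset ℕ)) = Set.univ := by
      rw [← Finset.coe_image, ← Finset.coe_univ, Finset.coe_inj]
      apply Finset.eq_univ_of_card
      rw [Finset.card_image_of_injOn (by simpa using hsinj)]
      simp
    obtain ⟨k, hk, rfl⟩ : j ∈ s '' (Finset.Iic n : Finset ℕ) := hcard ▸ Set.mem_univ j
    exact ⟨k, by simpa using hk, rfl⟩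
  have hpath := IsPath.of_seq (G := C) (w := fun k => v (s k)) (g := fun k => d (s k)) n
    (hl (s 0)).left_mem (fun k _ => by
      have := hl (s k)
      rwa [hadd] at this) (fun j hj k hk hjk => hsinj hj hk (hv hjk))
  have hVim : (fun k => v (s k)) '' Set.Iic n = V(C) := by
    rw [hV]
    ext x
    constructor
    · rintro ⟨k, -, rfl⟩; exact ⟨_, rfl⟩
    · rintro ⟨j, rfl⟩
      obtain ⟨k, hk, rfl⟩ := hsurj j
      exact ⟨k, hk, rfl⟩
  simp only [hVim, h0, hn] at hpath
  refine ⟨(fun k => d (s k)) '' Set.Iio n, ?_, ?_, ?_⟩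
  · rcases he.eq_and_eq_or_eq_and_eq (hl i) with ⟨rfl, rfl⟩ | ⟨rfl, rfl⟩
    · exact hpath.symm
    · exact hpath
  · rintro ⟨k, hk, hki⟩
    have h1 : s k = s n := by rw [hn]; exact hd hki
    have h2 : k < n := hk
    have := hsinj (Set.mem_Iic.2 h2.le) (Set.mem_Iic.2 le_rfl) h1
    omega
  · rw [hE]
    ext x
    constructor
    · rintro ⟨j, rfl⟩
      obtain ⟨k, hk, rfl⟩ := hsurj j
      rcases hk.eq_or_lt with rfl | hk
      · rw [hn]; exact Or.inl rfl
      · exact Or.inr ⟨k, hk, rfl⟩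
    · rintro (rfl | ⟨k, -, rfl⟩)
      · exact ⟨_, rfl⟩
      · exact ⟨_, rfl⟩

end SpatialGraph
namespace SpatialGraph
open scoped Graph

/-! ### Adding an edge to a spatial embedding -/

variable {α β : Type*} {G G' : Graph α β} {e₀ : β} {u v x : α}

/-- `G'` is obtained from `G` by adding the edge `e₀` from `u` to `v`. -/
structure IsAddEdge (G G' : Graph α β) (e₀ : β) (u v : α) : Prop where
  vertexSet_eq : V(G') = V(G)
  notMem : e₀ ∉ E(G)
  left_mem : u ∈ V(G)
  right_mem : v ∈ V(G)
  isLink_iff : ∀ e a b, G'.IsLink e a b ↔ G.IsLink e a b ∨ (e = e₀ ∧ s(a, b) = s(u, v))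

namespace IsAddEdge

theorem isLink (h : IsAddEdge G G' e₀ u v) : G'.IsLink e₀ u v :=
  (h.isLink_iff _ _ _).2 (Or.inr ⟨rfl, rfl⟩)

theorem le (h : IsAddEdge G G' e₀ u v) : G ≤ G' :=
  ⟨h.vertexSet_eq.symm.subset, fun _ _ _ h' => (h.isLink_iff _ _ _).2 (Or.inl h')⟩

theorem isLink_of_ne (h : IsAddEdge G G' e₀ u v) {e : β} (he : e ≠ e₀) {a b : α}
    (hl : G'.IsLink e a b) : G.IsLink e a b :=
  ((h.isLink_iff _ _ _).1 hl).resolve_right fun h' => he h'.1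

theorem mem_of_ne (h : IsAddEdge G G' e₀ u v) {e : β} (he : e ≠ e₀) (h' : e ∈ E(G')) :
    e ∈ E(G) := by
  obtain ⟨a, b, hab⟩ := G'.exists_isLink_of_mem_edgeSet h'
  exact (h.isLink_of_ne he hab).edge_mem

/-- A cycle which does not use the added edge is a cycle of the original graph. -/
theorem isCycleOf_of_notMem (h : IsAddEdge G G' e₀ u v) {C : Graph α β} (hC : IsCycleOf C G')
    (he : e₀ ∉ E(C)) : IsCycleOf C G := by
  refine hC.of_le ⟨hC.1.vertexSet_mono.trans h.vertexSet_eq.subset, fun e a b hab => ?_⟩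
  exact h.isLink_of_ne (fun hee => he (hee ▸ hab.edge_mem)) (hab.mono hC.1)

/-- What remains of a cycle through the added edge is a path of the original graph. -/
theorem exists_isPath (h : IsAddEdge G G' e₀ u v) {C : Graph α β} (hC : IsCycleOf C G')
    (he : e₀ ∈ E(C)) : ∃ E, IsPath G u v V(C) E ∧ E(C) = insert e₀ E := by
  have hl : C.IsLink e₀ u v := (hC.1.isLink_iff he).2 h.isLink
  obtain ⟨E, hp, hne, hE⟩ := hC.exists_isPath hl
  refine ⟨E, hp.transfer (hC.1.vertexSet_mono.trans h.vertexSet_eq.subset) fun e he' a b hab =>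
    h.isLink_of_ne (fun hee => hne (hee ▸ he')) (hab.mono hC.1), hE⟩

end IsAddEdge

namespace SpatialEmbedding

open Classical in
/-- The extension of a spatial embedding by a path which represents the added edge. -/
noncomputable def addEdge (f : SpatialEmbedding G) (h : IsAddEdge G G' e₀ u v) (γ : ℝ → (Fin 4 → ℝ))
    (hγ : IsPLOn γ (Set.Icc 0 1)) (hγS : Set.MapsTo γ (Set.Icc 0 1) threeSphere)
    (hinj : Set.InjOn γ (Set.Ioo 0 1)) (h0 : γ 0 = f.vertex u) (h1 : γ 1 = f.vertex v)
    (hd : ∀ t ∈ Set.Ioo (0 : ℝ) 1, γ t ∉ f.part V(G) E(G)) : SpatialEmbedding G' where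
  vertex := f.vertex
  edge := Function.update f.edge e₀ γ
  vertex_mem a ha := f.vertex_mem a (h.vertexSet_eq ▸ ha)
  edge_mem e he := by
    by_cases hee : e = e₀
    · intro t ht; rw [hee, Function.update_self]; exact hγS ht
    · rw [Function.update_of_ne hee]; exact f.edge_mem e (h.mem_of_ne hee he)
  edge_pl e he := by
    by_cases hee : e = e₀
    · subst hee; simpa using hγ
    · rw [Function.update_of_ne hee]; exact f.edge_pl e (h.mem_of_ne hee he)
  edge_ends e he := by
    by_cases hee : e = e₀
    · subst hee; simpa using ⟨u, v, h.isLink, h0, h1⟩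
    · rw [Function.update_of_ne hee]
      obtain ⟨a, b, hab, h'⟩ := f.edge_ends e (h.mem_of_ne hee he)
      exact ⟨a, b, hab.mono h.le, h'⟩
  vertex_injOn := h.vertexSet_eq ▸ f.vertex_injOn
  edge_inj e he e' he' s hs t ht hst := by
    have hmem : ∀ e ∈ E(G), ∀ s ∈ Set.Ioo (0 : ℝ) 1, f.edge e s ∈ f.part V(G) E(G) :=
      fun e he s hs => Or.inr (Set.mem_biUnion he ⟨s, Set.Ioo_subset_Icc_self hs, rfl⟩)
    by_cases hee : e = e₀ <;> by_cases hee' : e' = e₀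
    · rw [hee, hee', Function.update_self] at hst
      exact ⟨hee.trans hee'.symm, hinj hs ht hst⟩
    · rw [hee, Function.update_self, Function.update_of_ne hee'] at hst
      exact absurd (hst ▸ hmem e' (h.mem_of_ne hee' he') t ht) (hd s hs)
    · rw [hee', Function.update_self, Function.update_of_ne hee] at hst
      exact absurd (hst ▸ hmem e (h.mem_of_ne hee he) s hs) (hd t ht)
    · rw [Function.update_of_ne hee, Function.update_of_ne hee'] at hst
      exact f.edge_inj e (h.mem_of_ne hee he) e' (h.mem_of_ne hee' he') s hs t ht hst
  edge_ne_vertex e he t ht a ha := by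
    rw [h.vertexSet_eq] at ha
    by_cases hee : e = e₀
    · rw [hee, Function.update_self]
      intro heq
      exact hd t ht (heq ▸ Or.inl ⟨a, ha, rfl⟩)
    · rw [Function.update_of_ne hee]
      exact f.edge_ne_vertex e (h.mem_of_ne hee he) t ht a ha

section AddEdge
variable (f : SpatialEmbedding G) (h : IsAddEdge G G' e₀ u v) (γ : ℝ → (Fin 4 → ℝ))
    (hγ : IsPLOn γ (Set.Icc 0 1)) (hγS : Set.MapsTo γ (Set.Icc 0 1) threeSphere)
    (hinj : Set.InjOn γ (Set.Ioo 0 1)) (h0 : γ 0 = f.vertex u) (h1 : γ 1 = f.vertex v)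
    (hd : ∀ t ∈ Set.Ioo (0 : ℝ) 1, γ t ∉ f.part V(G) E(G))

theorem part_addEdge (V : Set α) {E : Set β} (hE : e₀ ∉ E) :
    (f.addEdge h γ hγ hγS hinj h0 h1 hd).part V E = f.part V E := by
  have : ∀ e ∈ E, (f.addEdge h γ hγ hγS hinj h0 h1 hd).edge e = f.edge e := fun e he => by
    have hee : e ≠ e₀ := fun hee => hE (hee ▸ he)
    simp [addEdge, hee]
  unfold part
  congr 1
  exact Set.iUnion₂_congr fun e he => by rw [this e he]

theorem part_addEdge_insert (V : Set α) {E : Set β} (hE : e₀ ∉ E) :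
    (f.addEdge h γ hγ hγS hinj h0 h1 hd).part V (insert e₀ E) = γ '' Set.Icc 0 1 ∪ f.part V E := by
  have h2 : (f.addEdge h γ hγ hγS hinj h0 h1 hd).edge e₀ = γ := by
    simp [addEdge]
  have h3 := f.part_addEdge h γ hγ hγS hinj h0 h1 hd V hE
  unfold part at h3 ⊢
  rw [Set.biUnion_insert, h2, Set.union_left_comm, h3]

/-- The replacement of the cycles through an added edge by cycles of the original graph, for
the transfer of knottedness and linkedness. -/
theorem isKnottedOrLinked_of_addEdge (hVfin : V(G).Finite) (hEfin : E(G).Finite)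
    (hf : (f.addEdge h γ hγ hγS hinj h0 h1 hd).IsKnottedOrLinked)
    (key : ∀ C E, IsCycleOf C G' → IsPath G u v V(C) E → E(C) = insert e₀ E →
      (IsTrivialKnot (γ '' Set.Icc 0 1 ∪ f.part V(C) E) ∧
        ∀ V' E', IsPart G V' E' → IsSegUnion (f.part V' E') → Disjoint V(C) V' →
          IsSplittable (γ '' Set.Icc 0 1 ∪ f.part V(C) E) (f.part V' E')) ∨
      ∃ C', IsCycleOf C' G ∧
        (∀ D, IsCycleOf D G → Disjoint V(C) V(D) → Disjoint V(C') V(D)) ∧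
        ∀ V' E', IsPart G V' E' → IsSegUnion (f.part V' E') → Disjoint V(C) V' →
          Disjoint V(C') V' → ∃ H, IsPLHomeo H ∧ (∀ z ∈ f.part V' E', H z = z) ∧
            H '' (γ '' Set.Icc 0 1 ∪ f.part V(C) E) = f.image C') : f.IsKnottedOrLinked := by
  set f' := f.addEdge h γ hγ hγS hinj h0 h1 hd with hf'
  have him : ∀ D, e₀ ∉ E(D) → f'.image D = f.image D := fun D hD =>
    f.part_addEdge h γ hγ hγS hinj h0 h1 hd V(D) hD
  have himC : ∀ C E, IsPath G u v V(C) E → E(C) = insert e₀ E →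
      f'.image C = γ '' Set.Icc 0 1 ∪ f.part V(C) E := fun C E hp hCE => by
    have := f.part_addEdge_insert h γ hγ hγS hinj h0 h1 hd V(C)
      (fun he => h.notMem (hp.isPart.2.1 he))
    rw [← hCE] at this
    exact this
  have hS' : ∀ {C}, IsCycleOf C G' → f'.image C ⊆ threeSphere := fun hC =>
    f'.image_subset_threeSphere hC.1
  have hseg : ∀ {D}, IsCycleOf D G → IsSegUnion (f.part V(D) E(D)) := fun hD =>
    f.isSegUnion_part (hVfin.subset hD.1.vertexSet_mono) (hEfin.subset hD.1.edgeSet_mono)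
      hD.1.edgeSet_mono
  -- The image of a cycle `C` through the new edge, as seen from any cycle `D` disjoint from it, is
  -- the image of the cycle `C'` of `G`.
  set R : Graph α β → Graph α β → Prop := fun C C' => (e₀ ∉ E(C) ∧ C' = C) ∨
    (e₀ ∈ E(C) ∧ IsCycleOf C' G ∧ ∀ D, IsCycleOf D G → f'.IsLinkedPair C D →
      f.IsLinkedPair C' D) with hR
  have hmain : ∀ C, IsCycleOf C G' → e₀ ∈ E(C) →
      (IsTrivialKnot (f'.image C) ∧ ∀ D, IsCycleOf D G → ¬ f'.IsLinkedPair C D) ∨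
      ∃ C', R C C' ∧ IsCycleOf C' G ∧
        (IsTrivialKnot (f.image C') → IsTrivialKnot (f'.image C)) := by
    intro C hC he
    obtain ⟨E, hp, hCE⟩ := h.exists_isPath hC he
    have hCim := himC C E hp hCE
    have hDim : ∀ {D}, IsCycleOf D G → f'.image D = f.part V(D) E(D) := fun {D} hD =>
      him D fun he => h.notMem (hD.1.edgeSet_mono he)
    have hempty : f.part (∅ : Set α) (∅ : Set β) = ∅ := by simp [part]
    rcases key C E hC hp hCE with ⟨h1, h2⟩ | ⟨C', hC', hdis, hH⟩
    · left
      rw [hCim]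
      refine ⟨h1, fun D hD hCD => hCD.2 ?_⟩
      rw [hCim, hDim hD]
      exact h2 _ _ (isPart_of_le hD.1) (hseg hD) hCD.1
    · right
      refine ⟨C', Or.inr ⟨he, hC', fun D hD hCD => ⟨hdis D hD hCD.1, fun hs => hCD.2 ?_⟩⟩, hC',
        fun ht => ?_⟩
      · obtain ⟨H, hHh, hfix, hHim⟩ := hH _ _ (isPart_of_le hD.1) (hseg hD) hCD.1
          (hdis D hD hCD.1)
        rw [← hCim] at hHim
        have hid : H '' f.image D = f.image D := by
          have : Set.EqOn H id (f.image D) := hfix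
          rw [this.image_eq, Set.image_id]
        rw [← hHim, ← hid] at hs
        rw [hDim hD]
        exact (isSplittable_image_iff (hS' hC) (f.image_subset_threeSphere hD.1) hHh).1 hs
      -- For a single cycle, the homeomorphism need not fix anything.
      · obtain ⟨H, hHh, -, hHim⟩ := hH ∅ ∅ (isPart_vertices (Set.empty_subset _))
          (by rw [hempty]; exact isSegUnion_empty) (Set.disjoint_empty _) (Set.disjoint_empty _)
        rw [← hHim, ← hCim] at ht
        exact (isTrivialKnot_image_iff (hS' hC) hHh).1 ht
  refine hf.transfer R (fun C hC hk => ?_) (fun C D hC hD hCD => ?_) (fun C C' hC hCC' => ?_)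
    fun C D C' D' hC hD hCC' hDD' hCD => ?_
  · by_cases he : e₀ ∈ E(C)
    · rcases hmain C hC he with ⟨h1, -⟩ | ⟨C', -, hC', ht⟩
      · exact absurd h1 hk
      · exact ⟨C', hC', fun h' => hk (ht h')⟩
    · exact ⟨C, h.isCycleOf_of_notMem hC he, by rwa [← him C he]⟩
  · by_cases he : e₀ ∈ E(C)
    · rcases hmain C hC he with ⟨-, h2⟩ | ⟨C', hCC', -⟩
      · refine absurd hCD (h2 D (h.isCycleOf_of_notMem hD fun he' => ?_))
        have h1 := ((hC.1.isLink_iff he).2 h.isLink).left_mem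
        have h2 := ((hD.1.isLink_iff he').2 h.isLink).left_mem
        exact Set.disjoint_left.1 hCD.1 h1 h2
      · exact ⟨C', hCC'⟩
    · exact ⟨C, Or.inl ⟨he, rfl⟩⟩
  · rcases hCC' with ⟨he, rfl⟩ | ⟨-, hC', -⟩
    · exact h.isCycleOf_of_notMem hC he
    · exact hC'
  · rcases hCC' with ⟨he, rfl⟩ | ⟨he, -, hC'⟩ <;> rcases hDD' with ⟨he', rfl⟩ | ⟨he', -, hD'⟩
    · refine ⟨hCD.1, ?_⟩
      rw [← him _ he, ← him _ he']
      exact hCD.2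
    · exact (hD' _ (h.isCycleOf_of_notMem hC he) hCD.symm).symm
    · exact hC' _ (h.isCycleOf_of_notMem hD he') hCD
    · have h1 := ((hC.1.isLink_iff he).2 h.isLink).left_mem
      have h2 := ((hD.1.isLink_iff he').2 h.isLink).left_mem
      exact absurd h2 (Set.disjoint_left.1 hCD.1 h1)

end AddEdge

end SpatialEmbedding

/-- A loop may be added to a graph without making it intrinsically knotted or completely
`3`-linked: it is embedded as the boundary of a small disk. -/
theorem IsIKorC3L.of_add_loop (hG' : IsIKorC3L G') (h : IsAddEdge G G' e₀ u u)
    (hVfin : V(G).Finite) (hEfin : E(G).Finite) : IsIKorC3L G := by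
  rw [isIKorC3L_iff] at hG' ⊢
  intro f
  obtain ⟨κ, hκ, hκu, hκX⟩ := exists_isFlatDisk_point (f.vertex_mem u h.left_mem)
    (f.isSegUnion_part hVfin hEfin le_rfl) (f.part_subset_threeSphere le_rfl le_rfl)
  have hγ : IsPLOn (κ ∘ boundaryPath) (Set.Icc 0 1) :=
    (hκ.isPLOn isPLOn_boundaryPath.isPolyhedron_image).comp isPLOn_boundaryPath
      (Set.mapsTo_image _ _)
  have him : (κ ∘ boundaryPath) '' Set.Icc 0 1 = κ '' diamondBoundary := by
    rw [Set.image_comp, image_boundaryPath]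
  have hu : f.vertex u ∈ κ '' diamondBoundary := by
    rw [← him, ← hκu]
    exact ⟨0, by simp, by rw [Function.comp_apply, boundaryPath_zero]⟩
  refine f.isKnottedOrLinked_of_addEdge h (κ ∘ boundaryPath) hγ
    (fun t ht => hκ.mem_threeSphere (boundaryPath_mem ht))
    (fun s hs t ht hst => boundaryPath_injOn hs ht (hκ.injective hst))
    (by rw [Function.comp_apply, boundaryPath_zero, hκu])
    (by rw [Function.comp_apply, boundaryPath_one, hκu])
    (fun t ht htX => boundaryPath_ne ht (hκX _ (boundaryPath_mem (Set.Ioo_subset_Icc_self ht)) htX))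
    hVfin hEfin (hG' _) fun C E hC hp hCE => Or.inl ?_
  obtain ⟨hV, rfl⟩ := hp.eq_of_closed
  have hpart : (κ ∘ boundaryPath) '' Set.Icc 0 1 ∪ f.part V(C) ∅ = κ '' diamondBoundary := by
    rw [him, hV, SpatialEmbedding.part]
    simp [hu]
  rw [hpart]
  refine ⟨hκ.isTrivialKnot_boundary, fun V' E' hP hseg hdis => ?_⟩
  refine hκ.isSplittable_boundary hseg.isCompact.isClosed
    (f.part_subset_threeSphere hP.1 hP.2.1) fun p hp hpZ => ?_
  have := hκX p hp (f.part_mono hP.1 hP.2.1 hpZ)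
  rw [this, hκu, f.vertex_mem_part hP h.left_mem] at hpZ
  exact Set.disjoint_left.1 hdis (hV ▸ rfl) hpZ

end SpatialGraph
namespace SpatialGraph
open scoped Graph

/-! ### Adding an edge alongside an arc -/

variable {α β : Type*} {G G' : Graph α β} {e₀ : β} {u v x : α}

namespace SpatialEmbedding

section Disk
variable (f : SpatialEmbedding G) {κ : ℝ × ℝ → (Fin 4 → ℝ)}

/-- An added edge is represented by the upper side of a flat disk which meets the embedded graph in
its diagonal only. -/
theorem isKnottedOrLinked_of_isFlatDisk (hκ : IsFlatDisk κ)
    (hX : ∀ p ∈ diamond, κ p ∈ f.part V(G) E(G) → p.2 = 0) (h : IsAddEdge G G' e₀ u v)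
    (hu : κ (-1, 0) = f.vertex u) (hv : κ (1, 0) = f.vertex v)
    (hVfin : V(G).Finite) (hEfin : E(G).Finite) (hG' : IsIKorC3L G')
    (key : ∀ C E, IsCycleOf C G' → IsPath G u v V(C) E → E(C) = insert e₀ E →
      (IsTrivialKnot (κ '' upperArc ∪ f.part V(C) E) ∧
        ∀ V' E', IsPart G V' E' → IsSegUnion (f.part V' E') → Disjoint V(C) V' →
          IsSplittable (κ '' upperArc ∪ f.part V(C) E) (f.part V' E')) ∨
      ∃ C', IsCycleOf C' G ∧
        (∀ D, IsCycleOf D G → Disjoint V(C) V(D) → Disjoint V(C') V(D)) ∧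
        ∀ V' E', IsPart G V' E' → IsSegUnion (f.part V' E') → Disjoint V(C) V' →
          Disjoint V(C') V' → ∃ H, IsPLHomeo H ∧ (∀ z ∈ f.part V' E', H z = z) ∧
            H '' (κ '' upperArc ∪ f.part V(C) E) = f.image C') : f.IsKnottedOrLinked := by
  have hγ : IsPLOn (κ ∘ upperPath) (Set.Icc 0 1) :=
    (hκ.isPLOn isPLOn_upperPath.isPolyhedron_image).comp isPLOn_upperPath (Set.mapsTo_image _ _)
  have him : (κ ∘ upperPath) '' Set.Icc 0 1 = κ '' upperArc := by
    rw [Set.image_comp, image_upperPath]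
  refine f.isKnottedOrLinked_of_addEdge h (κ ∘ upperPath) hγ
    (fun t ht => hκ.mem_threeSphere (upperPath_mem ht))
    (fun s hs t ht hst => upperPath_injective (hκ.injective hst))
    (by rw [Function.comp_apply, upperPath_zero, hu])
    (by rw [Function.comp_apply, upperPath_one, hv])
    (fun t ht htX => (upperPath_snd_pos ht).ne'
      (hX _ (upperPath_mem (Set.Ioo_subset_Icc_self ht)) htX))
    hVfin hEfin (isIKorC3L_iff.1 hG' _) ?_
  rw [him]
  exact key

theorem mem_part_of_isFlatDisk (hX : ∀ p ∈ diamond, κ p ∈ f.part V(G) E(G) → p.2 = 0)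
    {P : Set α} {Q : Set β} (hPQ : IsPart G P Q) (hA : f.part P Q = κ '' axis (-1) 1) {V : Set α}
    {E : Set β} (hVE : IsPart G V E) {p : ℝ × ℝ} (hp : p ∈ diamond) (hpV : κ p ∈ f.part V E) :
    κ p ∈ f.part (V ∩ P) (E ∩ Q) := by
  rw [← f.part_inter_part hVE hPQ]
  refine ⟨hpV, ?_⟩
  rw [hA]
  have h2 := hX p hp (f.part_mono hVE.1 hVE.2.1 hpV)
  have h1 : |p.1| ≤ 1 := by rw [mem_diamond] at hp; linarith [abs_nonneg p.2]
  exact ⟨p, ⟨Set.mem_Icc.2 (abs_le.1 h1), h2⟩, rfl⟩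

theorem part_empty (V : Set α) : f.part V ∅ = f.vertex '' V := by simp [part]

theorem IsPart.inter_eq_empty {V P : Set α} {E Q : Set β} (h : IsPart G V E) (h' : IsPart G P Q)
    (hd : Disjoint V P) : E ∩ Q = ∅ := by
  rw [Set.eq_empty_iff_forall_notMem]
  rintro e ⟨he, he'⟩
  obtain ⟨a, b, hab⟩ := G.exists_isLink_of_mem_edgeSet (h.2.1 he)
  exact Set.disjoint_left.1 hd (h.isLink he hab).1 (h'.isLink he' hab).1

variable (hκ : IsFlatDisk κ) (hX : ∀ p ∈ diamond, κ p ∈ f.part V(G) E(G) → p.2 = 0)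
  {P : Set α} {Q : Set β} (hPQ : IsPart G P Q) (hA : f.part P Q = κ '' axis (-1) 1)
include hκ hX hPQ hA

/-- The new edge and the arc alongside form a trivial knot, split from everything else. -/
theorem isTrivialKnot_and_isSplittable_arc :
    IsTrivialKnot (κ '' upperArc ∪ f.part P Q) ∧
      ∀ V' E', IsPart G V' E' → IsSegUnion (f.part V' E') → Disjoint P V' →
        IsSplittable (κ '' upperArc ∪ f.part P Q) (f.part V' E') := by
  rw [hA, Set.union_comm, ← Set.image_union]
  refine ⟨hκ.isTrivialKnot_upperArc, fun V' E' hP hseg hdis => ?_⟩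
  refine hκ.isSplittable_upperArc hseg (f.part_subset_threeSphere hP.1 hP.2.1) fun p hp hpZ => ?_
  have := f.mem_part_of_isFlatDisk hX hPQ hA hP hp hpZ
  rw [IsPart.inter_eq_empty hP hPQ hdis.symm, Set.inter_comm, hdis.inter_eq, part_empty,
    Set.image_empty] at this
  exact this

/-- The new edge may be pushed across the disk to the arc alongside. -/
theorem exists_push_arc (hu : κ (-1, 0) = f.vertex u) (hv : κ (1, 0) = f.vertex v)
    {V V' : Set α} {E E' : Set β} (hVE : IsPart G V E) (hseg : IsSegUnion (f.part V E))
    (hVP : V ∩ P ⊆ {u, v}) (hEQ : E ∩ Q = ∅) (hP : IsPart G V' E')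
    (hseg' : IsSegUnion (f.part V' E')) (hdis : Disjoint P V') :
    ∃ H, IsPLHomeo H ∧ (∀ z ∈ f.part V' E', H z = z) ∧
      H '' (κ '' upperArc ∪ f.part V E) = f.part (V ∪ P) (E ∪ Q) := by
  obtain ⟨H, hH, hfix, him⟩ := hκ.exists_move_upperArc (hseg.union hseg')
    (Set.union_subset (f.part_subset_threeSphere hVE.1 hVE.2.1)
      (f.part_subset_threeSphere hP.1 hP.2.1)) (by
    rintro p hp (hpZ | hpZ)
    · have := f.mem_part_of_isFlatDisk hX hPQ hA hVE hp hpZ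
      rw [hEQ, part_empty] at this
      obtain ⟨a, ha, hap⟩ := this
      rcases hVP ha with rfl | rfl
      · left; exact hκ.injective (hap.symm.trans hu.symm)
      · right; exact hκ.injective (hap.symm.trans hv.symm)
    · have := f.mem_part_of_isFlatDisk hX hPQ hA hP hp hpZ
      rw [IsPart.inter_eq_empty hP hPQ hdis.symm, Set.inter_comm, hdis.inter_eq, part_empty,
        Set.image_empty] at this
      exact absurd this (Set.notMem_empty _))
  refine ⟨H, hH, fun z hz => hfix z (Or.inr hz), ?_⟩
  have hid : H '' f.part V E = f.part V E := by
    have : Set.EqOn H id (f.part V E) := fun z hz => hfix z (Or.inl hz)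
    rw [this.image_eq, Set.image_id]
  rw [Set.image_union, him, hid, ← hA, part_union, Set.union_comm]

/-- The new edge together with the initial part of the arc alongside may be pushed across the disk
to the remaining part of the arc. -/
theorem exists_push_detour {ξ : ℝ} (hξ : ξ ∈ Set.Ioo (-1 : ℝ) 1)
    (hx : κ (ξ, 0) = f.vertex x) (hv : κ (1, 0) = f.vertex v)
    {V V' : Set α} {E E' : Set β} (hVE : IsPart G V E) (hseg : IsSegUnion (f.part V E))
    (hVP : V ∩ P ⊆ {x, v}) (hEQ : E ∩ Q = ∅) (hP : IsPart G V' E')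
    (hseg' : IsSegUnion (f.part V' E')) (hdis : Disjoint P V') :
    ∃ H, IsPLHomeo H ∧ (∀ z ∈ f.part V' E', H z = z) ∧
      H '' (κ '' upperArc ∪ (κ '' axis (-1) ξ ∪ f.part V E)) = κ '' axis ξ 1 ∪ f.part V E := by
  obtain ⟨H, hH, hfix, him⟩ := hκ.exists_move_detour hξ (hseg.union hseg')
    (Set.union_subset (f.part_subset_threeSphere hVE.1 hVE.2.1)
      (f.part_subset_threeSphere hP.1 hP.2.1)) (by
    rintro p hp (hpZ | hpZ)
    · have := f.mem_part_of_isFlatDisk hX hPQ hA hVE hp hpZ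
      rw [hEQ, part_empty] at this
      obtain ⟨a, ha, hap⟩ := this
      rcases hVP ha with rfl | rfl
      · left; exact hκ.injective (hap.symm.trans hx.symm)
      · right; exact hκ.injective (hap.symm.trans hv.symm)
    · have := f.mem_part_of_isFlatDisk hX hPQ hA hP hp hpZ
      rw [IsPart.inter_eq_empty hP hPQ hdis.symm, Set.inter_comm, hdis.inter_eq, part_empty,
        Set.image_empty] at this
      exact absurd this (Set.notMem_empty _))
  refine ⟨H, hH, fun z hz => hfix z (Or.inr hz), ?_⟩
  have hid : H '' f.part V E = f.part V E := by
    have : Set.EqOn H id (f.part V E) := fun z hz => hfix z (Or.inl hz)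
    rw [this.image_eq, Set.image_id]
  rw [← Set.union_assoc, ← Set.image_union, Set.union_comm upperArc, Set.image_union, him, hid]

end Disk

end SpatialEmbedding

/-- An edge parallel to an edge which is not a loop may be added to a graph without making it
intrinsically knotted or completely `3`-linked. -/
theorem IsIKorC3L.of_add_parallel (hG' : IsIKorC3L G') (h : IsAddEdge G G' e₀ u v) (huv : u ≠ v)
    {e : β} (he : G.IsLink e u v) (hVfin : V(G).Finite) (hEfin : E(G).Finite) : IsIKorC3L G := by
  rw [isIKorC3L_iff]
  intro f₀
  obtain ⟨γ, hγ, hinj, h0, h1, him⟩ := f₀.exists_arc he huv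
  have hPQ := isPart_link he
  obtain ⟨H₀, κ, hH₀, hκ, hκX, φ, hφ0, hφ1, -, hφ, hφim⟩ := exists_isFlatDisk_arc hγ hinj
    (fun t ht => by
      have : γ t ∈ f₀.part {u, v} {e} := him ▸ Set.mem_image_of_mem _ ht
      exact f₀.part_subset_threeSphere hPQ.1 hPQ.2.1 this)
    (f₀.isSegUnion_part hVfin hEfin le_rfl) (f₀.part_subset_threeSphere le_rfl le_rfl)
  refine SpatialEmbedding.isKnottedOrLinked_of_mapHomeo hH₀ ?_
  set f := f₀.mapHomeo hH₀ with hf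
  have hX : ∀ p ∈ diamond, κ p ∈ f.part V(G) E(G) → p.2 = 0 := fun p hp hpX =>
    hκX p hp (by rwa [hf, SpatialEmbedding.part_mapHomeo] at hpX)
  have hA : f.part {u, v} {e} = κ '' axis (-1) 1 := by
    rw [hf, SpatialEmbedding.part_mapHomeo, ← him, hφim 0 1 le_rfl zero_le_one le_rfl, hφ0, hφ1]
  have hu : κ (-1, 0) = f.vertex u := by
    rw [← hφ0, ← hφ 0 (by simp), h0]; rfl
  have hv : κ (1, 0) = f.vertex v := by
    rw [← hφ1, ← hφ 1 (by simp), h1]; rfl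
  have hseg : ∀ {V E}, IsPart G V E → IsSegUnion (f.part V E) := fun h =>
    f.isSegUnion_part (hVfin.subset h.1) (hEfin.subset h.2.1) h.2.1
  refine f.isKnottedOrLinked_of_isFlatDisk hκ hX h hu hv hVfin hEfin hG' fun C E hC hp hCE => ?_
  by_cases heE : e ∈ E
  · -- The cycle consists of the added edge and `e`.
    left
    obtain ⟨V₁, E₁, hp₁, -, -, hV, hE⟩ := hp.uncons heE he
    obtain ⟨rfl, rfl⟩ := hp₁.eq_of_closed
    have hE' : E = {e} := by rw [hE]; simp
    rw [hV, hE']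
    exact f.isTrivialKnot_and_isSplittable_arc hκ hX hPQ hA
  · right
    obtain ⟨C', hC', hV, hE⟩ := hp.exists_isCycleOf he heE
    have hsub : ({u, v} : Set α) ⊆ V(C) := by
      rintro _ (rfl | rfl)
      · exact hp.left_mem
      · exact hp.right_mem
    refine ⟨C', hC', fun D _ hD => hV ▸ hD, fun V' E' hP hs hdis _ => ?_⟩
    obtain ⟨H, hH, hfix, hHim⟩ := f.exists_push_arc hκ hX hPQ hA hu hv hp.isPart (hseg hp.isPart)
      Set.inter_subset_right (by simpa using heE) hP hs (hdis.mono_left hsub)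
    refine ⟨H, hH, hfix, hHim.trans ?_⟩
    rw [SpatialEmbedding.image_eq_part, hV, hE, Set.union_eq_left.2 hsub, Set.union_singleton]

/-- The local situation for the addition of an edge alongside a path of length two from `u` to `v`
through a vertex `x` with at most one further edge. -/
structure IsCherry (G : Graph α β) (u v x : α) (d₁ d₂ d₃ : β) : Prop where
  ne : u ≠ v
  ne_left : x ≠ u
  ne_right : x ≠ v
  ne_edge : d₁ ≠ d₂
  left : G.IsLink d₁ u x
  right : G.IsLink d₂ v x
  eq_of_isLink : ∀ e y, G.IsLink e x y → y ≠ x ∧ (e = d₁ ∨ e = d₂ ∨ e = d₃)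

theorem IsCherry.symm {d₁ d₂ d₃ : β} (h : IsCherry G u v x d₁ d₂ d₃) :
    IsCherry G v u x d₂ d₁ d₃ :=
  ⟨h.ne.symm, h.ne_right, h.ne_left, h.ne_edge.symm, h.right, h.left, fun e y he => by
    have := h.eq_of_isLink e y he; tauto⟩

theorem IsCherry.isPart {d₁ d₂ d₃ : β} (h : IsCherry G u v x d₁ d₂ d₃) :
    IsPart G {u, x, v} {d₁, d₂} := by
  have h1 := (isPart_link h.left).union (isPart_link h.right.symm)
  have hV : ({u, x} : Set α) ∪ {x, v} = {u, x, v} := by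
    ext a; simp only [Set.mem_union, Set.mem_insert_iff, Set.mem_singleton_iff]; tauto
  rwa [hV, Set.singleton_union] at h1

/-- A cycle through the middle of a path of length two uses one of the two edges of this path. -/
theorem IsCherry.exists_mem {d₁ d₂ d₃ : β} (hc : IsCherry G u v x d₁ d₂ d₃) {C H : Graph α β}
    (hC : IsCycleOf C H) (hx : x ∈ V(C)) (hCG : ∀ e y, C.IsLink e x y → G.IsLink e x y) :
    d₁ ∈ E(C) ∨ d₂ ∈ E(C) := by
  rcases hC.exists_inc hx with ⟨e, he⟩ | ⟨e, e', hne, ⟨y, hy⟩, ⟨y', hy'⟩⟩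
  · exact absurd rfl (hc.eq_of_isLink e x (hCG e x he)).1
  · rcases (hc.eq_of_isLink e y (hCG e y hy)).2 with rfl | rfl | rfl
    · exact Or.inl hy.edge_mem
    · exact Or.inr hy.edge_mem
    · rcases (hc.eq_of_isLink e' y' (hCG e' y' hy')).2 with rfl | rfl | rfl
      · exact Or.inl hy'.edge_mem
      · exact Or.inr hy'.edge_mem
      · exact absurd rfl hne

/-- The cycles which run through the added edge and the first half of the arc alongside. -/
theorem SpatialEmbedding.exists_cycle_detour (f : SpatialEmbedding G) {κ : ℝ × ℝ → (Fin 4 → ℝ)}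
    (hκ : IsFlatDisk κ) (hX : ∀ p ∈ diamond, κ p ∈ f.part V(G) E(G) → p.2 = 0) {d₁ d₂ d₃ : β}
    (hc : IsCherry G u v x d₁ d₂ d₃) {ξ : ℝ} (hξ : ξ ∈ Set.Ioo (-1 : ℝ) 1)
    (hA₁ : f.part {u, x} {d₁} = κ '' axis (-1) ξ) (hA₂ : f.part {x, v} {d₂} = κ '' axis ξ 1)
    (hA : f.part {u, x, v} {d₁, d₂} = κ '' axis (-1) 1)
    (hx : κ (ξ, 0) = f.vertex x) (hv : κ (1, 0) = f.vertex v)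
    (hVfin : V(G).Finite) (hEfin : E(G).Finite) {C : Graph α β} {E : Set β}
    (hp : IsPath G u v V(C) E) (h₁ : d₁ ∈ E) (h₂ : d₂ ∉ E) :
    ∃ C', IsCycleOf C' G ∧
        (∀ D, IsCycleOf D G → Disjoint V(C) V(D) → Disjoint V(C') V(D)) ∧
        ∀ V' E', IsPart G V' E' → IsSegUnion (f.part V' E') → Disjoint V(C) V' →
          Disjoint V(C') V' → ∃ H, IsPLHomeo H ∧ (∀ z ∈ f.part V' E', H z = z) ∧
            H '' (κ '' upperArc ∪ f.part V(C) E) = f.image C' := by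
  obtain ⟨V₁, E₁, hp₁, huV, hdE, hV, rfl⟩ := hp.uncons h₁ hc.left
  have h₂' : d₂ ∉ E₁ := fun h => h₂ (Or.inr h)
  obtain ⟨C', hC', hV', hE'⟩ := hp₁.exists_isCycleOf hc.right.symm h₂'
  refine ⟨C', hC', fun D _ hD => hD.mono_left (by rw [hV, hV']; exact Set.subset_insert _ _),
    fun V' E' hP hs hdis _ => ?_⟩
  have hsub : ({u, x, v} : Set α) ⊆ V(C) := by
    rw [hV]
    rintro _ (rfl | rfl | rfl)
    · exact Or.inl rfl
    · exact Or.inr hp₁.left_mem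
    · exact Or.inr hp₁.right_mem
  obtain ⟨H, hH, hfix, hHim⟩ := f.exists_push_detour hκ hX hc.isPart hA hξ hx hv hp₁.isPart
    (f.isSegUnion_part (hVfin.subset hp₁.isPart.1) (hEfin.subset hp₁.isPart.2.1) hp₁.isPart.2.1)
    (by rintro a ⟨ha, (rfl | rfl | rfl)⟩
        · exact absurd ha huV
        · exact Or.inl rfl
        · exact Or.inr rfl)
    (by rw [Set.eq_empty_iff_forall_notMem]
        rintro a ⟨ha, (rfl | rfl)⟩
        · exact hdE ha
        · exact h₂' ha) hP hs (hdis.mono_left hsub)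
  refine ⟨H, hH, hfix, ?_⟩
  have e1 : f.part V(C) (insert d₁ E₁) = κ '' axis (-1) ξ ∪ f.part V₁ E₁ := by
    rw [← hA₁, ← f.part_union, Set.singleton_union, hV, Set.insert_union, Set.singleton_union,
      Set.insert_eq_of_mem hp₁.left_mem]
  have e2 : f.image C' = κ '' axis ξ 1 ∪ f.part V₁ E₁ := by
    rw [SpatialEmbedding.image_eq_part, hV', hE', ← hA₂, ← f.part_union, Set.singleton_union,
      Set.insert_union, Set.singleton_union, Set.insert_eq_of_mem hp₁.right_mem,
      Set.insert_eq_of_mem hp₁.left_mem]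
  rw [e1, e2, hHim]

/-- An edge alongside a path of length two, whose middle vertex has at most one further edge, may be
added to a graph without making it intrinsically knotted or completely `3`-linked. -/
theorem IsIKorC3L.of_add_cherry (hG' : IsIKorC3L G') (h : IsAddEdge G G' e₀ u v) {d₁ d₂ d₃ : β}
    (hc : IsCherry G u v x d₁ d₂ d₃) (hVfin : V(G).Finite) (hEfin : E(G).Finite) :
    IsIKorC3L G := by
  rw [isIKorC3L_iff]
  intro f₀
  obtain ⟨γ₁, hγ₁, hinj₁, h10, h11, him₁⟩ := f₀.exists_arc hc.left hc.ne_left.symm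
  obtain ⟨γ₂, hγ₂, hinj₂, h20, h21, him₂⟩ := f₀.exists_arc hc.right.symm hc.ne_right
  have hPQ := hc.isPart
  have hmid : γ₁ 1 = γ₂ 0 := h11.trans h20.symm
  set γ := concat γ₁ γ₂ with hγ
  have hI1 := image_concat_left (γ₁ := γ₁) (γ₂ := γ₂)
  have hI2 := image_concat_right (γ₁ := γ₁) (γ₂ := γ₂) hmid
  have hunion : f₀.part {u, x, v} {d₁, d₂} = f₀.part {u, x} {d₁} ∪ f₀.part {x, v} {d₂} := by
    rw [← f₀.part_union, Set.singleton_union, Set.insert_union, Set.singleton_union,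
      Set.insert_eq_of_mem (show x ∈ ({x, v} : Set α) from Or.inl rfl)]
  have him : γ '' Set.Icc 0 1 = f₀.part {u, x, v} {d₁, d₂} := by
    rw [hunion, ← him₁, ← him₂, ← hI1, ← hI2, ← Set.image_union,
      Set.Icc_union_Icc_eq_Icc (by norm_num) (by norm_num)]
  have hinj : Set.InjOn γ (Set.Icc 0 1) := by
    refine concat_injOn hinj₁ hinj₂ hmid fun s hs t ht hst => ?_
    have hmem : γ₂ t ∈ f₀.part {u, x} {d₁} ∩ f₀.part {x, v} {d₂} :=
      ⟨hst ▸ him₁ ▸ Set.mem_image_of_mem _ hs, him₂ ▸ Set.mem_image_of_mem _ ht⟩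
    rw [f₀.part_inter_part (isPart_link hc.left) (isPart_link hc.right.symm)] at hmem
    have hE : ({d₁} : Set β) ∩ {d₂} = ∅ := by simpa using hc.ne_edge.symm
    rw [hE, f₀.part_empty] at hmem
    obtain ⟨a, ⟨ha, ha'⟩, hat⟩ := hmem
    have hax : a = x := by
      rcases ha with rfl | rfl
      · rcases ha' with ha' | ha'
        · exact ha'
        · exact absurd ha' hc.ne
      · rfl
    rw [hax, ← h20] at hat
    exact (hinj₂ (by simp) ht hat).symm
  obtain ⟨H₀, κ, hH₀, hκ, hκX, φ, hφ0, hφ1, hφinj, hφ, hφim⟩ := exists_isFlatDisk_arc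
    (isPLOn_concat hγ₁ hγ₂ hmid) hinj
    (fun t ht => by
      have : γ t ∈ f₀.part {u, x, v} {d₁, d₂} := him ▸ Set.mem_image_of_mem _ ht
      exact f₀.part_subset_threeSphere hPQ.1 hPQ.2.1 this)
    (f₀.isSegUnion_part hVfin hEfin le_rfl) (f₀.part_subset_threeSphere le_rfl le_rfl)
  refine SpatialEmbedding.isKnottedOrLinked_of_mapHomeo hH₀ ?_
  set f := f₀.mapHomeo hH₀ with hf
  have hhalf : (1 / 2 : ℝ) ∈ Set.Icc (0 : ℝ) 1 := by norm_num
  set ξ := φ (1 / 2) with hξ'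
  have hX : ∀ p ∈ diamond, κ p ∈ f.part V(G) E(G) → p.2 = 0 := fun p hp hpX =>
    hκX p hp (by rwa [hf, SpatialEmbedding.part_mapHomeo] at hpX)
  have hA : f.part {u, x, v} {d₁, d₂} = κ '' axis (-1) 1 := by
    rw [hf, SpatialEmbedding.part_mapHomeo, ← him, hφim 0 1 le_rfl zero_le_one le_rfl, hφ0, hφ1]
  have hA₁ : f.part {u, x} {d₁} = κ '' axis (-1) ξ := by
    rw [hf, SpatialEmbedding.part_mapHomeo, ← him₁, ← hI1,
      hφim 0 (1 / 2) le_rfl (by norm_num) (by norm_num), hφ0]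
  have hA₂ : f.part {x, v} {d₂} = κ '' axis ξ 1 := by
    rw [hf, SpatialEmbedding.part_mapHomeo, ← him₂, ← hI2,
      hφim (1 / 2) 1 (by norm_num) (by norm_num) le_rfl, hφ1]
  have hu : κ (-1, 0) = f.vertex u := by
    have : concat γ₁ γ₂ 0 = f₀.vertex u := by rw [concat_left (by norm_num), mul_zero, h10]
    rw [← hφ0, ← hφ 0 (by simp), this]; rfl
  have hv : κ (1, 0) = f.vertex v := by
    have : concat γ₁ γ₂ 1 = f₀.vertex v := by
      rw [concat_right hmid (by norm_num), ← h21]; norm_num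
    rw [← hφ1, ← hφ 1 (by simp), this]; rfl
  have hx : κ (ξ, 0) = f.vertex x := by
    have : concat γ₁ γ₂ (1 / 2) = f₀.vertex x := by
      rw [concat_left le_rfl, ← h11]; norm_num
    rw [← hφ _ hhalf, this]; rfl
  have hξ : ξ ∈ Set.Ioo (-1 : ℝ) 1 := by
    have hmem : κ (ξ, 0) ∈ κ '' axis (-1) 1 := by
      rw [hx, ← hA]
      exact Or.inl ⟨x, by simp, rfl⟩
    obtain ⟨p, hp, hpx⟩ := hmem
    rw [hκ.injective hpx] at hp
    have h3 : -1 ≠ ξ := fun h4 => by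
      have := hφinj (by simp) hhalf (hφ0.trans h4)
      norm_num at this
    have h5 : ξ ≠ 1 := fun h4 => by
      have := hφinj hhalf (by simp) (h4.trans hφ1.symm)
      norm_num at this
    exact ⟨lt_of_le_of_ne hp.1.1 h3, lt_of_le_of_ne hp.1.2 h5⟩
  have hseg : ∀ {V E}, IsPart G V E → IsSegUnion (f.part V E) := fun h =>
    f.isSegUnion_part (hVfin.subset h.1) (hEfin.subset h.2.1) h.2.1
  refine f.isKnottedOrLinked_of_isFlatDisk hκ hX h hu hv hVfin hEfin hG' fun C E hC hp hCE => ?_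
  by_cases h₁ : d₁ ∈ E
  · by_cases h₂ : d₂ ∈ E
    · -- The cycle consists of the added edge and the arc alongside.
      left
      obtain ⟨V₁, E₁, hp₁, huV, -, hV, rfl⟩ := hp.uncons h₁ hc.left
      obtain ⟨V₂, E₂, hp₂, -, -, rfl, rfl⟩ := hp₁.uncons (h₂.resolve_left hc.ne_edge.symm)
        hc.right.symm
      obtain ⟨rfl, rfl⟩ := hp₂.eq_of_closed
      have hE' : (insert d₁ (insert d₂ ∅) : Set β) = {d₁, d₂} := by simp
      rw [hV, hE']
      exact f.isTrivialKnot_and_isSplittable_arc hκ hX hPQ hA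
    · exact Or.inr (f.exists_cycle_detour hκ hX hc hξ hA₁ hA₂ hA hx hv hVfin hEfin hp h₁ h₂)
  · by_cases h₂ : d₂ ∈ E
    · -- This is the previous case for the reflected disk.
      right
      have hflip : ∀ a b : ℝ, (fun p : ℝ × ℝ => κ (-p.1, p.2)) '' axis a b =
          κ '' axis (-b) (-a) := by
        intro a b
        ext z
        constructor
        · rintro ⟨p, hp, rfl⟩
          exact ⟨(-p.1, p.2), ⟨⟨neg_le_neg hp.1.2, neg_le_neg hp.1.1⟩, hp.2⟩, rfl⟩
        · rintro ⟨p, hp, rfl⟩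
          exact ⟨(-p.1, p.2), ⟨⟨by simpa using neg_le_neg hp.1.2, by simpa using neg_le_neg hp.1.1⟩,
            hp.2⟩, by simp⟩
      have hflip' : (fun p : ℝ × ℝ => κ (-p.1, p.2)) '' upperArc = κ '' upperArc := by
        ext z
        constructor
        · rintro ⟨p, hp, rfl⟩
          exact ⟨(-p.1, p.2), by simpa [upperArc] using hp, rfl⟩
        · rintro ⟨p, hp, rfl⟩
          exact ⟨(-p.1, p.2), by simpa [upperArc] using hp, by simp⟩
      have hset : ({v, x, u} : Set α) = {u, x, v} := by
        ext a; simp only [Set.mem_insert_iff, Set.mem_singleton_iff]; tauto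
      have := f.exists_cycle_detour hκ.flip (fun p hp hpX => hX (-p.1, p.2)
        (by simpa [mem_diamond] using hp) hpX) hc.symm (ξ := -ξ)
        ⟨by linarith [hξ.2], by linarith [hξ.1]⟩
        (by rw [hflip, neg_neg, neg_neg, ← hA₂, Set.pair_comm])
        (by rw [hflip, neg_neg, ← hA₁, Set.pair_comm])
        (by rw [hflip, neg_neg, ← hA, hset, Set.pair_comm d₂ d₁])
        (by simpa using hx) (by simpa using hu) hVfin hEfin hp.symm h₂ h₁
      rwa [hflip'] at this
    · -- The cycle avoids the middle vertex of the arc alongside.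
      right
      have hxC : x ∉ V(C) := fun hxC => by
        have hCG : ∀ e y, C.IsLink e x y → G.IsLink e x y := fun e y he => by
          refine ((h.isLink_iff e x y).1 (he.mono hC.1)).resolve_right ?_
          rintro ⟨-, heq⟩
          rcases Sym2.eq_iff.1 heq with ⟨h3, -⟩ | ⟨h3, -⟩
          · exact hc.ne_left h3
          · exact hc.ne_right h3
        have hne : ∀ {d}, d ∈ E(G) → d ∈ E(C) → d ∈ E := fun {d} hdG hd => by
          rw [hCE] at hd
          exact hd.resolve_left fun h3 => h.notMem (h3 ▸ hdG)
        rcases hc.exists_mem hC hxC hCG with h3 | h3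
        · exact h₁ (hne hc.left.edge_mem h3)
        · exact h₂ (hne hc.right.edge_mem h3)
      have hp' := hp.snoc hc.right hxC
      obtain ⟨C', hC', hV, hE⟩ := hp'.exists_isCycleOf hc.left (by
        rintro (h3 | h3)
        · exact hc.ne_edge h3
        · exact h₁ h3)
      have hVC : V(C) ∪ {u, x, v} = V(C') := by
        rw [hV]
        ext a
        simp only [Set.mem_union, Set.mem_insert_iff, Set.mem_singleton_iff]
        constructor
        · rintro (h3 | rfl | rfl | rfl)
          · exact Or.inr h3
          · exact Or.inr hp.left_mem
          · exact Or.inl rfl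
          · exact Or.inr hp.right_mem
        · tauto
      refine ⟨C', hC', fun D hD hCD => ?_, fun V' E' hP hs hdis hdis' => ?_⟩
      · rw [hV, Set.disjoint_insert_left]
        refine ⟨fun hxD => ?_, hCD⟩
        -- A cycle through `x` uses one of the edges `ux` and `xv`, hence meets `C` in `u` or `v`.
        rcases hc.exists_mem hD hxD fun e y he => he.mono hD.1 with h3 | h3
        · exact Set.disjoint_left.1 hCD hp.left_mem
            ((isPart_of_le hD.1).isLink h3 hc.left).1
        · exact Set.disjoint_left.1 hCD hp.right_mem
            ((isPart_of_le hD.1).isLink h3 hc.right).1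
      · obtain ⟨H, hH, hfix, hHim⟩ := f.exists_push_arc hκ hX hPQ hA hu hv hp.isPart
          (hseg hp.isPart) (by
            rintro a ⟨ha, (rfl | rfl | rfl)⟩
            · exact Or.inl rfl
            · exact absurd ha hxC
            · exact Or.inr rfl)
          (by rw [Set.eq_empty_iff_forall_notMem]
              rintro a ⟨ha, (rfl | rfl)⟩
              · exact h₁ ha
              · exact h₂ ha) hP hs (hdis'.mono_left (hVC ▸ Set.subset_union_right))
        refine ⟨H, hH, hfix, hHim.trans ?_⟩
        rw [SpatialEmbedding.image_eq_part, hVC, hE, Set.union_insert, Set.union_singleton]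

end SpatialGraph
namespace SpatialGraph

open scoped Graph

/-! ### Triangles, stars and edges that can be dispensed with -/

variable {α β : Type*} {H K : Graph α β}

/-- `K` arises from `H` by an exchange of the triangle with vertices `u i` and edges `e i` (where
`e i` is opposite to `u i`) for the star with centre `x` and edges `f i` (where `f i` ends at
`u i`). That the edges are distinct, and that the `f i` are not among the remaining edges of `H`,
follows from the description of `K`. -/
structure IsTriangleStar (x : α) (e f : Fin 3 → β) (u : Fin 3 → α) (H K : Graph α β) : Prop where
  injective : Function.Injective u
  notMem : x ∉ V(H)
  isLink_triangle : ∀ i, H.IsLink (e i) (u (i + 1)) (u (i + 2))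
  vertexSet_eq : V(K) = insert x V(H)
  isLink_iff : ∀ g a b, K.IsLink g a b ↔
    (H.IsLink g a b ∧ g ∉ Set.range e) ∨ ∃ i, g = f i ∧ s(a, b) = s(u i, x)

namespace IsTriangleStar

variable {x : α} {e f : Fin 3 → β} {u : Fin 3 → α}

theorem mem (h : IsTriangleStar x e f u H K) (i : Fin 3) : u i ∈ V(H) := by
  have := (h.isLink_triangle (i + 1)).right_mem
  rwa [show i + 1 + 2 = i by omega] at this

theorem ne (h : IsTriangleStar x e f u H K) (i : Fin 3) : u i ≠ x :=
  fun hi => h.notMem (hi ▸ h.mem i)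

theorem isLink_star (h : IsTriangleStar x e f u H K) (i : Fin 3) : K.IsLink (f i) (u i) x :=
  (h.isLink_iff _ _ _).2 (Or.inr ⟨i, rfl, rfl⟩)

theorem injective_star (h : IsTriangleStar x e f u H K) : Function.Injective f := fun i j hij => by
  have h1 := h.isLink_star i
  rw [hij] at h1
  exact h.injective (h1.left_unique (h.isLink_star j))

theorem injective_triangle (h : IsTriangleStar x e f u H K) : Function.Injective e := by
  intro i j hij
  have h1 := h.isLink_triangle i
  rw [hij] at h1
  rcases h1.eq_and_eq_or_eq_and_eq (h.isLink_triangle j) with ⟨h2, -⟩ | ⟨h2, h3⟩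
  · simpa using h.injective h2
  · have h4 := h.injective h2
    have h5 := h.injective h3
    omega

theorem ne_of_isLink (h : IsTriangleStar x e f u H K) {g : β} {a b : α} (hg : H.IsLink g a b)
    (hge : g ∉ Set.range e) (i : Fin 3) : g ≠ f i := by
  rintro rfl
  have hK := (h.isLink_iff _ _ _).2 (Or.inl ⟨hg, hge⟩)
  rcases hK.right_eq_or_eq (h.isLink_star i).symm with h1 | h1
  all_goals
    rcases hK.symm.right_eq_or_eq (h.isLink_star i).symm with h2 | h2
  · exact h.notMem (h1 ▸ hg.right_mem)
  · exact h.notMem (h1 ▸ hg.right_mem)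
  · exact h.notMem (h2 ▸ hg.left_mem)
  · rcases (h.isLink_star i).right_eq_or_eq hK with h3 | h3
    · exact h.notMem (h3 ▸ hg.left_mem)
    · exact h.notMem (h3 ▸ hg.right_mem)

/-- The graph with the triangle is determined by the graph with the star. -/
theorem left_unique {u' : Fin 3 → α} {H' : Graph α β} (h : IsTriangleStar x e f u H K)
    (h' : IsTriangleStar x e f u' H' K) : H = H' := by
  have key : ∀ {u u' : Fin 3 → α} {H H' : Graph α β}, IsTriangleStar x e f u H K →
      IsTriangleStar x e f u' H' K → H ≤ H' := by
    intro u u' H H' h h'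
    have hu : u = u' := funext fun i => (h.isLink_star i).left_unique (h'.isLink_star i)
    refine ⟨fun a ha => ?_, fun g a b hg => ?_⟩
    · have h1 : a ∈ V(K) := h.vertexSet_eq ▸ Or.inr ha
      rw [h'.vertexSet_eq] at h1
      exact h1.resolve_left fun h2 => h.notMem (h2 ▸ ha)
    · by_cases hge : g ∈ Set.range e
      · obtain ⟨i, rfl⟩ := hge
        have h1 := h'.isLink_triangle i
        rw [← hu] at h1
        exact h1.isLink_iff_sym2_eq.2 ((h.isLink_triangle i).isLink_iff_sym2_eq.1 hg)
      · rcases (h'.isLink_iff g a b).1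
          ((h.isLink_iff _ _ _).2 (Or.inl ⟨hg, hge⟩)) with h1 | ⟨i, hi, -⟩
        · exact h1.1
        · exact absurd hi (h.ne_of_isLink hg hge i)
  exact le_antisymm (key h h') (key h' h)

/-- The graph `K`, together with new edges between those pairs of ends of the star which are
indexed by `I`. -/
def fill (h : IsTriangleStar x e f u H K) (I : Set (Fin 3)) : Graph α (β ⊕ Fin 3) where
  vertexSet := V(K)
  IsLink g a b := Sum.elim (fun g => K.IsLink g a b)
    (fun i => i ∈ I ∧ s(a, b) = s(u (i + 1), u (i + 2))) g
  isLink_symm g _ := ⟨fun a b hab => by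
    cases g with
    | inl g => exact Graph.IsLink.symm hab
    | inr i => exact ⟨hab.1, Sym2.eq_swap.trans hab.2⟩⟩
  eq_or_eq_of_isLink_of_isLink g a b c d hab hcd := by
    cases g with
    | inl g => exact Graph.IsLink.left_eq_or_eq hab hcd
    | inr i =>
      have := hab.2.trans hcd.2.symm
      rcases Sym2.eq_iff.1 this with h1 | h1
      · exact Or.inl h1.1
      · exact Or.inr h1.1
  left_mem_of_isLink g a b hab := by
    have hu : ∀ i, u i ∈ V(K) := fun i => h.vertexSet_eq ▸ Or.inr (h.mem i)
    cases g with
    | inl g => exact Graph.IsLink.left_mem hab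
    | inr i =>
      rcases Sym2.eq_iff.1 hab.2 with h1 | h1
      · exact h1.1 ▸ hu _
      · exact h1.1 ▸ hu _

theorem isAddEdge_fill (h : IsTriangleStar x e f u H K) {I : Set (Fin 3)} {i : Fin 3}
    (hi : i ∉ I) :
    IsAddEdge (h.fill I) (h.fill (insert i I)) (Sum.inr i) (u (i + 1)) (u (i + 2)) where
  vertexSet_eq := rfl
  notMem hmem := by
    obtain ⟨a, b, hab⟩ := (h.fill I).exists_isLink_of_mem_edgeSet hmem
    exact hi hab.1
  left_mem := by
    change _ ∈ V(K)
    exact h.vertexSet_eq ▸ Or.inr (h.mem _)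
  right_mem := by
    change _ ∈ V(K)
    exact h.vertexSet_eq ▸ Or.inr (h.mem _)
  isLink_iff g a b := by
    cases g with
    | inl g => simp [fill]
    | inr j =>
      simp only [fill, Sum.elim_inr, Set.mem_insert_iff, Sum.inr.injEq]
      constructor
      · rintro ⟨rfl | hj, hab⟩
        · exact Or.inr ⟨rfl, hab⟩
        · exact Or.inl ⟨hj, hab⟩
      · rintro (⟨hj, hab⟩ | ⟨rfl, hab⟩)
        · exact ⟨Or.inr hj, hab⟩
        · exact ⟨Or.inl rfl, hab⟩

theorem isCherry_fill (h : IsTriangleStar x e f u H K) (I : Set (Fin 3)) (i : Fin 3) :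
    IsCherry (h.fill I) (u (i + 1)) (u (i + 2)) x (Sum.inl (f (i + 1))) (Sum.inl (f (i + 2)))
      (Sum.inl (f i)) where
  ne hu := by have := h.injective hu; omega
  ne_left := (h.ne _).symm
  ne_right := (h.ne _).symm
  ne_edge hf := by have := h.injective_star (Sum.inl_injective hf); omega
  left := h.isLink_star _
  right := h.isLink_star _
  eq_of_isLink g y hg := by
    cases g with
    | inl g =>
      rcases (h.isLink_iff _ _ _).1 hg with h1 | ⟨j, rfl, h1⟩
      · exact absurd h1.1.left_mem h.notMem
      · refine ⟨?_, ?_⟩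
        · rcases Sym2.eq_iff.1 h1 with h2 | h2
          · exact absurd h2.1.symm (h.ne j)
          · exact h2.2 ▸ h.ne j
        · have hj : j = i + 1 ∨ j = i + 2 ∨ j = i := by omega
          rcases hj with rfl | rfl | rfl <;> simp
    | inr j =>
      rcases Sym2.eq_iff.1 hg.2 with h1 | h1
      · exact absurd h1.1.symm (h.ne _)
      · exact absurd h1.1.symm (h.ne _)

/-- Being intrinsically knotted or completely `3`-linked is inherited under the exchange of a
triangle for a star: an edge between two ends of the star is redundant since it can be drawn
alongside the two edges of the star. -/
theorem isIKorC3L (h : IsTriangleStar x e f u H K) (hH : IsIKorC3L H) (hVfin : V(H).Finite)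
    (hEfin : E(H).Finite) : IsIKorC3L K := by
  classical
  have hVK : V(K).Finite := by rw [h.vertexSet_eq]; exact hVfin.insert x
  have hEK : E(K).Finite := by
    refine (hEfin.union (Set.finite_range f)).subset fun g hg => ?_
    obtain ⟨a, b, hab⟩ := K.exists_isLink_of_mem_edgeSet hg
    rcases (h.isLink_iff _ _ _).1 hab with h1 | ⟨i, rfl, -⟩
    · exact Or.inl h1.1.edge_mem
    · exact Or.inr ⟨i, rfl⟩
  have hEI : ∀ I, E(h.fill I).Finite := fun I => by
    refine ((hEK.image Sum.inl).union (Set.finite_range Sum.inr)).subset fun g hg => ?_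
    obtain ⟨a, b, hab⟩ := (h.fill I).exists_isLink_of_mem_edgeSet hg
    cases g with
    | inl g => exact Or.inl ⟨g, Graph.IsLink.edge_mem hab, rfl⟩
    | inr i => exact Or.inr ⟨i, rfl⟩
  -- The graph `H` is part of the graph in which all three new edges are present.
  have hfull : IsIKorC3L (h.fill {0, 1, 2}) := by
    refine hH.of_embedding (fun g => if hg : g ∈ Set.range e then Sum.inr hg.choose else Sum.inl g)
      ?_ ?_ ?_
    · intro g _ g' _ hgg
      by_cases hg : g ∈ Set.range e <;> by_cases hg' : g' ∈ Set.range e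
      · simp only [hg, hg', dite_true] at hgg
        rw [← hg.choose_spec, ← hg'.choose_spec, Sum.inr_injective hgg]
      all_goals simp [hg, hg'] at hgg
      exact hgg
    · change _ ⊆ V(K)
      rw [h.vertexSet_eq]
      exact Set.subset_insert _ _
    · intro g a b hab
      by_cases hg : g ∈ Set.range e
      · simp only [hg, dite_true]
        refine ⟨by have : ∀ i : Fin 3, i ∈ ({0, 1, 2} : Set (Fin 3)) := by
                    intro i; fin_cases i <;> simp
                   exact this _, ?_⟩
        refine ((h.isLink_triangle hg.choose).isLink_iff_sym2_eq.1 ?_).symm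
        rwa [hg.choose_spec]
      · simp only [hg, dite_false]
        exact (h.isLink_iff _ _ _).2 (Or.inl ⟨hab, hg⟩)
  have step : ∀ (I : Set (Fin 3)) (i : Fin 3), i ∉ I → IsIKorC3L (h.fill (insert i I)) →
      IsIKorC3L (h.fill I) := fun I i hi hI =>
    hI.of_add_cherry (h.isAddEdge_fill hi) (h.isCherry_fill I i) hVK (hEI I)
  have h2 : IsIKorC3L (h.fill {2}) :=
    step _ 1 (by simp) (step _ 0 (by simp) hfull)
  have h0 : IsIKorC3L (h.fill ∅) := step ∅ 2 (by simp) (by simpa using h2)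
  refine h0.of_embedding (Sum.elim id f) ?_ subset_rfl ?_
  · have hinl : ∀ g ∈ E(h.fill ∅), ∃ g', g = Sum.inl g' := by
      intro g hg
      obtain ⟨a, b, hab⟩ := (h.fill ∅).exists_isLink_of_mem_edgeSet hg
      cases g with
      | inl g => exact ⟨g, rfl⟩
      | inr i => exact absurd hab.1 (by simp)
    intro g hg g' hg' hgg
    obtain ⟨g, rfl⟩ := hinl g hg
    obtain ⟨g', rfl⟩ := hinl g' hg'
    exact congrArg Sum.inl hgg
  · intro g a b hab
    cases g with
    | inl g => exact hab
    | inr i => exact absurd hab.1 (by simp)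

end IsTriangleStar

/-- Up to the names `ρ` of its edges, `K` is the graph `H` without the edge `e₀` (which need not be
an edge of `H`). -/
structure IsDeletion (ρ : β → β) (e₀ : β) (H K : Graph α β) : Prop where
  vertexSet_eq : V(K) = V(H)
  injOn : Set.InjOn ρ E(K)
  isLink : ∀ e a b, K.IsLink e a b → H.IsLink (ρ e) a b
  ne : ∀ e ∈ E(K), ρ e ≠ e₀
  exists_eq : ∀ e ∈ E(H), e ≠ e₀ → ∃ e' ∈ E(K), ρ e' = e

/-- The edge `e₀` of `H` is a loop or is parallel to an edge of `K`. -/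
def IsRedundant (e₀ : β) (H K : Graph α β) : Prop :=
  ∀ a b, H.IsLink e₀ a b → a = b ∨ ∃ e, K.IsLink e a b

variable {ρ : β → β} {e₀ : β}

theorem IsDeletion.isLink_of_isLink (h : IsDeletion ρ e₀ H K) {e : β} (he : e ∈ E(K)) {a b : α}
    (hab : H.IsLink (ρ e) a b) : K.IsLink e a b := by
  obtain ⟨c, d, hcd⟩ := K.exists_isLink_of_mem_edgeSet he
  exact hcd.isLink_iff_sym2_eq.2 ((h.isLink _ _ _ hcd).isLink_iff_sym2_eq.1 hab)

/-- A redundant edge does not matter for being intrinsically knotted or completely `3`-linked. -/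
theorem IsDeletion.isIKorC3L (h : IsDeletion ρ e₀ H K) (hr : IsRedundant e₀ H K)
    (hH : IsIKorC3L H) (hVfin : V(H).Finite) (hEfin : E(H).Finite) : IsIKorC3L K := by
  have hdel : IsIKorC3L (H.deleteEdges {e₀}) := by
    by_cases he : e₀ ∈ E(H)
    · obtain ⟨a, b, hab⟩ := H.exists_isLink_of_mem_edgeSet he
      have hadd : IsAddEdge (H.deleteEdges {e₀}) H e₀ a b := by
        refine ⟨rfl, by simp, hab.left_mem, hab.right_mem, fun e c d => ?_⟩
        by_cases hee : e = e₀
        · subst hee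
          simp [hab.isLink_iff_sym2_eq, eq_comm]
        · simp [hee]
      have hV' : V(H.deleteEdges {e₀}).Finite := hVfin
      have hE' : E(H.deleteEdges {e₀}).Finite :=
        hEfin.subset (Graph.IsSubgraph.edgeSet_mono Graph.deleteEdges_le)
      by_cases heq : a = b
      · subst heq
        exact hH.of_add_loop hadd hV' hE'
      · obtain ⟨e, hKe⟩ := (hr a b hab).resolve_left heq
        refine hH.of_add_parallel hadd heq (e := ρ e) ?_ hV' hE'
        simpa using ⟨h.isLink _ _ _ hKe, h.ne e hKe.edge_mem⟩
    · rwa [show H.deleteEdges {e₀} = H from ?_]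
      refine Graph.ext rfl fun e a b => ?_
      simp only [Graph.deleteEdges_isLink, Set.mem_singleton_iff, and_iff_left_iff_imp]
      rintro hab rfl
      exact he hab.edge_mem
  classical
  have hinv : ∀ e ∈ E(H.deleteEdges {e₀}), ∃ e' ∈ E(K), ρ e' = e := fun e he => by
    obtain ⟨a, b, hab⟩ := Graph.exists_isLink_of_mem_edgeSet he
    rw [Graph.deleteEdges_isLink] at hab
    exact h.exists_eq e hab.1.edge_mem hab.2
  choose! σ hσ hσρ using hinv
  refine hdel.of_embedding σ (fun e he e' he' hee => ?_) h.vertexSet_eq.symm.subset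
    fun e a b hab => ?_
  · rw [← hσρ e he, ← hσρ e' he', hee]
  · have he := hab.edge_mem
    rw [Graph.deleteEdges_isLink, ← hσρ e he] at hab
    rw [hσρ e he] at hab
    exact h.isLink_of_isLink (hσ e he) ((hσρ e he).symm ▸ hab.1)

end SpatialGraph
namespace SpatialGraph

open scoped Graph

/-! ### Minors -/

variable {α β : Type*} {G H K : Graph α β}

open Classical in
/-- The contraction of the edge `g` of `G`, where `g` has the ends `a` and `b`: the two ends are
merged into `a`. -/
noncomputable def contract (G : Graph α β) (g : β) (a b : α) : Graph α β :=
  (G.deleteEdges {g}).map (Function.update id b a)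

section contract

variable {g : β} {a b : α}

theorem isEdgeContraction_contract (hg : G.IsLink g a b) (hab : a ≠ b) :
    IsEdgeContraction G (contract G g a b) :=
  ⟨g, a, b, hg, hab, rfl⟩

open Classical in
theorem contract_isLink {h : β} {c d : α} : (contract G g a b).IsLink h c d ↔
    ∃ c' d', (G.IsLink h c' d' ∧ h ≠ g) ∧ Function.update id b a c' = c ∧
      Function.update id b a d' = d := by
  simp [contract, Graph.map, Relation.Map]

open Classical in
theorem vertexSet_contract : V(contract G g a b) = Function.update id b a '' V(G) := rfl

theorem mem_edgeSet_contract {h : β} : h ∈ E(contract G g a b) ↔ h ∈ E(G) ∧ h ≠ g := by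
  simp [contract]

theorem vertexSet_contract_subset (ha : a ∈ V(G)) : V(contract G g a b) ⊆ V(G) := by
  classical
  rintro - ⟨c, hc, rfl⟩
  by_cases hcb : c = b
  · simpa [Function.update, hcb] using ha
  · simpa [Function.update, hcb] using hc

/-- A subgraph of a contraction of `G` is a minor of `G`. -/
theorem isMinor_of_le_contract (hg : G.IsLink g a b) (hab : a ≠ b) (hK : K ≤ contract G g a b) :
    IsMinor K G := by
  classical
  have hφ : ∀ c, Function.update id b a c = if c = b then a else c := fun c => by
    simp [Function.update]
  have hb : b ∉ V(K) := fun hb => by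
    obtain ⟨c, -, hc⟩ := hK.vertexSet_mono hb
    rw [hφ] at hc
    split_ifs at hc with h1
    · exact hab hc
    · exact h1 hc
  by_cases ha : a ∈ V(K)
  · have hE : E(K) ⊆ E(G) \ {g} := fun h hh => by
      have := mem_edgeSet_contract.1 (hK.edgeSet_mono hh)
      simpa using this
    have hlink : ∀ {h c d}, h ∈ E(K) → G.IsLink h c d →
        K.IsLink h (Function.update id b a c) (Function.update id b a d) := fun {h c d} hh hcd =>
      (Graph.IsSubgraph.isLink_iff hK hh).2
        (contract_isLink.2 ⟨c, d, ⟨hcd, (hE hh).2⟩, rfl, rfl⟩)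
    have hback : ∀ {c}, Function.update id b a c ∈ V(K) → c ∈ insert b V(K) := fun {c} hc => by
      rw [hφ] at hc
      split_ifs at hc with h1
      · exact Or.inl h1
      · exact Or.inr hc
    set G' : Graph α β := (G.restrict (insert g E(K))).induce (insert b V(K)) with hG'
    have hG'l : ∀ h c d, G'.IsLink h c d ↔ G.IsLink h c d ∧ h ∈ insert g E(K) := fun h c d => by
      simp only [hG', Graph.induce, Graph.restrict_isLink]
      refine ⟨fun h1 => h1.1.symm, fun h1 => ⟨h1.symm, ?_⟩⟩
      rcases h1.2 with rfl | hh
      · rcases h1.1.eq_and_eq_or_eq_and_eq hg with ⟨rfl, rfl⟩ | ⟨rfl, rfl⟩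
        · exact ⟨Or.inr ha, Or.inl rfl⟩
        · exact ⟨Or.inl rfl, Or.inr ha⟩
      · exact ⟨hback (hlink hh h1.1).left_mem, hback (hlink hh h1.1).right_mem⟩
    have hG'le : G' ≤ G := by
      refine ⟨?_, fun h c d hcd => ((hG'l _ _ _).1 hcd).1⟩
      rintro c (rfl | hc)
      · exact hg.right_mem
      · exact vertexSet_contract_subset hg.left_mem (hK.vertexSet_mono hc)
    have hgG' : G'.IsLink g a b := (hG'l _ _ _).2 ⟨hg, Or.inl rfl⟩
    refine ⟨G', hG'le, Relation.ReflTransGen.single ?_⟩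
    convert isEdgeContraction_contract hgG' hab
    refine Graph.ext ?_ fun h c d => ?_
    · rw [vertexSet_contract]
      change _ = _ '' (insert b V(K))
      ext c
      constructor
      · intro hc
        refine ⟨c, Or.inr hc, ?_⟩
        rw [hφ, if_neg]
        rintro rfl
        exact hb hc
      · rintro ⟨c, rfl | hc, rfl⟩
        · simpa [hφ] using ha
        · rw [hφ, if_neg]
          · exact hc
          · rintro rfl
            exact hb hc
    · rw [contract_isLink]
      constructor
      · intro hcd
        obtain ⟨c', d', ⟨h1, h2⟩, hc, hd⟩ := contract_isLink.1 (hcd.mono hK)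
        exact ⟨c', d', ⟨(hG'l _ _ _).2 ⟨h1, Or.inr hcd.edge_mem⟩, h2⟩, hc, hd⟩
      · rintro ⟨c', d', ⟨h1, h2⟩, rfl, rfl⟩
        rw [hG'l] at h1
        exact hlink (h1.2.resolve_left h2) h1.1
  · -- If the merged vertex is not used, then no edge was altered.
    refine ⟨K, ⟨fun c hc => vertexSet_contract_subset hg.left_mem (hK.vertexSet_mono hc),
      fun h c d hcd => ?_⟩, Relation.ReflTransGen.refl⟩
    obtain ⟨c', d', ⟨h1, -⟩, hc, hd⟩ := contract_isLink.1 (hcd.mono hK)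
    have hcK := hcd.left_mem
    have hdK := hcd.right_mem
    rw [hφ] at hc hd
    split_ifs at hc hd with h2 h3 h3
    · exact absurd (hc ▸ hcK) ha
    · exact absurd (hc ▸ hcK) ha
    · exact absurd (hd ▸ hdK) ha
    · rwa [hc, hd] at h1

end contract

theorem IsEdgeContraction.exists_contract (h : IsEdgeContraction G H) :
    ∃ g a b, G.IsLink g a b ∧ a ≠ b ∧ H = contract G g a b := h

theorem IsEdgeContraction.vertexSet_subset (h : IsEdgeContraction G H) : V(H) ⊆ V(G) := by
  obtain ⟨g, a, b, hg, -, rfl⟩ := h.exists_contract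
  exact vertexSet_contract_subset hg.left_mem

theorem IsEdgeContraction.edgeSet_subset (h : IsEdgeContraction G H) : E(H) ⊆ E(G) := by
  obtain ⟨g, a, b, hg, -, rfl⟩ := h.exists_contract
  exact fun h hh => (mem_edgeSet_contract.1 hh).1

theorem IsMinor.subset (h : IsMinor H G) : V(H) ⊆ V(G) ∧ E(H) ⊆ E(G) := by
  obtain ⟨G', hle, hr⟩ := h
  induction hr with
  | refl => exact ⟨hle.vertexSet_mono, hle.edgeSet_mono⟩
  | tail _ hs ih => exact ⟨hs.vertexSet_subset.trans ih.1, hs.edgeSet_subset.trans ih.2⟩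

theorem IsMinor.tail (h : IsMinor H G) (hs : Relation.ReflTransGen IsEdgeContraction H K) :
    IsMinor K G := by
  obtain ⟨G', hle, hr⟩ := h
  exact ⟨G', hle, hr.trans hs⟩

/-! ### Contractions in a triangle and in a star -/

section deletion

variable {ρ : β → β} {e₀ : β}

/-- A contraction of an edge other than `e₀` is the same in `H` and in `K`. -/
theorem IsDeletion.contract (h : IsDeletion ρ e₀ H K) {g : β} {a b : α} (hg : K.IsLink g a b) :
    IsDeletion ρ e₀ (contract H (ρ g) a b) (contract K g a b) where
  vertexSet_eq := by rw [vertexSet_contract, vertexSet_contract, h.vertexSet_eq]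
  injOn := h.injOn.mono fun e he => (mem_edgeSet_contract.1 he).1
  isLink e c d hcd := by
    obtain ⟨c', d', ⟨h1, h2⟩, hc, hd⟩ := contract_isLink.1 hcd
    exact contract_isLink.2 ⟨c', d', ⟨h.isLink _ _ _ h1,
      fun h3 => h2 (h.injOn h1.edge_mem hg.edge_mem h3)⟩, hc, hd⟩
  ne e he := h.ne e (mem_edgeSet_contract.1 he).1
  exists_eq e he hne := by
    obtain ⟨h1, h2⟩ := mem_edgeSet_contract.1 he
    obtain ⟨e', he', rfl⟩ := h.exists_eq e h1 hne
    exact ⟨e', mem_edgeSet_contract.2 ⟨he', fun h3 => h2 (h3 ▸ rfl)⟩, rfl⟩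

/-- If the edge `e₀` itself is contracted and `g` is parallel to it, then contracting `g` in `K`
turns the edge of `H` named after `g` into a redundant loop. -/
theorem IsDeletion.contract_self (h : IsDeletion ρ e₀ H K) {g : β} {a b : α}
    (hg : K.IsLink g a b) :
    IsDeletion ρ (ρ g) (SpatialGraph.contract H e₀ a b) (SpatialGraph.contract K g a b) where
  vertexSet_eq := by rw [vertexSet_contract, vertexSet_contract, h.vertexSet_eq]
  injOn := h.injOn.mono fun e he => (mem_edgeSet_contract.1 he).1
  isLink e c d hcd := by
    obtain ⟨c', d', ⟨h1, h2⟩, hc, hd⟩ := contract_isLink.1 hcd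
    exact contract_isLink.2 ⟨c', d', ⟨h.isLink _ _ _ h1, h.ne e h1.edge_mem⟩, hc, hd⟩
  ne e he h3 := by
    obtain ⟨h1, h2⟩ := mem_edgeSet_contract.1 he
    exact h2 (h.injOn h1 hg.edge_mem h3)
  exists_eq e he hne := by
    obtain ⟨h1, h2⟩ := mem_edgeSet_contract.1 he
    obtain ⟨e', he', rfl⟩ := h.exists_eq e h1 h2
    exact ⟨e', mem_edgeSet_contract.2 ⟨he', fun h3 => hne (h3 ▸ rfl)⟩, rfl⟩

theorem contract_update_eq {a b : α} {c d : α} (hcd : s(c, d) = s(a, b)) [DecidableEq α] :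
    Function.update id b a c = Function.update id b a d := by
  by_cases hab : a = b <;>
    rcases Sym2.eq_iff.1 hcd with ⟨rfl, rfl⟩ | ⟨rfl, rfl⟩ <;> simp [Function.update]

/-- Contractions preserve the property of differing by a single redundant edge. -/
theorem IsDeletion.exists_contraction (h : IsDeletion ρ e₀ H K) (hr : IsRedundant e₀ H K)
    {H' : Graph α β} (hH' : IsEdgeContraction H H') :
    ∃ e₁ K', IsEdgeContraction K K' ∧ IsDeletion ρ e₁ H' K' ∧ IsRedundant e₁ H' K' := by
  classical
  obtain ⟨g, a, b, hg, hab, rfl⟩ := hH'.exists_contract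
  by_cases hge : g = e₀
  · subst hge
    obtain ⟨g', hg'⟩ := (hr a b hg).resolve_left hab
    refine ⟨_, _, isEdgeContraction_contract hg' hab, h.contract_self hg', fun c d hcd => ?_⟩
    left
    obtain ⟨c', d', ⟨h1, -⟩, rfl, rfl⟩ := contract_isLink.1 hcd
    have h2 := h.isLink _ _ _ hg'
    convert contract_update_eq ((h2.isLink_iff_sym2_eq.1 h1).symm)
  · obtain ⟨g', hg', rfl⟩ := h.exists_eq g hg.edge_mem hge
    have hgK := h.isLink_of_isLink hg' hg
    refine ⟨_, _, isEdgeContraction_contract hgK hab, h.contract hgK, fun c d hcd => ?_⟩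
    obtain ⟨c', d', ⟨h1, -⟩, rfl, rfl⟩ := contract_isLink.1 hcd
    rcases hr _ _ h1 with rfl | ⟨e, he⟩
    · exact Or.inl rfl
    · by_cases heg : e = g'
      · subst heg
        left
        convert contract_update_eq ((hgK.isLink_iff_sym2_eq.1 he).symm)
      · exact Or.inr ⟨e, contract_isLink.2 ⟨c', d', ⟨he, heg⟩, rfl, rfl⟩⟩

theorem IsDeletion.exists_le (h : IsDeletion ρ e₀ H K) {H' : Graph α β} (hle : H' ≤ H) :
    ∃ K' ≤ K, IsDeletion ρ e₀ H' K' := by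
  have hlink : ∀ {e c d}, ρ e ∈ E(H') → K.IsLink e c d → H'.IsLink (ρ e) c d :=
    fun {e c d} h1 h2 => (Graph.IsSubgraph.isLink_iff hle h1).2 (h.isLink _ _ _ h2)
  set K' : Graph α β := (K.restrict (ρ ⁻¹' E(H'))).induce V(H') with hK'
  have hK'l : ∀ e c d, K'.IsLink e c d ↔ K.IsLink e c d ∧ ρ e ∈ E(H') := fun e c d => by
    simp only [hK', Graph.induce, Graph.restrict_isLink]
    exact ⟨fun h1 => h1.1.symm, fun h1 => ⟨h1.symm, (hlink h1.2 h1.1).left_mem,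
      (hlink h1.2 h1.1).right_mem⟩⟩
  have hle' : K' ≤ K := ⟨fun c hc => h.vertexSet_eq ▸ hle.vertexSet_mono hc,
    fun e c d hcd => ((hK'l _ _ _).1 hcd).1⟩
  refine ⟨K', hle', rfl, h.injOn.mono hle'.edgeSet_mono, fun e c d hcd => ?_, fun e he' => ?_,
    fun e he' hne => ?_⟩
  · rw [hK'l] at hcd
    exact hlink hcd.2 hcd.1
  · exact h.ne e (hle'.edgeSet_mono he')
  · obtain ⟨e', h1, rfl⟩ := h.exists_eq e (hle.edgeSet_mono he') hne
    obtain ⟨c, d, hcd⟩ := K.exists_isLink_of_mem_edgeSet h1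
    exact ⟨e', ((hK'l _ _ _).2 ⟨hcd, he'⟩).edge_mem, rfl⟩

end deletion

namespace IsTriangleStar

variable {x : α} {e f : Fin 3 → β} {u : Fin 3 → α}

open Classical in
/-- Contracting the edge `f i` of the star leaves two of the edges of the triangle: `f (i + 1)`
becomes the edge opposite to `u (i + 2)`, and vice versa. -/
theorem isDeletion_contract (h : IsTriangleStar x e f u H K) (i : Fin 3) :
    IsDeletion (Function.update (Function.update id (f (i + 2)) (e (i + 1))) (f (i + 1))
      (e (i + 2))) (e i) H (contract K (f i) (u i) x) := by
  set ρ := Function.update (Function.update id (f (i + 2)) (e (i + 1))) (f (i + 1)) (e (i + 2))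
    with hρ
  have hf := h.injective_star
  have he := h.injective_triangle
  have hρ1 : ρ (f (i + 1)) = e (i + 2) := by simp [hρ]
  have hρ2 : ρ (f (i + 2)) = e (i + 1) := by
    have : f (i + 2) ≠ f (i + 1) := fun h1 => by have := hf h1; omega
    simp [hρ, Function.update, this]
  have hρH : ∀ {g c d}, H.IsLink g c d → g ∉ Set.range e → ρ g = g := fun {g c d} h1 h2 => by
    simp [hρ, Function.update, h.ne_of_isLink h1 h2]
  have hφ : ∀ {c}, c ∈ V(H) → Function.update id x (u i) c = c := fun {c} hc => by
    have : c ≠ x := fun h1 => h.notMem (h1 ▸ hc)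
    simp [Function.update, this]
  have hφx : Function.update id x (u i) x = u i := by simp
  have cases3 : ∀ j : Fin 3, j ≠ i → j = i + 1 ∨ j = i + 2 := by omega
  -- The three kinds of edges of the contracted graph.
  have hedge : ∀ g ∈ E(contract K (f i) (u i) x),
      (∃ c d, H.IsLink g c d ∧ g ∉ Set.range e) ∨ g = f (i + 1) ∨ g = f (i + 2) := fun g hg => by
    obtain ⟨hg, hne⟩ := mem_edgeSet_contract.1 hg
    obtain ⟨c, d, hcd⟩ := K.exists_isLink_of_mem_edgeSet hg
    rcases (h.isLink_iff _ _ _).1 hcd with h1 | ⟨j, rfl, -⟩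
    · exact Or.inl ⟨c, d, h1⟩
    · rcases cases3 j (fun h1 => hne (h1 ▸ rfl)) with rfl | rfl <;> simp
  refine ⟨?_, fun g hg g' hg' hgg => ?_, fun g c d hcd => ?_, fun g hg => ?_, fun g hg hne => ?_⟩
  · rw [vertexSet_contract, h.vertexSet_eq, Set.image_insert_eq, hφx]
    rw [Set.image_congr fun c hc => hφ hc, Set.image_id', Set.insert_eq_of_mem (h.mem i)]
  · have h12 : e (i + 1) ≠ e (i + 2) := fun h1 => by have := he h1; omega
    rcases hedge g hg with ⟨c, d, h1, h2⟩ | rfl | rfl <;>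
      rcases hedge g' hg' with ⟨c', d', h1', h2'⟩ | rfl | rfl
    · rwa [hρH h1 h2, hρH h1' h2'] at hgg
    · rw [hρH h1 h2, hρ1] at hgg; exact absurd ⟨_, hgg.symm⟩ h2
    · rw [hρH h1 h2, hρ2] at hgg; exact absurd ⟨_, hgg.symm⟩ h2
    · rw [hρH h1' h2', hρ1] at hgg; exact absurd ⟨_, hgg⟩ h2'
    · rfl
    · rw [hρ1, hρ2] at hgg; exact absurd hgg.symm h12
    · rw [hρH h1' h2', hρ2] at hgg; exact absurd ⟨_, hgg⟩ h2'
    · rw [hρ1, hρ2] at hgg; exact absurd hgg h12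
    · rfl
  · obtain ⟨c', d', ⟨h1, h2⟩, rfl, rfl⟩ := contract_isLink.1 hcd
    rcases (h.isLink_iff _ _ _).1 h1 with h3 | ⟨j, rfl, h3⟩
    · rw [hρH h3.1 h3.2, hφ h3.1.left_mem, hφ h3.1.right_mem]
      exact h3.1
    · have hj : H.IsLink (ρ (f j)) (u j) (u i) := by
        rcases cases3 j (fun h1 => h2 (h1 ▸ rfl)) with rfl | rfl
        · rw [hρ1]
          have := (h.isLink_triangle (i + 2)).symm
          rwa [show i + 2 + 2 = i + 1 by omega, show i + 2 + 1 = i by omega] at this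
        · rw [hρ2]
          have := h.isLink_triangle (i + 1)
          rwa [show i + 1 + 1 = i + 2 by omega, show i + 1 + 2 = i by omega] at this
      rcases Sym2.eq_iff.1 h3 with ⟨rfl, rfl⟩ | ⟨rfl, rfl⟩
      · rwa [hφx, hφ (h.mem j)]
      · rw [hφx, hφ (h.mem j)]
        exact hj.symm
  · rcases hedge g hg with ⟨c, d, h1, h2⟩ | rfl | rfl
    · rw [hρH h1 h2]
      exact fun h3 => h2 ⟨i, h3.symm⟩
    · rw [hρ1]; intro h1; have := he h1; omega
    · rw [hρ2]; intro h1; have := he h1; omega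
  · have hmem : ∀ j, j ≠ i → f j ∈ E(contract K (f i) (u i) x) := fun j hj =>
      mem_edgeSet_contract.2 ⟨(h.isLink_star j).edge_mem, fun h1 => hj (hf h1)⟩
    by_cases hge : g ∈ Set.range e
    · obtain ⟨j, rfl⟩ := hge
      rcases cases3 j (fun h1 => hne (h1 ▸ rfl)) with rfl | rfl
      · exact ⟨_, hmem (i + 2) (by omega), hρ2⟩
      · exact ⟨_, hmem (i + 1) (by omega), hρ1⟩
    · obtain ⟨c, d, hcd⟩ := H.exists_isLink_of_mem_edgeSet hg
      exact ⟨g, mem_edgeSet_contract.2 ⟨((h.isLink_iff _ _ _).2 (Or.inl ⟨hcd, hge⟩)).edge_mem,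
        h.ne_of_isLink hcd hge i⟩, hρH hcd hge⟩

/-- Contracting an edge that does not join two vertices of the triangle commutes with the
exchange. -/
theorem contract (h : IsTriangleStar x e f u H K) {g : β} {a b : α} (hg : H.IsLink g a b)
    (hab : a ≠ b) (hu : a ∉ Set.range u ∨ b ∉ Set.range u) :
    K.IsLink g a b ∧ ∃ u', IsTriangleStar x e f u' (SpatialGraph.contract H g a b)
      (SpatialGraph.contract K g a b) := by
  classical
  have hge : ∀ i, e i ≠ g := by
    rintro i rfl
    rcases hg.eq_and_eq_or_eq_and_eq (h.isLink_triangle i) with ⟨rfl, rfl⟩ | ⟨rfl, rfl⟩ <;>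
      rcases hu with h1 | h1 <;> exact h1 ⟨_, rfl⟩
  have hge' : g ∉ Set.range e := by rintro ⟨i, hi⟩; exact hge i hi
  have hgK : K.IsLink g a b := (h.isLink_iff _ _ _).2 (Or.inl ⟨hg, hge'⟩)
  set φ : α → α := Function.update id b a with hφ
  have hφ' : ∀ c, φ c = if c = b then a else c := fun c => by simp [hφ, Function.update]
  have hbx : x ≠ b := fun h1 => h.notMem (h1 ▸ hg.right_mem)
  have hax : x ≠ a := fun h1 => h.notMem (h1 ▸ hg.left_mem)
  have hφx : φ x = x := by rw [hφ', if_neg hbx]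
  refine ⟨hgK, φ ∘ u, fun i j hij => ?_, ?_, fun i => ?_, ?_, fun k c d => ?_⟩
  · simp only [Function.comp_apply, hφ'] at hij
    split_ifs at hij with h1 h2 h2
    · exact h.injective (h1.trans h2.symm)
    · rcases hu with h3 | h3
      · exact absurd ⟨_, hij.symm⟩ h3
      · exact absurd ⟨_, h1⟩ h3
    · rcases hu with h3 | h3
      · exact absurd ⟨_, hij⟩ h3
      · exact absurd ⟨_, h2⟩ h3
    · exact h.injective hij
  · exact fun hx => h.notMem (vertexSet_contract_subset hg.left_mem hx)
  · exact contract_isLink.2 ⟨_, _, ⟨h.isLink_triangle i, hge i⟩, rfl, rfl⟩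
  · rw [vertexSet_contract, vertexSet_contract, h.vertexSet_eq, Set.image_insert_eq]
    exact congrArg (fun z => insert z _) hφx
  · rw [contract_isLink, contract_isLink]
    constructor
    · rintro ⟨c', d', ⟨h1, h2⟩, rfl, rfl⟩
      rcases (h.isLink_iff _ _ _).1 h1 with h3 | ⟨i, rfl, h3⟩
      · exact Or.inl ⟨⟨c', d', ⟨h3.1, h2⟩, rfl, rfl⟩, h3.2⟩
      · refine Or.inr ⟨i, rfl, ?_⟩
        have := congrArg (Sym2.map φ) h3
        rw [Sym2.map_mk, Sym2.map_mk, hφx] at this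
        exact this
    · rintro (⟨⟨c', d', ⟨h1, h2⟩, rfl, rfl⟩, h3⟩ | ⟨i, rfl, h3⟩)
      · exact ⟨c', d', ⟨(h.isLink_iff _ _ _).2 (Or.inl ⟨h1, h3⟩), h2⟩, rfl, rfl⟩
      · have hne : f i ≠ g := (h.ne_of_isLink hg hge' i).symm
        rcases Sym2.eq_iff.1 h3 with ⟨hc, hd⟩ | ⟨hc, hd⟩
        · exact ⟨u i, x, ⟨h.isLink_star i, hne⟩, hc.symm, hφx.trans hd.symm⟩
        · exact ⟨x, u i, ⟨(h.isLink_star i).symm, hne⟩, hφx.trans hc.symm, hd.symm⟩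

/-- If two vertices of the triangle are merged, then two edges of the triangle become parallel. One
of them is redundant, and without it the same graph arises from the star by contracting an edge of
the star and the edge that was contracted in `H`. -/
theorem exists_contraction (h : IsTriangleStar x e f u H K) {H' : Graph α β}
    (hH' : IsEdgeContraction H H') :
    ∃ K', Relation.ReflTransGen IsEdgeContraction K K' ∧
      ((∃ u', IsTriangleStar x e f u' H' K') ∨
        ∃ ρ e₀, IsDeletion ρ e₀ H' K' ∧ IsRedundant e₀ H' K') := by
  classical
  obtain ⟨g, a, b, hg, hab, rfl⟩ := hH'.exists_contract
  by_cases hu : a ∉ Set.range u ∨ b ∉ Set.range u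
  · obtain ⟨hgK, hT⟩ := h.contract hg hab hu
    exact ⟨_, Relation.ReflTransGen.single (isEdgeContraction_contract hgK hab), Or.inl hT⟩
  · push Not at hu
    obtain ⟨⟨i, rfl⟩, ⟨j, rfl⟩⟩ := hu
    have hij : i ≠ j := fun h1 => hab (h1 ▸ rfl)
    have hD := h.isDeletion_contract i
    set ρ := Function.update (Function.update id (f (i + 2)) (e (i + 1))) (f (i + 1)) (e (i + 2))
    set K₁ := SpatialGraph.contract K (f i) (u i) x with hK₁
    have hK : IsEdgeContraction K K₁ := isEdgeContraction_contract (h.isLink_star i) (h.ne i)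
    have hgi : g ≠ e i := by
      rintro rfl
      rcases hg.eq_and_eq_or_eq_and_eq (h.isLink_triangle i) with ⟨h1, -⟩ | ⟨h1, -⟩ <;>
        have := h.injective h1 <;> omega
    obtain ⟨g', hg', rfl⟩ := hD.exists_eq g hg.edge_mem hgi
    have hgK := hD.isLink_of_isLink hg' hg
    refine ⟨_, (Relation.ReflTransGen.single hK).tail (isEdgeContraction_contract hgK hab),
      Or.inr ⟨ρ, e i, hD.contract hgK, fun c d hcd => Or.inr ?_⟩⟩
    -- The third vertex of the triangle is joined to the merged vertex by an edge of the star.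
    obtain ⟨k, hki, hkj⟩ : ∃ k, k ≠ i ∧ k ≠ j := by
      have : ∀ i j : Fin 3, ∃ k, k ≠ i ∧ k ≠ j := by decide
      exact this i j
    have hfk : K₁.IsLink (f k) (u k) (u i) := by
      refine contract_isLink.2 ⟨u k, x, ⟨h.isLink_star k, fun h1 => hki (h.injective_star h1)⟩,
        ?_, by simp⟩
      simp [Function.update, h.ne k]
    have hne : f k ≠ g' := by
      rintro rfl
      rcases hgK.eq_and_eq_or_eq_and_eq hfk with ⟨h1, -⟩ | ⟨-, h1⟩
      · exact hki (h.injective h1).symm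
      · exact hkj (h.injective h1).symm
    have hφ : ∀ l, Function.update id (u j) (u i) (u l) = if l = j then u i else u l := fun l => by
      by_cases hl : l = j
      · simp [hl]
      · simp [Function.update, hl, h.injective.eq_iff]
    obtain ⟨c', d', ⟨h1, -⟩, rfl, rfl⟩ := contract_isLink.1 hcd
    have hkl : (SpatialGraph.contract K₁ g' (u i) (u j)).IsLink (f k) (u k) (u i) :=
      contract_isLink.2 ⟨u k, u i, ⟨hfk, hne⟩, by rw [hφ, if_neg hkj], by rw [hφ, if_neg hij]⟩
    have hends : s(c', d') = s(u j, u k) := by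
      rw [← (h.isLink_triangle i).isLink_iff_sym2_eq.1 h1]
      have : (j = i + 1 ∧ k = i + 2) ∨ (j = i + 2 ∧ k = i + 1) := by omega
      rcases this with ⟨rfl, rfl⟩ | ⟨rfl, rfl⟩
      · rfl
      · exact Sym2.eq_swap
    refine ⟨f k, ?_⟩
    rcases Sym2.eq_iff.1 hends with ⟨rfl, rfl⟩ | ⟨rfl, rfl⟩
    · rw [hφ, hφ, if_pos rfl, if_neg hkj]
      exact hkl.symm
    · rw [hφ, hφ, if_pos rfl, if_neg hkj]
      exact hkl

/-- A subgraph containing the triangle corresponds to a subgraph containing the star. -/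
theorem exists_le (h : IsTriangleStar x e f u H K) {H' : Graph α β} (hle : H' ≤ H)
    (he : ∀ i, e i ∈ E(H')) : ∃ K' ≤ K, IsTriangleStar x e f u H' K' := by
  have htri : ∀ i, H'.IsLink (e i) (u (i + 1)) (u (i + 2)) := fun i =>
    (Graph.IsSubgraph.isLink_iff hle (he i)).2 (h.isLink_triangle i)
  have hmem : ∀ i, u i ∈ V(H') := fun i => by
    have := (htri (i + 1)).right_mem
    rwa [show i + 1 + 2 = i by omega] at this
  set K' : Graph α β := (K.restrict (E(H') \ Set.range e ∪ Set.range f)).induce (insert x V(H'))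
    with hK'
  have hK'l : ∀ g c d, K'.IsLink g c d ↔
      (H'.IsLink g c d ∧ g ∉ Set.range e) ∨ ∃ i, g = f i ∧ s(c, d) = s(u i, x) := by
    intro g c d
    simp only [hK', Graph.induce, Graph.restrict_isLink, h.isLink_iff]
    constructor
    · rintro ⟨⟨h2, h1 | h1⟩, -, -⟩
      · rcases h2 with h2 | ⟨i, rfl⟩
        · exact Or.inl ⟨(Graph.IsSubgraph.isLink_iff hle h2.1).2 h1.1, h1.2⟩
        · exact absurd rfl (h.ne_of_isLink h1.1 h1.2 i)
      · exact Or.inr h1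
    · rintro (h1 | ⟨i, rfl, h1⟩)
      · exact ⟨⟨Or.inl ⟨h1.1.edge_mem, h1.2⟩, Or.inl ⟨h1.1.mono hle, h1.2⟩⟩,
          Or.inr h1.1.left_mem, Or.inr h1.1.right_mem⟩
      · refine ⟨⟨Or.inr ⟨i, rfl⟩, Or.inr ⟨i, rfl, h1⟩⟩, ?_⟩
        rcases Sym2.eq_iff.1 h1 with ⟨rfl, rfl⟩ | ⟨rfl, rfl⟩
        · exact ⟨Or.inr (hmem i), Or.inl rfl⟩
        · exact ⟨Or.inl rfl, Or.inr (hmem i)⟩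
  refine ⟨K', ⟨?_, fun g c d hcd => ?_⟩, h.injective, fun hx => h.notMem (hle.vertexSet_mono hx),
    htri, rfl, hK'l⟩
  · change insert x V(H') ⊆ V(K)
    rw [h.vertexSet_eq]
    exact Set.insert_subset_insert hle.vertexSet_mono
  · rw [hK'l] at hcd
    rw [h.isLink_iff]
    exact hcd.imp_left fun h1 => ⟨h1.1.mono hle, h1.2⟩

/-- Every minor of the graph with the triangle is matched by a minor of the graph with the star:
either the triangle survives and the two minors are related by an exchange again, or they differ
only in the names of edges and in one redundant edge. -/
theorem exists_isMinor {G₁ G₂ : Graph α β} (h : IsTriangleStar x e f u G₁ G₂) (hH : IsMinor H G₁) :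
    ∃ K, IsMinor K G₂ ∧ ((∃ u', IsTriangleStar x e f u' H K) ∨
      ∃ ρ e₀, IsDeletion ρ e₀ H K ∧ IsRedundant e₀ H K) := by
  obtain ⟨G', hle, hr⟩ := hH
  induction hr with
  | refl =>
    by_cases he : ∀ i, e i ∈ E(G')
    · obtain ⟨K, hK, hT⟩ := h.exists_le hle he
      exact ⟨K, ⟨K, hK, Relation.ReflTransGen.refl⟩, Or.inl ⟨u, hT⟩⟩
    · push Not at he
      obtain ⟨i, hi⟩ := he
      obtain ⟨K, hK, hD⟩ := (h.isDeletion_contract i).exists_le hle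
      exact ⟨K, isMinor_of_le_contract (h.isLink_star i) (h.ne i) hK,
        Or.inr ⟨_, _, hD, fun a b hab => absurd hab.edge_mem hi⟩⟩
  | tail _ hs ih =>
    obtain ⟨K, hK, ⟨u', hT⟩ | ⟨ρ, e₀, hD, hR⟩⟩ := ih
    · obtain ⟨K', hKK', hK'⟩ := hT.exists_contraction hs
      exact ⟨K', hK.tail hKK', hK'⟩
    · obtain ⟨e₁, K', hKK', hD', hR'⟩ := hD.exists_contraction hR hs
      exact ⟨K', hK.tail (Relation.ReflTransGen.single hKK'), Or.inr ⟨ρ, e₁, hD', hR'⟩⟩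

end IsTriangleStar

theorem IsDeltaYExchange.exists_isTriangleStar {G₁ G₂ : Graph α β} (h : IsDeltaYExchange G₁ G₂) :
    ∃ x e f u, IsTriangleStar x e f u G₁ G₂ := by
  obtain ⟨u, v, w, x, e₁, e₂, e₃, f₁, f₂, f₃, ⟨huv, hvw, hwu⟩, ⟨he₁, he₂, he₃⟩, hx, -, -, hV,
    hlink⟩ := h
  refine ⟨x, ![e₂, e₃, e₁], ![f₁, f₂, f₃], ![u, v, w], fun i j hij => ?_, hx, fun i => ?_, hV,
    fun g a b => ?_⟩
  · fin_cases i <;> fin_cases j <;> simp_all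
  · fin_cases i
    · exact he₂
    · exact he₃
    · exact he₁
  · rw [hlink]
    have hrange : g ∈ Set.range ![e₂, e₃, e₁] ↔ g ∈ ({e₁, e₂, e₃} : Set β) := by
      simp only [Set.mem_range, Fin.exists_fin_succ, Set.mem_insert_iff, Set.mem_singleton_iff]
      simp [eq_comm]
      tauto
    rw [hrange]
    simp [Fin.exists_fin_succ]

end SpatialGraph

open SpatialGraph in
theorem lemma2p7 {α β : Type*} (GΔ GY : Graph α β)
    (hV : GΔ.vertexSet.Finite) (hE : GΔ.edgeSet.Finite)
    (hexch : IsDeltaYExchange GΔ GY)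
    (hmin : IsMinorMinimal IsIKorC3L GY) :
    (∀ H : Graph α β, IsProperMinor H GΔ → ¬ IsIKorC3L H) ∧
      (IsIKorC3L GΔ → IsMinorMinimal IsIKorC3L GΔ) := by
  obtain ⟨x, e, f, u, h⟩ := hexch.exists_isTriangleStar
  have main : ∀ H : Graph α β, IsProperMinor H GΔ → ¬ IsIKorC3L H := by
    rintro H ⟨hmH, hne⟩ hH
    obtain ⟨hVH, hEH⟩ := hmH.subset
    have hVfin := hV.subset hVH
    have hEfin := hE.subset hEH
    obtain ⟨K, hK, ⟨u', hT⟩ | ⟨ρ, e₀, hD, hR⟩⟩ := h.exists_isMinor hmH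
    · refine hmin.2 K ⟨hK, ?_⟩ (hT.isIKorC3L hH hVfin hEfin)
      rintro rfl
      exact hne (hT.left_unique h)
    · refine hmin.2 K ⟨hK, ?_⟩ (hD.isIKorC3L hR hH hVfin hEfin)
      -- The centre of the star is not a vertex of `H`.
      rintro rfl
      refine h.notMem (hVH (hD.vertexSet_eq ▸ ?_))
      exact h.vertexSet_eq ▸ Set.mem_insert _ _
  exact ⟨main, fun hΔ => ⟨hΔ, main⟩⟩
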